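/- **Setting.** Let $x_1,\dots,x_n\in\mathbb R^d$ have labels $y_i\in\{+1,-1\}$, both labels occurring, and let $0<\varepsilon<1$. *Hard-margin SVM:* minimize $\frac12\|w\|^2$ over $(w,b)$ subject to $y_i(w^{\mathsf T}x_i-b)\ge 1$ for all $i$; the data are assumed to be separable, i.e. a feasible $(w,b)$ exists. A $(1-\varepsilon)$-approximation is a feasible $(w,b)$ with $(1-\varepsilon)\cdot\frac12\|w\|^2\le\mathrm{OPT}$, where $\mathrm{OPT}>0$ is the minimum. *$\nu$-SVM* ($0<\nu\le 1$): minimize $\frac12\|w\|^2-\rho+\frac\nu2\sum_i\delta_i$ over $(w,b,\rho,\delta)$ subject to $y_i(w^{\mathsf T}x_i-b)\ge\rho-\delta_i$ and $\delta_i\ge 0$ for all $i$. The reduced convex hull of a class is the set of convex combinations of its points in which every weight is at most $\nu$; the two reduced hulls are assumed to be non-empty and disjoint. A $(1-\varepsilon)$-approximation is a feasible $(w,b,\rho,\delta)$ whose objective is at most $(1-\varepsilon)\,\mathrm{OPT}$, where $\mathrm{OPT}<0$ is the minimum. *The parameter $\beta$.* Let $\beta\in(0,1]$ be the ratio of the minimum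 squared distance between the two convex hulls of the classes (for $\nu$-SVM: between the two reduced convex hulls) to the maximum squared distance $\max_{i,j}\|x_i-x_j\|^2$ among the points. *Machine model.* A randomized real RAM with unit-cost steps: exact real arithmetic, $\exp$, $\log$, comparisons, fair coin tosses, and addition, truncated subtraction and comparison of array indices; no rounding operation. **Theorem.** There is a randomized algorithm for hard-margin SVM, and there is one for $\nu$-SVM, which, given $n$, $d$, the labelled points and $\varepsilon$ (and $\nu$), but not $\beta$, with probability at least $1-\frac1n$ halts with a $(1-\varepsilon)$-approximation after $\tilde O\big(n(d+\sqrt{d/(\varepsilon\beta)})\big)$ steps. That is, for each of the two algorithms there are absolute constants $C>0$ and $k\in\mathbb N$ (independent of the data, $n$, $d$, $\varepsilon$, $\nu$) such that the number of steps is at most $$C\,\Big(1+\log n+\log d+\log\tfrac1\varepsilon+\log\tfrac1\beta\Big)^{k}\; n\Big(d+\sqrt{\tfrac{d}{\varepsilon\beta}}\Big).$$ -/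

import Mathlib

/-! Randomized real random access machine with unit-cost operations. -/

namespace RealRAM

/-- Index expressions. The only operations on indices are constants, reading a cell of an integer
array, addition and truncated subtraction. Arrays are named by literals of the program. -/
inductive IExpr : Type
  | const (k : ℕ)
  | load (a : ℕ) (i : IExpr)
  | add (e f : IExpr)
  | sub (e f : IExpr)

/-- Real expressions: exact arithmetic, exponential and logarithm. There is no rounding
operation, and there are no real constants except those built from natural numbers. -/
inductive RExpr : Type
  | cast (e : IExpr)
  | load (a : ℕ) (i : IExpr)
  | add (e f : RExpr)
  | sub (e f : RExpr)
  | mul (e f : RExpr)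
  | div (e f : RExpr)
  | exp (e : RExpr)
  | log (e : RExpr)

/-- Tests: strict comparison of two indices or of two reals. -/
inductive BExpr : Type
  | ilt (e f : IExpr)
  | rlt (e f : RExpr)

/-- Programs. `iset a i e` and `rset a i e` write the value of `e` into cell `i` of the integer,
respectively real, array `a`; `flip a i` writes a fair random bit into a cell of an integer
array. -/
inductive Cmd : Type
  | iset (a : ℕ) (i e : IExpr)
  | rset (a : ℕ) (i : IExpr) (e : RExpr)
  | flip (a : ℕ) (i : IExpr)
  | seq (c₁ c₂ : Cmd)
  | ite (b : BExpr) (c₁ c₂ : Cmd)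
  | loop (b : BExpr) (c : Cmd)

/-- The memory: for every array name, the contents of its cells. -/
structure State where
  int : ℕ → ℕ → ℕ
  real : ℕ → ℕ → ℝ

def IExpr.eval (s : State) : IExpr → ℕ
  | .const k => k
  | .load a i => s.int a (i.eval s)
  | .add e f => e.eval s + f.eval s
  | .sub e f => e.eval s - f.eval s

noncomputable def RExpr.eval (s : State) : RExpr → ℝ
  | .cast e => (e.eval s : ℝ)
  | .load a i => s.real a (i.eval s)
  | .add e f => e.eval s + f.eval s
  | .sub e f => e.eval s - f.eval s
  | .mul e f => e.eval s * f.eval s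
  | .div e f => e.eval s / f.eval s
  | .exp e => Real.exp (e.eval s)
  | .log e => Real.log (e.eval s)

def BExpr.Holds (s : State) : BExpr → Prop
  | .ilt e f => e.eval s < f.eval s
  | .rlt e f => e.eval s < f.eval s

def State.writeInt (s : State) (a i v : ℕ) : State :=
  { s with int := Function.update s.int a (Function.update (s.int a) i v) }

def State.writeReal (s : State) (a i : ℕ) (v : ℝ) : State :=
  { s with real := Function.update s.real a (Function.update (s.real a) i v) }

/-- A configuration: the stack of commands still to be executed, and the memory. -/
abbrev Config : Type := List Cmd × State

open Classical in
/-- One step of the machine. Every assignment, coin toss, sequencing and test costs one step; the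
expressions in it have a size fixed by the program. A configuration with an empty stack has
halted. -/
noncomputable def step : Config → PMF Config
  | ([], s) => PMF.pure ([], s)
  | (.iset a i e :: K, s) => PMF.pure (K, s.writeInt a (i.eval s) (e.eval s))
  | (.rset a i e :: K, s) => PMF.pure (K, s.writeReal a (i.eval s) (e.eval s))
  | (.flip a i :: K, s) =>
      (PMF.uniformOfFintype Bool).map fun r => (K, s.writeInt a (i.eval s) r.toNat)
  | (.seq c₁ c₂ :: K, s) => PMF.pure (c₁ :: c₂ :: K, s)
  | (.ite b c₁ c₂ :: K, s) => PMF.pure (if b.Holds s then (c₁ :: K, s) else (c₂ :: K, s))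
  | (.loop b c :: K, s) =>
      PMF.pure (if b.Holds s then (c :: .loop b c :: K, s) else (K, s))

/-- The distribution of the configuration after `t` steps. -/
noncomputable def runFor : ℕ → Config → PMF Config
  | 0, c => PMF.pure c
  | t + 1, c => (step c).bind (runFor t)

/-- Started in memory `s`, the program `c` has, with probability at least `p`, halted within `T`
steps in a memory that satisfies `good`. -/
def SucceedsWithin (c : Cmd) (s : State) (T p : ℝ) (good : State → Prop) : Prop :=
  ENNReal.ofReal p ≤
    (runFor ⌊T⌋₊ ([c], s)).toOuterMeasure {z | z.1 = [] ∧ good z.2}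

end RealRAM

namespace SVM

/-- Points of the class with label `σ`. -/
def classPoints {n d : ℕ} (x : Fin n → EuclideanSpace ℝ (Fin d)) (y : Fin n → ℤˣ) (σ : ℤˣ) :
    Set (EuclideanSpace ℝ (Fin d)) :=
  x '' {i | y i = σ}

/-- The reduced convex hull of the class with label `σ`: convex combinations of its points in
which every weight is at most `ν`. -/
def reducedHull {n d : ℕ} (ν : ℝ) (x : Fin n → EuclideanSpace ℝ (Fin d)) (y : Fin n → ℤˣ)
    (σ : ℤˣ) : Set (EuclideanSpace ℝ (Fin d)) :=
  {p | ∃ η : Fin n → ℝ, (∀ i, 0 ≤ η i ∧ η i ≤ ν) ∧ (∀ i, y i ≠ σ → η i = 0) ∧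
    ∑ i, η i = 1 ∧ p = ∑ i, η i • x i}

/-- Constraints of the hard-margin SVM. -/
def HMFeasible {n d : ℕ} (x : Fin n → EuclideanSpace ℝ (Fin d)) (y : Fin n → ℤˣ)
    (w : EuclideanSpace ℝ (Fin d)) (b : ℝ) : Prop :=
  ∀ i, 1 ≤ ((y i : ℤ) : ℝ) * (inner ℝ w (x i) - b)

/-- Objective of the hard-margin SVM. -/
noncomputable def hmObjective {d : ℕ} (w : EuclideanSpace ℝ (Fin d)) : ℝ :=
  1 / 2 * ‖w‖ ^ 2

/-- `(w, b)` is a `(1 - ε)`-approximation of the hard-margin SVM: it is feasible, and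
`1 - ε` times its objective is at most the minimum (which is positive). -/
def HMApprox {n d : ℕ} (ε : ℝ) (x : Fin n → EuclideanSpace ℝ (Fin d)) (y : Fin n → ℤˣ)
    (w : EuclideanSpace ℝ (Fin d)) (b : ℝ) : Prop :=
  HMFeasible x y w b ∧
    ∀ w' b', HMFeasible x y w' b' → (1 - ε) * hmObjective w ≤ hmObjective w'

/-- Constraints of the `ν`-SVM. -/
def NuFeasible {n d : ℕ} (x : Fin n → EuclideanSpace ℝ (Fin d)) (y : Fin n → ℤˣ)
    (w : EuclideanSpace ℝ (Fin d)) (b ρ : ℝ) (δ : Fin n → ℝ) : Prop :=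
  ∀ i, ρ - δ i ≤ ((y i : ℤ) : ℝ) * (inner ℝ w (x i) - b) ∧ 0 ≤ δ i

/-- Objective of the `ν`-SVM. -/
noncomputable def nuObjective {n d : ℕ} (ν : ℝ) (w : EuclideanSpace ℝ (Fin d)) (ρ : ℝ)
    (δ : Fin n → ℝ) : ℝ :=
  1 / 2 * ‖w‖ ^ 2 - ρ + ν / 2 * ∑ i, δ i

/-- `(w, b, ρ, δ)` is a `(1 - ε)`-approximation of the `ν`-SVM: it is feasible, and its objective
is at most `1 - ε` times the minimum (which is negative if the reduced hulls are disjoint). -/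
def NuApprox {n d : ℕ} (ε ν : ℝ) (x : Fin n → EuclideanSpace ℝ (Fin d)) (y : Fin n → ℤˣ)
    (w : EuclideanSpace ℝ (Fin d)) (b ρ : ℝ) (δ : Fin n → ℝ) : Prop :=
  NuFeasible x y w b ρ δ ∧
    ∀ w' b' ρ' δ', NuFeasible x y w' b' ρ' δ' →
      nuObjective ν w ρ δ ≤ (1 - ε) * nuObjective ν w' ρ' δ'

/-- The distance between two sets. -/
noncomputable def minDist {d : ℕ} (S T : Set (EuclideanSpace ℝ (Fin d))) : ℝ :=
  sInf (Set.image2 dist S T)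

/-- The parameter `β`: the squared distance between the two hulls `S`, `T` over the squared
maximum distance among the points. -/
noncomputable def distRatio {n d : ℕ} (x : Fin n → EuclideanSpace ℝ (Fin d))
    (S T : Set (EuclideanSpace ℝ (Fin d))) : ℝ :=
  minDist S T ^ 2 / Metric.diam (Set.range x) ^ 2

/-- The step bound `C · L ^ k · n (d + √(d / (ε β)))`, with
`L = 1 + log n + log d + log (1 / ε) + log (1 / β)`. -/
noncomputable def timeBound (C : ℝ) (k n d : ℕ) (ε β : ℝ) : ℝ :=
  C * (1 + Real.log n + Real.log d + Real.log (1 / ε) + Real.log (1 / β)) ^ k *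
    (n * (d + √(d / (ε * β))))

/-- The initial memory. Integer array `0` holds `n`, `d`; real array `0` holds the points, one
after the other; real array `1` holds the labels; real array `2` holds the real parameters. All
other cells are zero. -/
noncomputable def inputState {n d : ℕ} (x : Fin n → EuclideanSpace ℝ (Fin d)) (y : Fin n → ℤˣ)
    (params : List ℝ) : RealRAM.State where
  int a j := if a = 0 then [n, d].getD j 0 else 0
  real a j :=
    if a = 0 then
      if h : j < n * d then
        x (finProdFinEquiv.symm ⟨j, h⟩).1 (finProdFinEquiv.symm ⟨j, h⟩).2
      else 0
    else if a = 1 then (if h : j < n then ((y ⟨j, h⟩ : ℤ) : ℝ) else 0)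
    else if a = 2 then params.getD j 0
    else 0

/-- The output vector `w`, read from real array `3`. -/
noncomputable def outW (d : ℕ) (s : RealRAM.State) : EuclideanSpace ℝ (Fin d) :=
  WithLp.toLp 2 fun j => s.real 3 j

/-- The output offset `b`. -/
def outB (s : RealRAM.State) : ℝ := s.real 4 0

/-- The output `ρ`. -/
def outRho (s : RealRAM.State) : ℝ := s.real 4 1

/-- The output slack vector `δ`, read from real array `5`. -/
def outSlack (n : ℕ) (s : RealRAM.State) : Fin n → ℝ := fun i => s.real 5 i

end SVM

/-!
Both problems are dual to finding the shortest vector `∑ j, η j • A j`, where `A j` is the point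
`x j`, translated, scaled and multiplied with its label, and the weights `η` lie between `0` and
`ν` and sum to `1` in each class (`ν = 1` for the hard margin). The vectors `∑ j, η j • A j` are
the differences of points of the two reduced hulls, so their least squared length is `β` or more in
the units of `A`. A vector of nearly least length, together with a threshold for each class, gives
a solution of the primal problem and a lower bound for its optimum (`Normalized.nuApprox`,
`Normalized.hmApprox`), and whether the bounds are good enough can be tested. So the program never
has to know `β`: it runs with guesses `q ^ 2 = 1/4, 1/16, …` for `ε β` until the test succeeds, and
a wrong guess does no harm.

For a guess, the squared length plus a small multiple `γ` of the negative entropy is minimized as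
the saddle point problem `min_η max_w ⟨w, ∑ j, η j • A j⟩ - ‖w‖² / 2 + γ ent η` by the stochastic
primal-dual coordinate method: a random coordinate of `w` is updated, then all weights, by a
multiplicative step. The entropy is strongly convex in the `ℓ¹`-norm (`Soft.le_gap`, from Pinsker's
inequality); hence a coordinate step is controlled by the largest entries of the matrix, and
the potential `Psi` contracts in expectation by the factor `1 - 1 / (2 m + 4 pS)` in each step
(`sum_Psi_le`). For that, the entries must not exceed the order of `√(log (n m) / m)`. A Hadamard
transform with random signs, on the coordinates padded to a power of two `m`, achieves this without
changing inner products; its failure probability is bounded by an exponential potential that is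
followed through the coin tosses (`flatPot_step`, `flatPot_zero`).
The number of steps for a guess is of order `m + √m / q` up to logarithms, each of cost `n` up to
logarithms. The multiplicative step needs a normalization in the capped simplices; it is done by
bisection, up to an error `δ` that all estimates carry along.

Random runs of the machine are treated by an expectation transformer: `val φ t` is the expectation
of `φ` over runs that halt within `t` steps. Sequences and loops have rules in which a potential
takes the role of an invariant (`val_seq`, `val_loop`); deterministic pieces of the program are
handled by triples `Runs` with a time bound. Each iteration step is sampled and bounded in
`val_step`, a whole level in `le_val_level` and `le_val_level_of_sq_le`, the program in `val_prog`,
and `exists_params` turns the step counts into the claimed bound. The failure probability is at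
most `1 / (2 n)` for the signs and `1 / (2 n)` for the first guess that is small enough.
-/

/-! ### Expectation transformer of the machine -/

namespace RealRAM

open Classical in
/-- The expectation of `φ` over the final memory of the runs from a configuration that halt within
`t` steps. -/
noncomputable def val (φ : State → ENNReal) : ℕ → Config → ENNReal
  | 0, ([], s) => φ s
  | 0, (_ :: _, _) => 0
  | _ + 1, ([], s) => φ s
  | t + 1, (.iset a i e :: K, s) => val φ t (K, s.writeInt a (i.eval s) (e.eval s))
  | t + 1, (.rset a i e :: K, s) => val φ t (K, s.writeReal a (i.eval s) (e.eval s))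
  | t + 1, (.flip a i :: K, s) =>
      (val φ t (K, s.writeInt a (i.eval s) 0) + val φ t (K, s.writeInt a (i.eval s) 1)) / 2
  | t + 1, (.seq c₁ c₂ :: K, s) => val φ t (c₁ :: c₂ :: K, s)
  | t + 1, (.ite b c₁ c₂ :: K, s) => if b.Holds s then val φ t (c₁ :: K, s) else val φ t (c₂ :: K, s)
  | t + 1, (.loop b c :: K, s) =>
      if b.Holds s then val φ t (c :: .loop b c :: K, s) else val φ t (K, s)

@[simp] lemma val_nil (φ : State → ENNReal) (t : ℕ) (s : State) : val φ t ([], s) = φ s := by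
  cases t <;> rfl

open Classical in
/-- The expectation of an indicator function is a probability of the machine. -/
lemma val_indicator_le (good : State → Prop) (t : ℕ) (z : Config) :
    val (fun s => if good s then 1 else 0) t z ≤
      (runFor t z).toOuterMeasure {z | z.1 = [] ∧ good z.2} := by
  induction t generalizing z with
  | zero =>
    obtain ⟨K, s⟩ := z
    cases K with
    | nil =>
      by_cases h : good s
      · simp [runFor, PMF.toOuterMeasure_pure_apply, h]
      · simp [h]
    | cons c K => simp [val]
  | succ t ih =>
    obtain ⟨K, s⟩ := z
    match K with
    | [] => simpa [runFor, step, PMF.pure_bind, val] using ih ([], s)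
    | .iset a i e :: K => simpa [runFor, step, PMF.pure_bind, val] using ih _
    | .rset a i e :: K => simpa [runFor, step, PMF.pure_bind, val] using ih _
    | .seq c₁ c₂ :: K => simpa [runFor, step, PMF.pure_bind, val] using ih _
    | .ite b c₁ c₂ :: K =>
      by_cases h : b.Holds s
      · simpa [runFor, step, PMF.pure_bind, val, h] using ih (c₁ :: K, s)
      · simpa [runFor, step, PMF.pure_bind, val, h] using ih (c₂ :: K, s)
    | .loop b c :: K =>
      by_cases h : b.Holds s
      · simpa [runFor, step, PMF.pure_bind, val, h] using ih (c :: .loop b c :: K, s)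
      · simpa [runFor, step, PMF.pure_bind, val, h] using ih (K, s)
    | .flip a i :: K =>
      simp only [runFor, step, PMF.bind_map, PMF.toOuterMeasure_bind_apply, val, tsum_fintype,
        Fintype.sum_bool, PMF.uniformOfFintype_apply, Fintype.card_bool, Function.comp]
      rw [ENNReal.div_eq_inv_mul, mul_add, add_comm]
      exact add_le_add (mul_le_mul' (by norm_num) (ih _)) (mul_le_mul' (by norm_num) (ih _))

lemma val_mono {φ ψ : State → ENNReal} (h : ∀ s, φ s ≤ ψ s) (t : ℕ) (z : Config) :
    val φ t z ≤ val ψ t z := by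
  induction t generalizing z with
  | zero => obtain ⟨_ | _, s⟩ := z <;> simp [val, h]
  | succ t ih =>
    obtain ⟨K, s⟩ := z
    match K with
    | [] => simp [h]
    | .iset a i e :: K => exact ih _
    | .rset a i e :: K => exact ih _
    | .seq c₁ c₂ :: K => exact ih _
    | .ite b c₁ c₂ :: K => simp only [val]; split_ifs <;> exact ih _
    | .loop b c :: K => simp only [val]; split_ifs <;> exact ih _
    | .flip a i :: K =>
      simp only [val]
      exact ENNReal.div_le_div_right (add_le_add (ih _) (ih _)) _

lemma val_succ_le (φ : State → ENNReal) (t : ℕ) (z : Config) : val φ t z ≤ val φ (t + 1) z := by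
  induction t generalizing z with
  | zero => obtain ⟨_ | _, s⟩ := z <;> simp [val]
  | succ t ih =>
    obtain ⟨K, s⟩ := z
    match K with
    | [] => simp
    | .iset a i e :: K => exact ih _
    | .rset a i e :: K => exact ih _
    | .seq c₁ c₂ :: K => exact ih _
    | .ite b c₁ c₂ :: K => rw [val, val]; split_ifs <;> exact ih _
    | .loop b c :: K => rw [val, val]; split_ifs <;> exact ih _
    | .flip a i :: K =>
      rw [val, val]
      exact ENNReal.div_le_div_right (add_le_add (ih _) (ih _)) _

lemma val_le_val {φ : State → ENNReal} {t t' : ℕ} (h : t ≤ t') (z : Config) :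
    val φ t z ≤ val φ t' z :=
  monotone_nat_of_le_succ (f := fun t => val φ t z) (fun t => val_succ_le φ t z) h

/-- Running a stack `S` first and the rest `K` of the stack afterwards. -/
lemma val_append (φ : State → ENNReal) (K : List Cmd) (T₁ T₂ : ℕ) (S : List Cmd) (s : State) :
    val (fun s' => val φ T₂ (K, s')) T₁ (S, s) ≤ val φ (T₁ + T₂) (S ++ K, s) := by
  induction T₁ generalizing S s with
  | zero =>
    cases S <;> simp [val]
  | succ t ih =>
    rw [Nat.succ_add]
    match S with
    | [] => simpa using val_le_val (by omega) _
    | .iset a i e :: S => exact ih _ _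
    | .rset a i e :: S => exact ih _ _
    | .seq c₁ c₂ :: S => exact ih (c₁ :: c₂ :: S) _
    | .ite b c₁ c₂ :: S =>
      rw [List.cons_append, val, val]
      split_ifs
      · exact ih (c₁ :: S) _
      · exact ih (c₂ :: S) _
    | .loop b c :: S =>
      rw [List.cons_append, val, val]
      split_ifs
      · exact ih (c :: .loop b c :: S) _
      · exact ih S _
    | .flip a i :: S =>
      rw [List.cons_append, val, val]
      exact ENNReal.div_le_div_right (add_le_add (ih _ _) (ih _ _)) _

open Classical in
lemma succeedsWithin_of_val {c : Cmd} {s : State} {T p : ℝ} {good : State → Prop} {t : ℕ}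
    (ht : (t : ℝ) ≤ T)
    (hval : ENNReal.ofReal p ≤ val (fun s => if good s then 1 else 0) t ([c], s)) :
    SucceedsWithin c s T p good :=
  hval.trans ((val_le_val (Nat.le_floor ht) _).trans (val_indicator_le _ _ _))

lemma val_seq {φ : State → ENNReal} {c₁ c₂ : Cmd} {T₁ T₂ T : ℕ} {s : State}
    (hT : T₁ + T₂ + 1 ≤ T) :
    val (fun s' => val φ T₂ ([c₂], s')) T₁ ([c₁], s) ≤ val φ T ([.seq c₁ c₂], s) :=
  (val_append φ [c₂] T₁ T₂ [c₁] s).trans (val_le_val (t := T₁ + T₂ + 1) hT ([.seq c₁ c₂], s))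

/-- Integer arrays to which a program may write. -/
def Cmd.wi : Cmd → List ℕ
  | .iset a _ _ => [a]
  | .rset _ _ _ => []
  | .flip a _ => [a]
  | .seq c₁ c₂ => c₁.wi ++ c₂.wi
  | .ite _ c₁ c₂ => c₁.wi ++ c₂.wi
  | .loop _ c => c.wi

/-- Real arrays to which a program may write. -/
def Cmd.wr : Cmd → List ℕ
  | .iset _ _ _ => []
  | .rset a _ _ => [a]
  | .flip _ _ => []
  | .seq c₁ c₂ => c₁.wr ++ c₂.wr
  | .ite _ c₁ c₂ => c₁.wr ++ c₂.wr
  | .loop _ c => c.wr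

/-- The memories `s` and `s'` differ at most in arrays to which `c` may write. -/
def Agree (c : Cmd) (s s' : State) : Prop :=
  (∀ a, a ∉ c.wi → s'.int a = s.int a) ∧ (∀ a, a ∉ c.wr → s'.real a = s.real a)

lemma Agree.refl (c : Cmd) (s : State) : Agree c s s := ⟨fun _ _ => rfl, fun _ _ => rfl⟩

lemma Agree.trans {c : Cmd} {s s' s'' : State} (h : Agree c s s') (h' : Agree c s' s'') :
    Agree c s s'' :=
  ⟨fun a ha => (h'.1 a ha).trans (h.1 a ha), fun a ha => (h'.2 a ha).trans (h.2 a ha)⟩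

lemma Agree.mono {c c' : Cmd} {s s' : State} (h : Agree c s s') (hi : ∀ a ∈ c.wi, a ∈ c'.wi)
    (hr : ∀ a ∈ c.wr, a ∈ c'.wr) : Agree c' s s' :=
  ⟨fun a ha => h.1 a fun h' => ha (hi a h'), fun a ha => h.2 a fun h' => ha (hr a h')⟩

open Classical in
lemma val_frame_stack (φ : State → ENNReal) (P : State → Prop) (C : List Cmd → Prop)
    (hseq : ∀ c₁ c₂ K, C (.seq c₁ c₂ :: K) → C (c₁ :: c₂ :: K))
    (hite : ∀ b c₁ c₂ K, C (.ite b c₁ c₂ :: K) → C (c₁ :: K) ∧ C (c₂ :: K))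
    (hloop : ∀ b c K, C (.loop b c :: K) → C (c :: .loop b c :: K))
    (htail : ∀ c K, C (c :: K) → C K)
    (hset : ∀ a i e K s v j, C (.iset a i e :: K) → P s → P (s.writeInt a j v))
    (hrset : ∀ a i e K s v j, C (.rset a i e :: K) → P s → P (s.writeReal a j v))
    (hflip : ∀ a i K s v j, C (.flip a i :: K) → P s → P (s.writeInt a j v))
    (t : ℕ) (K : List Cmd) (s : State) (hC : C K) (hP : P s) :
    val φ t (K, s) ≤ val (fun s' => if P s' then φ s' else 0) t (K, s) := by
  induction t generalizing K s with
  | zero => cases K <;> simp [val, hP]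
  | succ t ih =>
    match K with
    | [] => simp [hP]
    | .iset a i e :: K => exact ih _ _ (htail _ _ hC) (hset _ _ _ _ _ _ _ hC hP)
    | .rset a i e :: K => exact ih _ _ (htail _ _ hC) (hrset _ _ _ _ _ _ _ hC hP)
    | .seq c₁ c₂ :: K => exact ih _ _ (hseq _ _ _ hC) hP
    | .ite b c₁ c₂ :: K =>
      rw [val, val]
      split_ifs
      · exact ih _ _ (hite _ _ _ _ hC).1 hP
      · exact ih _ _ (hite _ _ _ _ hC).2 hP
    | .loop b c :: K =>
      rw [val, val]
      split_ifs
      · exact ih _ _ (hloop _ _ _ hC) hP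
      · exact ih _ _ (htail _ _ hC) hP
    | .flip a i :: K =>
      rw [val, val]
      exact ENNReal.div_le_div_right (add_le_add
        (ih _ _ (htail _ _ hC) (hflip _ _ _ _ _ _ hC hP))
        (ih _ _ (htail _ _ hC) (hflip _ _ _ _ _ _ hC hP))) _

open Classical in
/-- A program leaves the arrays unchanged to which it never writes. -/
lemma val_frame (φ : State → ENNReal) (t : ℕ) (c : Cmd) (s : State) :
    val φ t ([c], s) ≤ val (fun s' => if Agree c s s' then φ s' else 0) t ([c], s) := by
  refine val_frame_stack φ (Agree c s)
    (fun K => ∀ c' ∈ K, (∀ a ∈ c'.wi, a ∈ c.wi) ∧ (∀ a ∈ c'.wr, a ∈ c.wr))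
    ?_ ?_ ?_ ?_ ?_ ?_ ?_ t [c] s (by simp) (Agree.refl _ _)
  · intro c₁ c₂ K h
    simp only [List.forall_mem_cons, Cmd.wi, Cmd.wr, List.mem_append] at h ⊢
    exact ⟨⟨fun a ha => h.1.1 a (.inl ha), fun a ha => h.1.2 a (.inl ha)⟩,
      ⟨fun a ha => h.1.1 a (.inr ha), fun a ha => h.1.2 a (.inr ha)⟩, h.2⟩
  · intro b c₁ c₂ K h
    simp only [List.forall_mem_cons, Cmd.wi, Cmd.wr, List.mem_append] at h ⊢
    exact ⟨⟨⟨fun a ha => h.1.1 a (.inl ha), fun a ha => h.1.2 a (.inl ha)⟩, h.2⟩,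
      ⟨fun a ha => h.1.1 a (.inr ha), fun a ha => h.1.2 a (.inr ha)⟩, h.2⟩
  · intro b c' K h
    simp only [List.forall_mem_cons, Cmd.wi, Cmd.wr] at h ⊢
    exact ⟨h.1, h⟩
  · intro c' K h
    exact (List.forall_mem_cons.1 h).2
  · intro a i e K s' v j h hP
    have h' := (List.forall_mem_cons.1 h).1.1 a (by simp [Cmd.wi])
    refine ⟨fun a' ha' => ?_, fun a' ha' => hP.2 a' ha'⟩
    have : a' ≠ a := fun h => ha' (h ▸ h')
    simp [State.writeInt, this, hP.1 a' ha']
  · intro a i e K s' v j h hP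
    have h' := (List.forall_mem_cons.1 h).1.2 a (by simp [Cmd.wr])
    refine ⟨fun a' ha' => hP.1 a' ha', fun a' ha' => ?_⟩
    have : a' ≠ a := fun h => ha' (h ▸ h')
    simp [State.writeReal, this, hP.2 a' ha']
  · intro a i K s' v j h hP
    have h' := (List.forall_mem_cons.1 h).1.1 a (by simp [Cmd.wi])
    refine ⟨fun a' ha' => ?_, fun a' ha' => hP.2 a' ha'⟩
    have : a' ≠ a := fun h => ha' (h ▸ h')
    simp [State.writeInt, this, hP.1 a' ha']

/-- A deterministic Hoare triple with a time bound: started in memory `s`, the program `c` halts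
within `T` steps in a memory that satisfies `Q`, whatever the coins. -/
def Runs (c : Cmd) (T : ℕ) (s : State) (Q : State → Prop) : Prop :=
  ∃ s', Q s' ∧ ∀ φ, φ s' ≤ val φ T ([c], s)

lemma Runs.imp {c : Cmd} {T T' : ℕ} {s : State} {Q Q' : State → Prop} (h : Runs c T s Q)
    (hT : T ≤ T') (hQ : ∀ s', Q s' → Q' s') : Runs c T' s Q' :=
  let ⟨s', h₁, h₂⟩ := h
  ⟨s', hQ _ h₁, fun φ => (h₂ φ).trans (val_le_val hT _)⟩

open Classical in
lemma Runs.frame {c : Cmd} {T : ℕ} {s : State} {Q : State → Prop} (h : Runs c T s Q) :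
    Runs c T s fun s' => Agree c s s' ∧ Q s' := by
  obtain ⟨s', h₁, h₂⟩ := h
  refine ⟨s', ⟨?_, h₁⟩, h₂⟩
  by_contra hA
  have h3 := (h₂ fun x => if x = s' then 1 else 0).trans (val_frame _ T c s)
  have h4 : (fun x => if Agree c s x then (if x = s' then (1 : ENNReal) else 0) else 0) =
      fun _ => 0 := by
    funext x
    by_cases hx : x = s'
    · subst hx; simp [hA]
    · simp [hx]
  have h5 : ∀ t z, val (fun _ => 0) t z = 0 := by
    intro t
    induction t with
    | zero => rintro ⟨_ | _, s⟩ <;> rfl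
    | succ t ih =>
      rintro ⟨K, s⟩
      match K with
      | [] => rfl
      | .iset a i e :: K => exact ih _
      | .rset a i e :: K => exact ih _
      | .seq c₁ c₂ :: K => exact ih _
      | .ite b c₁ c₂ :: K => rw [val]; split_ifs <;> exact ih _
      | .loop b c :: K => rw [val]; split_ifs <;> exact ih _
      | .flip a i :: K => rw [val, ih, ih]; simp
  rw [h4, h5] at h3
  simp at h3

lemma Runs.le_val {c : Cmd} {T : ℕ} {s : State} {Q : State → Prop} (h : Runs c T s Q)
    {φ : State → ENNReal} {p : ENNReal} (hp : ∀ s', Q s' → p ≤ φ s') : p ≤ val φ T ([c], s) :=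
  let ⟨s', h₁, h₂⟩ := h
  (hp s' h₁).trans (h₂ φ)

lemma Runs.iset {a : ℕ} {i e : IExpr} {T : ℕ} {s : State} {Q : State → Prop} (hT : 1 ≤ T)
    (h : Q (s.writeInt a (i.eval s) (e.eval s))) : Runs (.iset a i e) T s Q := by
  refine ⟨_, h, fun φ => le_trans ?_ (val_le_val hT _)⟩
  simp [val]

lemma Runs.rset {a : ℕ} {i : IExpr} {e : RExpr} {T : ℕ} {s : State} {Q : State → Prop}
    (hT : 1 ≤ T) (h : Q (s.writeReal a (i.eval s) (e.eval s))) : Runs (.rset a i e) T s Q := by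
  refine ⟨_, h, fun φ => le_trans ?_ (val_le_val hT _)⟩
  simp [val]

/-- Sequential composition; the second triple may use that the first program only changes the
arrays to which it writes. -/
lemma Runs.seq {c₁ c₂ : Cmd} {T₁ T₂ T : ℕ} {s : State} {Q₁ Q : State → Prop}
    (h₁ : Runs c₁ T₁ s Q₁) (h₂ : ∀ s', Agree c₁ s s' → Q₁ s' → Runs c₂ T₂ s' Q)
    (hT : T₁ + T₂ + 1 ≤ T) : Runs (.seq c₁ c₂) T s Q := by
  obtain ⟨s', ⟨hA, hQ⟩, h'⟩ := h₁.frame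
  obtain ⟨s'', hQ', h''⟩ := h₂ s' hA hQ
  exact ⟨s'', hQ', fun φ => ((h'' φ).trans (h' _)).trans (val_seq hT)⟩

lemma Runs.ite {b : BExpr} {c₁ c₂ : Cmd} {T T' : ℕ} {s : State} {Q : State → Prop}
    (h₁ : b.Holds s → Runs c₁ T s Q) (h₂ : ¬ b.Holds s → Runs c₂ T s Q) (hT : T + 1 ≤ T') :
    Runs (.ite b c₁ c₂) T' s Q := by
  by_cases h : b.Holds s
  · obtain ⟨s', hQ, h'⟩ := h₁ h
    refine ⟨s', hQ, fun φ => le_trans ?_ (val_le_val hT _)⟩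
    simpa [val, h] using h' φ
  · obtain ⟨s', hQ, h'⟩ := h₂ h
    refine ⟨s', hQ, fun φ => le_trans ?_ (val_le_val hT _)⟩
    simpa [val, h] using h' φ

/-- The rule for loops: `ψ k` is a lower bound for the expectation of `φ` after the loop, when `k`
passes through the body have been made. -/
lemma val_loop {b : BExpr} {c : Cmd} {φ : State → ENNReal} (ψ : ℕ → State → ENNReal) (N T : ℕ)
    (hend : ∀ k, k ≤ N → ∀ s, ¬ b.Holds s → ψ k s ≤ φ s)
    (hstep : ∀ k, k < N → ∀ s, b.Holds s → ψ k s ≤ val (ψ (k + 1)) T ([c], s))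
    (hlast : ∀ s, b.Holds s → ψ N s = 0) (s : State) :
    ψ 0 s ≤ val φ (N * (T + 1) + 1) ([.loop b c], s) := by
  have key : ∀ j k, k + j = N → ∀ s, ψ k s ≤ val φ (j * (T + 1) + 1) ([.loop b c], s) := by
    intro j
    induction j with
    | zero =>
      intro k hk s
      by_cases h : b.Holds s
      · have : k = N := by omega
        rw [this, hlast s h]; exact zero_le
      · simpa [val, h] using hend k (by omega) s h
    | succ j ih =>
      intro k hk s
      by_cases h : b.Holds s
      · calc ψ k s ≤ val (ψ (k + 1)) T ([c], s) := hstep k (by omega) s h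
          _ ≤ val (fun s' => val φ (j * (T + 1) + 1) ([.loop b c], s')) T ([c], s) :=
            val_mono (ih (k + 1) (by omega)) _ _
          _ ≤ val φ (T + (j * (T + 1) + 1)) ([c] ++ [.loop b c], s) := val_append _ _ _ _ _ _
          _ = val φ (T + (j * (T + 1) + 1) + 1) ([.loop b c], s) := by simp [val, h]
          _ ≤ _ := val_le_val (by ring_nf; omega) _
      · simpa [val, h] using hend k (by omega) s h
  exact key N 0 (by simp) s

/-- The rule for deterministic loops with invariant `I`. -/
lemma Runs.loop {b : BExpr} {c : Cmd} (I : ℕ → State → Prop) (N T : ℕ) {T' : ℕ} {s : State}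
    {Q : State → Prop} (h0 : I 0 s)
    (hb : ∀ k s', k ≤ N → Agree c s s' → I k s' → (b.Holds s' ↔ k < N))
    (hstep : ∀ k s', k < N → Agree c s s' → I k s' → b.Holds s' → Runs c T s' (I (k + 1)))
    (hQ : ∀ s', Agree c s s' → I N s' → ¬ b.Holds s' → Q s')
    (hT : N * (T + 1) + 1 ≤ T') : Runs (.loop b c) T' s Q := by
  have key : ∀ j k, k + j = N → ∀ s', Agree c s s' → I k s' →
      Runs (.loop b c) (j * (T + 1) + 1) s' Q := by
    intro j
    induction j with
    | zero =>
      intro k hk s' hA hI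
      have hk' : k = N := by omega
      subst hk'
      have hn : ¬ b.Holds s' := by simp [hb k s' le_rfl hA hI]
      exact ⟨s', hQ s' hA hI hn, fun φ => by simp [val, hn]⟩
    | succ j ih =>
      intro k hk s' hA hI
      have hh : b.Holds s' := (hb k s' (by omega) hA hI).2 (by omega)
      obtain ⟨s₁, ⟨hA₁, hI₁⟩, h₁⟩ := (hstep k s' (by omega) hA hI hh).frame
      obtain ⟨s₂, hQ₂, h₂⟩ := ih (k + 1) (by omega) s₁ (hA.trans hA₁) hI₁
      refine ⟨s₂, hQ₂, fun φ => ?_⟩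
      calc φ s₂ ≤ val φ (j * (T + 1) + 1) ([.loop b c], s₁) := h₂ φ
        _ ≤ val (fun s' => val φ (j * (T + 1) + 1) ([.loop b c], s')) T ([c], s') := h₁ _
        _ ≤ val φ (T + (j * (T + 1) + 1)) ([c] ++ [.loop b c], s') := val_append _ _ _ _ _ _
        _ = val φ (T + (j * (T + 1) + 1) + 1) ([.loop b c], s') := by simp [val, hh]
        _ ≤ _ := val_le_val (by ring_nf; omega) _
  exact (key N 0 (by simp) s (Agree.refl _ _) h0).imp hT fun _ h => h

/-- `for v := 0, …, N - 1 do c`, where cell `0` of the integer array `v` is the counter. -/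
def forLoop (v : ℕ) (N : IExpr) (c : Cmd) : Cmd :=
  .seq (.iset v (.const 0) (.const 0))
    (.loop (.ilt (.load v (.const 0)) N)
      (.seq c (.iset v (.const 0) (.add (.load v (.const 0)) (.const 1)))))

lemma Runs.forLoop {v : ℕ} {N : IExpr} {c : Cmd} (I : ℕ → State → Prop) (n T : ℕ) {T' : ℕ}
    {s : State} {Q : State → Prop} (hv : v ∉ c.wi)
    (hN : ∀ s', Agree (RealRAM.forLoop v N c) s s' → N.eval s' = n)
    (hI : ∀ k s' x, I k s' → I k (s'.writeInt v 0 x)) (h0 : I 0 s)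
    (hstep : ∀ k s', k < n → Agree (RealRAM.forLoop v N c) s s' → s'.int v 0 = k → I k s' →
      Runs c T s' (I (k + 1)))
    (hQ : ∀ s', Agree (RealRAM.forLoop v N c) s s' → I n s' → Q s')
    (hT : n * (T + 3) + 3 ≤ T') : Runs (RealRAM.forLoop v N c) T' s Q := by
  have hA0 : ∀ x, Agree (RealRAM.forLoop v N c) s (s.writeInt v 0 x) := by
    intro x
    refine ⟨fun a ha => ?_, fun a ha => rfl⟩
    have : a ≠ v := fun h => ha (by simp [RealRAM.forLoop, Cmd.wi, h])
    simp [State.writeInt, this]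
  have hsub : ∀ s' s'', Agree (.seq c (.iset v (.const 0) (.add (.load v (.const 0)) (.const 1))))
      s' s'' → Agree (RealRAM.forLoop v N c) s' s'' := fun s' s'' h =>
    h.mono (by simp [RealRAM.forLoop, Cmd.wi]; tauto) (by simp [RealRAM.forLoop, Cmd.wr])
  refine Runs.seq (Q₁ := fun s' => s' = s.writeInt v 0 0) (T₁ := 1) (T₂ := n * (T + 3) + 1)
    (Runs.iset le_rfl rfl) ?_ (by omega)
  rintro s₀ - rfl
  refine Runs.loop (fun k s' => s'.int v 0 = k ∧ I k s') n (T + 2)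
    ⟨by simp [State.writeInt], hI _ _ _ h0⟩ ?_ ?_ ?_ le_rfl
  · rintro k s' - hA ⟨hk, -⟩
    simp [BExpr.Holds, IExpr.eval, hk, hN s' ((hA0 0).trans (hsub _ _ hA))]
  · rintro k s' hkn hA ⟨hk, hIk⟩ -
    refine Runs.seq (hstep k s' hkn ((hA0 0).trans (hsub _ _ hA)) hk hIk) (T₂ := 1) ?_ le_rfl
    intro s'' hA'' hI''
    refine Runs.iset le_rfl ⟨?_, ?_⟩
    · simp [State.writeInt, IExpr.eval, hA''.1 v hv, hk]
    · exact hI _ _ _ hI''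
  · rintro s' hA ⟨-, hIn⟩ -
    exact hQ s' ((hA0 0).trans (hsub _ _ hA)) hIn

end RealRAM

/-! ### Entropy on a product of two capped simplices -/

namespace SPDC

open Finset

/-- Negative entropy of the first `n` coordinates. -/
noncomputable def ent (n : ℕ) (u : ℕ → ℝ) : ℝ := ∑ j ∈ range n, u j * Real.log (u j)

/-- Weight vectors on `n` points which are divided by `c` into the classes `0` and `1`: the weights
lie between `0` and `ν`, and those of each class sum to `1`. -/
def capSimplex (n : ℕ) (ν : ℝ) (c : ℕ → ℕ) : Set (ℕ → ℝ) :=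
  {η | (∀ j < n, 0 ≤ η j ∧ η j ≤ ν) ∧
    ∀ k < 2, ∑ j ∈ range n, (if c j = k then η j else 0) = 1}

/-- The `ℓ¹`-distance of the first `n` coordinates. -/
def l1 (n : ℕ) (u v : ℕ → ℝ) : ℝ := ∑ j ∈ range n, |u j - v j|

/-- The Bregman distance of the negative entropy, from `η` to `u`, where `z` plays the role of a
subgradient at `η`. -/
noncomputable def gap (n : ℕ) (z η u : ℕ → ℝ) : ℝ :=
  ent n u - ent n η - ∑ j ∈ range n, z j * (u j - η j)

/-- `η` approximately maximizes `⟨z, ·⟩ - ent` over the capped simplices: up to an error of `δ`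
in the logarithm, the weights are `min ν (exp (z j + lo))`, with one normalization `lo` for each
class. -/
structure Soft (n : ℕ) (ν : ℝ) (c : ℕ → ℕ) (z lo : ℕ → ℝ) (δ : ℝ) (η : ℕ → ℝ) : Prop where
  mem : η ∈ capSimplex n ν c
  pos : ∀ j < n, 0 < η j
  log : ∀ j < n, (η j = ν ∧ Real.log ν ≤ z j + lo (c j)) ∨
    (z j + lo (c j) ≤ Real.log (η j) ∧ Real.log (η j) ≤ z j + lo (c j) + δ ∧
      z j + lo (c j) ≤ Real.log ν)

variable {n m : ℕ} {ν δ : ℝ} {c : ℕ → ℕ} {u v z lo η : ℕ → ℝ}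

lemma sum_classes (hc : ∀ j < n, c j < 2) (f : ℕ → ℝ) :
    ∑ j ∈ range n, f j = ∑ j ∈ range n, (if c j = 0 then f j else 0) +
      ∑ j ∈ range n, (if c j = 1 then f j else 0) := by
  rw [← sum_add_distrib]
  refine sum_congr rfl fun j hj => ?_
  have := hc j (mem_range.1 hj)
  interval_cases c j <;> simp

lemma sum_class_mul (hc : ∀ j < n, c j < 2) (hu : u ∈ capSimplex n ν c) (g : ℕ → ℝ) :
    ∑ j ∈ range n, g (c j) * u j = g 0 + g 1 := by
  rw [sum_classes hc]
  have h : ∀ k < 2, ∑ j ∈ range n, (if c j = k then g (c j) * u j else 0) = g k := by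
    intro k hk
    rw [← mul_one (g k), ← hu.2 k hk, mul_sum]
    refine sum_congr rfl fun j _ => ?_
    split_ifs with h <;> simp [h]
  rw [h 0 (by norm_num), h 1 (by norm_num)]

lemma sum_eq_two (hc : ∀ j < n, c j < 2) (hu : u ∈ capSimplex n ν c) :
    ∑ j ∈ range n, u j = 2 := by
  have := sum_class_mul hc hu fun _ => 1
  norm_num at this
  exact this

lemma ent_nonpos (hν : ν ≤ 1) (hu : u ∈ capSimplex n ν c) : ent n u ≤ 0 :=
  sum_nonpos fun j hj => by
    have h := hu.1 j (mem_range.1 hj)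
    exact mul_nonpos_of_nonneg_of_nonpos h.1 (Real.log_nonpos h.1 (h.2.trans hν))

lemma neg_ent_le (hn : 0 < n) (hc : ∀ j < n, c j < 2) (hu : u ∈ capSimplex n ν c) :
    -(2 * Real.log n) ≤ ent n u := by
  have hn' : (0 : ℝ) < n := by exact_mod_cast hn
  have key : ∀ j ∈ range n, u j - 1 / n - u j * Real.log n ≤ u j * Real.log (u j) := by
    intro j hj
    rcases (hu.1 j (mem_range.1 hj)).1.eq_or_lt with h | h
    · rw [← h]; simp
    · have h1 := Real.log_le_sub_one_of_pos (x := 1 / (n * u j)) (by positivity)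
      rw [Real.log_div one_ne_zero (by positivity), Real.log_one,
        Real.log_mul hn'.ne' h.ne'] at h1
      have h2 := mul_le_mul_of_nonneg_left h1 h.le
      have h3 : u j * (1 / (n * u j) - 1) = 1 / n - u j := by field_simp
      nlinarith
  have := sum_le_sum key
  rw [sum_sub_distrib, sum_sub_distrib, ← sum_mul, sum_eq_two hc hu] at this
  simp only [sum_const, card_range, nsmul_eq_mul] at this
  rw [mul_one_div_cancel hn'.ne'] at this
  unfold ent
  linarith

lemma sq_sqrt_sub_le {x y : ℝ} (hx : 0 ≤ x) (hy : 0 < y) :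
    (√x - √y) ^ 2 ≤ x * (Real.log x - Real.log y) - x + y := by
  rcases hx.eq_or_lt with rfl | hx
  · simp [Real.sq_sqrt hy.le]
  · have h := Real.log_le_sub_one_of_pos (x := √y / √x) (by positivity)
    rw [Real.log_div (by positivity) (by positivity), Real.log_sqrt hx.le, Real.log_sqrt hy.le] at h
    have h2 := mul_le_mul_of_nonneg_left h hx.le
    have h3 : x * (√y / √x - 1) = √x * √y - x := by
      have : x / √x = √x := Real.div_sqrt
      calc x * (√y / √x - 1) = x / √x * √y - x := by ring
        _ = _ := by rw [this]
    have h4 := Real.sq_sqrt hx.le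
    have h5 := Real.sq_sqrt hy.le
    nlinarith

/-- A weak form of Pinsker's inequality, for measures of total mass `2`. -/
lemma l1_sq_le (hc : ∀ j < n, c j < 2) (hu : u ∈ capSimplex n ν c) (hη : η ∈ capSimplex n ν c)
    (hpos : ∀ j < n, 0 < η j) :
    1 / 8 * l1 n u η ^ 2 ≤
      ∑ j ∈ range n, (u j * (Real.log (u j) - Real.log (η j)) - u j + η j) := by
  have h1 : l1 n u η = ∑ j ∈ range n, |√(u j) - √(η j)| * (√(u j) + √(η j)) := by
    refine sum_congr rfl fun j hj => ?_
    have hx := (hu.1 j (mem_range.1 hj)).1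
    have hy := (hpos j (mem_range.1 hj)).le
    rw [← abs_of_nonneg (add_nonneg (Real.sqrt_nonneg (u j)) (Real.sqrt_nonneg (η j))), ← abs_mul]
    congr 1
    nlinarith [Real.sq_sqrt hx, Real.sq_sqrt hy]
  have h2 : l1 n u η ^ 2 ≤ (∑ j ∈ range n, |√(u j) - √(η j)| ^ 2) *
      ∑ j ∈ range n, (√(u j) + √(η j)) ^ 2 := by
    rw [h1]; exact sum_mul_sq_le_sq_mul_sq _ _ _
  have h3 : ∑ j ∈ range n, (√(u j) + √(η j)) ^ 2 ≤ 8 := by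
    calc ∑ j ∈ range n, (√(u j) + √(η j)) ^ 2 ≤ ∑ j ∈ range n, (2 * u j + 2 * η j) := by
          refine sum_le_sum fun j hj => ?_
          have hx := (hu.1 j (mem_range.1 hj)).1
          have hy := (hpos j (mem_range.1 hj)).le
          nlinarith [Real.sq_sqrt hx, Real.sq_sqrt hy, sq_nonneg (√(u j) - √(η j))]
      _ = 8 := by
          rw [sum_add_distrib, ← mul_sum, ← mul_sum, sum_eq_two hc hu, sum_eq_two hc hη]; norm_num
  have h4 : ∑ j ∈ range n, |√(u j) - √(η j)| ^ 2 ≤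
      ∑ j ∈ range n, (u j * (Real.log (u j) - Real.log (η j)) - u j + η j) :=
    sum_le_sum fun j hj => by
      rw [sq_abs]
      exact sq_sqrt_sub_le (hu.1 j (mem_range.1 hj)).1 (hpos j (mem_range.1 hj))
  have h5 : 0 ≤ ∑ j ∈ range n, |√(u j) - √(η j)| ^ 2 := sum_nonneg fun _ _ => by positivity
  nlinarith

/-- Strong convexity of the entropy in the `ℓ¹`-norm, up to the error of the approximate
maximizer. -/
lemma Soft.le_gap (hc : ∀ j < n, c j < 2) (hδ : 0 ≤ δ) (hs : Soft n ν c z lo δ η)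
    (hu : u ∈ capSimplex n ν c) : 1 / 8 * l1 n u η ^ 2 - 4 * δ ≤ gap n z η u := by
  have h1 := l1_sq_le hc hu hs.mem hs.pos
  have h2 : ∀ j ∈ range n, (u j * (Real.log (u j) - Real.log (η j)) - u j + η j)
      - δ * u j - δ * η j ≤
      u j * Real.log (u j) - η j * Real.log (η j) - z j * (u j - η j) - (u j - η j)
        - lo (c j) * u j + lo (c j) * η j := by
    intro j hj
    have hj' := mem_range.1 hj
    have hu0 := hu.1 j hj'
    have hp := hs.pos j hj'
    rcases hs.log j hj' with ⟨h, h'⟩ | ⟨h, h', -⟩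
    · rw [h] at hp ⊢
      nlinarith [mul_nonneg (sub_nonneg.2 hu0.2) (sub_nonneg.2 h'), mul_nonneg hδ hu0.1]
    · nlinarith [mul_nonneg (sub_nonneg.2 h') hp.le, mul_nonneg (sub_nonneg.2 h) hu0.1,
        mul_nonneg hδ hu0.1]
  have h3 := sum_le_sum h2
  simp only [sum_sub_distrib (s := range n), sum_add_distrib (s := range n), ← mul_sum,
    sum_class_mul hc hu lo, sum_class_mul hc hs.mem lo, sum_eq_two hc hu,
    sum_eq_two hc hs.mem] at h3
  simp only [sum_sub_distrib (s := range n), sum_add_distrib (s := range n),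
    sum_eq_two hc hu, sum_eq_two hc hs.mem] at h1
  unfold gap ent
  linarith

/-! ### One step of the stochastic primal-dual method -/

/-- The inner product of `v` with the `i`-th coordinates of the points. -/
def ip (n : ℕ) (M : ℕ → ℕ → ℝ) (i : ℕ) (v : ℕ → ℝ) : ℝ := ∑ j ∈ range n, M j i * v j

lemma ip_add (M : ℕ → ℕ → ℝ) (i : ℕ) (u v : ℕ → ℝ) :
    ip n M i (fun j => u j + v j) = ip n M i u + ip n M i v := by
  simp [ip, mul_add, sum_add_distrib]

lemma ip_sub (M : ℕ → ℕ → ℝ) (i : ℕ) (u v : ℕ → ℝ) :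
    ip n M i (fun j => u j - v j) = ip n M i u - ip n M i v := by
  simp [ip, mul_sub, sum_sub_distrib]

lemma ip_smul (M : ℕ → ℕ → ℝ) (i : ℕ) (a : ℝ) (v : ℕ → ℝ) :
    ip n M i (fun j => a * v j) = a * ip n M i v := by
  simp only [ip, mul_sum]; exact sum_congr rfl fun _ _ => by ring

lemma sum_swap (M : ℕ → ℕ → ℝ) (w v : ℕ → ℝ) :
    ∑ j ∈ range n, (∑ k ∈ range m, w k * M j k) * v j = ∑ k ∈ range m, w k * ip n M k v := by
  simp only [ip, mul_sum, sum_mul]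
  rw [sum_comm]
  exact sum_congr rfl fun _ _ => sum_congr rfl fun _ _ => by ring

lemma ip_sq_le {M : ℕ → ℕ → ℝ} {i : ℕ} {Λ r : ℝ} (hr : 0 ≤ r) (hM : ∀ j < n, r * M j i ^ 2 ≤ Λ)
    (u v : ℕ → ℝ) : r * ip n M i (fun j => u j - v j) ^ 2 ≤ Λ * l1 n u v ^ 2 := by
  have h1 : |√r * ip n M i (fun j => u j - v j)| ≤ √Λ * l1 n u v := by
    rw [abs_mul, abs_of_nonneg (Real.sqrt_nonneg _), ip, l1, mul_sum]
    refine (mul_le_mul_of_nonneg_left (abs_sum_le_sum_abs _ _) (Real.sqrt_nonneg _)).trans ?_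
    rw [mul_sum]
    refine sum_le_sum fun j hj => ?_
    rw [abs_mul, ← mul_assoc]
    refine mul_le_mul_of_nonneg_right ?_ (abs_nonneg _)
    rw [← Real.sqrt_sq (abs_nonneg (M j i)), ← Real.sqrt_mul hr, sq_abs]
    exact Real.sqrt_le_sqrt (hM j (mem_range.1 hj))
  rcases Nat.eq_zero_or_pos n with rfl | hn
  · simp [ip, l1]
  have hΛ : 0 ≤ Λ := (by positivity : (0 : ℝ) ≤ r * M 0 i ^ 2).trans (hM 0 hn)
  have := sq_le_sq' (by linarith [neg_abs_le (√r * ip n M i fun j => u j - v j)])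
    ((le_abs_self _).trans h1)
  rwa [mul_pow, mul_pow, Real.sq_sqrt hr, Real.sq_sqrt hΛ] at this

/-- Projection to the interval `[-2, 2]`. -/
noncomputable def clip (x : ℝ) : ℝ := max (-2) (min 2 x)

lemma abs_clip_le (x : ℝ) : |clip x| ≤ 2 :=
  abs_le.2 ⟨le_max_left _ _, max_le (by norm_num) (min_le_left _ _)⟩

lemma clip_mul_nonpos (x : ℝ) {y : ℝ} (hy : |y| ≤ 2) : (clip x - y) * (clip x - x) ≤ 0 := by
  obtain ⟨h1, h2⟩ := abs_le.1 hy
  unfold clip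
  rcases le_total x 2 with h | h
  · rw [min_eq_right h]
    rcases le_total (-2) x with h' | h'
    · rw [max_eq_right h']; simp
    · rw [max_eq_left h']; nlinarith
  · rw [min_eq_left h, max_eq_right (by norm_num)]; nlinarith

/-- The proximal step in one primal coordinate. -/
lemma clip_step {σ w q y : ℝ} (hσ : 0 < σ) (hy : |y| ≤ 2) :
    let v := clip ((w + σ * q) / (1 + σ))
    (1 + 1 / (2 * σ)) * (v - y) ^ 2 + 1 / (2 * σ) * (v - w) ^ 2 ≤
      1 / (2 * σ) * (w - y) ^ 2 + (v - y) * (q - y) := by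
  intro v
  have h := clip_mul_nonpos ((w + σ * q) / (1 + σ)) hy
  have h2 : (1 + 1 / (2 * σ)) * (v - y) ^ 2 + 1 / (2 * σ) * (v - w) ^ 2 -
      (1 / (2 * σ) * (w - y) ^ 2 + (v - y) * (q - y)) =
      (1 + σ) / σ * ((v - y) * (v - (w + σ * q) / (1 + σ))) := by
    have : 1 + σ ≠ 0 := by positivity
    field_simp
    ring
  have h3 : (1 + σ) / σ * ((v - y) * (v - (w + σ * q) / (1 + σ))) ≤ 0 :=
    mul_nonpos_of_nonneg_of_nonpos (by positivity) h
  linarith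

/-- The entropic proximal step, compared with a point `ηs` that satisfies a variational
inequality. -/
lemma prox_ineq {γ τ : ℝ} {ub us ηs ηn zn : ℕ → ℝ} (hγ : 0 < γ) (hτ : 0 < τ)
    (hz : ∀ j < n, zn j = (z j - τ * ub j) / (1 + τ * γ))
    (hvi : 0 ≤ ∑ j ∈ range n, us j * (ηn j - ηs j) + γ * (ent n ηn - ent n ηs)) :
    (1 / τ + γ) * gap n zn ηn ηs + 1 / τ * gap n z η ηn ≤
      1 / τ * gap n z η ηs - ∑ j ∈ range n, (ub j - us j) * (ηn j - ηs j) := by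
  have h1 : (1 / τ + γ) * ∑ j ∈ range n, zn j * (ηs j - ηn j) =
      1 / τ * ∑ j ∈ range n, z j * (ηs j - ηn j) - ∑ j ∈ range n, ub j * (ηs j - ηn j) := by
    rw [mul_sum, mul_sum, ← sum_sub_distrib]
    refine sum_congr rfl fun j hj => ?_
    rw [hz j (mem_range.1 hj)]
    have : 1 + τ * γ ≠ 0 := by positivity
    field_simp
  have h2 : ∑ j ∈ range n, z j * (ηs j - ηn j) = ∑ j ∈ range n, z j * (ηs j - η j) -
      ∑ j ∈ range n, z j * (ηn j - η j) := by
    rw [← sum_sub_distrib]; exact sum_congr rfl fun _ _ => by ring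
  have h3 : ∑ j ∈ range n, (ub j - us j) * (ηn j - ηs j) =
      - ∑ j ∈ range n, ub j * (ηs j - ηn j) - ∑ j ∈ range n, us j * (ηn j - ηs j) := by
    rw [← sum_neg_distrib, ← sum_sub_distrib]; exact sum_congr rfl fun _ _ => by ring
  unfold gap
  rw [h3]
  rw [h2] at h1
  linear_combination hvi - h1

/-- The potential of the stochastic primal-dual method: the distance from the saddle point
`(ws, ηs)`, with a correction for the extrapolation. -/
noncomputable def Psi (n m : ℕ) (M : ℕ → ℕ → ℝ) (ηs ws : ℕ → ℝ) (σ Λ P e : ℝ)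
    (η ηp w z : ℕ → ℝ) : ℝ :=
  P * (gap n z η ηs + e) + m * (1 + 1 / (2 * σ)) * ∑ k ∈ range m, (w k - ws k) ^ 2 +
    ∑ k ∈ range m, (w k - ws k) * ip n M k (fun j => η j - ηp j) + 2 * σ * Λ * l1 n η ηp ^ 2

lemma sum_update {i : ℕ} (hi : i < m) (w : ℕ → ℝ) (x : ℝ) (f : ℕ → ℝ → ℝ) :
    ∑ k ∈ range m, f k (Function.update w i x k) =
      ∑ k ∈ range m, f k (w k) - f i (w i) + f i x := by
  have hi' := mem_range.2 hi
  rw [← add_sum_erase _ _ hi', ← add_sum_erase _ (fun k => f k (w k)) hi']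
  rw [sum_congr rfl (g := fun k => f k (w k)) fun k hk => by
    rw [Function.update_of_ne (ne_of_mem_erase hk)]]
  simp [add_comm]

lemma remainder_le {m σ Λ θ x A B a b : ℝ} (hm : 1 ≤ m) (hσ : 0 < σ)
    (hθ : 1 / 2 ≤ θ) (hθ1 : θ ≤ 1) (hA : m * A ^ 2 ≤ Λ * a ^ 2) (hB : m * B ^ 2 ≤ Λ * b ^ 2) :
    m * x * (θ * B) - (m - 1) * x * A ≤
      m / (2 * σ) * x ^ 2 + σ * Λ * a ^ 2 + σ * Λ * b ^ 2 := by
  obtain ⟨s, hs⟩ : ∃ s, s = (m - 1) / m := ⟨_, rfl⟩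
  have hs0 : 0 ≤ s := hs ▸ div_nonneg (by linarith) (by linarith)
  have hs1 : s ≤ 1 := hs ▸ (div_le_one (by linarith)).2 (by linarith)
  have hsm : m - 1 = m * s := by rw [hs]; field_simp
  have k1 : x * (θ * B - s * A) ≤ 1 / (2 * σ) * x ^ 2 + σ / 2 * (θ * B - s * A) ^ 2 := by
    have : 1 / (2 * σ) * x ^ 2 + σ / 2 * (θ * B - s * A) ^ 2 - x * (θ * B - s * A) =
      1 / (2 * σ) * (x - σ * (θ * B - s * A)) ^ 2 := by field_simp; ring
    have h0 : 0 ≤ 1 / (2 * σ) * (x - σ * (θ * B - s * A)) ^ 2 := by positivity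
    linarith
  have k2 : (θ * B - s * A) ^ 2 ≤ 2 * (B ^ 2 + A ^ 2) := by
    have a1 : (θ * B) ^ 2 ≤ B ^ 2 := by
      rw [mul_pow]; exact mul_le_of_le_one_left (sq_nonneg _) (pow_le_one₀ (by linarith) hθ1)
    have a2 : (s * A) ^ 2 ≤ A ^ 2 := by
      rw [mul_pow]; exact mul_le_of_le_one_left (sq_nonneg _) (pow_le_one₀ hs0 hs1)
    linarith [sq_nonneg (θ * B + s * A), (by ring : (θ * B - s * A) ^ 2 =
      2 * (θ * B) ^ 2 + 2 * (s * A) ^ 2 - (θ * B + s * A) ^ 2)]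
  have k3 : m * (x * (θ * B - s * A)) ≤ m * (1 / (2 * σ) * x ^ 2 + σ * (B ^ 2 + A ^ 2)) :=
    mul_le_mul_of_nonneg_left (by linarith [mul_le_mul_of_nonneg_left k2 hσ.le]) (by linarith)
  have k4 := mul_le_mul_of_nonneg_left (add_le_add hA hB) hσ.le
  rw [hsm]
  have k5 : m / (2 * σ) = m * (1 / (2 * σ)) := by ring
  rw [k5]
  linarith

/-- The expected decrease of the potential, when the coordinate `i` is uniformly random: an
application of the two proximal inequalities in which the bilinear terms telescope, up to a
remainder that the strong convexity absorbs. -/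
lemma sum_Psi_le {M : ℕ → ℕ → ℝ} {ηs ws ηp w : ℕ → ℝ} {σ Λ γ τ θ e : ℝ} (hm : 0 < m)
    (hσ : 0 < σ) (hγ : 0 < γ) (hτ : 0 < τ)
    (hM : ∀ j < n, ∀ i < m, m * M j i ^ 2 ≤ Λ) (hΛ : 0 ≤ Λ)
    (hws : ∀ i < m, ws i = ip n M i ηs) (hws2 : ∀ i < m, |ws i| ≤ 2)
    (hτσ : 1 / τ = 24 * σ * Λ) (hθτ : 1 / τ ≤ θ * (1 / τ + γ))
    (hθm : (1 - θ) * (m * (1 + 1 / (2 * σ))) ≤ 1) (hθ : 1 / 2 ≤ θ) (hθ1 : θ ≤ 1)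
    (wn : ℕ → ℝ) (ηn zn : ℕ → ℕ → ℝ)
    (hwn : ∀ i < m, wn i = clip ((w i + σ * ip n M i (fun j => η j + θ * (η j - ηp j))) / (1 + σ)))
    (hzn : ∀ i < m, ∀ j < n, zn i j =
      (z j - τ * (∑ k ∈ range m, w k * M j k + m * (wn i - w i) * M j i)) / (1 + τ * γ))
    (hvi : ∀ i < m, 0 ≤ ∑ j ∈ range n, (∑ k ∈ range m, ws k * M j k) * (ηn i j - ηs j) +
      γ * (ent n (ηn i) - ent n ηs))
    (hgap : ∀ i < m, 1 / 8 * l1 n (ηn i) η ^ 2 - e ≤ gap n z η (ηn i))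
    (hgap0 : -e ≤ gap n z η ηs) :
    ∑ i ∈ range m, Psi n m M ηs ws σ Λ (1 / τ + γ) e (ηn i) η (Function.update w i (wn i)) (zn i) ≤
      m * (θ * Psi n m M ηs ws σ Λ (1 / τ + γ) e η ηp w z + (1 / τ + γ) * e) := by
  set P := 1 / τ + γ with hP
  set c1 := 1 + 1 / (2 * σ) with hc1
  set N := ∑ k ∈ range m, (w k - ws k) ^ 2 with hN
  set C : (ℕ → ℝ) → ℝ := fun v => ∑ k ∈ range m, (w k - ws k) * ip n M k v with hC
  set D0 := gap n z η ηs with hD0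
  set X : ℕ → ℝ := fun i => ip n M i (fun j => η j - ηs j) with hX
  set B : ℕ → ℝ := fun i => ip n M i (fun j => η j - ηp j) with hB
  have hm' : (1 : ℝ) ≤ m := by exact_mod_cast hm
  have hstep : ∀ i ∈ range m,
      Psi n m M ηs ws σ Λ P e (ηn i) η (Function.update w i (wn i)) (zn i) ≤
      (D0 / τ + e / τ + P * e - C (fun j => η j - ηs j) + m * c1 * N + σ * Λ * l1 n η ηp ^ 2)
      - m * (w i - ws i) ^ 2 + m * ((w i - ws i) * X i + θ * ((w i - ws i) * B i)) := by
    intro i hi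
    have hi' := mem_range.1 hi
    set A := ip n M i (fun j => ηn i j - η j) with hA
    have e1 := prox_ineq (η := η) hγ hτ (hzn i hi') (hvi i hi')
    have e2 : ∑ j ∈ range n, (∑ k ∈ range m, w k * M j k + m * (wn i - w i) * M j i -
        ∑ k ∈ range m, ws k * M j k) * (ηn i j - ηs j) =
        C (fun j => ηn i j - η j) + C (fun j => η j - ηs j) + m * (wn i - w i) * (A + X i) := by
      have q1 : ∀ j ∈ range n, (∑ k ∈ range m, w k * M j k + m * (wn i - w i) * M j i -
        ∑ k ∈ range m, ws k * M j k) * (ηn i j - ηs j) =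
        (∑ k ∈ range m, (w k - ws k) * M j k) * (ηn i j - ηs j) +
          m * (wn i - w i) * (M j i * (ηn i j - ηs j)) := by
        intro j _
        simp only [sub_mul, sum_sub_distrib]; ring
      rw [sum_congr rfl q1, sum_add_distrib, sum_swap M (fun k => w k - ws k), ← mul_sum]
      have q2 : ∀ k, ip n M k (fun j => ηn i j - ηs j) =
          ip n M k (fun j => ηn i j - η j) + ip n M k (fun j => η j - ηs j) := by
        intro k; rw [← ip_add]; congr 1; ext j; ring
      have q3 : ∑ j ∈ range n, M j i * (ηn i j - ηs j) = A + X i := q2 i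
      rw [q3, hC]
      simp only [q2, mul_add, sum_add_distrib]
    have e3 := clip_step (w := w i) (q := ip n M i (fun j => η j + θ * (η j - ηp j))) hσ
      (hws2 i hi')
    simp only [← hwn i hi'] at e3
    have e4 : ip n M i (fun j => η j + θ * (η j - ηp j)) - ws i = X i + θ * B i := by
      rw [hws i hi', ip_add, ip_smul]; simp only [hX, hB, ip_sub]; ring
    rw [e4] at e3
    have hpsi : Psi n m M ηs ws σ Λ P e (ηn i) η (Function.update w i (wn i)) (zn i) =
        P * (gap n (zn i) (ηn i) ηs + e) + m * c1 * (N - (w i - ws i) ^ 2 + (wn i - ws i) ^ 2) +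
        (C (fun j => ηn i j - η j) + (wn i - w i) * A) + 2 * σ * Λ * l1 n (ηn i) η ^ 2 := by
      unfold Psi
      rw [sum_update hi' w (wn i) fun k x => (x - ws k) ^ 2,
        sum_update hi' w (wn i) fun k x => (x - ws k) * ip n M k fun j => ηn i j - η j]
      simp only [hN, hC, hA]; ring
    have hA2 : m * A ^ 2 ≤ Λ * l1 n (ηn i) η ^ 2 :=
      ip_sq_le (by positivity) (fun j hj => hM j hj i hi') _ _
    have hB2 : m * B i ^ 2 ≤ Λ * l1 n η ηp ^ 2 :=
      ip_sq_le (by positivity) (fun j hj => hM j hj i hi') _ _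
    -- the remainder, by the inequality between the means
    have hrem : m * (wn i - w i) * (θ * B i) - (m - 1) * (wn i - w i) * A ≤
        m / (2 * σ) * (wn i - w i) ^ 2 + σ * Λ * l1 n (ηn i) η ^ 2 + σ * Λ * l1 n η ηp ^ 2 := by
      exact remainder_le hm' hσ hθ hθ1 hA2 hB2
    have e5 := mul_le_mul_of_nonneg_left (hgap i hi') (by positivity : 0 ≤ 1 / τ)
    rw [hpsi]
    have e6 := mul_le_mul_of_nonneg_left e3 (by positivity : (0 : ℝ) ≤ m)
    rw [e2] at e1
    have e7 : (m : ℝ) / (2 * σ) = m * (1 / (2 * σ)) := by ring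
    rw [e7] at hrem
    have e8 : 1 / τ * (1 / 8 * l1 n (ηn i) η ^ 2 - e) =
        3 * σ * Λ * l1 n (ηn i) η ^ 2 - e / τ := by
      have : e / τ = 1 / τ * e := by ring
      rw [this, hτσ]; ring
    rw [e8] at e5
    have e9 : D0 / τ = 1 / τ * D0 := by ring
    rw [e9]
    linear_combination e1 + e5 + e6 + hrem + m * (w i - ws i) ^ 2 * (hc1.le)
  refine (sum_le_sum hstep).trans ?_
  simp only [sum_add_distrib, sum_sub_distrib, sum_const, card_range, nsmul_eq_mul, ← mul_sum]
  have hCX : ∑ i ∈ range m, (w i - ws i) * X i = C (fun j => η j - ηs j) := rfl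
  have hCB : ∑ i ∈ range m, (w i - ws i) * B i = C (fun j => η j - ηp j) := rfl
  rw [hCX, hCB]
  unfold Psi
  have hN0 : 0 ≤ N := sum_nonneg fun _ _ => sq_nonneg _
  have f1 : D0 / τ + e / τ ≤ θ * P * (D0 + e) := by
    have := mul_le_mul_of_nonneg_right hθτ (by linarith : 0 ≤ D0 + e)
    calc D0 / τ + e / τ = 1 / τ * (D0 + e) := by ring
      _ ≤ _ := this
  have f2 := mul_le_mul_of_nonneg_right hθm hN0
  have f3 : σ * Λ * l1 n η ηp ^ 2 ≤ θ * (2 * σ * Λ * l1 n η ηp ^ 2) := by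
    have : 0 ≤ σ * Λ * l1 n η ηp ^ 2 := by positivity
    nlinarith
  have f4 : D0 / τ + e / τ + P * e - C (fun j => η j - ηs j) + m * c1 * N +
      σ * Λ * l1 n η ηp ^ 2 - N + (C (fun j => η j - ηs j) + θ * C (fun j => η j - ηp j)) ≤
      θ * (P * (D0 + e) + m * c1 * N + C (fun j => η j - ηp j) + 2 * σ * Λ * l1 n η ηp ^ 2) +
        P * e := by linarith
  have := mul_le_mul_of_nonneg_left f4 (by positivity : (0 : ℝ) ≤ m)
  linarith

/-- The potential controls the distance of the weights from the saddle point. -/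
lemma le_Psi {M : ℕ → ℕ → ℝ} {ηs ws ηp w : ℕ → ℝ} {σ Λ P e : ℝ} (hm : 0 < m)
    (hσ : 0 < σ) (hM : ∀ j < n, ∀ i < m, m * M j i ^ 2 ≤ Λ) (hΛ : 0 ≤ Λ)
    (hP : 24 * σ * Λ ≤ P) (hgap : 1 / 8 * l1 n ηs η ^ 2 - e ≤ gap n z η ηs) :
    3 * σ * Λ * l1 n ηs η ^ 2 ≤ Psi n m M ηs ws σ Λ P e η ηp w z := by
  have hm' : (1 : ℝ) ≤ m := by exact_mod_cast hm
  have h1 : 3 * σ * Λ * l1 n ηs η ^ 2 ≤ P * (gap n z η ηs + e) := by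
    have h0 : 0 ≤ 24 * σ * Λ := by positivity
    calc 3 * σ * Λ * l1 n ηs η ^ 2 = 24 * σ * Λ * (1 / 8 * l1 n ηs η ^ 2) := by ring
      _ ≤ P * (gap n z η ηs + e) :=
        mul_le_mul hP (by linarith) (by positivity) (h0.trans hP)
  have h2 : ∀ k ∈ range m, -(1 / (2 * σ) * (w k - ws k) ^ 2 * m +
      2 * σ * (Λ / m) * l1 n η ηp ^ 2) ≤ (w k - ws k) * ip n M k (fun j => η j - ηp j) := by
    intro k hk
    have hB := ip_sq_le (by positivity : (0 : ℝ) ≤ m)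
      (fun j hj => hM j hj k (mem_range.1 hk)) η ηp
    set b := ip n M k (fun j => η j - ηp j)
    have hb : b ^ 2 ≤ Λ / m * l1 n η ηp ^ 2 := by
      rw [div_mul_eq_mul_div, le_div_iff₀ (by linarith)]; linarith
    have k1 : 0 ≤ 1 / (2 * σ) * (w k - ws k + σ * b) ^ 2 := by positivity
    have k2 : 1 / (2 * σ) * (w k - ws k + σ * b) ^ 2 =
        1 / (2 * σ) * (w k - ws k) ^ 2 + (w k - ws k) * b + σ / 2 * b ^ 2 := by
      field_simp; ring
    have k3 : 1 / (2 * σ) * (w k - ws k) ^ 2 ≤ 1 / (2 * σ) * (w k - ws k) ^ 2 * m :=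
      le_mul_of_one_le_right (by positivity) hm'
    have k4 : σ / 2 * b ^ 2 ≤ 2 * σ * (Λ / m) * l1 n η ηp ^ 2 := by
      have := mul_le_mul_of_nonneg_left hb (by positivity : 0 ≤ 2 * σ)
      have h0 : 0 ≤ σ * b ^ 2 := by positivity
      linarith
    linarith
  have h3 := sum_le_sum h2
  rw [sum_neg_distrib, sum_add_distrib, ← sum_mul, ← mul_sum] at h3
  simp only [sum_const, card_range, nsmul_eq_mul] at h3
  have h4 : m * (2 * σ * (Λ / m) * l1 n η ηp ^ 2) = 2 * σ * Λ * l1 n η ηp ^ 2 := by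
    field_simp
  rw [h4] at h3
  have h5 : 0 ≤ ∑ k ∈ range m, (w k - ws k) ^ 2 := sum_nonneg fun _ _ => sq_nonneg _
  unfold Psi
  nlinarith [mul_nonneg (by positivity : (0 : ℝ) ≤ m) h5]

end SPDC

namespace SPDC

open Finset

variable {n m d : ℕ} {ν δ : ℝ} {c : ℕ → ℕ} {u v z lo η : ℕ → ℝ}

/-! ### The regularized saddle point -/

lemma capSimplex_combo {ηs : ℕ → ℝ} (hs : ηs ∈ capSimplex n ν c) (hu : u ∈ capSimplex n ν c)
    {t : ℝ} (ht : 0 ≤ t) (ht1 : t ≤ 1) :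
    (fun j => (1 - t) * ηs j + t * u j) ∈ capSimplex n ν c := by
  refine ⟨fun j hj => ?_, fun k hk => ?_⟩
  · have h1 := hs.1 j hj
    have h2 := hu.1 j hj
    have ht' : 0 ≤ 1 - t := by linarith
    refine ⟨add_nonneg (mul_nonneg ht' h1.1) (mul_nonneg ht h2.1), ?_⟩
    nlinarith [mul_le_mul_of_nonneg_left h1.2 ht', mul_le_mul_of_nonneg_left h2.2 ht]
  · have : ∀ j ∈ range n, (if c j = k then (1 - t) * ηs j + t * u j else 0) =
        (1 - t) * (if c j = k then ηs j else 0) + t * (if c j = k then u j else 0) := by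
      intro j _; split_ifs <;> ring
    rw [sum_congr rfl this, sum_add_distrib, ← mul_sum, ← mul_sum, hs.2 k hk, hu.2 k hk]
    ring

lemma ent_combo_le {ηs : ℕ → ℝ} (hs : ηs ∈ capSimplex n ν c) (hu : u ∈ capSimplex n ν c)
    {t : ℝ} (ht : 0 ≤ t) (ht1 : t ≤ 1) :
    ent n (fun j => (1 - t) * ηs j + t * u j) ≤ (1 - t) * ent n ηs + t * ent n u := by
  unfold ent
  rw [mul_sum, mul_sum, ← sum_add_distrib]
  refine sum_le_sum fun j hj => ?_
  have := Real.convexOn_mul_log.2 (hs.1 j (mem_range.1 hj)).1 (hu.1 j (mem_range.1 hj)).1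
    (by linarith : 0 ≤ 1 - t) ht (by ring)
  simpa [smul_eq_mul] using this

lemma exists_min_capSimplex {f : (ℕ → ℝ) → ℝ} (hf : Continuous f)
    (hloc : ∀ u v, (∀ j < n, u j = v j) → f u = f v) (hne : (capSimplex n ν c).Nonempty) :
    ∃ ηs ∈ capSimplex n ν c, ∀ u ∈ capSimplex n ν c, f ηs ≤ f u := by
  -- the weights beyond the first `n` are cut off, which makes the set compact
  set B : Set (ℕ → ℝ) := Set.univ.pi fun j => if j < n then Set.Icc 0 ν else {0} with hB
  have hBc : IsCompact B := isCompact_univ_pi fun j => by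
    split_ifs
    · exact isCompact_Icc
    · exact isCompact_singleton
  have hcl : IsClosed {η : ℕ → ℝ | ∀ k < 2, ∑ j ∈ range n, (if c j = k then η j else 0) = 1} := by
    simp only [Set.ofPred_forall]
    refine isClosed_iInter fun k => isClosed_iInter fun _ => isClosed_eq ?_ continuous_const
    refine continuous_finsetSum _ fun j _ => ?_
    split_ifs
    · exact continuous_apply j
    · exact continuous_const
  have hmem : ∀ u ∈ capSimplex n ν c, (fun j => if j < n then u j else 0) ∈
      B ∩ {η : ℕ → ℝ | ∀ k < 2, ∑ j ∈ range n, (if c j = k then η j else 0) = 1} := by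
    intro u hu
    refine ⟨fun j _ => ?_, fun k hk => ?_⟩
    · by_cases hj : j < n
      · simpa [hj] using hu.1 j hj
      · simp [hj]
    · rw [← hu.2 k hk]
      exact sum_congr rfl fun j hj => by simp [mem_range.1 hj]
  obtain ⟨u0, hu0⟩ := hne
  obtain ⟨ηs, hηs, hmin⟩ := (hBc.inter_right hcl).exists_isMinOn ⟨_, hmem u0 hu0⟩ hf.continuousOn
  refine ⟨ηs, ⟨fun j hj => ?_, hηs.2⟩, fun u hu => ?_⟩
  · have := hηs.1 j (Set.mem_univ _)
    simpa [hj] using this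
  · refine (hmin (hmem u hu)).trans_eq (hloc _ _ fun j hj => by simp [hj])

/-- The regularized problem has a solution, and it satisfies the variational inequality. -/
lemma exists_saddle (M : ℕ → ℕ → ℝ) (m : ℕ) {γ : ℝ} (hγ : 0 < γ)
    (hne : (capSimplex n ν c).Nonempty) :
    ∃ ηs ∈ capSimplex n ν c, ∀ u ∈ capSimplex n ν c,
      0 ≤ ∑ j ∈ range n, (∑ k ∈ range m, ip n M k ηs * M j k) * (u j - ηs j) +
        γ * (ent n u - ent n ηs) := by
  set f : (ℕ → ℝ) → ℝ := fun η => 1 / 2 * ∑ k ∈ range m, ip n M k η ^ 2 + γ * ent n η with hf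
  have hcont : Continuous f := by
    refine (continuous_const.mul (continuous_finsetSum _ fun k _ => Continuous.pow ?_ 2)).add
      (continuous_const.mul (continuous_finsetSum _ fun j _ => ?_))
    · exact continuous_finsetSum _ fun j _ => continuous_const.mul (continuous_apply j)
    · exact Real.continuous_mul_log.comp (continuous_apply j)
  obtain ⟨ηs, hηs, hmin⟩ := exists_min_capSimplex hcont (fun u v h => by
    have h1 : ∀ k, ip n M k u = ip n M k v := fun k =>
      sum_congr rfl fun j hj => by rw [h j (mem_range.1 hj)]
    have h2 : ent n u = ent n v := sum_congr rfl fun j hj => by rw [h j (mem_range.1 hj)]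
    simp only [hf, h1, h2]) hne
  refine ⟨ηs, hηs, fun u hu => ?_⟩
  rw [sum_swap M]
  set L := ∑ k ∈ range m, ip n M k ηs * ip n M k (fun j => u j - ηs j)
  set Q := ∑ k ∈ range m, ip n M k (fun j => u j - ηs j) ^ 2
  have key : ∀ t : ℝ, 0 < t → t ≤ 1 → 0 ≤ L + γ * (ent n u - ent n ηs) + t * (Q / 2) := by
    intro t ht ht1
    have h1 := hmin _ (capSimplex_combo hηs hu ht.le ht1)
    have h2 := ent_combo_le hηs hu ht.le ht1
    have h3 : ∑ k ∈ range m, ip n M k (fun j => (1 - t) * ηs j + t * u j) ^ 2 =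
        ∑ k ∈ range m, ip n M k ηs ^ 2 + 2 * t * L + t ^ 2 * Q := by
      rw [mul_sum, mul_sum, ← sum_add_distrib, ← sum_add_distrib]
      refine sum_congr rfl fun k _ => ?_
      rw [ip_add, ip_smul, ip_smul, ip_sub]; ring
    simp only [hf, h3] at h1
    have h4 := mul_le_mul_of_nonneg_left h2 hγ.le
    have h5 : 0 ≤ t * (L + γ * (ent n u - ent n ηs) + t * (Q / 2)) := by linarith
    exact nonneg_of_mul_nonneg_right h5 ht
  by_contra hneg
  push Not at hneg
  set a := L + γ * (ent n u - ent n ηs)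
  have hQ : 0 ≤ Q := sum_nonneg fun _ _ => sq_nonneg _
  have h1 := key (min 1 (-a / (Q + 1))) (lt_min one_pos (div_pos (by linarith) (by linarith)))
    (min_le_left _ _)
  have h2 : min 1 (-a / (Q + 1)) * (Q / 2) ≤ -a / (Q + 1) * (Q / 2) :=
    mul_le_mul_of_nonneg_right (min_le_right _ _) (by linarith)
  have h3 : -a / (Q + 1) * (Q / 2) < -a := by
    rw [div_mul_eq_mul_div, div_lt_iff₀ (by linarith)]; nlinarith
  linarith

/-! ### The certificate -/

/-- The bilinear form of the Gram matrix of the points. -/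
def gram (n d : ℕ) (A : ℕ → ℕ → ℝ) (u v : ℕ → ℝ) : ℝ :=
  ∑ k ∈ range d, ip n A k u * ip n A k v

lemma gram_eq_sum (A : ℕ → ℕ → ℝ) (u v : ℕ → ℝ) :
    gram n d A u v = ∑ i ∈ range n, ∑ j ∈ range n, (∑ k ∈ range d, A i k * A j k) * (u i * v j) := by
  simp only [gram, ip, sum_mul_sum]
  rw [sum_comm]
  refine sum_congr rfl fun i _ => ?_
  rw [sum_comm]
  refine sum_congr rfl fun j _ => ?_
  rw [sum_mul]
  exact sum_congr rfl fun k _ => by ring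

lemma gram_congr {A M : ℕ → ℕ → ℝ} (h : ∀ i < n, ∀ j < n, ∑ k ∈ range m, M i k * M j k =
    ∑ k ∈ range d, A i k * A j k) (u v : ℕ → ℝ) : gram n m M u v = gram n d A u v := by
  rw [gram_eq_sum, gram_eq_sum]
  exact sum_congr rfl fun i hi => sum_congr rfl fun j hj => by
    rw [h i (mem_range.1 hi) j (mem_range.1 hj)]

lemma gram_sub_left (A : ℕ → ℕ → ℝ) (u u' v : ℕ → ℝ) :
    gram n d A (fun j => u j - u' j) v = gram n d A u v - gram n d A u' v := by
  simp only [gram, ip_sub, sub_mul, sum_sub_distrib]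

lemma gram_comm (A : ℕ → ℕ → ℝ) (u v : ℕ → ℝ) : gram n d A u v = gram n d A v u :=
  sum_congr rfl fun _ _ => mul_comm _ _

lemma abs_gram_entry_le {A : ℕ → ℕ → ℝ} (hA : ∀ j < n, ∑ k ∈ range d, A j k ^ 2 ≤ 1) {i j : ℕ}
    (hi : i < n) (hj : j < n) : |∑ k ∈ range d, A i k * A j k| ≤ 1 := by
  refine abs_le_one_iff_mul_self_le_one.2 ?_
  rw [← sq]
  refine (sum_mul_sq_le_sq_mul_sq _ _ _).trans ?_
  exact mul_le_one₀ (hA i hi) (sum_nonneg fun _ _ => sq_nonneg _) (hA j hj)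

lemma abs_gram_sub_le {A : ℕ → ℕ → ℝ} (hc : ∀ j < n, c j < 2)
    (hA : ∀ j < n, ∑ k ∈ range d, A j k ^ 2 ≤ 1) (u u' : ℕ → ℝ) (hv : v ∈ capSimplex n ν c) :
    |gram n d A u v - gram n d A u' v| ≤ 2 * l1 n u u' := by
  rw [← gram_sub_left, gram_eq_sum, ← sum_eq_two hc hv]
  simp_rw [l1]
  rw [sum_mul_sum, sum_comm]
  refine (abs_sum_le_sum_abs _ _).trans (sum_le_sum fun i hi => ?_)
  refine (abs_sum_le_sum_abs _ _).trans (sum_le_sum fun j hj => ?_)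
  have h1 := abs_gram_entry_le hA (mem_range.1 hj) (mem_range.1 hi)
  have h2 := (hv.1 i (mem_range.1 hi)).1
  rw [abs_mul, abs_mul, abs_of_nonneg h2]
  have := mul_le_mul_of_nonneg_right h1 (mul_nonneg (abs_nonneg (u j - u' j)) h2)
  linarith

/-- The lower bound for the support function of a reduced hull that the threshold `th k`
provides. -/
noncomputable def dualVal (n : ℕ) (ν : ℝ) (c : ℕ → ℕ) (a th : ℕ → ℝ) (k : ℕ) : ℝ :=
  th k - ν * ∑ j ∈ range n, (if c j = k then max 0 (th k - a j) else 0)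

/-- The thresholds that belong to an approximate maximizer of the regularized problem lose only
the size of the regularization term. -/
lemma le_dualVal_add {γ : ℝ} {a th : ℕ → ℝ} (hn : 0 < n) (hc : ∀ j < n, c j < 2) (hν : ν ≤ 1)
    (hν0 : 0 < ν) (hγ : 0 < γ) (hδ : 0 ≤ δ) (hs : Soft n ν c z lo δ η)
    (hz : ∀ j < n, z j = -a j / γ) (hth : ∀ k < 2, th k = γ * (lo k - Real.log ν)) :
    ∑ j ∈ range n, a j * η j - γ * (2 * Real.log n + 2 * δ) ≤
      dualVal n ν c a th 0 + dualVal n ν c a th 1 := by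
  have h1 : dualVal n ν c a th 0 + dualVal n ν c a th 1 =
      ∑ j ∈ range n, (th (c j) * η j - ν * max 0 (th (c j) - a j)) := by
    rw [sum_sub_distrib, sum_class_mul hc hs.mem, ← mul_sum,
      sum_classes hc fun j => max 0 (th (c j) - a j)]
    have : ∀ k, ∑ j ∈ range n, (if c j = k then max 0 (th (c j) - a j) else 0) =
        ∑ j ∈ range n, (if c j = k then max 0 (th k - a j) else 0) := fun k =>
      sum_congr rfl fun j _ => by split_ifs with h <;> simp [h]
    rw [this, this]
    unfold dualVal
    ring
  have h2 : ∀ j ∈ range n, a j * η j + γ * (η j * Real.log (η j)) - γ * δ * η j ≤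
      th (c j) * η j - ν * max 0 (th (c j) - a j) := by
    intro j hj
    have hj' := mem_range.1 hj
    have hp := hs.pos j hj'
    have hle := (hs.mem.1 j hj').2
    have hzz : γ * z j = -a j := by rw [hz j hj']; field_simp
    have hlogη : Real.log (η j) ≤ 0 := Real.log_nonpos hp.le (hle.trans hν)
    have hlogν : Real.log ν ≤ 0 := Real.log_nonpos hν0.le hν
    have hg1 : 0 ≤ γ * η j := by positivity
    have hg2 : 0 ≤ γ * η j * δ := by positivity
    rw [hth _ (hc j hj')]
    rcases hs.log j hj' with ⟨h, h'⟩ | ⟨h, h', h''⟩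
    · have h3 : 0 ≤ γ * (lo (c j) - Real.log ν) - a j := by
        have := mul_nonneg hγ.le (sub_nonneg.2 h')
        nlinarith
      rw [max_eq_right h3]
      rw [h] at hlogη hg1 hg2 ⊢
      nlinarith [mul_nonneg hg1 (neg_nonneg.2 hlogη)]
    · have h3 : γ * (lo (c j) - Real.log ν) - a j ≤ 0 := by
        have := mul_nonneg hγ.le (sub_nonneg.2 h'')
        nlinarith
      rw [max_eq_left h3]
      nlinarith [mul_nonneg hg1 (neg_nonneg.2 hlogν), mul_nonneg hg1 (sub_nonneg.2 h')]
  have h3 := sum_le_sum h2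
  rw [sum_sub_distrib, sum_add_distrib, ← mul_sum, ← mul_sum, sum_eq_two hc hs.mem] at h3
  have h4 := mul_le_mul_of_nonneg_left (neg_ent_le hn hc hs.mem) hγ.le
  rw [h1]
  unfold ent at h4
  linarith

/-- Weights that are close to the regularized solution pass the test. -/
lemma certificate_of_close {A M : ℕ → ℕ → ℝ} {γ ω : ℝ} {a th ηs η' : ℕ → ℝ} (hn : 0 < n)
    (hc : ∀ j < n, c j < 2) (hν : ν ≤ 1) (hν0 : 0 < ν) (hγ : 0 < γ) (hδ : 0 ≤ δ)
    (hA : ∀ j < n, ∑ k ∈ range d, A j k ^ 2 ≤ 1)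
    (hM : ∀ i < n, ∀ j < n, ∑ k ∈ range m, M i k * M j k = ∑ k ∈ range d, A i k * A j k)
    (hηs : ηs ∈ capSimplex n ν c)
    (hvi : ∀ u ∈ capSimplex n ν c,
      0 ≤ ∑ j ∈ range n, (∑ k ∈ range m, ip n M k ηs * M j k) * (u j - ηs j) +
        γ * (ent n u - ent n ηs))
    (hη : η ∈ capSimplex n ν c) (hω : l1 n ηs η ≤ ω)
    (ha : ∀ j < n, a j = ∑ k ∈ range d, ip n A k η * A j k)
    (hs : Soft n ν c z lo δ η')
    (hz : ∀ j < n, z j = -a j / γ) (hth : ∀ k < 2, th k = γ * (lo k - Real.log ν)) :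
    gram n d A η η - 6 * ω - γ * (4 * Real.log n + 2 * δ) ≤
      dualVal n ν c a th 0 + dualVal n ν c a th 1 := by
  have h1 := le_dualVal_add hn hc hν hν0 hγ hδ hs hz hth
  have h2 : ∑ j ∈ range n, a j * η' j = gram n d A η η' := by
    rw [gram, ← sum_swap]
    exact sum_congr rfl fun j hj => by rw [ha j (mem_range.1 hj)]
  have h3 := hvi η' hs.mem
  rw [sum_swap M] at h3
  have h4 : ∑ k ∈ range m, ip n M k ηs * ip n M k (fun j => η' j - ηs j) =
      gram n d A ηs η' - gram n d A ηs ηs := by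
    rw [← gram_congr hM, ← gram_congr hM]
    simp only [gram, ip_sub, mul_sub, sum_sub_distrib]
  rw [h4] at h3
  have h5 := abs_le.1 (abs_gram_sub_le hc hA ηs η hs.mem)
  have h6 := abs_le.1 (abs_gram_sub_le hc hA ηs η hηs)
  have h7 := abs_le.1 (abs_gram_sub_le hc hA ηs η hη)
  have h8 := gram_comm (n := n) (d := d) A ηs η
  have h9 := mul_le_mul_of_nonneg_left (neg_ent_le hn hc hηs) hγ.le
  have h10 := mul_nonpos_of_nonneg_of_nonpos hγ.le (ent_nonpos hν hs.mem)
  linarith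

end SPDC

/-! ### From certificates to approximate solutions -/

namespace SPDC

open Finset SVM

variable {n d : ℕ} {ν D : ℝ} {c : ℕ → ℕ} {u η : ℕ → ℝ} {x : Fin n → EuclideanSpace ℝ (Fin d)}
  {y : Fin n → ℤˣ} {A : ℕ → ℕ → ℝ} {x0 : ℕ → ℝ}

/-- The rows of `A` are the points, relative to the centre `x0`, in units of `D` and multiplied by
their labels; `c` divides them into the class `0` of the positive and the class `1` of the negative
points. -/
structure Normalized (x : Fin n → EuclideanSpace ℝ (Fin d)) (y : Fin n → ℤˣ) (x0 : ℕ → ℝ) (D : ℝ)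
    (A : ℕ → ℕ → ℝ) (c : ℕ → ℕ) : Prop where
  pos : 0 < D
  cls : ∀ j : Fin n, c j = if y j = 1 then 0 else 1
  entry : ∀ (j : Fin n) (k : Fin d), A j k = ((y j : ℤ) : ℝ) * (x j k - x0 k) / D

lemma Normalized.cls_lt (h : Normalized x y x0 D A c) : ∀ j < n, c j < 2 := by
  intro j hj
  have := h.cls ⟨j, hj⟩
  simp only at this
  rw [this]; split_ifs <;> norm_num

lemma label_cast (s : ℤˣ) : ((s : ℤ) : ℝ) = if s = 1 then 1 else -1 := by
  rcases Int.units_eq_one_or s with rfl | rfl <;> simp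

lemma Normalized.sum_label (h : Normalized x y x0 D A c) (hη : η ∈ capSimplex n ν c) :
    ∑ j : Fin n, η j * ((y j : ℤ) : ℝ) = 0 := by
  have h1 := sum_class_mul h.cls_lt hη fun k => if k = 0 then 1 else -1
  rw [Finset.sum_range] at h1
  norm_num at h1
  rw [← h1]
  refine sum_congr rfl fun j _ => ?_
  rw [label_cast, h.cls j]
  by_cases hy : y j = 1 <;> simp [hy]

lemma inner_eq_sum (v w : EuclideanSpace ℝ (Fin d)) : inner ℝ v w = ∑ k, v k * w k := by
  simp [PiLp.inner_apply, mul_comm]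

lemma Normalized.sum_row (h : Normalized x y x0 D A c) (w : EuclideanSpace ℝ (Fin d)) (j : Fin n) :
    D * ∑ k : Fin d, w k * A j k = ((y j : ℤ) : ℝ) * (inner ℝ w (x j) - ∑ k : Fin d, w k * x0 k) := by
  rw [inner_eq_sum, ← sum_sub_distrib, mul_sum, mul_sum]
  refine sum_congr rfl fun k _ => ?_
  rw [h.entry]
  have := h.pos.ne'
  field_simp

lemma Normalized.sum_ip (h : Normalized x y x0 D A c) (hη : η ∈ capSimplex n ν c)
    (w : EuclideanSpace ℝ (Fin d)) (b : ℝ) :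
    D * ∑ k : Fin d, w k * ip n A k η =
      ∑ j : Fin n, η j * (((y j : ℤ) : ℝ) * (inner ℝ w (x j) - b)) := by
  have h1 : ∑ k : Fin d, w k * ip n A k η = ∑ j : Fin n, η j * ∑ k : Fin d, w k * A j k := by
    simp only [ip, Finset.sum_range, mul_sum]
    rw [sum_comm]
    exact sum_congr rfl fun _ _ => sum_congr rfl fun _ _ => by ring
  rw [h1, mul_sum]
  have h2 : ∑ j : Fin n, η j * (((y j : ℤ) : ℝ) * (inner ℝ w (x j) - b)) =
      ∑ j : Fin n, D * (η j * ∑ k : Fin d, w k * A j k) +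
        (∑ k : Fin d, w k * x0 k - b) * ∑ j : Fin n, η j * ((y j : ℤ) : ℝ) := by
    rw [mul_sum, ← sum_add_distrib]
    refine sum_congr rfl fun j _ => ?_
    rw [mul_left_comm D, h.sum_row]; ring
  rw [h2, h.sum_label hη]; ring

lemma gram_self (A : ℕ → ℕ → ℝ) (η : ℕ → ℝ) : gram n d A η η = ∑ k : Fin d, ip n A k η ^ 2 := by
  simp only [gram, Finset.sum_range, sq]

lemma norm_sq_eq_of_smul {w : EuclideanSpace ℝ (Fin d)} {a : ℝ} {W : ℕ → ℝ}
    (hw : ∀ k : Fin d, w k = a * W k) : ‖w‖ ^ 2 = a ^ 2 * ∑ k : Fin d, W k ^ 2 := by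
  rw [EuclideanSpace.norm_sq_eq, mul_sum]
  refine sum_congr rfl fun k _ => ?_
  rw [hw, Real.norm_eq_abs, sq_abs, mul_pow]

/-- Weak duality for the `ν`-SVM. -/
lemma Normalized.nu_weak_duality (h : Normalized x y x0 D A c) (hη : η ∈ capSimplex n ν c)
    {w : EuclideanSpace ℝ (Fin d)} {b ρ : ℝ} {δ : Fin n → ℝ} (hf : NuFeasible x y w b ρ δ) :
    -(D ^ 2 / 8 * gram n d A η η) ≤ nuObjective ν w ρ δ := by
  have h1 := h.sum_ip hη w b
  have h2 : ∑ j : Fin n, η j * (ρ - δ j) ≤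
      ∑ j : Fin n, η j * (((y j : ℤ) : ℝ) * (inner ℝ w (x j) - b)) :=
    sum_le_sum fun j _ => mul_le_mul_of_nonneg_left (hf j).1 (hη.1 j j.2).1
  have h3 : ∑ j : Fin n, η j * (ρ - δ j) = 2 * ρ - ∑ j : Fin n, η j * δ j := by
    have := sum_eq_two h.cls_lt hη
    rw [Finset.sum_range] at this
    simp only [mul_sub, sum_sub_distrib, ← sum_mul, this]
  have h4 : ∑ j : Fin n, η j * δ j ≤ ν * ∑ j : Fin n, δ j := by
    rw [mul_sum]
    exact sum_le_sum fun j _ => mul_le_mul_of_nonneg_right (hη.1 j j.2).2 (hf j).2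
  have h5 : D * ∑ k : Fin d, w k * ip n A k η ≤ ‖w‖ ^ 2 + D ^ 2 / 4 * gram n d A η η := by
    rw [gram_self, EuclideanSpace.norm_sq_eq, mul_sum, mul_sum, ← sum_add_distrib]
    refine sum_le_sum fun k _ => ?_
    rw [Real.norm_eq_abs, sq_abs]
    nlinarith [sq_nonneg (w k - D / 2 * ip n A k η)]
  unfold nuObjective
  linarith

/-- Weak duality for the hard-margin SVM. -/
lemma Normalized.hm_weak_duality (h : Normalized x y x0 D A c) (hη : η ∈ capSimplex n ν c)
    {w : EuclideanSpace ℝ (Fin d)} {b : ℝ} (hf : HMFeasible x y w b) :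
    4 ≤ D ^ 2 * ‖w‖ ^ 2 * gram n d A η η := by
  have h1 := h.sum_ip hη w b
  have h2 : ∑ j : Fin n, η j * 1 ≤
      ∑ j : Fin n, η j * (((y j : ℤ) : ℝ) * (inner ℝ w (x j) - b)) :=
    sum_le_sum fun j _ => mul_le_mul_of_nonneg_left (hf j) (hη.1 j j.2).1
  have h3 := sum_eq_two h.cls_lt hη
  rw [Finset.sum_range] at h3
  simp only [mul_one] at h2
  rw [h3, ← h1] at h2
  have h4 : (∑ k : Fin d, w k * ip n A k η) ^ 2 ≤ ‖w‖ ^ 2 * gram n d A η η := by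
    rw [gram_self, EuclideanSpace.norm_sq_eq]
    refine (sum_mul_sq_le_sq_mul_sq _ _ _).trans_eq ?_
    simp
  have h5 := mul_le_mul_of_nonneg_left h4 (sq_nonneg D)
  nlinarith

variable {a th : ℕ → ℝ} {ε : ℝ}

/-- The output for the `ν`-SVM that belongs to a certificate. -/
lemma Normalized.nuApprox (h : Normalized x y x0 D A c) (hη : η ∈ capSimplex n ν c)
    (hε1 : ε < 1)
    (ha : ∀ j < n, a j = ∑ k ∈ range d, ip n A k η * A j k)
    (hcert : (1 - ε / 2) * gram n d A η η ≤ dualVal n ν c a th 0 + dualVal n ν c a th 1)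
    {w : EuclideanSpace ℝ (Fin d)} {b ρ : ℝ} {δ : Fin n → ℝ}
    (hw : ∀ k : Fin d, w k = D / 2 * ip n A k η)
    (hb : b = D / 2 * ∑ k ∈ range d, ip n A k η * x0 k + D ^ 2 / 4 * (th 0 - th 1))
    (hρ : ρ = D ^ 2 / 4 * (th 0 + th 1))
    (hδ : ∀ j, δ j = D ^ 2 / 2 * max 0 (th (c j) - a j)) :
    NuApprox ε ν x y w b ρ δ := by
  have hD := h.pos
  have hrow : ∀ j : Fin n, ((y j : ℤ) : ℝ) * (inner ℝ w (x j) - D / 2 *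
      ∑ k ∈ range d, ip n A k η * x0 k) = D ^ 2 / 2 * a j := by
    intro j
    have h1 := h.sum_row w j
    have h2 : ∑ k : Fin d, w k * x0 k = D / 2 * ∑ k ∈ range d, ip n A k η * x0 k := by
      rw [Finset.sum_range, mul_sum]
      exact sum_congr rfl fun k _ => by rw [hw, mul_assoc]
    have h3 : ∑ k : Fin d, w k * A j k = D / 2 * a j := by
      rw [ha j j.2, Finset.sum_range, mul_sum]
      exact sum_congr rfl fun k _ => by rw [hw, mul_assoc]
    rw [← h2, ← h1, h3]; ring
  have hfeas : NuFeasible x y w b ρ δ := by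
    intro j
    have h1 := hrow j
    rw [hδ]
    refine ⟨?_, by positivity⟩
    have h2 : ((y j : ℤ) : ℝ) * (inner ℝ w (x j) - b) = D ^ 2 / 2 * a j -
        ((y j : ℤ) : ℝ) * (D ^ 2 / 4 * (th 0 - th 1)) := by rw [← h1, hb]; ring
    have h3 : D ^ 2 / 2 * (th (c j) - a j) ≤ D ^ 2 / 2 * max 0 (th (c j) - a j) :=
      mul_le_mul_of_nonneg_left (le_max_right _ _) (by positivity)
    rw [h2, hρ, label_cast]
    rw [h.cls] at h3 ⊢
    by_cases hy : y j = 1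
    · simp only [hy, if_true] at h3 ⊢
      linarith
    · simp only [hy, if_false] at h3 ⊢
      linarith
  refine ⟨hfeas, fun w' b' ρ' δ' hf' => ?_⟩
  have h1 := h.nu_weak_duality hη hf'
  have h2 : nuObjective ν w ρ δ = D ^ 2 / 8 * gram n d A η η -
      D ^ 2 / 4 * (dualVal n ν c a th 0 + dualVal n ν c a th 1) := by
    have h3 : ∑ j, δ j = D ^ 2 / 2 * (∑ j ∈ range n, (if c j = 0 then max 0 (th 0 - a j) else 0) +
        ∑ j ∈ range n, (if c j = 1 then max 0 (th 1 - a j) else 0)) := by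
      have h4 := sum_classes h.cls_lt fun j => max 0 (th (c j) - a j)
      have : ∀ k, ∑ j ∈ range n, (if c j = k then max 0 (th (c j) - a j) else 0) =
        ∑ j ∈ range n, (if c j = k then max 0 (th k - a j) else 0) := fun k =>
        sum_congr rfl fun j _ => by split_ifs with h <;> simp [h]
      rw [this, this] at h4
      rw [← h4, Finset.sum_range, mul_sum]
      exact sum_congr rfl fun j _ => hδ j
    unfold nuObjective dualVal
    rw [norm_sq_eq_of_smul (W := fun k => ip n A k η) hw, gram_self, h3, hρ]
    ring
  rw [h2]
  have h3 := mul_le_mul_of_nonneg_left hcert (by positivity : 0 ≤ D ^ 2 / 4)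
  have h4 := mul_le_mul_of_nonneg_left h1 (by linarith : 0 ≤ 1 - ε)
  linarith

/-- The output for the hard-margin SVM that belongs to a certificate. -/
lemma Normalized.hmApprox (h : Normalized x y x0 D A c) (hη : η ∈ capSimplex n 1 c)
    (hε : 0 < ε) (hε1 : ε < 1)
    (ha : ∀ j < n, a j = ∑ k ∈ range d, ip n A k η * A j k)
    (hcert : (1 - ε / 2) * gram n d A η η ≤ dualVal n 1 c a th 0 + dualVal n 1 c a th 1)
    (hsep : ∃ w b, HMFeasible x y w b)
    {w : EuclideanSpace ℝ (Fin d)} {b G : ℝ}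
    (hG : G = dualVal n 1 c a th 0 + dualVal n 1 c a th 1)
    (hw : ∀ k : Fin d, w k = 2 / (G * D) * ip n A k η)
    (hb : b = 2 / (G * D) * ∑ k ∈ range d, ip n A k η * x0 k +
      (dualVal n 1 c a th 0 - dualVal n 1 c a th 1) / G) :
    HMApprox ε x y w b := by
  have hD := h.pos
  have hgr : 0 < gram n d A η η := by
    obtain ⟨w', b', hf⟩ := hsep
    have h1 := h.hm_weak_duality hη hf
    by_contra hneg
    have := mul_nonpos_of_nonneg_of_nonpos (by positivity : 0 ≤ D ^ 2 * ‖w'‖ ^ 2) (not_lt.1 hneg)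
    linarith
  have hGpos : 0 < G := by
    rw [hG]; exact (mul_pos (by linarith) hgr).trans_le hcert
  have hrow : ∀ j : Fin n, ((y j : ℤ) : ℝ) * (inner ℝ w (x j) - 2 / (G * D) *
      ∑ k ∈ range d, ip n A k η * x0 k) = 2 / G * a j := by
    intro j
    have h1 := h.sum_row w j
    have h2 : ∑ k : Fin d, w k * x0 k = 2 / (G * D) * ∑ k ∈ range d, ip n A k η * x0 k := by
      rw [Finset.sum_range, mul_sum]
      exact sum_congr rfl fun k _ => by rw [hw, mul_assoc]
    have h3 : ∑ k : Fin d, w k * A j k = 2 / (G * D) * a j := by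
      rw [ha j j.2, Finset.sum_range, mul_sum]
      exact sum_congr rfl fun k _ => by rw [hw, mul_assoc]
    rw [← h2, ← h1, h3]
    field_simp
  have hle : ∀ j : Fin n, dualVal n 1 c a th (c j) ≤ a j := by
    intro j
    unfold dualVal
    have h1 : max 0 (th (c j) - a j) ≤
        ∑ i ∈ range n, (if c i = c j then max 0 (th (c j) - a i) else 0) := by
      have := single_le_sum (s := range n)
        (f := fun i => if c i = c j then max 0 (th (c j) - a i) else 0)
        (fun i _ => by positivity) (mem_range.2 j.2)
      simpa using this
    linarith [le_max_right 0 (th (c j) - a j)]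
  refine ⟨fun j => ?_, fun w' b' hf' => ?_⟩
  · have h1 := hrow j
    have h2 : ((y j : ℤ) : ℝ) * (inner ℝ w (x j) - b) = 2 / G * a j -
        ((y j : ℤ) : ℝ) * ((dualVal n 1 c a th 0 - dualVal n 1 c a th 1) / G) := by
      rw [← h1, hb]; ring
    have h3 := hle j
    rw [h2, label_cast]
    rw [h.cls] at h3
    have h4 : 1 = (dualVal n 1 c a th 0 + dualVal n 1 c a th 1) / G := by
      rw [← hG, div_self hGpos.ne']
    have h5 : ∀ t, t ≤ a j → 2 / G * t ≤ 2 / G * a j := fun t ht =>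
      mul_le_mul_of_nonneg_left ht (by positivity)
    have h6 := h5 _ h3
    by_cases hy : y j = 1
    · simp only [hy, if_true] at h6 ⊢
      generalize dualVal n 1 c a th 0 = g0 at h4 h6 ⊢
      generalize dualVal n 1 c a th 1 = g1 at h4 h6 ⊢
      refine h4.le.trans (le_trans (le_of_eq ?_) (sub_le_sub_right h6 _))
      field_simp; ring
    · simp only [hy, if_false] at h6 ⊢
      generalize dualVal n 1 c a th 0 = g0 at h4 h6 ⊢
      generalize dualVal n 1 c a th 1 = g1 at h4 h6 ⊢
      refine h4.le.trans (le_trans (le_of_eq ?_) (sub_le_sub_right h6 _))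
      field_simp; ring
  · have h1 := h.hm_weak_duality hη hf'
    set g := gram n d A η η
    have h2 : ‖w‖ ^ 2 = 4 * g / (G * D) ^ 2 := by
      rw [norm_sq_eq_of_smul (W := fun k => ip n A k η) hw, ← gram_self]; ring
    unfold hmObjective
    rw [h2]
    have h3 : (1 - ε) * g ^ 2 ≤ G ^ 2 := by
      have : ((1 - ε / 2) * g) ^ 2 ≤ G ^ 2 := by
        rw [hG]; exact pow_le_pow_left₀ (mul_nonneg (by linarith) hgr.le) hcert 2
      nlinarith [mul_nonneg (sq_nonneg ε) (sq_nonneg g)]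
    have h4 : (1 - ε) * (4 * g / (G * D) ^ 2) ≤ ‖w'‖ ^ 2 := by
      rw [mul_div_assoc', div_le_iff₀ (by positivity)]
      have h5 : 4 * ((1 - ε) * g ^ 2) ≤ D ^ 2 * ‖w'‖ ^ 2 * g * G ^ 2 :=
        mul_le_mul h1 h3 (mul_nonneg (by linarith) (sq_nonneg _)) (by linarith)
      have h6 : g * ((1 - ε) * (4 * g)) ≤ g * (‖w'‖ ^ 2 * (G * D) ^ 2) := by linarith
      exact le_of_mul_le_mul_left h6 hgr
    linarith

/-! ### The distance ratio -/

lemma mem_reducedHull (hη : η ∈ capSimplex n ν c)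
    {σ : ℤˣ} {k : ℕ} (hk : k < 2) (hσ : ∀ j : Fin n, c j = k ↔ y j = σ) :
    ∑ j : Fin n, (if c j = k then η j else 0) • x j ∈ reducedHull ν x y σ := by
  have hν : 0 ≤ ν := by
    by_contra hneg
    have h1 := hη.2 k hk
    rw [Finset.sum_eq_zero] at h1
    · norm_num at h1
    · intro j hj
      have := hη.1 j (mem_range.1 hj)
      linarith
  refine ⟨fun j => if c j = k then η j else 0, fun j => ?_, fun j hj => ?_, ?_, rfl⟩
  · simp only
    split_ifs
    · exact hη.1 j j.2
    · exact ⟨le_rfl, hν⟩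
  · simp only
    rw [if_neg fun h' => hj ((hσ j).1 h')]
  · rw [← hη.2 k hk, Finset.sum_range]

lemma Normalized.cls_iff (h : Normalized x y x0 D A c) (j : Fin n) :
    (c j = 0 ↔ y j = 1) ∧ (c j = 1 ↔ y j = -1) := by
  rw [h.cls]
  rcases Int.units_eq_one_or (y j) with hy | hy
  · rw [hy]; decide
  · rw [hy]; decide

lemma Normalized.dist_sq (h : Normalized x y x0 D A c) (hη : η ∈ capSimplex n ν c) :
    dist (∑ j : Fin n, (if c j = 0 then η j else 0) • x j)
      (∑ j : Fin n, (if c j = 1 then η j else 0) • x j) ^ 2 = D ^ 2 * gram n d A η η := by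
  have hD := h.pos.ne'
  rw [dist_eq_norm, EuclideanSpace.norm_sq_eq, gram_self, mul_sum]
  refine sum_congr rfl fun k _ => ?_
  rw [Real.norm_eq_abs, sq_abs, ← mul_pow]
  congr 1
  have h0 := h.sum_label hη
  have h1 : D * ip n A k η = ∑ j : Fin n, η j * ((y j : ℤ) : ℝ) * (x j k) -
      (∑ j : Fin n, η j * ((y j : ℤ) : ℝ)) * x0 k := by
    rw [ip, Finset.sum_range, mul_sum, sum_mul, ← sum_sub_distrib]
    refine sum_congr rfl fun j _ => ?_
    rw [h.entry]; field_simp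
  rw [h1, h0, zero_mul, sub_zero, ← sum_sub_distrib]
  simp only [WithLp.ofLp_sum, Finset.sum_apply, PiLp.sub_apply, PiLp.smul_apply, smul_eq_mul]
  refine sum_congr rfl fun j _ => ?_
  rw [label_cast, h.cls]
  by_cases hy : y j = 1 <;> simp [hy]

lemma minDist_le {S T : Set (EuclideanSpace ℝ (Fin d))} {p q : EuclideanSpace ℝ (Fin d)}
    (hp : p ∈ S) (hq : q ∈ T) : minDist S T ≤ dist p q :=
  csInf_le ⟨0, by rintro _ ⟨_, _, _, _, rfl⟩; exact dist_nonneg⟩ ⟨p, hp, q, hq, rfl⟩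

lemma minDist_nonneg (S T : Set (EuclideanSpace ℝ (Fin d))) : 0 ≤ minDist S T :=
  Real.sInf_nonneg (by rintro _ ⟨_, _, _, _, rfl⟩; exact dist_nonneg)

/-- The distance ratio bounds the squared norm of `∑ j, η j • A j` from below. -/
lemma Normalized.distRatio_le_gram (h : Normalized x y x0 D A c) (hη : η ∈ capSimplex n ν c)
    (hD : D ≤ Metric.diam (Set.range x)) :
    distRatio x (reducedHull ν x y 1) (reducedHull ν x y (-1)) ≤ gram n d A η η := by
  have h1 := minDist_le (mem_reducedHull (x := x) hη (by norm_num) fun j => (h.cls_iff j).1)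
    (mem_reducedHull (x := x) hη (by norm_num) fun j => (h.cls_iff j).2)
  have h2 := pow_le_pow_left₀ (minDist_nonneg _ _) h1 2
  rw [h.dist_sq hη] at h2
  have hpos := h.pos
  have hdiam := hpos.trans_le hD
  have hg : 0 ≤ gram n d A η η := by rw [gram_self]; exact sum_nonneg fun _ _ => sq_nonneg _
  unfold distRatio
  rw [div_le_iff₀ (by positivity)]
  refine h2.trans ?_
  rw [mul_comm]
  exact mul_le_mul_of_nonneg_left (pow_le_pow_left₀ hpos.le hD 2) hg

lemma classPoints_convexHull (x : Fin n → EuclideanSpace ℝ (Fin d)) (y : Fin n → ℤˣ) (σ : ℤˣ) :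
    convexHull ℝ (classPoints x y σ) = reducedHull 1 x y σ := by
  apply Set.Subset.antisymm
  · refine convexHull_min ?_ ?_
    · rintro _ ⟨i, hi, rfl⟩
      refine ⟨fun j => if j = i then 1 else 0, fun j => ?_, fun j hj => ?_, by simp, by simp⟩
      · simp only; split_ifs <;> norm_num
      · have : j ≠ i := fun h => hj (h ▸ hi)
        simp [this]
    · rintro _ ⟨η, h1, h2, h3, rfl⟩ _ ⟨ξ, g1, g2, g3, rfl⟩ s t hs ht hst
      refine ⟨fun j => s * η j + t * ξ j, fun j => ⟨?_, ?_⟩, fun j hj => ?_, ?_, ?_⟩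
      · exact add_nonneg (mul_nonneg hs (h1 j).1) (mul_nonneg ht (g1 j).1)
      · nlinarith [mul_le_mul_of_nonneg_left (h1 j).2 hs, mul_le_mul_of_nonneg_left (g1 j).2 ht]
      · simp [h2 j hj, g2 j hj]
      · rw [sum_add_distrib, ← mul_sum, ← mul_sum, h3, g3]; linarith
      · simp only [add_smul, sum_add_distrib, mul_smul, smul_sum]
  · rintro _ ⟨η, h1, h2, h3, rfl⟩
    have h4 : ∑ i, η i • x i = ∑ i ∈ univ.filter (fun i => y i = σ), η i • x i := by
      rw [sum_filter]
      refine sum_congr rfl fun i _ => ?_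
      split_ifs with h
      · rfl
      · rw [h2 i h, zero_smul]
    rw [h4]
    refine (convex_convexHull ℝ _).sum_mem (fun i _ => (h1 i).1) ?_ fun i hi => ?_
    · rw [← h3, sum_filter]
      refine sum_congr rfl fun i _ => ?_
      split_ifs with h
      · rfl
      · rw [h2 i h]
    · exact subset_convexHull ℝ _ ⟨i, (mem_filter.1 hi).2, rfl⟩

/-- The classes in the encoding by natural numbers. -/
noncomputable def clsOf (y : Fin n → ℤˣ) (j : ℕ) : ℕ :=
  if h : j < n then (if y ⟨j, h⟩ = 1 then 0 else 1) else 0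

lemma capSimplex_nonempty (h1 : (reducedHull ν x y 1).Nonempty)
    (h2 : (reducedHull ν x y (-1)).Nonempty) : (capSimplex n ν (clsOf y)).Nonempty := by
  obtain ⟨_, η, a1, a2, a3, -⟩ := h1
  obtain ⟨_, ξ, b1, b2, b3, -⟩ := h2
  refine ⟨fun j => if h : j < n then η ⟨j, h⟩ + ξ ⟨j, h⟩ else 0, fun j hj => ?_, fun k hk => ?_⟩
  · simp only [hj, dite_true]
    rcases Int.units_eq_one_or (y ⟨j, hj⟩) with hy | hy
    · rw [b2 _ (by rw [hy]; decide), add_zero]; exact a1 _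
    · rw [a2 _ (by rw [hy]; decide), zero_add]; exact b1 _
  · rw [Finset.sum_range]
    interval_cases k
    · rw [← a3]
      refine sum_congr rfl fun j _ => ?_
      rcases Int.units_eq_one_or (y j) with hy | hy
      · simp [clsOf, hy, b2 j (by rw [hy]; decide)]
      · simp [clsOf, hy, a2 j (by rw [hy]; decide)]
    · rw [← b3]
      refine sum_congr rfl fun j _ => ?_
      rcases Int.units_eq_one_or (y j) with hy | hy
      · simp [clsOf, hy, b2 j (by rw [hy]; decide)]
      · simp [clsOf, hy, a2 j (by rw [hy]; decide)]

lemma isCompact_reducedHull (ν : ℝ) (x : Fin n → EuclideanSpace ℝ (Fin d)) (y : Fin n → ℤˣ)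
    (σ : ℤˣ) : IsCompact (reducedHull ν x y σ) := by
  have : reducedHull ν x y σ = (fun η : Fin n → ℝ => ∑ i, η i • x i) ''
      (Set.univ.pi (fun _ => Set.Icc 0 ν) ∩
        ((⋂ i, ⋂ (_ : y i ≠ σ), {η | η i = 0}) ∩ {η | ∑ i, η i = 1})) := by
    ext p
    constructor
    · rintro ⟨η, e1, e2, e3, rfl⟩
      exact ⟨η, ⟨fun i _ => e1 i, by simpa using e2, e3⟩, rfl⟩
    · rintro ⟨η, ⟨e1, e2, e3⟩, rfl⟩
      exact ⟨η, fun i => e1 i (Set.mem_univ i), by simpa using e2, e3, rfl⟩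
  rw [this]
  refine IsCompact.image ((isCompact_univ_pi fun _ => isCompact_Icc).inter_right
    (IsClosed.inter ?_ (isClosed_eq (by fun_prop) continuous_const))) (by fun_prop)
  exact isClosed_iInter fun i => isClosed_iInter fun _ =>
    isClosed_eq (continuous_apply i) continuous_const

/-- Disjoint reduced hulls have a positive distance, by compactness. -/
lemma minDist_pos (h1 : (reducedHull ν x y 1).Nonempty) (h2 : (reducedHull ν x y (-1)).Nonempty)
    (hd : Disjoint (reducedHull ν x y 1) (reducedHull ν x y (-1))) :
    0 < minDist (reducedHull ν x y 1) (reducedHull ν x y (-1)) := by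
  have hcomp := (isCompact_reducedHull ν x y 1).prod (isCompact_reducedHull ν x y (-1))
  obtain ⟨z, hz, hmin⟩ := hcomp.exists_isMinOn (h1.prod h2)
    (f := fun z => dist z.1 z.2) continuous_dist.continuousOn
  have hpq : z.1 ≠ z.2 := fun h => Set.disjoint_left.1 hd hz.1 (h ▸ hz.2)
  refine (dist_pos.2 hpq).trans_le (le_csInf (h1.image2 h2) ?_)
  rintro _ ⟨p', hp', q', hq', rfl⟩
  exact isMinOn_iff.1 hmin (p', q') (Set.mk_mem_prod hp' hq')

lemma reducedHull_subset (hν : ν ≤ 1) (σ : ℤˣ) :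
    reducedHull ν x y σ ⊆ convexHull ℝ (Set.range x) := by
  refine Set.Subset.trans ?_ (convexHull_mono (Set.image_subset_range x {i | y i = σ}))
  change _ ⊆ convexHull ℝ (classPoints x y σ)
  rw [classPoints_convexHull]
  rintro _ ⟨η, e1, e⟩
  exact ⟨η, fun i => ⟨(e1 i).1, (e1 i).2.trans hν⟩, e⟩

lemma minDist_le_diam (hν : ν ≤ 1) (h1 : (reducedHull ν x y 1).Nonempty)
    (h2 : (reducedHull ν x y (-1)).Nonempty) :
    minDist (reducedHull ν x y 1) (reducedHull ν x y (-1)) ≤ Metric.diam (Set.range x) := by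
  obtain ⟨p, hp⟩ := h1
  obtain ⟨q, hq⟩ := h2
  rw [← convexHull_diam]
  refine (minDist_le hp hq).trans (Metric.dist_le_diam_of_mem ?_ (reducedHull_subset hν _ hp)
    (reducedHull_subset hν _ hq))
  exact isBounded_convexHull.2 (Set.finite_range x).isBounded

lemma distRatio_pos_le_one (hν : ν ≤ 1) (h1 : (reducedHull ν x y 1).Nonempty)
    (h2 : (reducedHull ν x y (-1)).Nonempty)
    (hd : Disjoint (reducedHull ν x y 1) (reducedHull ν x y (-1))) :
    0 < distRatio x (reducedHull ν x y 1) (reducedHull ν x y (-1)) ∧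
      distRatio x (reducedHull ν x y 1) (reducedHull ν x y (-1)) ≤ 1 := by
  have e1 := minDist_pos h1 h2 hd
  have e2 := minDist_le_diam hν h1 h2
  have e3 := e1.trans_le e2
  refine ⟨div_pos (by positivity) (by positivity), (div_le_one (by positivity)).2 ?_⟩
  exact pow_le_pow_left₀ e1.le e2 2

lemma disjoint_of_separable {w : EuclideanSpace ℝ (Fin d)} {b : ℝ} (hf : HMFeasible x y w b) :
    Disjoint (reducedHull 1 x y 1) (reducedHull 1 x y (-1)) := by
  have hcv : ∀ σ : ℤˣ, ∀ p ∈ reducedHull 1 x y σ, 1 ≤ ((σ : ℤ) : ℝ) * (inner ℝ w p - b) := by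
    rintro σ _ ⟨η, e1, e2, e3, rfl⟩
    have h1 : ((σ : ℤ) : ℝ) * (inner ℝ w (∑ i, η i • x i) - b) =
        ∑ i, η i * (((σ : ℤ) : ℝ) * (inner ℝ w (x i) - b)) := by
      simp only [inner_sum, inner_smul_right]
      have h2 : b = ∑ i, η i * b := by rw [← sum_mul, e3, one_mul]
      conv_lhs => rw [h2]
      rw [← sum_sub_distrib, mul_sum]
      exact sum_congr rfl fun i _ => by ring
    rw [h1]
    calc (1 : ℝ) = ∑ i, η i * 1 := by simp [e3]
      _ ≤ _ := sum_le_sum fun i _ => by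
          by_cases hi : y i = σ
          · rw [← hi]; exact mul_le_mul_of_nonneg_left (hf i) (e1 i).1
          · rw [e2 i hi]; simp
  rw [Set.disjoint_left]
  intro p hp hq
  have h1 : (1 : ℝ) ≤ ((1 : ℤˣ) : ℤ) * (inner ℝ w p - b) := hcv 1 p hp
  have h2 : (1 : ℝ) ≤ ((-1 : ℤˣ) : ℤ) * (inner ℝ w p - b) := hcv (-1) p hq
  simp only [Units.val_one, Units.val_neg, Int.cast_one, Int.cast_neg] at h1 h2
  linarith

end SPDC

/-! ### The randomized Hadamard transform -/

namespace SPDC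

open Finset

variable {n m d : ℕ}

/-- One stage of the Walsh-Hadamard transform in constant-geometry form, on vectors of length
`h + h`: sums of neighbours go to the first half, differences to the second. -/
def stage (h : ℕ) (v : ℕ → ℝ) (k : ℕ) : ℝ :=
  if k < h then v (k + k) + v (k + k + 1) else v (k - h + (k - h)) - v (k - h + (k - h) + 1)

lemma sum_range_double (h : ℕ) (g : ℕ → ℝ) :
    ∑ k ∈ range (h + h), g k = ∑ k ∈ range h, (g (k + k) + g (k + k + 1)) := by
  induction h with
  | zero => simp
  | succ h ih =>
    rw [show h + 1 + (h + 1) = h + h + 1 + 1 by ring, sum_range_succ, sum_range_succ, ih,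
      sum_range_succ, add_assoc]

lemma sum_stage_mul (h : ℕ) (v w : ℕ → ℝ) :
    ∑ k ∈ range (h + h), stage h v k * stage h w k = 2 * ∑ k ∈ range (h + h), v k * w k := by
  rw [sum_range_add, sum_range_double h fun k => v k * w k, ← sum_add_distrib, mul_sum]
  refine sum_congr rfl fun k hk => ?_
  simp only [stage, mem_range.1 hk, if_true, Nat.not_lt.2 (Nat.le_add_right h k), if_false,
    Nat.add_sub_cancel_left]
  ring

lemma sum_iterate_stage_mul (h p : ℕ) (v w : ℕ → ℝ) :
    ∑ k ∈ range (h + h), (stage h)^[p] v k * (stage h)^[p] w k =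
      2 ^ p * ∑ k ∈ range (h + h), v k * w k := by
  induction p with
  | zero => simp
  | succ p ih =>
    simp only [Function.iterate_succ_apply']
    rw [sum_stage_mul, ih, pow_succ]; ring

/-- The coefficients of the transform are bounded by one: as long as fewer than `log₂` of the
length stages have been made, the two neighbours that a stage combines depend on disjoint sets of
entries. -/
lemma exists_stage_coeff {p h : ℕ} (hh : h + h = 2 ^ p) (j : ℕ) (hj : j ≤ p) :
    ∃ C : ℕ → ℕ → ℝ, (∀ v, ∀ k < h + h, (stage h)^[j] v k = ∑ l ∈ range (h + h), C k l * v l) ∧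
      (∀ k < h + h, ∀ l, |C k l| ≤ 1) ∧
      ∀ k < h + h, ∀ l, C k l ≠ 0 → k % 2 ^ (p - j) = l / 2 ^ j := by
  induction j with
  | zero =>
    refine ⟨fun k l => if k = l then 1 else 0, fun v k hk => ?_, fun k _ l => ?_,
      fun k hk l hkl => ?_⟩
    · simp [hk]
    · simp only; split_ifs <;> simp
    · have : k = l := by by_contra h'; simp [h'] at hkl
      rw [← this, Nat.sub_zero, ← hh, Nat.mod_eq_of_lt hk]; simp
  | succ j ih =>
    obtain ⟨C, h1, h2, h3⟩ := ih (by omega)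
    obtain ⟨N, hN⟩ : ∃ N, N = 2 ^ (p - (j + 1)) := ⟨_, rfl⟩
    have hN2 : 2 ^ (p - j) = 2 * N := by
      rw [hN, ← pow_succ']; congr 1; omega
    have hNpos : 0 < N := hN ▸ by positivity
    obtain ⟨q, hq⟩ : N ∣ h := by
      have h4 : 2 ^ p = 2 * (N * 2 ^ j) := by
        rw [hN, ← pow_add, ← pow_succ']; congr 1; omega
      exact ⟨2 ^ j, by omega⟩
    have hmod0 : ∀ k, (k + k) % (2 * N) = 2 * (k % N) := fun k => by
      rw [← two_mul, Nat.mul_mod_mul_left]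
    have hmod1 : ∀ k, (k + k + 1) % (2 * N) = 2 * (k % N) + 1 := fun k => by
      have e1 := Nat.div_add_mod k N
      have e2 := Nat.mod_lt k hNpos
      have e3 : k + k + 1 = 2 * (k % N) + 1 + 2 * N * (k / N) := by
        conv_lhs => rw [← e1]
        ring
      rw [e3, Nat.add_mul_mod_self_left, Nat.mod_eq_of_lt (by omega)]
    have hdiv : ∀ l, l / 2 ^ (j + 1) = l / 2 ^ j / 2 := fun l => by
      rw [Nat.div_div_eq_div_mul, pow_succ]
    -- of two neighbours, at most one has a non-zero coefficient
    have hpair : ∀ k < h, ∀ l, (C (k + k) l = 0 ∨ C (k + k + 1) l = 0) ∧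
        ((C (k + k) l ≠ 0 ∨ C (k + k + 1) l ≠ 0) → k % N = l / 2 ^ (j + 1)) := by
      intro k hk l
      have a1 := h3 (k + k) (by omega) l
      have a2 := h3 (k + k + 1) (by omega) l
      rw [hN2, hmod0] at a1
      rw [hN2, hmod1] at a2
      rw [hdiv]
      refine ⟨?_, ?_⟩
      · by_contra hcon
        push Not at hcon
        have b1 := a1 hcon.1
        have b2 := a2 hcon.2
        omega
      · rintro (b | b)
        · have := a1 b; omega
        · have := a2 b; omega
    refine ⟨fun k l => stage h (fun k' => C k' l) k, fun v k hk => ?_, fun k hk l => ?_,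
      fun k hk l hkl => ?_⟩
    · have e := h1 v
      rw [Function.iterate_succ_apply']
      generalize (stage h)^[j] v = V at e ⊢
      simp only [stage]
      split_ifs with hkh
      · rw [e _ (by omega), e _ (by omega), ← sum_add_distrib]
        exact sum_congr rfl fun l _ => by ring
      · rw [e _ (by omega), e _ (by omega), ← sum_sub_distrib]
        exact sum_congr rfl fun l _ => by ring
    · simp only [stage]
      split_ifs with hkh
      · rcases (hpair k hkh l).1 with h4 | h4
        · rw [h4, zero_add]; exact h2 _ (by omega) _
        · rw [h4, add_zero]; exact h2 _ (by omega) _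
      · rcases (hpair (k - h) (by omega) l).1 with h4 | h4
        · rw [h4, zero_sub, abs_neg]; exact h2 _ (by omega) _
        · rw [h4, sub_zero]; exact h2 _ (by omega) _
    · simp only [stage] at hkl
      rw [← hN]
      split_ifs at hkl with hkh
      · refine (hpair k hkh l).2 ?_
        by_contra hcon
        push Not at hcon
        exact hkl (by rw [hcon.1, hcon.2, add_zero])
      · have hk' : (k - h) % N = k % N := by
          have e : k = k - h + N * q := by omega
          conv_rhs => rw [e, Nat.add_mul_mod_self_left]
        rw [← hk']
        refine (hpair (k - h) (by omega) l).2 ?_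
        by_contra hcon
        push Not at hcon
        exact hkl (by rw [hcon.1, hcon.2, sub_zero])

/-- A point with random signs, padded with zeros and scaled. -/
noncomputable def signedRow (d : ℕ) (rm : ℝ) (r : ℕ → ℕ) (A : ℕ → ℕ → ℝ) (j k : ℕ) : ℝ :=
  if k < d then (1 - 2 * (r k : ℝ)) * A j k / rm else 0

/-- The rotated points: `p` stages of the transform applied to the points with random signs. -/
noncomputable def rotated (h p d : ℕ) (rm : ℝ) (r : ℕ → ℕ) (A : ℕ → ℕ → ℝ) (j : ℕ) : ℕ → ℝ :=
  (stage h)^[p] (signedRow d rm r A j)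

/-- The transform has length `m = 2 ^ p`; if `m = 1`, there are no stages and `h` is irrelevant. -/
def IsHalf (m h p : ℕ) : Prop := m = 2 ^ p ∧ (p = 0 ∨ h + h = m)

lemma sum_rotated_mul {h p : ℕ} (hm : IsHalf m h p) (hd : d ≤ m) {rm : ℝ} (hrm : rm ^ 2 = m)
    {r : ℕ → ℕ} (hr : ∀ k < m, r k ≤ 1) (A : ℕ → ℕ → ℝ) (i j : ℕ) :
    ∑ k ∈ range m, rotated h p d rm r A i k * rotated h p d rm r A j k =
      ∑ k ∈ range d, A i k * A j k := by
  have h1 : ∑ k ∈ range m, rotated h p d rm r A i k * rotated h p d rm r A j k =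
      m * ∑ k ∈ range m, signedRow d rm r A i k * signedRow d rm r A j k := by
    rcases hm with ⟨h1, h2 | h2⟩
    · subst h2; simp [rotated, h1]
    · have := sum_iterate_stage_mul h p (signedRow d rm r A i) (signedRow d rm r A j)
      rw [h2] at this
      rw [h1] at this ⊢
      simpa [rotated] using this
  rw [h1, mul_sum, ← sum_subset (range_mono hd) (fun k _ hk => ?_)]
  · refine sum_congr rfl fun k hk => ?_
    have hk' := mem_range.1 hk
    have hm0 : (m : ℝ) ≠ 0 := by
      rw [hm.1]; positivity
    have hs : (1 - 2 * (r k : ℝ)) ^ 2 = 1 := by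
      have := hr k (by omega)
      interval_cases r k <;> norm_num
    have hrm0 : rm ≠ 0 := by
      rintro rfl; apply hm0; rw [← hrm]; norm_num
    simp only [signedRow, hk', if_true]
    rw [← hrm]
    field_simp
    rw [hs]; ring
  · have : ¬ k < d := fun h' => hk (mem_range.2 h')
    simp [signedRow, this]

/-- Every entry of the rotated points is a combination of the random signs. -/
lemma exists_rotated_coeff {h p : ℕ} (hm : IsHalf m h p) (hd : d ≤ m) {rm : ℝ} (hrm : rm ^ 2 = m)
    {A : ℕ → ℕ → ℝ} (hA : ∀ j < n, ∑ k ∈ range d, A j k ^ 2 ≤ 1) :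
    ∃ cf : ℕ → ℕ → ℕ → ℝ, (∀ r j, ∀ i < m, rotated h p d rm r A j i =
      ∑ l ∈ range m, (1 - 2 * (r l : ℝ)) * cf j i l) ∧
      ∀ j < n, ∀ i < m, ∑ l ∈ range m, cf j i l ^ 2 ≤ 1 / m := by
  obtain ⟨C, h1, h2⟩ : ∃ C : ℕ → ℕ → ℝ, (∀ v, ∀ k < m, (stage h)^[p] v k =
      ∑ l ∈ range m, C k l * v l) ∧ ∀ k < m, ∀ l, |C k l| ≤ 1 := by
    rcases hm with ⟨h1, h2 | h2⟩
    · subst h2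
      refine ⟨fun _ _ => 1, fun v k hk => ?_, by simp⟩
      rw [pow_zero] at h1
      subst h1
      have : k = 0 := by omega
      simp [this]
    · rw [← h2] at h1 ⊢
      obtain ⟨C, e1, e2, -⟩ := exists_stage_coeff h1 p le_rfl
      exact ⟨C, e1, e2⟩
  refine ⟨fun j i l => if l < d then C i l * A j l / rm else 0, fun r j i hi => ?_,
    fun j hj i hi => ?_⟩
  · rw [rotated, h1 _ _ hi]
    refine sum_congr rfl fun l _ => ?_
    by_cases hl : l < d
    · simp only [signedRow, hl, if_true]; ring
    · simp [signedRow, hl]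
  · have hm0 : (0 : ℝ) < m := by rw [hm.1]; positivity
    rw [← sum_subset (range_mono hd) (fun k _ hk => ?_)]
    · calc ∑ l ∈ range d, (if l < d then C i l * A j l / rm else 0) ^ 2 ≤
          ∑ l ∈ range d, A j l ^ 2 / m := by
            refine sum_le_sum fun l hl => ?_
            rw [if_pos (mem_range.1 hl), div_pow, hrm, mul_pow]
            refine div_le_div_of_nonneg_right (mul_le_of_le_one_left (sq_nonneg _) ?_) hm0.le
            rw [sq_le_one_iff_abs_le_one]; exact h2 i hi l
        _ ≤ 1 / m := by
            rw [← sum_div]; exact div_le_div_of_nonneg_right (hA j hj) hm0.le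
    · have : ¬ k < d := fun h' => hk (mem_range.2 h')
      simp [this]

/-- An exponential potential for the event that some entry exceeds `t`, when the first `k` signs
have been drawn. -/
noncomputable def flatPot (n m : ℕ) (cf : ℕ → ℕ → ℕ → ℝ) (lam t : ℝ) (k : ℕ) (r : ℕ → ℕ) : ℝ :=
  ∑ j ∈ range n, ∑ i ∈ range m,
    (Real.exp (lam * ∑ l ∈ range k, (1 - 2 * (r l : ℝ)) * cf j i l) +
      Real.exp (-(lam * ∑ l ∈ range k, (1 - 2 * (r l : ℝ)) * cf j i l))) *
    Real.exp (lam ^ 2 / 2 * (1 / m - ∑ l ∈ range k, cf j i l ^ 2) - lam * t)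

lemma exp_avg_le (S c a : ℝ) : Real.exp (S + c) * Real.exp (a - c ^ 2 / 2) +
    Real.exp (S - c) * Real.exp (a - c ^ 2 / 2) ≤ 2 * (Real.exp S * Real.exp a) := by
  have h := Real.cosh_le_exp_half_sq c
  rw [Real.cosh_eq] at h
  have h2 : Real.exp (a - c ^ 2 / 2) = Real.exp a / Real.exp (c ^ 2 / 2) := Real.exp_sub _ _
  rw [h2, sub_eq_add_neg S, Real.exp_add, Real.exp_add]
  have hpos := Real.exp_pos (c ^ 2 / 2)
  have h3 : Real.exp S * Real.exp c * (Real.exp a / Real.exp (c ^ 2 / 2)) +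
    Real.exp S * Real.exp (-c) * (Real.exp a / Real.exp (c ^ 2 / 2)) =
    2 * (Real.exp S * Real.exp a) * ((Real.exp c + Real.exp (-c)) / 2 / Real.exp (c ^ 2 / 2)) := by
    field_simp
  rw [h3]
  exact mul_le_of_le_one_right (by positivity) ((div_le_one hpos).2 h)

lemma flatPot_step (n m : ℕ) (cf : ℕ → ℕ → ℕ → ℝ) (lam t : ℝ) (k : ℕ) (r : ℕ → ℕ) :
    (flatPot n m cf lam t (k + 1) (Function.update r k 0) +
      flatPot n m cf lam t (k + 1) (Function.update r k 1)) / 2 ≤ flatPot n m cf lam t k r := by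
  have hsum : ∀ (v j i : ℕ), ∑ l ∈ range (k + 1), (1 - 2 * (Function.update r k v l : ℝ)) * cf j i l =
      ∑ l ∈ range k, (1 - 2 * (r l : ℝ)) * cf j i l + (1 - 2 * (v : ℝ)) * cf j i k := by
    intro v j i
    rw [sum_range_succ]
    congr 1
    · refine sum_congr rfl fun l hl => ?_
      rw [Function.update_of_ne (mem_range.1 hl).ne]
    · simp
  rw [div_le_iff₀ two_pos]
  unfold flatPot
  simp only [hsum, sum_range_succ (fun l => cf _ _ l ^ 2)]
  rw [← sum_add_distrib, sum_mul]
  refine sum_le_sum fun j _ => ?_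
  rw [← sum_add_distrib, sum_mul]
  refine sum_le_sum fun i _ => ?_
  generalize ∑ l ∈ range k, (1 - 2 * (r l : ℝ)) * cf j i l = S
  generalize ∑ l ∈ range k, cf j i l ^ 2 = V
  generalize cf j i k = x
  have e1 := exp_avg_le (lam * S) (lam * x) (lam ^ 2 / 2 * (1 / m - V) - lam * t)
  have e2 := exp_avg_le (-(lam * S)) (lam * x) (lam ^ 2 / 2 * (1 / m - V) - lam * t)
  have e3 : lam ^ 2 / 2 * (1 / m - (V + x ^ 2)) - lam * t =
      lam ^ 2 / 2 * (1 / m - V) - lam * t - (lam * x) ^ 2 / 2 := by ring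
  rw [e3]
  have e4 : lam * (S + (1 - 2 * ((0 : ℕ) : ℝ)) * x) = lam * S + lam * x := by push_cast; ring
  have e5 : lam * (S + (1 - 2 * ((1 : ℕ) : ℝ)) * x) = lam * S - lam * x := by push_cast; ring
  rw [e4, e5]
  have e6 : -(lam * S + lam * x) = -(lam * S) - lam * x := by ring
  have e7 : -(lam * S - lam * x) = -(lam * S) + lam * x := by ring
  rw [e6, e7]
  linarith

/-- The threshold and the exponent are chosen such that the failure probability is `1 / (2 n)`. -/
lemma flatPot_zero {Λ : ℝ} (hn : 0 < n) (hm : 0 < m) (hΛ : Λ = 2 * Real.log (4 * n ^ 2 * m))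
    (cf : ℕ → ℕ → ℕ → ℝ) (r : ℕ → ℕ) :
    flatPot n m cf (√(m * Λ)) (√(Λ / m)) 0 r = 1 / (2 * n) := by
  have hn' : (1 : ℝ) ≤ n := by exact_mod_cast hn
  have hm' : (1 : ℝ) ≤ m := by exact_mod_cast hm
  have hΛ0 : 0 ≤ Λ := by
    rw [hΛ]
    have : (1 : ℝ) ≤ 4 * n ^ 2 * m := by nlinarith [mul_le_mul hn' hn' zero_le_one (by linarith)]
    exact mul_nonneg (by norm_num) (Real.log_nonneg this)
  have h1 : √(m * Λ) * √(Λ / m) = Λ := by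
    rw [← Real.sqrt_mul (by positivity)]
    have : m * Λ * (Λ / m) = Λ ^ 2 := by field_simp
    rw [this, Real.sqrt_sq hΛ0]
  have h2 : √(m * Λ) ^ 2 / 2 * (1 / m - 0) - Λ = -(Λ / 2) := by
    rw [Real.sq_sqrt (by positivity)]; field_simp; ring
  have h3 : Real.exp (-(Λ / 2)) = 1 / (4 * n ^ 2 * m) := by
    rw [Real.exp_neg, hΛ, mul_div_cancel_left₀ _ two_ne_zero, Real.exp_log (by positivity), one_div]
  simp only [flatPot, range_zero, sum_empty, mul_zero, neg_zero, Real.exp_zero, h1, h2, h3,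
    sum_const, card_range, nsmul_eq_mul]
  field_simp
  norm_num

lemma flat_of_flatPot_lt {Λ : ℝ} {cf : ℕ → ℕ → ℕ → ℝ} {r : ℕ → ℕ} (hm : 0 < m) (hΛ : 0 < Λ)
    (hcf : ∀ j < n, ∀ i < m, ∑ l ∈ range m, cf j i l ^ 2 ≤ 1 / m)
    (hlt : flatPot n m cf (√(m * Λ)) (√(Λ / m)) m r < 1) {i j : ℕ} (hj : j < n) (hi : i < m) :
    m * (∑ l ∈ range m, (1 - 2 * (r l : ℝ)) * cf j i l) ^ 2 ≤ Λ := by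
  by_contra hcon
  push Not at hcon
  set X := ∑ l ∈ range m, (1 - 2 * (r l : ℝ)) * cf j i l
  set lam := √(m * Λ)
  have hm' : (0 : ℝ) < m := by exact_mod_cast hm
  have hlam : 0 < lam := Real.sqrt_pos.2 (by positivity)
  have hX : √(Λ / m) ≤ |X| := by
    rw [← Real.sqrt_sq_eq_abs]
    exact Real.sqrt_le_sqrt ((div_le_iff₀' hm').2 hcon.le)
  refine absurd hlt (not_lt.2 ?_)
  have hterm : 1 ≤ (Real.exp (lam * X) + Real.exp (-(lam * X))) *
      Real.exp (lam ^ 2 / 2 * (1 / m - ∑ l ∈ range m, cf j i l ^ 2) - lam * √(Λ / m)) := by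
    have h1 : Real.exp (lam * |X|) ≤ Real.exp (lam * X) + Real.exp (-(lam * X)) := by
      rcases abs_cases X with ⟨h, -⟩ | ⟨h, -⟩ <;> rw [h]
      · linarith [Real.exp_pos (-(lam * X))]
      · rw [mul_neg]; linarith [Real.exp_pos (lam * X)]
    refine le_trans ?_ (mul_le_mul_of_nonneg_right h1 (Real.exp_pos _).le)
    rw [← Real.exp_add]
    apply Real.one_le_exp
    have h2 := mul_le_mul_of_nonneg_left hX hlam.le
    have h3 : 0 ≤ lam ^ 2 / 2 * (1 / m - ∑ l ∈ range m, cf j i l ^ 2) :=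
      mul_nonneg (by positivity) (sub_nonneg.2 (hcf j hj i hi))
    linarith
  refine hterm.trans ?_
  unfold flatPot
  have h1 := single_le_sum (s := range n) (f := fun j => ∑ i ∈ range m,
    (Real.exp (lam * ∑ l ∈ range m, (1 - 2 * (r l : ℝ)) * cf j i l) +
      Real.exp (-(lam * ∑ l ∈ range m, (1 - 2 * (r l : ℝ)) * cf j i l))) *
    Real.exp (lam ^ 2 / 2 * (1 / m - ∑ l ∈ range m, cf j i l ^ 2) - lam * √(Λ / m)))
    (fun j _ => sum_nonneg fun i _ => by positivity) (mem_range.2 hj)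
  refine le_trans ?_ h1
  exact single_le_sum (s := range m) (f := fun i =>
    (Real.exp (lam * ∑ l ∈ range m, (1 - 2 * (r l : ℝ)) * cf j i l) +
      Real.exp (-(lam * ∑ l ∈ range m, (1 - 2 * (r l : ℝ)) * cf j i l))) *
    Real.exp (lam ^ 2 / 2 * (1 / m - ∑ l ∈ range m, cf j i l ^ 2) - lam * √(Λ / m)))
    (fun i _ => by positivity) (mem_range.2 hi)

end SPDC

/-! ### The parameters of a level -/

namespace SPDC

open Finset

/-- The logarithm that occurs in all parameters of the level with guess `q ^ 2` for `ε β`. -/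
noncomputable def pL (n m : ℕ) (q : ℝ) : ℝ := Real.log (16 * n * m / q ^ 2)
/-- The weight of the entropy. -/
noncomputable def pG (n m : ℕ) (q : ℝ) : ℝ := q ^ 2 / (64 * pL n m q)
/-- The number of steps after which the potential is halved is of order `m + pS n m q`. -/
noncomputable def pS (n m : ℕ) (q : ℝ) : ℝ := 16 * pL n m q * √m / q
/-- The primal step size. -/
noncomputable def pσ (n m : ℕ) (q : ℝ) : ℝ := m / (2 * (m + 4 * pS n m q))
/-- The dual step size. -/
noncomputable def pτ (n m : ℕ) (q : ℝ) : ℝ := 1 / (96 * pσ n m q * pL n m q)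
/-- The factor of the extrapolation, and of the decrease of the potential. -/
noncomputable def pθ (n m : ℕ) (q : ℝ) : ℝ := 1 - 1 / (2 * m + 4 * pS n m q)
/-- The accuracy of the normalization. -/
noncomputable def pδ (n m : ℕ) (q : ℝ) : ℝ := Real.exp (-(18 * pL n m q))
/-- The number of steps of the level. -/
noncomputable def pN (n m : ℕ) (q : ℝ) : ℝ := 13 * pL n m q * (2 * m + 4 * pS n m q)
/-- A bound for the entries of the dual vector. -/
noncomputable def pZ (n m : ℕ) (q : ℝ) : ℝ := 6 * m / pG n m q

section

variable {n m : ℕ} {q : ℝ}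

/-- The size of the instance and the guess. -/
structure Level (n m : ℕ) (q : ℝ) : Prop where
  hn : 2 ≤ n
  hm : 1 ≤ m
  hq : 0 < q
  hq1 : q ≤ 1

namespace Level

lemma one_le_n (h : Level n m q) : (2 : ℝ) ≤ n := by exact_mod_cast h.hn
lemma one_le_m (h : Level n m q) : (1 : ℝ) ≤ m := by exact_mod_cast h.hm

lemma base_ge (h : Level n m q) : 16 * n * m ≤ 16 * n * m / q ^ 2 := by
  have := h.hq
  exact le_div_self (by positivity) (by positivity) (pow_le_one₀ this.le h.hq1)

lemma le_base (h : Level n m q) : (32 : ℝ) ≤ 16 * n * m / q ^ 2 := by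
  refine le_trans ?_ h.base_ge
  nlinarith [mul_le_mul h.one_le_n h.one_le_m zero_le_one (by linarith [h.one_le_n])]

lemma one_le_pL (h : Level n m q) : 1 ≤ pL n m q := by
  rw [pL, Real.le_log_iff_exp_le (by linarith [h.le_base])]
  linarith [Real.exp_one_lt_d9, h.le_base]

lemma exp_pL (h : Level n m q) : Real.exp (pL n m q) = 16 * n * m / q ^ 2 :=
  Real.exp_log (by linarith [h.le_base])

lemma pL_le (h : Level n m q) : pL n m q ≤ 16 * n * m / q ^ 2 := by
  rw [← h.exp_pL]; linarith [Real.add_one_le_exp (pL n m q)]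

lemma log_n_le (h : Level n m q) : Real.log n ≤ pL n m q := by
  refine Real.log_le_log (by linarith [h.one_le_n]) (le_trans ?_ h.base_ge)
  nlinarith [mul_le_mul_of_nonneg_left h.one_le_m (by linarith [h.one_le_n] : (0 : ℝ) ≤ n),
    h.one_le_n]

lemma flat_le (h : Level n m q) : 2 * Real.log (4 * n ^ 2 * m) ≤ 4 * pL n m q := by
  have h1 : Real.log (4 * n ^ 2 * m) ≤ Real.log ((16 * n * m / q ^ 2) ^ 2) := by
    have hn := h.one_le_n
    have hm := h.one_le_m
    refine Real.log_le_log (by positivity) ?_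
    refine le_trans ?_ (pow_le_pow_left₀ (by positivity) h.base_ge 2)
    have : 4 * (n : ℝ) ^ 2 * m ≤ 4 * (n : ℝ) ^ 2 * (64 * m ^ 2) :=
      mul_le_mul_of_nonneg_left (by nlinarith) (by positivity)
    nlinarith
  rw [Real.log_pow] at h1
  unfold pL
  push_cast at h1
  linarith

lemma pG_pos (h : Level n m q) : 0 < pG n m q := by
  have := h.one_le_pL
  have := h.hq
  unfold pG; positivity

lemma pG_le (h : Level n m q) : pG n m q ≤ 1 := by
  have := h.one_le_pL
  have h2 : q ^ 2 ≤ 1 := pow_le_one₀ h.hq.le h.hq1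
  unfold pG
  rw [div_le_one (by positivity)]
  linarith

lemma pS_pos (h : Level n m q) : 0 < pS n m q := by
  have := h.one_le_pL
  have := h.hq
  have := h.one_le_m
  unfold pS; positivity

lemma pS_sq (h : Level n m q) : pG n m q * pS n m q ^ 2 = 4 * pL n m q * m := by
  have h1 := h.one_le_pL
  have h2 := h.hq
  have h3 := h.one_le_m
  unfold pG pS
  rw [div_pow, mul_pow, Real.sq_sqrt (by positivity)]
  field_simp
  ring

lemma sigma_pos (h : Level n m q) : 0 < pσ n m q := by
  have := h.pS_pos
  have := h.one_le_m
  unfold pσ; positivity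

lemma tau_pos (h : Level n m q) : 0 < pτ n m q := by
  have := h.sigma_pos
  have := h.one_le_pL
  unfold pτ; positivity

lemma _root_.SPDC.inv_tau : 1 / pτ n m q = 24 * pσ n m q * (4 * pL n m q) := by
  unfold pτ; rw [one_div_one_div]; ring

lemma rate_ge (h : Level n m q) : 2 ≤ 2 * m + 4 * pS n m q := by
  linarith [h.pS_pos, h.one_le_m]

lemma half_le_theta (h : Level n m q) : 1 / 2 ≤ pθ n m q := by
  have : 1 / (2 * m + 4 * pS n m q) ≤ 1 / 2 := one_div_le_one_div_of_le two_pos h.rate_ge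
  unfold pθ; linarith

lemma theta_le_one (h : Level n m q) : pθ n m q ≤ 1 := by
  have : 0 ≤ 1 / (2 * m + 4 * pS n m q) := one_div_nonneg.2 (by linarith [h.rate_ge])
  unfold pθ; linarith

lemma primal_rate (h : Level n m q) : m * (1 + 1 / (2 * pσ n m q)) = 2 * m + 4 * pS n m q := by
  have h1 := h.one_le_m
  have h2 := h.pS_pos
  unfold pσ
  field_simp
  ring

lemma theta_m (h : Level n m q) : (1 - pθ n m q) * (m * (1 + 1 / (2 * pσ n m q))) ≤ 1 := by
  rw [h.primal_rate, pθ, sub_sub_cancel, one_div_mul_cancel (by linarith [h.rate_ge])]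

lemma potential_weight_le (h : Level n m q) :
    1 / pτ n m q + pG n m q ≤ pG n m q * (2 * m + 4 * pS n m q) := by
  have h1 := h.one_le_m
  have h2 := h.pS_pos
  have h3 := h.one_le_pL
  have h4 := h.pG_pos
  have h5 : 1 / pτ n m q ≤ 3 * pG n m q * pS n m q := by
    rw [inv_tau]
    have h6 : 24 * pσ n m q * (4 * pL n m q) = 48 * pL n m q * m / (m + 4 * pS n m q) := by
      unfold pσ; field_simp; ring
    rw [h6, div_le_iff₀ (by positivity)]
    have := h.pS_sq
    have h7 : 0 ≤ 3 * pG n m q * pS n m q * m := by positivity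
    nlinarith
  nlinarith [mul_pos h4 h2]

lemma theta_tau (h : Level n m q) :
    1 / pτ n m q ≤ pθ n m q * (1 / pτ n m q + pG n m q) := by
  have h1 := h.potential_weight_le
  have h2 : (1 / pτ n m q + pG n m q) / (2 * m + 4 * pS n m q) ≤ pG n m q := by
    rw [div_le_iff₀ (by linarith [h.rate_ge])]; exact h1
  have h3 : pθ n m q * (1 / pτ n m q + pG n m q) = 1 / pτ n m q + pG n m q -
      (1 / pτ n m q + pG n m q) / (2 * m + 4 * pS n m q) := by
    unfold pθ; ring
  linarith

lemma pδ_eq (h : Level n m q) : pδ n m q = 1 / (16 * n * m / q ^ 2) ^ 18 := by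
  rw [pδ, Real.exp_neg, ← h.exp_pL, ← Real.exp_nat_mul, one_div]
  norm_num

lemma _root_.SPDC.pδ_pos : 0 < pδ n m q := Real.exp_pos _

lemma pδ_le_one (h : Level n m q) : pδ n m q ≤ 1 := by
  unfold pδ
  exact Real.exp_le_one_iff.2 (by linarith [h.one_le_pL])

lemma pZ_pos (h : Level n m q) : 0 < pZ n m q := by
  have := h.pG_pos
  have := h.one_le_m
  unfold pZ; positivity

lemma rate_le (h : Level n m q) : 2 * m + 4 * pS n m q ≤ (16 * n * m / q ^ 2) ^ 3 := by
  have hb := h.le_base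
  have hn := h.one_le_n
  have hm := h.one_le_m
  have h1 := h.pL_le
  have hL := h.one_le_pL
  set b := 16 * n * m / q ^ 2 with hbdef
  have h2 : 16 * √m / q ≤ b := by
    have e1 : √(m : ℝ) ≤ m := by
      rw [Real.sqrt_le_left (by linarith)]; nlinarith
    have e2 : q ^ 2 ≤ q := by nlinarith [h.hq, h.hq1]
    have hq := h.hq
    rw [hbdef]
    refine div_le_div₀ (by positivity) ?_ (by positivity) e2
    nlinarith
  have h3 : pS n m q ≤ b * b := by
    have : pS n m q = pL n m q * (16 * √m / q) := by unfold pS; ring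
    rw [this]
    have hq := h.hq
    exact mul_le_mul h1 h2 (by positivity) (by linarith)
  have h4 : (2 : ℝ) * m ≤ b := by
    refine le_trans ?_ h.base_ge
    nlinarith
  nlinarith [mul_nonneg (sub_nonneg.2 hb) (sq_nonneg b)]

lemma inv_sigma_le (h : Level n m q) : 1 / pσ n m q ≤ 2 * (2 * m + 4 * pS n m q) := by
  have hm := h.one_le_m
  have hS := h.pS_pos
  unfold pσ
  rw [one_div_div, div_le_iff₀ (by linarith)]
  nlinarith [mul_nonneg (sub_nonneg.2 hm) hS.le]

lemma inv_sq_le (h : Level n m q) : 1 / (q ^ 2 / 64) ≤ 2 * (16 * n * m / q ^ 2) := by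
  have hn := h.one_le_n
  have hm := h.one_le_m
  have hq := h.hq
  rw [one_div_div, mul_div_assoc', div_le_div_iff_of_pos_right (by positivity)]
  nlinarith

/-- The factor that turns the potential into a failure probability. -/
lemma weight_le (h : Level n m q) :
    1 / (3 * pσ n m q * (4 * pL n m q) * (q ^ 2 / 64) ^ 2) ≤ (16 * n * m / q ^ 2) ^ 7 := by
  have hb := h.le_base
  have h1 := h.inv_sigma_le
  have h2 := h.inv_sq_le
  have hR := h.rate_le
  have hL := h.one_le_pL
  have hσ := h.sigma_pos
  have hq := h.hq
  generalize 16 * n * m / q ^ 2 = b at hb h2 hR ⊢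
  have e1 : 1 / pσ n m q ≤ b ^ 4 := by
    have e0 : 0 ≤ b ^ 3 := by have : 0 ≤ b := by linarith
                              positivity
    calc 1 / pσ n m q ≤ 2 * b ^ 3 := by linarith
      _ ≤ b * b ^ 3 := mul_le_mul_of_nonneg_right (by linarith) e0
      _ = b ^ 4 := by ring
  have e2 : (1 / (q ^ 2 / 64)) ^ 2 ≤ b ^ 3 := by
    have e3 := pow_le_pow_left₀ (by positivity) h2 2
    nlinarith [mul_nonneg (sub_nonneg.2 hb) (by positivity : 0 ≤ b ^ 2)]
  have e4 : 1 / (3 * pσ n m q * (4 * pL n m q) * (q ^ 2 / 64) ^ 2) =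
      1 / (12 * pL n m q) * (1 / pσ n m q * (1 / (q ^ 2 / 64)) ^ 2) := by
    field_simp; ring
  have e5 : 1 / (12 * pL n m q) ≤ 1 := by
    rw [div_le_one (by positivity)]; linarith
  rw [e4]
  calc _ ≤ 1 * (b ^ 4 * b ^ 3) :=
        mul_le_mul e5 (mul_le_mul e1 e2 (by positivity) (by positivity)) (by positivity)
          zero_le_one
    _ = b ^ 7 := by ring

lemma theta_pow_le (h : Level n m q) {N : ℕ} (hN : pN n m q ≤ N) :
    pθ n m q ^ N ≤ 1 / (16 * n * m / q ^ 2) ^ 13 := by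
  have hR2 := h.rate_ge
  have hθ0 := h.half_le_theta
  rw [← h.exp_pL, ← Real.exp_nat_mul, one_div, ← Real.exp_neg]
  unfold pN at hN
  have e1 : pθ n m q ≤ Real.exp (-(1 / (2 * m + 4 * pS n m q))) := by
    have := Real.add_one_le_exp (-(1 / (2 * m + 4 * pS n m q)))
    unfold pθ; linarith
  generalize 2 * m + 4 * pS n m q = R at hR2 e1 hN
  calc pθ n m q ^ N ≤ Real.exp (-(1 / R)) ^ N := pow_le_pow_left₀ (by linarith) e1 N
    _ = Real.exp (-(N / R)) := by rw [← Real.exp_nat_mul]; congr 1; ring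
    _ ≤ Real.exp (-((13 : ℕ) * pL n m q)) := by
        apply Real.exp_le_exp.2
        have : 13 * pL n m q ≤ N / R := by
          rw [le_div_iff₀ (by linarith)]; exact hN
        push_cast
        linarith

lemma failure_arith {b R a P δ lg Ψ N t ν : ℝ} (hb : 32 ≤ b) (hR0 : 0 ≤ R) (hR : R ≤ b ^ 3)
    (ha0 : 0 ≤ a) (ha : a ≤ b ^ 7) (hP0 : 0 ≤ P) (hP : P ≤ R) (hδ : δ = 1 / b ^ 18)
    (hδ1 : δ ≤ 1) (hlg0 : 0 ≤ lg) (hlg : lg ≤ b) (hΨ : Ψ ≤ P * (2 * lg + 4 * δ) + R * 4)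
    (hN : N ≤ 13 * (b * R) + 1) (ht0 : 0 ≤ t) (ht : t ≤ 1 / b ^ 13)
    (hν : 0 < ν) (hνb : 16 * ν ≤ b) :
    a * t * Ψ + N * (a * P * (4 * δ)) ≤ 1 / (2 * ν) := by
  have e0 : 0 < b := by linarith
  have hδ0 : 0 < δ := by rw [hδ]; positivity
  have haP : a * P ≤ b ^ 10 := by
    calc a * P ≤ b ^ 7 * b ^ 3 := mul_le_mul ha (hP.trans hR) hP0 (by positivity)
      _ = b ^ 10 := by ring
  have haΨ : a * Ψ ≤ b ^ 12 := by
    have e1 := mul_le_mul_of_nonneg_left hΨ ha0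
    have e2 : a * (R * 4) ≤ b ^ 7 * (b ^ 3 * 4) :=
      mul_le_mul ha (by linarith) (by positivity) (by positivity)
    have e3 : a * P * (2 * lg + 4 * δ) ≤ b ^ 10 * (2 * b + 4) :=
      mul_le_mul haP (by linarith) (by positivity) (by positivity)
    have e4 : 0 ≤ b ^ 10 := by positivity
    have e5 : 2 * b + 8 ≤ b ^ 2 := by nlinarith
    have e6 := mul_le_mul_of_nonneg_left e5 e4
    calc a * Ψ ≤ a * P * (2 * lg + 4 * δ) + a * (R * 4) := by linarith
      _ ≤ b ^ 10 * (2 * b + 4) + b ^ 7 * (b ^ 3 * 4) := add_le_add e3 e2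
      _ = b ^ 10 * (2 * b + 8) := by ring
      _ ≤ b ^ 10 * b ^ 2 := e6
      _ = b ^ 12 := by ring
  have t1 : a * t * Ψ ≤ 1 / b := by
    calc a * t * Ψ = t * (a * Ψ) := by ring
      _ ≤ t * b ^ 12 := mul_le_mul_of_nonneg_left haΨ ht0
      _ ≤ 1 / b ^ 13 * b ^ 12 := mul_le_mul_of_nonneg_right ht (by positivity)
      _ = 1 / b := by field_simp
  have t2 : N * (a * P * (4 * δ)) ≤ 4 / b ^ 2 := by
    have e1 : N ≤ b ^ 6 := by
      have e2 : b * R ≤ b * b ^ 3 := mul_le_mul_of_nonneg_left hR e0.le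
      have e4 : 1 ≤ b ^ 4 := one_le_pow₀ (by linarith)
      have e5 : 14 ≤ b ^ 2 := by nlinarith
      calc N ≤ 13 * (b * b ^ 3) + 1 := by linarith
        _ ≤ 14 * b ^ 4 := by linarith [(by ring : b * b ^ 3 = b ^ 4)]
        _ ≤ b ^ 2 * b ^ 4 := mul_le_mul_of_nonneg_right e5 (by positivity)
        _ = b ^ 6 := by ring
    calc N * (a * P * (4 * δ)) ≤ b ^ 6 * (b ^ 10 * (4 * δ)) :=
          mul_le_mul e1 (mul_le_mul_of_nonneg_right haP (by positivity))
            (by positivity) (by positivity)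
      _ = 4 / b ^ 2 := by rw [hδ]; field_simp
  have t3 : 4 / b ^ 2 ≤ 1 / b := by
    rw [div_le_div_iff₀ (by positivity) e0]; nlinarith
  have t4 : 2 / b ≤ 1 / (2 * ν) := by
    rw [div_le_div_iff₀ e0 (by linarith)]; linarith
  have t5 : 2 / b = 1 / b + 1 / b := by ring
  linarith

/-- The choice of the numbers of steps and of the accuracy: the final potential is, in units in
which `1` makes the test fail, at most `1 / (2 n)`. -/
lemma failure_le (h : Level n m q) {Ψ : ℝ} {N : ℕ} (hN1 : pN n m q ≤ N) (hN2 : N ≤ pN n m q + 1)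
    (hΨ : Ψ ≤ (1 / pτ n m q + pG n m q) * (2 * Real.log n + 4 * pδ n m q) +
      m * (1 + 1 / (2 * pσ n m q)) * 4) :
    1 / (3 * pσ n m q * (4 * pL n m q) * (q ^ 2 / 64) ^ 2) * pθ n m q ^ N * Ψ +
      N * (1 / (3 * pσ n m q * (4 * pL n m q) * (q ^ 2 / 64) ^ 2) *
        (1 / pτ n m q + pG n m q) * (4 * pδ n m q)) ≤ 1 / (2 * n) := by
  have hL := h.one_le_pL
  have hG := h.pG_pos
  have hτ := h.tau_pos
  have hσ := h.sigma_pos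
  have hq := h.hq
  have hn := h.one_le_n
  rw [h.primal_rate] at hΨ
  refine failure_arith h.le_base (by linarith [h.rate_ge]) h.rate_le (by positivity) h.weight_le
    (by positivity)
    (h.potential_weight_le.trans (mul_le_of_le_one_left (by linarith [h.rate_ge]) h.pG_le))
    h.pδ_eq h.pδ_le_one (Real.log_nonneg (by linarith)) (h.log_n_le.trans h.pL_le) hΨ
    (hN2.trans ?_) (pow_nonneg (by linarith [h.half_le_theta]) N)
    (h.theta_pow_le hN1) (by linarith) ?_
  · unfold pN
    have := mul_le_mul_of_nonneg_right h.pL_le (by linarith [h.rate_ge] :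
      0 ≤ 2 * m + 4 * pS n m q)
    linarith
  · refine le_trans ?_ h.base_ge
    nlinarith [h.one_le_m]

/-- The accuracy suffices for the test. -/
lemma accuracy_le (h : Level n m q) :
    6 * (q ^ 2 / 64) + pG n m q * (4 * Real.log n + 2 * pδ n m q) ≤ q ^ 2 / 2 := by
  have hL := h.one_le_pL
  have hG := h.pG_pos
  have h1 := mul_le_mul_of_nonneg_left (by linarith [h.log_n_le, h.pδ_le_one] :
    4 * Real.log n + 2 * pδ n m q ≤ 6 * pL n m q) hG.le
  have h2 : pG n m q * (6 * pL n m q) = q ^ 2 * (6 / 64) := by unfold pG; field_simp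
  nlinarith [sq_nonneg q]

/-- The bisection for the normalization takes logarithmically many steps. -/
lemma bisection_steps (h : Level n m q) :
    ∃ K : ℕ, (2 * pZ n m q + Real.log n) / 2 ^ K ≤ pδ n m q ∧ K ≤ 40 * pL n m q := by
  have hb := h.le_base
  have hL := h.one_le_pL
  have hLb := h.pL_le
  have hlog := h.log_n_le
  have hq := h.hq
  have hn := h.one_le_n
  have hm := h.one_le_m
  have hδ := h.pδ_eq
  have hZ : pZ n m q = 384 * m / q ^ 2 * pL n m q := by
    unfold pZ pG; field_simp; ring
  have hZb : 384 * (m : ℝ) / q ^ 2 ≤ 24 * (16 * n * m / q ^ 2) := by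
    rw [mul_div_assoc', div_le_div_iff_of_pos_right (by positivity)]; nlinarith
  set b := 16 * n * m / q ^ 2 with hbdef
  have hrange : 2 * pZ n m q + Real.log n ≤ b ^ 4 := by
    have e1 : pZ n m q ≤ 24 * b * b := by
      rw [hZ]; exact mul_le_mul hZb hLb (by linarith) (by linarith)
    have e2 : 0 ≤ b ^ 2 := by positivity
    have e3 : 49 ≤ b ^ 2 := by nlinarith
    nlinarith [mul_le_mul_of_nonneg_left e3 e2]
  refine ⟨⌊40 * pL n m q⌋₊, ?_, Nat.floor_le (by linarith)⟩
  have hpow : b ^ 22 ≤ (2 : ℝ) ^ ⌊40 * pL n m q⌋₊ := by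
    have e1 : (2 : ℝ) ^ ⌊40 * pL n m q⌋₊ = Real.exp (Real.log 2 * ⌊40 * pL n m q⌋₊) := by
      rw [mul_comm (Real.log 2), Real.exp_nat_mul, Real.exp_log two_pos]
    rw [e1, ← Real.exp_log (by linarith : 0 < b), ← Real.exp_nat_mul]
    change Real.exp (_ * pL n m q) ≤ _
    apply Real.exp_le_exp.2
    have e2 := (Nat.lt_floor_add_one (40 * pL n m q)).le
    have e3 := Real.log_two_gt_d9
    have e4 : 0.6931471803 * (40 * pL n m q - 1) ≤ Real.log 2 * ⌊40 * pL n m q⌋₊ :=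
      mul_le_mul e3.le (by linarith) (by linarith) (by linarith)
    push_cast
    linarith
  have e0 : 0 < b := by linarith
  rw [hδ, div_le_div_iff₀ (by positivity) (by positivity), one_mul]
  calc (2 * pZ n m q + Real.log n) * b ^ 18 ≤ b ^ 4 * b ^ 18 :=
        mul_le_mul_of_nonneg_right hrange (by positivity)
    _ = b ^ 22 := by ring
    _ ≤ _ := hpow

end Level

end

end SPDC

/-! ### Rules for loops that fill an array or add up numbers -/

namespace RealRAM

lemma Agree.int {c : Cmd} {s s' : State} (h : Agree c s s') (a : ℕ) (ha : a ∉ c.wi) :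
    s'.int a = s.int a := h.1 a ha

lemma Agree.real {c : Cmd} {s s' : State} (h : Agree c s s') (a : ℕ) (ha : a ∉ c.wr) :
    s'.real a = s.real a := h.2 a ha

@[simp] lemma writeInt_real (s : State) (a i v : ℕ) : (s.writeInt a i v).real = s.real := rfl

@[simp] lemma writeReal_int (s : State) (a i : ℕ) (v : ℝ) : (s.writeReal a i v).int = s.int := rfl

@[simp] lemma writeInt_self (s : State) (a i v : ℕ) :
    (s.writeInt a i v).int a = Function.update (s.int a) i v := by simp [State.writeInt]

@[simp] lemma writeReal_self (s : State) (a i : ℕ) (v : ℝ) :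
    (s.writeReal a i v).real a = Function.update (s.real a) i v := by simp [State.writeReal]

lemma writeInt_of_ne (s : State) {a b : ℕ} (h : b ≠ a) (i v : ℕ) :
    (s.writeInt a i v).int b = s.int b := by simp [State.writeInt, h]

lemma writeReal_of_ne (s : State) {a b : ℕ} (h : b ≠ a) (i : ℕ) (v : ℝ) :
    (s.writeReal a i v).real b = s.real b := by simp [State.writeReal, h]

/-- A loop whose `k`-th pass writes `f k` into cell `ix k` of the real array `a`. -/
lemma Runs.fillBody {v a : ℕ} {N : IExpr} {c : Cmd} {s : State} {Q : State → Prop} {T' : ℕ}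
    (n T : ℕ) (ix : ℕ → ℕ) (f : ℕ → ℝ) (hv : v ∉ c.wi)
    (hix : ∀ i < n, ∀ j < n, ix i = ix j → i = j)
    (hN : ∀ s', Agree (RealRAM.forLoop v N c) s s' → N.eval s' = n)
    (hc : ∀ k < n, ∀ s', Agree (RealRAM.forLoop v N c) s s' → s'.int v 0 = k →
      s'.real a (ix k) = s.real a (ix k) →
      Runs c T s' fun s'' => s''.real a = Function.update (s'.real a) (ix k) (f k))
    (hQ : ∀ s', Agree (RealRAM.forLoop v N c) s s' → (∀ k < n, s'.real a (ix k) = f k) →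
      (∀ i, (∀ k < n, ix k ≠ i) → s'.real a i = s.real a i) → Q s')
    (hT : n * (T + 3) + 3 ≤ T') : Runs (RealRAM.forLoop v N c) T' s Q := by
  refine Runs.forLoop (fun k s' => (∀ l < k, l < n → s'.real a (ix l) = f l) ∧
    ∀ i, (∀ l < k, l < n → ix l ≠ i) → s'.real a i = s.real a i) n T hv hN
    (fun _ _ _ h => h) ⟨by simp, fun _ _ => rfl⟩ ?_ ?_ hT
  · rintro k s' hk hA hk' ⟨h1, h2⟩
    have h3 : s'.real a (ix k) = s.real a (ix k) :=
      h2 _ fun l hl hln h => hl.ne (hix l hln k hk h)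
    refine (hc k hk s' hA hk' h3).imp le_rfl fun s'' h => ⟨fun l hl hln => ?_, fun i hi => ?_⟩
    · rw [h]
      rcases (Nat.lt_succ_iff_lt_or_eq.1 hl) with hl' | rfl
      · rw [Function.update_of_ne fun h => hl'.ne (hix l hln k hk h), h1 l hl' hln]
      · simp
    · rw [h, Function.update_of_ne fun h => hi k (by omega) hk h.symm]
      exact h2 i fun l hl => hi l (by omega)
  · rintro s' hA ⟨h1, h2⟩
    exact hQ s' hA (fun k hk => h1 k hk hk) fun i hi => h2 i fun l hl _ => hi l hl

/-- `for v := 0, …, N - 1 do a[idx] := e`. -/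
def fill (v a : ℕ) (N idx : IExpr) (e : RExpr) : Cmd := RealRAM.forLoop v N (.rset a idx e)

lemma Runs.fill {v a : ℕ} {N idx : IExpr} {e : RExpr} {s : State} {Q : State → Prop} {T' : ℕ}
    (n : ℕ) (ix : ℕ → ℕ) (f : ℕ → ℝ) (hix : ∀ i < n, ∀ j < n, ix i = ix j → i = j)
    (hN : ∀ s', Agree (RealRAM.fill v a N idx e) s s' → N.eval s' = n)
    (he : ∀ k < n, ∀ s', Agree (RealRAM.fill v a N idx e) s s' → s'.int v 0 = k →
      idx.eval s' = ix k ∧ (s'.real a (ix k) = s.real a (ix k) → e.eval s' = f k))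
    (hQ : ∀ s', Agree (RealRAM.fill v a N idx e) s s' → (∀ k < n, s'.real a (ix k) = f k) →
      (∀ i, (∀ k < n, ix k ≠ i) → s'.real a i = s.real a i) → Q s')
    (hT : 4 * n + 3 ≤ T') : Runs (RealRAM.fill v a N idx e) T' s Q := by
  refine Runs.fillBody n 1 ix f (by simp [Cmd.wi]) hix hN ?_ hQ (by omega)
  intro k hk s' hA hk' h
  obtain ⟨h1, h2⟩ := he k hk s' hA hk'
  exact Runs.rset le_rfl (by simp [h1, h2 h])

/-- Filling an array in its natural order. -/
lemma Runs.fillId {v a : ℕ} {N : IExpr} {e : RExpr} {s : State} {Q : State → Prop} {T' : ℕ}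
    (n : ℕ) (f : ℕ → ℝ)
    (hN : ∀ s', Agree (RealRAM.fill v a N (.load v (.const 0)) e) s s' → N.eval s' = n)
    (he : ∀ k < n, ∀ s', Agree (RealRAM.fill v a N (.load v (.const 0)) e) s s' →
      s'.int v 0 = k → s'.real a k = s.real a k → e.eval s' = f k)
    (hQ : ∀ s', Agree (RealRAM.fill v a N (.load v (.const 0)) e) s s' →
      (∀ k < n, s'.real a k = f k) → Q s')
    (hT : 4 * n + 3 ≤ T') : Runs (RealRAM.fill v a N (.load v (.const 0)) e) T' s Q :=
  Runs.fill n id f (fun _ _ _ _ h => h) hN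
    (fun k hk s' hA hk' => ⟨by simp [IExpr.eval, hk'], fun h => he k hk s' hA hk' h⟩)
    (fun s' hA h _ => hQ s' hA h) hT

/-- Cell `0` of the real array `a` becomes the sum of `e` for `v = 0, …, N - 1`. -/
def accum (v a : ℕ) (N : IExpr) (e : RExpr) : Cmd :=
  .seq (.rset a (.const 0) (.cast (.const 0)))
    (RealRAM.forLoop v N (.rset a (.const 0) (.add (.load a (.const 0)) e)))

lemma Runs.accum {v a : ℕ} {N : IExpr} {e : RExpr} {s : State} {Q : State → Prop} {T' : ℕ}
    (n : ℕ) (f : ℕ → ℝ)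
    (hN : ∀ s', Agree (RealRAM.accum v a N e) s s' → N.eval s' = n)
    (he : ∀ k < n, ∀ s', Agree (RealRAM.accum v a N e) s s' → s'.int v 0 = k → e.eval s' = f k)
    (hQ : ∀ s', Agree (RealRAM.accum v a N e) s s' →
      s'.real a 0 = ∑ k ∈ Finset.range n, f k → Q s')
    (hT : 4 * n + 5 ≤ T') : Runs (RealRAM.accum v a N e) T' s Q := by
  refine Runs.seq (Runs.rset (Q := fun s' => s'.real a 0 = 0) le_rfl
    (by simp [IExpr.eval, RExpr.eval])) (T₂ := 4 * n + 3) ?_ (by omega)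
  intro s₁ hA₁ h₁
  have hsub : ∀ s', Agree (RealRAM.forLoop v N (.rset a (.const 0)
      (.add (.load a (.const 0)) e))) s₁ s' → Agree (RealRAM.accum v a N e) s s' := fun s' h =>
    (hA₁.mono (by simp [Cmd.wi]) (by simp [Cmd.wr, RealRAM.accum])).trans
      (h.mono (by simp [RealRAM.accum, Cmd.wi])
        (by simp only [RealRAM.accum, Cmd.wr, List.mem_append]; tauto))
  refine Runs.forLoop (fun k s' => s'.real a 0 = ∑ l ∈ Finset.range k, f l) n 1
    (by simp [Cmd.wi]) (fun s' h => hN s' (hsub s' h)) (fun _ _ _ h => h) (by simp [h₁]) ?_ ?_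
    (by omega)
  · intro k s' hk hA hk' h
    refine Runs.rset le_rfl ?_
    simp [IExpr.eval, RExpr.eval, h, he k hk s' (hsub s' hA) hk', Finset.sum_range_succ]
  · exact fun s' hA h => hQ s' (hsub s' hA) h

end RealRAM

/-! ### The program

The memory has the following layout; a variable is cell `0` of an array.

Integer arrays: `0` holds `n`, `d`; `1` is `m`, the padded dimension; `2` is `m / 2`; `3` and `4`
hold the offsets `j * m` and `j * d` of the rows; `5` holds the classes `0` and `1` of the labels
`+1` and `-1`; `6` holds the random signs; `10`, `11`, `13`, `16`, `18`, `19` are counters; `14` is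
the random coordinate; `15` is `1` after the output; `17` is a scratch cell.

Real arrays, besides input and output (`0` to `5`): `6` holds the normalized points, `7` their
scale, `10` the rotated points; `13` is `ν`; `20` is the guess `q`; `21` to `31` are the parameters
of the level; `40` and `41` hold the current and the previous weights, `42` the dual vector that
determines the weights, `43` the inner products of the rows with the primal vector, `44` the primal
vector; `45` holds the normalization constants of the classes and `46` is the width of their
bracket; `61` holds the vector `∑ j, η j • A j`, `62` is its squared length, `63` holds its inner
products with the rows, `64` the thresholds of the classes, `65` their excess over those products,
`67` the dual bounds. The other arrays are scratch space. -/

namespace SPDC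

open RealRAM

/-- Cell `0` of an integer array. -/
abbrev iv (a : ℕ) : IExpr := .load a (.const 0)
/-- Cell `0` of a real array. -/
abbrev rv (a : ℕ) : RExpr := .load a (.const 0)
/-- The real number `k`. -/
abbrev rc (k : ℕ) : RExpr := .cast (.const k)
/-- Cell `k` of the real array `a`, where `k` is the value of cell `0` of the integer array `v`. -/
abbrev rat (a v : ℕ) : RExpr := .load a (iv v)
/-- The class of the point with the index in the integer variable `v`. -/
abbrev cls (v : ℕ) : IExpr := .load 5 (iv v)
/-- The number of points. -/
abbrev eN : IExpr := iv 0
/-- The dimension. -/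
abbrev eD : IExpr := .load 0 (.const 1)
/-- The real variable `a` gets the value `e`. -/
abbrev setv (a : ℕ) (e : RExpr) : Cmd := .rset a (.const 0) e
/-- A program without effect on the result: it writes to a scratch cell. -/
abbrev skip : Cmd := .iset 17 (.const 0) (.const 0)

/-- `dst[j] := min ν (exp (z[j] + lo[class j] + g))`. -/
def capExp (g : RExpr) (dst : ℕ) : Cmd :=
  forLoop 10 eN (.seq (setv 47 (.exp (.add (.add (rat 42 10) (.load 45 (cls 10))) g)))
    (.ite (.rlt (rv 13) (rv 47)) (.rset dst (iv 10) (rv 13)) (.rset dst (iv 10) (rv 47))))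

/-- `dst[k]` becomes the sum of `src[j]` over class `k`. -/
def classSum (src dst : ℕ) : Cmd :=
  .seq (.rset dst (.const 0) (rc 0)) (.seq (.rset dst (.const 1) (rc 0))
    (forLoop 10 eN (.rset dst (cls 10) (.add (.load dst (cls 10)) (rat src 10)))))

/-- One bisection step for the normalization constants of the two classes. -/
def bisect : Cmd :=
  .seq (setv 46 (.div (rv 46) (rc 2))) (.seq (capExp (rv 46) 49) (.seq (classSum 49 48)
    (.seq (.ite (.rlt (.load 48 (.const 0)) (rc 1))
        (.rset 45 (.const 0) (.add (.load 45 (.const 0)) (rv 46))) skip)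
      (.ite (.rlt (.load 48 (.const 1)) (rc 1))
        (.rset 45 (.const 1) (.add (.load 45 (.const 1)) (rv 46))) skip))))

/-- The weights `min ν (exp (z[j] + lo[class j]))`, normalized in both classes: bisection for `lo`,
and interpolation between the last two brackets. -/
def softmax : Cmd :=
  .seq (.rset 45 (.const 0) (.sub (rc 0) (.add (rv 29) (.log (.cast eN)))))
  (.seq (.rset 45 (.const 1) (.sub (rc 0) (.add (rv 29) (.log (.cast eN)))))
  (.seq (setv 46 (.add (.add (rv 29) (rv 29)) (.log (.cast eN))))
  (.seq (.loop (.rlt (rv 28) (rv 46)) bisect)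
  (.seq (capExp (rc 0) 49) (.seq (classSum 49 48)
  (.seq (capExp (rv 46) 50) (.seq (classSum 50 51)
  (fill 10 40 eN (iv 10) (.add (rat 49 10)
    (.mul (.div (.sub (rc 1) (.load 48 (cls 10)))
      (.sub (.load 51 (cls 10)) (.load 48 (cls 10)))) (.sub (rat 50 10) (rat 49 10))))))))))))

/-- A random index below `m`, in the integer variable `14`. -/
def sample : Cmd :=
  .seq (.iset 14 (.const 0) (.const 0)) (.seq (.iset 13 (.const 0) (.const 1))
    (.loop (.ilt (iv 13) (iv 1)) (.seq (.flip 17 (.const 0))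
      (.seq (.iset 14 (.const 0) (.add (.add (iv 14) (iv 14)) (iv 17)))
        (.iset 13 (.const 0) (.add (iv 13) (iv 13)))))))

/-- The entry of the rotated matrix in row `v` and column `i`, the random index. -/
abbrev matEntry (v : ℕ) : RExpr := .load 10 (.add (.load 3 (iv v)) (iv 14))

/-- The update of the primal coordinate with the random index, and the dual step. -/
def coordStep : Cmd :=
  .seq (accum 10 52 eN (.mul (matEntry 10)
    (.add (rat 40 10) (.mul (rv 26) (.sub (rat 40 10) (rat 41 10))))))
  (.seq (setv 53 (.div (.add (rat 44 14) (.mul (rv 24) (rv 52))) (.add (rc 1) (rv 24))))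
  (.seq (.ite (.rlt (rc 2) (rv 53)) (setv 53 (rc 2)) skip)
  (.seq (.ite (.rlt (rv 53) (.sub (rc 0) (rc 2))) (setv 53 (.sub (rc 0) (rc 2))) skip)
  (.seq (setv 54 (.sub (rv 53) (rat 44 14)))
  (.seq (fill 10 42 eN (iv 10) (.div (.sub (rat 42 10) (.mul (rv 25) (.add (rat 43 10)
      (.mul (.mul (.cast (iv 1)) (rv 54)) (matEntry 10))))) (.add (rc 1) (.mul (rv 25) (rv 22)))))
  (.seq (fill 10 43 eN (iv 10) (.add (rat 43 10) (.mul (rv 54) (matEntry 10))))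
  (.seq (.rset 44 (iv 14) (rv 53))
  (.seq (fill 10 41 eN (iv 10) (rat 40 10)) softmax))))))))

/-- The parameters of the level with guess `q`. -/
def params : Cmd :=
  .seq (setv 30 (.exp (.div (.log (.cast (iv 1))) (rc 2))))
  (.seq (setv 21 (.log (.div (.mul (.mul (rc 16) (.cast eN)) (.cast (iv 1))) (.mul (rv 20) (rv 20)))))
  (.seq (setv 22 (.div (.mul (rv 20) (rv 20)) (.mul (rc 64) (rv 21))))
  (.seq (setv 23 (.div (.mul (.mul (rc 16) (rv 21)) (rv 30)) (rv 20)))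
  (.seq (setv 24 (.div (.cast (iv 1)) (.mul (rc 2) (.add (.cast (iv 1)) (.mul (rc 4) (rv 23))))))
  (.seq (setv 25 (.div (rc 1) (.mul (.mul (rc 96) (rv 24)) (rv 21))))
  (.seq (setv 31 (.add (.mul (rc 2) (.cast (iv 1))) (.mul (rc 4) (rv 23))))
  (.seq (setv 26 (.sub (rc 1) (.div (rc 1) (rv 31))))
  (.seq (setv 27 (.mul (.mul (rc 13) (rv 21)) (rv 31)))
  (.seq (setv 28 (.exp (.sub (rc 0) (.mul (rc 18) (rv 21)))))
  (setv 29 (.div (.mul (rc 6) (.cast (iv 1))) (rv 22))))))))))))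

/-- The start of a level: zero vectors, and the weights that belong to them. -/
def levelInit : Cmd :=
  .seq (fill 10 42 eN (iv 10) (rc 0)) (.seq (fill 10 43 eN (iv 10) (rc 0))
  (.seq (fill 10 44 (iv 1) (iv 10) (rc 0)) (.seq softmax (fill 10 41 eN (iv 10) (rat 40 10)))))

/-- The stochastic primal-dual iteration. -/
def iterate : Cmd :=
  .seq (.iset 16 (.const 0) (.const 0))
    (.loop (.rlt (.cast (iv 16)) (rv 27)) (.seq (.seq sample coordStep)
      (.iset 16 (.const 0) (.add (iv 16) (.const 1)))))

/-- Entry `k` of row `j` of the centred data. -/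
abbrev datEntry (vj vk : ℕ) : RExpr := .load 6 (.add (.load 4 (iv vj)) (iv vk))

/-- The dual bounds for the current weights `η`. The thresholds come from one more normalization:
they are the multipliers of the weights that maximize the regularized linear form given by the inner
products of the rows with `∑ j, η j • A j`. -/
def certificate : Cmd :=
  .seq (forLoop 11 eD (.seq (accum 10 60 eN (.mul (datEntry 10 11) (rat 40 10)))
    (.rset 61 (iv 11) (rv 60))))
  (.seq (accum 11 62 eD (.mul (rat 61 11) (rat 61 11)))
  (.seq (forLoop 10 eN (.seq (accum 11 60 eD (.mul (rat 61 11) (datEntry 10 11)))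
    (.rset 63 (iv 10) (rv 60))))
  (.seq (fill 10 42 eN (iv 10) (.div (.sub (rc 0) (rat 63 10)) (rv 22)))
  (.seq softmax
  (.seq (.rset 64 (.const 0) (.mul (rv 22) (.sub (.load 45 (.const 0)) (.log (rv 13)))))
  (.seq (.rset 64 (.const 1) (.mul (rv 22) (.sub (.load 45 (.const 1)) (.log (rv 13)))))
  (.seq (forLoop 10 eN (.ite (.rlt (rat 63 10) (.load 64 (cls 10)))
    (.rset 65 (iv 10) (.sub (.load 64 (cls 10)) (rat 63 10))) (.rset 65 (iv 10) (rc 0))))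
  (.seq (classSum 65 66)
  (.seq (.rset 67 (.const 0)
    (.sub (.load 64 (.const 0)) (.mul (rv 13) (.load 66 (.const 0)))))
  (.rset 67 (.const 1)
    (.sub (.load 64 (.const 1)) (.mul (rv 13) (.load 66 (.const 1))))))))))))))

/-- One level: the guess `q ^ 2` for `ε β`, with `q` half of its previous value, the iteration, and
the test whether the result is accurate. -/
def level (out : Cmd) : Cmd :=
  .seq (setv 20 (.div (rv 20) (rc 2))) (.seq params (.seq levelInit (.seq iterate (.seq certificate
    (.ite (.rlt (.add (.load 67 (.const 0)) (.load 67 (.const 1)))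
        (.mul (.sub (rc 1) (.div (rv 2) (rc 2))) (rv 62)))
      skip (.seq out (.iset 15 (.const 0) (.const 1))))))))

/-- `m` is the least power of two that is at least `d`, and variable `2` holds `m / 2`. -/
def powerOfTwo : Cmd :=
  .seq (.iset 1 (.const 0) (.const 1)) (.loop (.ilt (iv 1) eD)
    (.seq (.iset 2 (.const 0) (iv 1)) (.iset 1 (.const 0) (.add (iv 1) (iv 1)))))

/-- Row offsets and classes. -/
def tables : Cmd :=
  .seq (.iset 18 (.const 0) (.const 0)) (.seq (.iset 19 (.const 0) (.const 0))
  (forLoop 10 eN (.seq (.iset 3 (iv 10) (iv 18)) (.seq (.iset 4 (iv 10) (iv 19))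
    (.seq (.iset 18 (.const 0) (.add (iv 18) (iv 1))) (.seq (.iset 19 (.const 0) (.add (iv 19) eD))
    (.ite (.rlt (rc 0) (rat 1 10)) (.iset 5 (iv 10) (.const 0)) (.iset 5 (iv 10) (.const 1)))))))))

/-- Translation by the first point, multiplication with the labels, and scaling by the largest
distance from the first point; its root is taken by means of `exp` and `log`. -/
def center : Cmd :=
  .seq (forLoop 10 eN (fill 11 8 eD (.add (.load 4 (iv 10)) (iv 11))
    (.mul (rat 1 10) (.sub (.load 0 (.add (.load 4 (iv 10)) (iv 11))) (rat 0 11)))))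
  (.seq (setv 9 (rc 0))
  (.seq (forLoop 10 eN (.seq (accum 11 60 eD (.mul (.load 8 (.add (.load 4 (iv 10)) (iv 11)))
      (.load 8 (.add (.load 4 (iv 10)) (iv 11)))))
    (.ite (.rlt (rv 9) (rv 60)) (setv 9 (rv 60)) skip)))
  (.seq (setv 7 (.exp (.div (.log (rv 9)) (rc 2))))
  (forLoop 10 eN (fill 11 6 eD (.add (.load 4 (iv 10)) (iv 11))
    (.div (.load 8 (.add (.load 4 (iv 10)) (iv 11))) (rv 7)))))))

/-- Random signs. -/
def signs : Cmd := forLoop 10 (iv 1) (.flip 6 (iv 10))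

/-- One stage of the Walsh-Hadamard transform. -/
def stageCmd : Cmd :=
  .seq (forLoop 11 (iv 1) (.ite (.ilt (iv 11) (iv 2))
    (.rset 56 (iv 11) (.add (.load 55 (.add (iv 11) (iv 11)))
      (.load 55 (.add (.add (iv 11) (iv 11)) (.const 1)))))
    (.rset 56 (iv 11) (.sub (.load 55 (.add (.sub (iv 11) (iv 2)) (.sub (iv 11) (iv 2))))
      (.load 55 (.add (.add (.sub (iv 11) (iv 2)) (.sub (iv 11) (iv 2))) (.const 1)))))))
  (fill 11 55 (iv 1) (iv 11) (rat 56 11))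

/-- The rotation of the rows of the data. -/
def rotate : Cmd :=
  .seq (setv 57 (.exp (.div (.log (.cast (iv 1))) (rc 2))))
  (forLoop 10 eN
    (.seq (forLoop 11 (iv 1) (.ite (.ilt (iv 11) eD)
      (.rset 55 (iv 11) (.div (.mul (.sub (rc 1) (.mul (rc 2) (.cast (.load 6 (iv 11)))))
        (datEntry 10 11)) (rv 57)))
      (.rset 55 (iv 11) (rc 0))))
    (.seq (.iset 13 (.const 0) (.const 1))
    (.seq (.loop (.ilt (iv 13) (iv 1))
      (.seq stageCmd (.iset 13 (.const 0) (.add (iv 13) (iv 13)))))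
    (fill 11 10 (iv 1) (.add (.load 3 (iv 10)) (iv 11)) (rat 55 11))))))

/-- The program, up to the choice of the bound `ν` of the weights and of the output. -/
def prog (setNu out : Cmd) : Cmd :=
  .seq setNu (.seq powerOfTwo (.seq tables (.seq center (.seq signs (.seq rotate
    (.seq (setv 20 (rc 1)) (.loop (.ilt (iv 15) (.const 1)) (level out))))))))

/-- Cell `68` becomes the inner product of the normal vector and the first point. -/
def offsetSum : Cmd := accum 11 68 eD (.mul (rat 61 11) (rat 0 11))

/-- The output for the hard-margin problem. -/
def hmOut : Cmd :=
  .seq offsetSum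
  (.seq (setv 69 (.add (.load 67 (.const 0)) (.load 67 (.const 1))))
  (.seq (setv 70 (.div (rc 2) (.mul (rv 69) (rv 7))))
  (.seq (fill 11 3 eD (iv 11) (.mul (rv 70) (rat 61 11)))
  (setv 4 (.add (.mul (rv 70) (rv 68))
    (.div (.sub (.load 67 (.const 0)) (.load 67 (.const 1))) (rv 69)))))))

/-- The output for the `ν`-SVM. -/
def nuOut : Cmd :=
  .seq offsetSum
  (.seq (fill 11 3 eD (iv 11) (.mul (.div (rv 7) (rc 2)) (rat 61 11)))
  (.seq (.rset 4 (.const 0) (.add (.mul (.div (rv 7) (rc 2)) (rv 68))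
    (.mul (.div (.mul (rv 7) (rv 7)) (rc 4)) (.sub (.load 64 (.const 0)) (.load 64 (.const 1))))))
  (.seq (.rset 4 (.const 1)
    (.mul (.div (.mul (rv 7) (rv 7)) (rc 4)) (.add (.load 64 (.const 0)) (.load 64 (.const 1)))))
  (fill 10 5 eN (iv 10) (.mul (.div (.mul (rv 7) (rv 7)) (rc 2)) (rat 65 10))))))

end SPDC

/-! ### The normalization of the weights -/

namespace RealRAM

/-- The program writes only to integer arrays from `i` on and to real arrays from `r` on. -/
abbrev Cmd.Above (c : Cmd) (i r : ℕ) : Prop := (∀ a ∈ c.wi, i ≤ a) ∧ ∀ a ∈ c.wr, r ≤ a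

lemma Agree.int_of_lt {c : Cmd} {s s' : State} {i r a : ℕ} (h : Agree c s s') (hc : c.Above i r)
    (ha : a < i) : s'.int a = s.int a := h.1 a fun h' => (hc.1 a h').not_gt ha

lemma Agree.real_of_lt {c : Cmd} {s s' : State} {i r a : ℕ} (h : Agree c s s') (hc : c.Above i r)
    (ha : a < r) : s'.real a = s.real a := h.2 a fun h' => (hc.2 a h').not_gt ha

end RealRAM

namespace SPDC

open Finset RealRAM

/-- A normalized instance: numbers of points, of coordinates and of rotated coordinates, weight
bound, accuracy, scale, classes, rows, rotated rows, and origin. -/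
structure Inst where
  n : ℕ
  d : ℕ
  m : ℕ
  ν : ℝ
  ε : ℝ
  D : ℝ
  c : ℕ → ℕ
  A : ℕ → ℕ → ℝ
  M : ℕ → ℕ → ℝ
  x0 : ℕ → ℝ

namespace Inst

/-- The properties of an instance that the program establishes whatever the coins show; `gram` says
that the rotation preserves inner products. -/
structure Valid (I : Inst) : Prop where
  hn : 2 ≤ I.n
  hm : 1 ≤ I.m
  ν_pos : 0 < I.ν
  ν_le : I.ν ≤ 1
  ε_pos : 0 < I.ε
  c_lt : ∀ j < I.n, I.c j < 2
  nonempty : (capSimplex I.n I.ν I.c).Nonempty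
  row : ∀ j < I.n, ∑ k ∈ range I.d, I.A j k ^ 2 ≤ 1
  gram : ∀ i < I.n, ∀ j < I.n, ∑ k ∈ range I.m, I.M i k * I.M j k =
    ∑ k ∈ range I.d, I.A i k * I.A j k

/-- The instance is stored in memory. -/
structure Stored (I : Inst) (s : State) : Prop where
  n : s.int 0 0 = I.n
  d : s.int 0 1 = I.d
  m : s.int 1 0 = I.m
  offM : ∀ j < I.n, s.int 3 j = j * I.m
  offD : ∀ j < I.n, s.int 4 j = j * I.d
  c : ∀ j < I.n, s.int 5 j = I.c j
  x0 : ∀ k < I.d, s.real 0 k = I.x0 k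
  ε : s.real 2 0 = I.ε
  A : ∀ j < I.n, ∀ k < I.d, s.real 6 (j * I.d + k) = I.A j k
  D : s.real 7 0 = I.D
  M : ∀ j < I.n, ∀ k < I.m, s.real 10 (j * I.m + k) = I.M j k
  ν : s.real 13 0 = I.ν

lemma Stored.agree {I : Inst} {s s' : State} {p : Cmd} (h : I.Stored s) (hA : Agree p s s')
    (hp : p.Above 10 20) : I.Stored s' := by
  constructor
  all_goals
    first
    | rw [hA.int_of_lt hp (by norm_num)]
    | rw [hA.real_of_lt hp (by norm_num)]
  exacts [h.n, h.d, h.m, h.offM, h.offD, h.c, h.x0, h.ε, h.A, h.D, h.M, h.ν]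

/-- The instance and the parameters of the level with guess `q` are stored in memory. -/
structure AtLevel (I : Inst) (q : ℝ) (s : State) : Prop extends I.Stored s where
  guess : s.real 20 0 = q
  γ : s.real 22 0 = pG I.n I.m q
  σ : s.real 24 0 = pσ I.n I.m q
  τ : s.real 25 0 = pτ I.n I.m q
  θ : s.real 26 0 = pθ I.n I.m q
  N : s.real 27 0 = pN I.n I.m q
  δ : s.real 28 0 = pδ I.n I.m q
  Z : s.real 29 0 = pZ I.n I.m q

lemma AtLevel.agree {I : Inst} {q : ℝ} {s s' : State} {p : Cmd} (h : I.AtLevel q s)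
    (hA : Agree p s s') (hp : p.Above 10 40) : I.AtLevel q s' := by
  refine ⟨h.toStored.agree hA ⟨hp.1, fun a ha => le_trans (by norm_num) (hp.2 a ha)⟩,
    ?_, ?_, ?_, ?_, ?_, ?_, ?_, ?_⟩
  all_goals rw [hA.real_of_lt hp (by norm_num)]
  exacts [h.guess, h.γ, h.σ, h.τ, h.θ, h.N, h.δ, h.Z]

end Inst

/-- The sum of `f` over class `k`. -/
def csum (n : ℕ) (c : ℕ → ℕ) (f : ℕ → ℝ) (k : ℕ) : ℝ :=
  ∑ j ∈ range n, if c j = k then f j else 0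

section

variable {n : ℕ} {ν δ : ℝ} {c : ℕ → ℕ} {u z lo η : ℕ → ℝ}

lemma csum_congr {f g : ℕ → ℝ} {k : ℕ} (h : ∀ j < n, c j = k → f j = g j) :
    csum n c f k = csum n c g k :=
  sum_congr rfl fun j hj => by split_ifs with h'; exacts [h j (mem_range.1 hj) h', rfl]

lemma csum_le_csum {f g : ℕ → ℝ} {k : ℕ} (h : ∀ j < n, c j = k → f j ≤ g j) :
    csum n c f k ≤ csum n c g k :=
  sum_le_sum fun j hj => by split_ifs with h'; exacts [h j (mem_range.1 hj) h', le_rfl]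

/-- Interpolation between two brackets for the normalization constants. -/
lemma soft_of_bracket {g : ℝ} {P Q : ℕ → ℝ} (hν : 0 < ν) (hc : ∀ j < n, c j < 2) (hg : 0 ≤ g)
    (hgδ : g ≤ δ) (hP : ∀ j < n, P j = min ν (Real.exp (z j + lo (c j))))
    (hQ : ∀ j < n, Q j = min ν (Real.exp (z j + lo (c j) + g)))
    (hS : ∀ k < 2, csum n c P k ≤ 1) (hH : ∀ k < 2, 1 ≤ csum n c Q k)
    (hη : ∀ j < n, η j = P j + (1 - csum n c P (c j)) / (csum n c Q (c j) - csum n c P (c j)) *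
      (Q j - P j)) : Soft n ν c z lo δ η := by
  have hPQ : ∀ j < n, P j ≤ Q j := fun j hj => by
    rw [hP j hj, hQ j hj]
    exact min_le_min_left _ (Real.exp_le_exp.2 (by linarith))
  have hP0 : ∀ j < n, 0 < P j := fun j hj => by
    rw [hP j hj]; exact lt_min hν (Real.exp_pos _)
  have hQν : ∀ j < n, Q j ≤ ν := fun j hj => by rw [hQ j hj]; exact min_le_left _ _
  have ht : ∀ k < 2, 0 ≤ (1 - csum n c P k) / (csum n c Q k - csum n c P k) ∧
      (1 - csum n c P k) / (csum n c Q k - csum n c P k) ≤ 1 := fun k hk =>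
    ⟨div_nonneg (by linarith [hS k hk]) (by linarith [hS k hk, hH k hk]),
      div_le_one_of_le₀ (by linarith [hH k hk]) (by linarith [hS k hk, hH k hk])⟩
  have hlow : ∀ j < n, P j ≤ η j := fun j hj => by
    rw [hη j hj]
    linarith [mul_nonneg (ht _ (hc j hj)).1 (sub_nonneg.2 (hPQ j hj))]
  have hup : ∀ j < n, η j ≤ Q j := fun j hj => by
    rw [hη j hj]
    linarith [mul_le_mul_of_nonneg_right (ht _ (hc j hj)).2 (sub_nonneg.2 (hPQ j hj))]
  refine ⟨⟨fun j hj => ⟨(hP0 j hj).le.trans (hlow j hj), (hup j hj).trans (hQν j hj)⟩,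
    fun k hk => ?_⟩, fun j hj => (hP0 j hj).trans_le (hlow j hj), fun j hj => ?_⟩
  · change csum n c η k = 1
    have h1 : csum n c η k = csum n c P k + (1 - csum n c P k) /
        (csum n c Q k - csum n c P k) * (csum n c Q k - csum n c P k) := by
      rw [csum_congr (g := fun j => P j + (1 - csum n c P k) /
        (csum n c Q k - csum n c P k) * (Q j - P j)) fun j hj hk => by rw [hη j hj, hk]]
      generalize (1 - csum n c P k) / (csum n c Q k - csum n c P k) = t
      simp only [csum]
      rw [← sum_sub_distrib, mul_sum, ← sum_add_distrib]
      exact sum_congr rfl fun j _ => by split_ifs <;> ring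
    rw [h1]
    -- If both brackets are equal to `1`, the quotient has the junk value `0`, which is right.
    rcases eq_or_ne (csum n c Q k - csum n c P k) 0 with h0 | h0
    · rw [h0]; linarith [hS k hk, hH k hk]
    · rw [div_mul_cancel₀ _ h0]; ring
  · rcases le_or_gt (Real.log ν) (z j + lo (c j)) with h | h
    · left
      refine ⟨le_antisymm ((hup j hj).trans (hQν j hj)) (le_trans ?_ (hlow j hj)), h⟩
      rw [hP j hj, min_eq_left ((Real.log_le_iff_le_exp hν).1 h)]
    · right
      refine ⟨?_, ?_, h.le⟩
      · rw [Real.le_log_iff_exp_le ((hP0 j hj).trans_le (hlow j hj))]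
        refine le_trans ?_ (hlow j hj)
        rw [hP j hj, min_eq_right ((Real.lt_log_iff_exp_lt hν).1 h).le]
      · rw [Real.log_le_iff_le_exp ((hP0 j hj).trans_le (hlow j hj))]
        refine (hup j hj).trans ?_
        rw [hQ j hj]
        exact (min_le_right _ _).trans (Real.exp_le_exp.2 (by linarith))

/-- The lower end of the initial bracket for the normalization constants. -/
lemma csum_start_le {Z : ℝ} (hn : 0 < n) (hz : ∀ j < n, |z j| ≤ Z) (k : ℕ) :
    csum n c (fun j => min ν (Real.exp (z j + -(Z + Real.log n)))) k ≤ 1 := by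
  have hn' : (0 : ℝ) < n := by exact_mod_cast hn
  have h1 : ∀ j ∈ range n, (if c j = k then min ν (Real.exp (z j + -(Z + Real.log n))) else 0) ≤
      1 / (n : ℝ) := by
    intro j hj
    have h2 : Real.exp (z j + -(Z + Real.log n)) ≤ 1 / n := by
      rw [one_div, ← Real.exp_log hn', ← Real.exp_neg, Real.exp_log hn']
      exact Real.exp_le_exp.2 (by linarith [(abs_le.1 (hz j (mem_range.1 hj))).2])
    split_ifs
    · exact (min_le_right _ _).trans h2
    · positivity
  refine (sum_le_sum h1).trans ?_
  rw [sum_const, card_range, nsmul_eq_mul, mul_one_div_cancel hn'.ne']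

/-- The upper end of the initial bracket for the normalization constants. -/
lemma le_csum_start {Z : ℝ} (hν : ν ≤ 1) (hz : ∀ j < n, |z j| ≤ Z) (hu : u ∈ capSimplex n ν c)
    {k : ℕ} (hk : k < 2) : 1 ≤ csum n c (fun j => min ν (Real.exp (z j + Z))) k := by
  rw [← hu.2 k hk]
  refine csum_le_csum fun j hj _ => (hu.1 j hj).2.trans (le_min le_rfl (hν.trans ?_))
  exact Real.one_le_exp (by linarith [(abs_le.1 (hz j hj)).1])

end

section

variable {I : Inst} {s : State} {Q : State → Prop}

lemma runs_capExp {g : RExpr} {dst T : ℕ} {G : ℝ} (hs : I.Stored s)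
    (hdst : 47 < dst)
    (hg : ∀ s', Agree (capExp g dst) s s' → g.eval s' = G)
    (hQ : ∀ s', Agree (capExp g dst) s s' →
      (∀ j < I.n, s'.real dst j = min I.ν (Real.exp (s.real 42 j + s.real 45 (I.c j) + G))) → Q s')
    (hT : 7 * I.n + 3 ≤ T) : Runs (capExp g dst) T s Q := by
  have hw : ∀ a < 47, a ∉ (capExp g dst).wr := by
    intro a ha
    simp [capExp, forLoop, Cmd.wr]
    omega
  have hab : (capExp g dst).Above 10 20 := by
    constructor
    · simp [capExp, forLoop, Cmd.wi]
    · simp [capExp, forLoop, Cmd.wr]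
      omega
  refine Runs.fillBody I.n 4 id
    (fun j => min I.ν (Real.exp (s.real 42 j + s.real 45 (I.c j) + G))) (by simp [Cmd.wi])
    (fun _ _ _ _ h => h) (fun s' h => (hs.agree h hab).n) ?_ (fun s' h1 h2 _ => hQ s' h1 h2)
    (by omega)
  intro j hj s' hA hj' _
  have hs' := hs.agree hA hab
  refine Runs.seq (Runs.rset (Q := fun s'' => s''.real 47 0 =
      Real.exp (s.real 42 j + s.real 45 (I.c j) + G)) le_rfl ?_) (T₂ := 2) ?_ le_rfl
  · simp [RExpr.eval, IExpr.eval, hj', hs'.c j hj, hA.real 42 (hw _ (by norm_num)),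
      hA.real 45 (hw _ (by norm_num)), hg s' hA]
  · intro s₁ hA₁ h₁
    have e1 : s₁.int 10 0 = j := by rw [hA₁.int 10 (by simp [Cmd.wi]), hj']
    have e2 : s₁.real 13 0 = I.ν := by rw [hA₁.real 13 (by simp [Cmd.wr]), hs'.ν]
    have e3 : s₁.real dst = s'.real dst := hA₁.real dst (by simp [Cmd.wr]; omega)
    refine Runs.ite (T := 1) (fun h => Runs.rset le_rfl ?_) (fun h => Runs.rset le_rfl ?_) le_rfl
    · simp only [BExpr.Holds, RExpr.eval, IExpr.eval, e2, h₁] at h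
      simp [RExpr.eval, IExpr.eval, e1, e2, e3, min_eq_left h.le]
    · simp only [BExpr.Holds, RExpr.eval, IExpr.eval, e2, h₁, not_lt] at h
      simp [RExpr.eval, IExpr.eval, e1, e3, h₁, min_eq_right h]

lemma runs_classSum {src dst T : ℕ} (hs : I.Stored s)
    (hsrc : src ≠ dst) (hdst : 20 ≤ dst)
    (hQ : ∀ s', Agree (classSum src dst) s s' →
      (∀ k < 2, s'.real dst k = csum I.n I.c (s.real src) k) → Q s')
    (hT : 4 * I.n + 7 ≤ T) : Runs (classSum src dst) T s Q := by
  have hab : ∀ c ∈ [Cmd.rset dst (.const 0) (rc 0), Cmd.rset dst (.const 1) (rc 0),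
    (forLoop 10 eN (.rset dst (cls 10) (.add (.load dst (cls 10)) (rat src 10))))],
    c.Above 10 20 ∧ src ∉ c.wr := by
    simp [Cmd.Above, forLoop, Cmd.wi, Cmd.wr, hsrc, hdst]
  refine Runs.seq (T₂ := 4 * I.n + 5) (Runs.rset (Q := fun s' => s'.real dst 0 = 0) le_rfl
    (by simp [RExpr.eval, IExpr.eval])) ?_ (by omega)
  intro s₁ hA₁ h₁
  refine Runs.seq (T₂ := 4 * I.n + 3) (Runs.rset
    (Q := fun s' => s'.real dst 0 = 0 ∧ s'.real dst 1 = 0) le_rfl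
    (by simp [RExpr.eval, IExpr.eval, h₁])) ?_ (by omega)
  rintro s₂ hA₂ ⟨h₂, h₂'⟩
  have hs₂ := (hs.agree hA₁ (hab _ (by simp)).1).agree hA₂ (hab _ (by simp)).1
  have hsrc₂ : s₂.real src = s.real src :=
    (hA₂.real src (hab _ (by simp)).2).trans (hA₁.real src (hab _ (by simp)).2)
  refine Runs.forLoop (fun j s' => ∀ k < 2, s'.real dst k = csum j I.c (s.real src) k) I.n 1
    (by simp [Cmd.wi]) (fun s' h => (hs₂.agree h (hab _ (by simp)).1).n) (fun _ _ _ h => h) ?_ ?_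
    ?_ (by omega)
  · intro k hk
    interval_cases k <;> simp [csum, h₂, h₂']
  · intro j s' hj hA hj' h
    refine Runs.rset le_rfl fun k hk => ?_
    have e1 : s'.int 5 j = I.c j := (hs₂.agree hA (hab _ (by simp)).1).c j hj
    have e2 : s'.real src = s.real src := (hA.real src (hab _ (by simp)).2).trans hsrc₂
    rcases eq_or_ne (I.c j) k with rfl | hne
    · simp [RExpr.eval, IExpr.eval, hj', e1, e2, h _ hk, csum, sum_range_succ]
    · simp [IExpr.eval, hj', e1, h _ hk, csum, sum_range_succ, hne, Function.update_of_ne hne.symm]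
  · intro s' hA h
    refine hQ s' ?_ h
    refine ((hA₁.mono ?_ ?_).trans (hA₂.mono ?_ ?_)).trans (hA.mono ?_ ?_) <;>
      simp [classSum, Cmd.wi, Cmd.wr, forLoop]

end

end SPDC

namespace SPDC

open Finset RealRAM

/-- The normalization constants `lo` and `lo + g` of the two classes give total weights at most
`1` and at least `1`. -/
def Bracket (I : Inst) (z lo : ℕ → ℝ) (g : ℝ) : Prop :=
  ∀ k < 2, csum I.n I.c (fun j => min I.ν (Real.exp (z j + lo k))) k ≤ 1 ∧
    1 ≤ csum I.n I.c (fun j => min I.ν (Real.exp (z j + (lo k + g)))) k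

variable {I : Inst} {s : State} {Q : State → Prop} {q : ℝ}

lemma runs_bisect {T : ℕ} {z : ℕ → ℝ} {g : ℝ} (hs : I.Stored s) (hz : s.real 42 = z)
    (hg : s.real 46 0 = g) (hB : Bracket I z (s.real 45) g)
    (hQ : ∀ s', Agree bisect s s' → s'.real 46 0 = g / 2 → Bracket I z (s'.real 45) (g / 2) → Q s')
    (hT : 11 * I.n + 20 ≤ T) : Runs bisect T s Q := by
  suffices h : Runs bisect (11 * I.n + 20) s fun s' =>
      s'.real 46 0 = g / 2 ∧ Bracket I z (s'.real 45) (g / 2) from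
    h.frame.imp hT fun s' h => hQ s' h.1 h.2.1 h.2.2
  set lo := s.real 45 with hlo
  refine Runs.seq (Runs.rset (Q := fun s' => s'.real 46 0 = g / 2) le_rfl
    (by simp [RExpr.eval, IExpr.eval, hg])) (T₂ := 11 * I.n + 18) ?_ (by omega)
  intro s₁ hA₁ h₁
  have hs₁ := hs.agree hA₁ (by decide)
  have hz₁ : s₁.real 42 = z := by rw [hA₁.real 42 (by decide), hz]
  have hl₁ : s₁.real 45 = lo := by rw [hA₁.real 45 (by decide)]
  refine Runs.seq (T₁ := 7 * I.n + 3) (T₂ := 4 * I.n + 14) (Q₁ := fun s' => ∀ j < I.n,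
    s'.real 49 j = min I.ν (Real.exp (z j + lo (I.c j) + g / 2))) (runs_capExp (G := g / 2) hs₁
      (by norm_num) (fun s' hA => ?_) (fun s' _ h => by rwa [hz₁, hl₁] at h) le_rfl) ?_ (by omega)
  · simp [RExpr.eval, IExpr.eval, hA.real 46 (by decide), h₁]
  intro s₂ hA₂ h₂
  have hs₂ := hs₁.agree hA₂ (by decide)
  have hl₂ : s₂.real 45 = lo := by rw [hA₂.real 45 (by decide), hl₁]
  have hg₂ : s₂.real 46 0 = g / 2 := by rw [hA₂.real 46 (by decide), h₁]
  refine Runs.seq (T₁ := 4 * I.n + 7) (T₂ := 6) (Q₁ := fun s' => ∀ k < 2, s'.real 48 k =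
    csum I.n I.c (fun j => min I.ν (Real.exp (z j + (lo k + g / 2)))) k)
    (runs_classSum hs₂ (by norm_num) (by norm_num) (fun s' _ h k hk => ?_) le_rfl) ?_ (by omega)
  · rw [h k hk]
    exact csum_congr fun j hj hj' => by rw [h₂ j hj, hj', add_assoc]
  intro s₃ hA₃ h₃
  have hl₃ : s₃.real 45 = lo := by rw [hA₃.real 45 (by decide), hl₂]
  have hg₃ : s₃.real 46 0 = g / 2 := by rw [hA₃.real 46 (by decide), hg₂]
  have key : ∀ k < 2, ∀ t : ℝ, (csum I.n I.c (fun j => min I.ν (Real.exp (z j + (lo k + g / 2)))) k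
      < 1 → t = lo k + g / 2) → (¬ csum I.n I.c
      (fun j => min I.ν (Real.exp (z j + (lo k + g / 2)))) k < 1 → t = lo k) →
      csum I.n I.c (fun j => min I.ν (Real.exp (z j + t))) k ≤ 1 ∧
        1 ≤ csum I.n I.c (fun j => min I.ν (Real.exp (z j + (t + g / 2)))) k := by
    intro k hk t h h'
    by_cases hlt : csum I.n I.c (fun j => min I.ν (Real.exp (z j + (lo k + g / 2)))) k < 1
    · rw [h hlt]
      refine ⟨hlt.le, ?_⟩
      rw [show lo k + g / 2 + g / 2 = lo k + g by ring]
      exact (hB k hk).2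
    · rw [h' hlt]
      exact ⟨(hB k hk).1, not_lt.1 hlt⟩
  refine Runs.seq (T₁ := 2) (T₂ := 2) (Q₁ := fun s' => s'.real 45 1 = lo 1 ∧
      csum I.n I.c (fun j => min I.ν (Real.exp (z j + s'.real 45 0))) 0 ≤ 1 ∧
      1 ≤ csum I.n I.c (fun j => min I.ν (Real.exp (z j + (s'.real 45 0 + g / 2)))) 0)
    (Runs.ite (T := 1) (fun h => Runs.rset le_rfl ?_) (fun h => Runs.iset le_rfl ?_) le_rfl) ?_
    (by norm_num)
  · simp only [BExpr.Holds, RExpr.eval, IExpr.eval, h₃ 0 two_pos, Nat.cast_one] at h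
    refine ⟨by simp [IExpr.eval, hl₃], key 0 two_pos _ (fun _ => ?_) fun h' => absurd h h'⟩
    simp [RExpr.eval, IExpr.eval, hl₃, hg₃]
  · simp only [BExpr.Holds, RExpr.eval, IExpr.eval, h₃ 0 two_pos, Nat.cast_one] at h
    refine ⟨by simp [hl₃], key 0 two_pos _ (fun h' => absurd h' h) fun _ => by simp [hl₃]⟩
  rintro s₄ hA₄ ⟨h₄, h₄'⟩
  have hg₄ : s₄.real 46 0 = g / 2 := by rw [hA₄.real 46 (by decide), hg₃]
  have h₄₈ : s₄.real 48 = s₃.real 48 := hA₄.real 48 (by decide)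
  refine Runs.ite (T := 1) (fun h => Runs.rset le_rfl ?_) (fun h => Runs.iset le_rfl ?_) le_rfl
  · simp only [BExpr.Holds, RExpr.eval, IExpr.eval, h₄₈, h₃ 1 one_lt_two, Nat.cast_one] at h
    refine ⟨by simp [writeReal_of_ne, hg₄], fun k hk => ?_⟩
    interval_cases k
    · simpa [IExpr.eval] using h₄'
    · refine key 1 one_lt_two _ (fun _ => ?_) fun h' => absurd h h'
      simp [RExpr.eval, IExpr.eval, h₄, hg₄]
  · simp only [BExpr.Holds, RExpr.eval, IExpr.eval, h₄₈, h₃ 1 one_lt_two, Nat.cast_one] at h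
    refine ⟨by simp [hg₄], fun k hk => ?_⟩
    interval_cases k
    · simpa using h₄'
    · exact key 1 one_lt_two _ (fun h' => absurd h' h) fun _ => by simp [h₄]

/-- A bound for the running time of the normalization with `K` bisection steps. -/
def softT (n K : ℕ) : ℕ := (K + 2) * (11 * n + 21) + 4 * n + 24

/-- The normalization makes the weights in array `40` an approximate maximizer for the dual vector
in array `42`. -/
lemma runs_softmax {T K : ℕ} (hI : I.Valid) (hs : I.AtLevel q s) (hq : Level I.n I.m q)
    (hz : ∀ j < I.n, |s.real 42 j| ≤ pZ I.n I.m q)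
    (hK : (2 * pZ I.n I.m q + Real.log I.n) / 2 ^ K ≤ pδ I.n I.m q)
    (hQ : ∀ s', Agree softmax s s' →
      Soft I.n I.ν I.c (s.real 42) (s'.real 45) (pδ I.n I.m q) (s'.real 40) → Q s')
    (hT : softT I.n K ≤ T) : Runs softmax T s Q := by
  suffices h : Runs softmax (softT I.n K) s fun s' =>
      Soft I.n I.ν I.c (s.real 42) (s'.real 45) (pδ I.n I.m q) (s'.real 40) from
    h.frame.imp hT fun s' h => hQ s' h.1 h.2
  unfold softT
  set z := s.real 42 with hz0
  set Z := pZ I.n I.m q with hZ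
  set δ := pδ I.n I.m q with hδ
  classical
  have hKex : ∃ K : ℕ, (2 * Z + Real.log I.n) / 2 ^ K ≤ δ := ⟨K, hK⟩
  set K₀ := Nat.find hKex with hK₀
  have hK₀K : K₀ ≤ K := Nat.find_min' hKex hK
  have hg0 : 0 ≤ 2 * Z + Real.log I.n := by
    have := hq.pZ_pos
    have := Real.log_nonneg (by linarith [hq.one_le_n] : (1 : ℝ) ≤ I.n)
    positivity
  have hKiff : ∀ k, k ≤ K₀ → (δ < (2 * Z + Real.log I.n) / 2 ^ k ↔ k < K₀) := by
    intro k hk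
    constructor
    · intro h
      refine lt_of_le_of_ne hk fun h' => ?_
      rw [h'] at h
      exact h.not_ge (Nat.find_spec hKex)
    · exact fun h => not_le.1 (Nat.find_min hKex h)
  have hTm : K₀ * (11 * I.n + 21) ≤ K * (11 * I.n + 21) := Nat.mul_le_mul_right _ hK₀K
  have hTe : (K + 2) * (11 * I.n + 21) = K * (11 * I.n + 21) + 22 * I.n + 42 := by ring
  refine Runs.seq (Runs.rset (Q := fun s' => s'.real 45 0 = -(Z + Real.log I.n)) (T := 1) le_rfl
    ?_) (T₂ := K * (11 * I.n + 21) + 26 * I.n + 60) ?_ (by omega)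
  · simp [RExpr.eval, IExpr.eval, hs.Z, hs.n, hZ]
  intro s₁ hA₁ h₁
  have hs₁ := hs.agree hA₁ (by decide)
  refine Runs.seq (Runs.rset (Q := fun s' => s'.real 45 0 = -(Z + Real.log I.n) ∧
    s'.real 45 1 = -(Z + Real.log I.n)) (T := 1) le_rfl ?_)
    (T₂ := K * (11 * I.n + 21) + 26 * I.n + 58) ?_ (by omega)
  · simp [RExpr.eval, IExpr.eval, hs₁.Z, hs₁.n, hZ, h₁]
  intro s₂ hA₂ h₂
  have hs₂ := hs₁.agree hA₂ (by decide)
  refine Runs.seq (Runs.rset (Q := fun s' => s'.real 46 0 = 2 * Z + Real.log I.n) (T := 1) le_rfl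
    ?_) (T₂ := K * (11 * I.n + 21) + 26 * I.n + 56) ?_ (by omega)
  · simp [RExpr.eval, IExpr.eval, hs₂.Z, hs₂.n, hZ]; ring
  intro s₃ hA₃ h₃
  have hs₃ := hs₂.agree hA₃ (by decide)
  have hz₃ : s₃.real 42 = z := by
    rw [hA₃.real 42 (by decide), hA₂.real 42 (by decide), hA₁.real 42 (by decide)]
  have hl₃ : s₃.real 45 = s₂.real 45 := hA₃.real 45 (by decide)
  have hB₃ : Bracket I z (s₃.real 45) (2 * Z + Real.log I.n) := by
    obtain ⟨u, hu⟩ := hI.nonempty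
    have h0 : ∀ k < 2, s₃.real 45 k = -(Z + Real.log I.n) := by
      intro k hk
      rw [hl₃]
      interval_cases k
      exacts [h₂.1, h₂.2]
    intro k hk
    rw [h0 k hk, show -(Z + Real.log I.n) + (2 * Z + Real.log I.n) = Z by ring]
    exact ⟨csum_start_le (by linarith [hI.hn]) hz k, le_csum_start hI.ν_le hz hu hk⟩
  refine Runs.seq (T₁ := K₀ * (11 * I.n + 21) + 1) (T₂ := 26 * I.n + 54)
    (Q₁ := fun s' => ∃ g, 0 ≤ g ∧ g ≤ δ ∧ s'.real 46 0 = g ∧ Bracket I z (s'.real 45) g)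
    (Runs.loop (fun k s' => s'.real 46 0 = (2 * Z + Real.log I.n) / 2 ^ k ∧
      Bracket I z (s'.real 45) ((2 * Z + Real.log I.n) / 2 ^ k)) K₀ (11 * I.n + 20)
      ⟨by simpa using h₃, by simpa using hB₃⟩ ?_ ?_ ?_ le_rfl) ?_ (by omega)
  · rintro k s' hk hA ⟨hg, -⟩
    simp only [BExpr.Holds, RExpr.eval, IExpr.eval, hg, (hs₃.agree hA (by decide)).δ]
    exact hKiff k hk
  · rintro k s' hk hA ⟨hg, hB⟩ -
    have e : (2 * Z + Real.log I.n) / 2 ^ (k + 1) = (2 * Z + Real.log I.n) / 2 ^ k / 2 := by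
      rw [pow_succ, div_div]
    rw [e]
    exact runs_bisect (hs₃.agree hA (by decide)).toStored
      (by rw [hA.real 42 (by decide), hz₃]) hg hB (fun _ _ h h' => ⟨h, h'⟩) le_rfl
  · rintro s' hA ⟨hg, hB⟩ -
    exact ⟨_, by positivity, Nat.find_spec hKex, hg, hB⟩
  rintro s₄ hA₄ ⟨g, hg0, hgδ, hg₄, hB⟩
  have hs₄ := (hs₃.agree hA₄ (by decide)).toStored
  have hz₄ : s₄.real 42 = z := by rw [hA₄.real 42 (by decide), hz₃]
  set lo := s₄.real 45 with hlo
  refine Runs.seq (T₁ := 7 * I.n + 3) (T₂ := 19 * I.n + 50) (Q₁ := fun s' => ∀ j < I.n,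
    s'.real 49 j = min I.ν (Real.exp (z j + lo (I.c j)))) (runs_capExp (G := 0) hs₄
      (by norm_num) (fun s' hA => ?_) (fun s' _ h => by simpa [hz₄] using h) le_rfl) ?_ (by omega)
  · simp [RExpr.eval, IExpr.eval]
  intro s₅ hA₅ h₅
  have hs₅ := hs₄.agree hA₅ (by decide)
  refine Runs.seq (T₁ := 4 * I.n + 7) (T₂ := 15 * I.n + 42) (Q₁ := fun s' => ∀ k < 2,
    s'.real 48 k = csum I.n I.c (s₅.real 49) k)
    (runs_classSum hs₅ (by norm_num) (by norm_num) (fun s' _ h => h) le_rfl) ?_ (by omega)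
  intro s₆ hA₆ h₆
  have hs₆ := hs₅.agree hA₆ (by decide)
  have hl₆ : s₆.real 45 = lo := by rw [hA₆.real 45 (by decide), hA₅.real 45 (by decide)]
  have hz₆ : s₆.real 42 = z := by rw [hA₆.real 42 (by decide), hA₅.real 42 (by decide), hz₄]
  have hg₆ : s₆.real 46 0 = g := by rw [hA₆.real 46 (by decide), hA₅.real 46 (by decide), hg₄]
  have h₆₄₉ : s₆.real 49 = s₅.real 49 := hA₆.real 49 (by decide)
  refine Runs.seq (T₁ := 7 * I.n + 3) (T₂ := 8 * I.n + 38) (Q₁ := fun s' => ∀ j < I.n,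
    s'.real 50 j = min I.ν (Real.exp (z j + lo (I.c j) + g))) (runs_capExp (G := g) hs₆
      (by norm_num) (fun s' hA => ?_) (fun s' _ h => by simpa [hz₆, hl₆] using h) le_rfl) ?_
      (by omega)
  · simp [RExpr.eval, IExpr.eval, hA.real 46 (by decide), hg₆]
  intro s₇ hA₇ h₇
  have hs₇ := hs₆.agree hA₇ (by decide)
  refine Runs.seq (T₁ := 4 * I.n + 7) (T₂ := 4 * I.n + 20) (Q₁ := fun s' => ∀ k < 2,
    s'.real 51 k = csum I.n I.c (s₇.real 50) k)
    (runs_classSum hs₇ (by norm_num) (by norm_num) (fun s' _ h => h) le_rfl) ?_ (by omega)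
  intro s₈ hA₈ h₈
  have hs₈ := hs₇.agree hA₈ (by decide)
  have hl₈ : s₈.real 45 = lo := by rw [hA₈.real 45 (by decide), hA₇.real 45 (by decide), hl₆]
  have e50 : s₈.real 50 = s₇.real 50 := hA₈.real 50 (by decide)
  have e49 : s₈.real 49 = s₅.real 49 := by
    rw [hA₈.real 49 (by decide), hA₇.real 49 (by decide), h₆₄₉]
  have e48 : s₈.real 48 = s₆.real 48 := by
    rw [hA₈.real 48 (by decide), hA₇.real 48 (by decide)]
  refine Runs.fillId I.n (fun j => s₅.real 49 j + (1 - csum I.n I.c (s₅.real 49) (I.c j)) /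
    (csum I.n I.c (s₇.real 50) (I.c j) - csum I.n I.c (s₅.real 49) (I.c j)) *
      (s₇.real 50 j - s₅.real 49 j)) (fun s' hA => (hs₈.agree hA (by decide)).n) ?_ ?_ (by omega)
  · intro j hj s' hA hj' _
    simp [RExpr.eval, IExpr.eval, hj', (hs₈.agree hA (by decide)).c j hj,
      hA.real 48 (by decide), hA.real 49 (by decide), hA.real 50 (by decide),
      hA.real 51 (by decide), e48, e49, e50, h₆ _ (hI.c_lt j hj), h₈ _ (hI.c_lt j hj)]
  · intro s' hA h
    have hl' : s'.real 45 = lo := by rw [hA.real 45 (by decide), hl₈]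
    rw [hl']
    refine soft_of_bracket hI.ν_pos hI.c_lt hg0 hgδ h₅ h₇ (fun k hk => ?_) (fun k hk => ?_) h
    · rw [csum_congr fun j hj hj' => (h₅ j hj).trans (by rw [hj'])]
      exact (hB k hk).1
    · rw [csum_congr fun j hj hj' => (h₇ j hj).trans (by rw [hj', add_assoc])]
      exact (hB k hk).2

end SPDC

/-! ### One step of the iteration -/

namespace RealRAM

open Classical in
lemma val_mono_agree {φ ψ : State → ENNReal} {c : Cmd} {s : State} {t : ℕ}
    (h : ∀ s', Agree c s s' → φ s' ≤ ψ s') : val φ t ([c], s) ≤ val ψ t ([c], s) := by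
  refine (val_frame φ t c s).trans (val_mono (fun s' => ?_) t _)
  split_ifs with h'
  · exact h s' h'
  · exact zero_le

end RealRAM

namespace SPDC

open Finset RealRAM

/-- The loop in `sample`. -/
def sampleLoop : Cmd :=
  .loop (.ilt (iv 13) (iv 1)) (.seq (.flip 17 (.const 0))
    (.seq (.iset 14 (.const 0) (.add (.add (iv 14) (iv 14)) (iv 17)))
      (.iset 13 (.const 0) (.add (iv 13) (iv 13)))))

lemma val_sampleLoop {p : ℕ} (j : ℕ) : ∀ (k : ℕ) (s : State), k + j = p → s.int 1 0 = 2 ^ p →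
    s.int 13 0 = 2 ^ k → ∃ S : ℕ → State,
      (∀ r < 2 ^ j, Agree sampleLoop s (S r) ∧ (S r).int 14 0 = s.int 14 0 * 2 ^ j + r) ∧
      ∀ φ, (∑ r ∈ range (2 ^ j), φ (S r)) / 2 ^ j ≤ val φ (6 * j + 1) ([sampleLoop], s) := by
  induction j with
  | zero =>
    intro k s hk h1 h13
    refine ⟨fun _ => s, fun r hr => ⟨Agree.refl _ _, ?_⟩, fun φ => ?_⟩
    · simp at hr; simp [hr]
    · have hk' : k = p := by omega
      subst hk'
      simp [RealRAM.val, sampleLoop, BExpr.Holds, IExpr.eval, h1, h13]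
  | succ j ih =>
    intro k s hk h1 h13
    -- The state after a pass through the loop in which the coin shows `b`.
    let nxt : ℕ → State := fun b =>
      ((s.writeInt 17 0 b).writeInt 14 0 (s.int 14 0 + s.int 14 0 + b)).writeInt 13 0
        (s.int 13 0 + s.int 13 0)
    have hA : ∀ b, Agree sampleLoop s (nxt b) := by
      intro b
      refine ⟨fun a ha => ?_, fun a _ => rfl⟩
      simp only [sampleLoop, Cmd.wi, List.mem_append, List.mem_cons, List.not_mem_nil, or_false,
        not_or] at ha
      simp [nxt, writeInt_of_ne _ ha.1, writeInt_of_ne _ ha.2.1, writeInt_of_ne _ ha.2.2]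
    have hS := fun b => ih (k + 1) (nxt b) (by omega)
      (by simp [nxt, writeInt_of_ne, h1]) (by simp [nxt, h13, pow_succ]; omega)
    choose S hS1 hS2 using hS
    refine ⟨fun r => if r < 2 ^ j then S 0 r else S 1 (r - 2 ^ j), fun r hr => ?_, fun φ => ?_⟩
    · have h14 : ∀ b, (nxt b).int 14 0 = s.int 14 0 + s.int 14 0 + b := by
        intro b; simp [nxt, writeInt_of_ne]
      dsimp only
      split_ifs with h
      · refine ⟨(hA 0).trans (hS1 0 r h).1, ?_⟩
        rw [(hS1 0 r h).2, h14, pow_succ]; ring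
      · have hr' : r - 2 ^ j < 2 ^ j := by rw [pow_succ] at hr; omega
        refine ⟨(hA 1).trans (hS1 1 _ hr').1, ?_⟩
        rw [(hS1 1 _ hr').2, h14, pow_succ]
        have : r = 2 ^ j + (r - 2 ^ j) := by omega
        conv_rhs => rw [this]
        ring
    · have hhold : s.int 13 0 < s.int 1 0 := by
        rw [h1, h13]; exact Nat.pow_lt_pow_right one_lt_two (by omega)
      have hval : ∀ t, val φ (t + 6) ([sampleLoop], s) =
          (val φ t ([sampleLoop], nxt 0) + val φ t ([sampleLoop], nxt 1)) / 2 := by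
        intro t
        conv_lhs => rw [sampleLoop]
        simp [RealRAM.val, BExpr.Holds, IExpr.eval, hhold, nxt, writeInt_of_ne]
        rfl
      have hsum : ∑ r ∈ range (2 ^ (j + 1)),
          φ (if r < 2 ^ j then S 0 r else S 1 (r - 2 ^ j)) =
          ∑ r ∈ range (2 ^ j), φ (S 0 r) + ∑ r ∈ range (2 ^ j), φ (S 1 r) := by
        rw [pow_succ, mul_two, sum_range_add]
        congr 1
        · exact sum_congr rfl fun r hr => by rw [if_pos (mem_range.1 hr)]
        · exact sum_congr rfl fun r _ => by
            rw [if_neg (by omega), Nat.add_sub_cancel_left]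
      rw [show 6 * (j + 1) + 1 = 6 * j + 1 + 6 by ring, hval, hsum, pow_succ]
      refine le_trans (le_of_eq ?_) (ENNReal.div_le_div_right
        (add_le_add (hS2 0 φ) (hS2 1 φ)) 2)
      simp only [div_eq_mul_inv]
      rw [ENNReal.mul_inv (by simp) (by simp), ← add_mul, mul_assoc]

/-- A uniformly random index below `m = 2 ^ p`. -/
lemma val_sample {p : ℕ} {s : State} (h1 : s.int 1 0 = 2 ^ p) : ∃ S : ℕ → State,
    (∀ r < 2 ^ p, Agree sample s (S r) ∧ (S r).int 14 0 = r) ∧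
    ∀ φ, (∑ r ∈ range (2 ^ p), φ (S r)) / 2 ^ p ≤ val φ (6 * p + 5) ([sample], s) := by
  obtain ⟨S, hS1, hS2⟩ := val_sampleLoop (p := p) p 0 ((s.writeInt 14 0 0).writeInt 13 0 1) (by simp)
    (by simp [writeInt_of_ne, h1]) (by simp)
  refine ⟨S, fun r hr => ⟨?_, ?_⟩, fun φ => (hS2 φ).trans (le_of_eq ?_)⟩
  · have hA : Agree sample s ((s.writeInt 14 0 0).writeInt 13 0 1) := by
      refine ⟨fun a ha => ?_, fun a _ => rfl⟩
      simp only [sample, Cmd.wi, List.mem_append, List.mem_cons, List.not_mem_nil, or_false,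
        not_or] at ha
      simp [writeInt_of_ne _ ha.1, writeInt_of_ne _ ha.2.1]
    exact hA.trans ((hS1 r hr).1.mono (by decide) (by decide))
  · rw [(hS1 r hr).2]; simp [writeInt_of_ne]
  · have h : ∀ t, val φ t ([sampleLoop], (s.writeInt 14 0 0).writeInt 13 0 1) =
        val φ (t + 4) ([sample], s) := fun t => by simp [sample, RealRAM.val, IExpr.eval]; rfl
    exact h _

/-- The memory between two steps of the iteration. -/
structure Iter (I : Inst) (q : ℝ) (s : State) : Prop extends I.AtLevel q s where
  soft : Soft I.n I.ν I.c (s.real 42) (s.real 45) (pδ I.n I.m q) (s.real 40)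
  z_le : ∀ j < I.n, |s.real 42 j| ≤ pZ I.n I.m q
  w_le : ∀ k < I.m, |s.real 44 k| ≤ 2
  u_eq : ∀ j < I.n, s.real 43 j = ∑ k ∈ range I.m, s.real 44 k * I.M j k

variable {I : Inst} {s : State} {Q : State → Prop} {q : ℝ}

lemma Inst.Valid.abs_M_le (hI : I.Valid) {j k : ℕ} (hj : j < I.n) (hk : k < I.m) :
    |I.M j k| ≤ 1 := by
  have h1 : I.M j k * I.M j k ≤ 1 := by
    refine (single_le_sum (f := fun k => I.M j k * I.M j k) (fun _ _ => mul_self_nonneg _)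
      (mem_range.2 hk)).trans ?_
    rw [hI.gram j hj j hj]
    simpa only [sq] using hI.row j hj
  exact abs_le_one_iff_mul_self_le_one.2 h1

/-- The dual vector stays bounded, so that the bisection has a bounded starting interval. -/
lemma dual_bound {Z m γ τ z u : ℝ} (hγ : 0 < γ) (hτ : 0 < τ) (hZ : Z = 6 * m / γ) (hz : |z| ≤ Z)
    (hu : |u| ≤ 6 * m) : |(z - τ * u) / (1 + τ * γ)| ≤ Z := by
  have h0 : 0 < 1 + τ * γ := by positivity
  have h1 : Z * γ = 6 * m := by rw [hZ]; field_simp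
  rw [abs_div, abs_of_pos h0, div_le_iff₀ h0]
  calc |z - τ * u| ≤ |z| + |τ * u| := abs_sub _ _
    _ ≤ Z + τ * (6 * m) := by
      rw [abs_mul, abs_of_pos hτ]
      exact add_le_add hz (mul_le_mul_of_nonneg_left hu hτ.le)
    _ = Z * (1 + τ * γ) := by rw [← h1]; ring

/-- The running time of one step. -/
def coordT (n K : ℕ) : ℕ := softT n K + 16 * n + 50

/-- One step with the random coordinate `i`. -/
lemma runs_coordStep {T K i : ℕ} (hI : I.Valid) (hq : Level I.n I.m q) (hs : Iter I q s)
    (hi : s.int 14 0 = i) (him : i < I.m)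
    (hK : (2 * pZ I.n I.m q + Real.log I.n) / 2 ^ K ≤ pδ I.n I.m q)
    (hQ : ∀ s' wn, Agree coordStep s s' → Iter I q s' →
      (∀ j < I.n, s'.real 41 j = s.real 40 j) →
      wn = clip ((s.real 44 i + pσ I.n I.m q * ip I.n I.M i (fun j => s.real 40 j +
        pθ I.n I.m q * (s.real 40 j - s.real 41 j))) / (1 + pσ I.n I.m q)) →
      s'.real 44 = Function.update (s.real 44) i wn →
      (∀ j < I.n, s'.real 42 j = (s.real 42 j - pτ I.n I.m q *
        (∑ k ∈ range I.m, s.real 44 k * I.M j k + I.m * (wn - s.real 44 i) * I.M j i)) /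
          (1 + pτ I.n I.m q * pG I.n I.m q)) → Q s')
    (hT : coordT I.n K ≤ T) : Runs coordStep T s Q := by
  set wn := clip ((s.real 44 i + pσ I.n I.m q * ip I.n I.M i (fun j => s.real 40 j +
    pθ I.n I.m q * (s.real 40 j - s.real 41 j))) / (1 + pσ I.n I.m q)) with hwn
  suffices h : Runs coordStep (coordT I.n K) s fun s' => Iter I q s' ∧
      (∀ j < I.n, s'.real 41 j = s.real 40 j) ∧ s'.real 44 = Function.update (s.real 44) i wn ∧
      ∀ j < I.n, s'.real 42 j = (s.real 42 j - pτ I.n I.m q *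
        (∑ k ∈ range I.m, s.real 44 k * I.M j k + I.m * (wn - s.real 44 i) * I.M j i)) /
          (1 + pτ I.n I.m q * pG I.n I.m q) from
    h.frame.imp hT fun s' h => hQ s' wn h.1 h.2.1 h.2.2.1 rfl h.2.2.2.1 h.2.2.2.2
  unfold coordT
  have hM : ∀ s', I.Stored s' → ∀ j < I.n, s'.int 10 0 = j → s'.int 14 0 = i →
      (matEntry 10).eval s' = I.M j i := by
    intro s' h j hj h10 h14
    simp [RExpr.eval, IExpr.eval, h10, h14, h.offM j hj, h.M j hj i him]
  refine Runs.seq (T₁ := 4 * I.n + 5) (T₂ := softT I.n K + 12 * I.n + 40)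
    (Q₁ := fun s' => s'.real 52 0 = ip I.n I.M i (fun j => s.real 40 j +
      pθ I.n I.m q * (s.real 40 j - s.real 41 j)))
    (Runs.accum I.n (fun j => I.M j i * (s.real 40 j + pθ I.n I.m q *
      (s.real 40 j - s.real 41 j))) (fun s' hA => (hs.agree hA (by decide)).n) ?_
      (fun s' _ h => h) le_rfl) ?_ (by omega)
  · intro j hj s' hA hj'
    have hs' := hs.agree hA (by decide)
    rw [RExpr.eval, hM s' hs'.toStored j hj hj' (by rw [hA.int 14 (by decide), hi])]
    simp [RExpr.eval, IExpr.eval, hj', hA.real 40 (by decide), hA.real 41 (by decide), hs'.θ]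
  intro s₁ hA₁ h₁
  have hs₁ := hs.agree hA₁ (by decide)
  have w₁ : s₁.real 44 = s.real 44 := hA₁.real 44 (by decide)
  have i₁ : s₁.int 14 0 = i := by rw [hA₁.int 14 (by decide), hi]
  refine Runs.seq (T₁ := 1) (T₂ := softT I.n K + 12 * I.n + 38) (Q₁ := fun s' => s'.real 53 0 =
    (s.real 44 i + pσ I.n I.m q * ip I.n I.M i (fun j => s.real 40 j +
      pθ I.n I.m q * (s.real 40 j - s.real 41 j))) / (1 + pσ I.n I.m q))
    (Runs.rset le_rfl ?_) ?_ (by omega)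
  · simp [RExpr.eval, IExpr.eval, w₁, i₁, hs₁.σ, h₁]
  generalize (s.real 44 i + pσ I.n I.m q * ip I.n I.M i (fun j => s.real 40 j +
      pθ I.n I.m q * (s.real 40 j - s.real 41 j))) / (1 + pσ I.n I.m q) = x at hwn
  intro s₂ hA₂ h₂
  refine Runs.seq (T₁ := 2) (T₂ := softT I.n K + 12 * I.n + 35) (Q₁ := fun s' => s'.real 53 0 =
    min 2 x) (Runs.ite (T := 1) (fun h => Runs.rset le_rfl ?_) (fun h => Runs.iset le_rfl ?_)
      le_rfl) ?_ (by omega)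
  · simp [BExpr.Holds, RExpr.eval, IExpr.eval, h₂] at h
    simp [RExpr.eval, IExpr.eval, min_eq_left h.le]
  · simp [BExpr.Holds, RExpr.eval, IExpr.eval, h₂] at h
    simp [h₂, min_eq_right h]
  intro s₃ hA₃ h₃
  refine Runs.seq (T₁ := 2) (T₂ := softT I.n K + 12 * I.n + 32) (Q₁ := fun s' => s'.real 53 0 =
    wn) (Runs.ite (T := 1) (fun h => Runs.rset le_rfl ?_) (fun h => Runs.iset le_rfl ?_)
      le_rfl) ?_ (by omega)
  · simp only [BExpr.Holds, RExpr.eval, IExpr.eval, h₃] at h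
    norm_num at h
    rw [hwn, clip, max_eq_left (min_le_iff.2 (.inr h.le))]
    simp [RExpr.eval, IExpr.eval]
  · simp only [BExpr.Holds, RExpr.eval, IExpr.eval, h₃] at h
    norm_num at h
    rw [hwn, clip, max_eq_right (le_min (by norm_num) h)]
    simp [h₃]
  have hwn2 : |wn| ≤ 2 := hwn ▸ abs_clip_le x
  clear_value wn
  intro s₄ hA₄ h₄
  have w₄ : s₄.real 44 = s.real 44 := by
    rw [hA₄.real 44 (by decide), hA₃.real 44 (by decide), hA₂.real 44 (by decide), w₁]
  have i₄ : s₄.int 14 0 = i := by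
    rw [hA₄.int 14 (by decide), hA₃.int 14 (by decide), hA₂.int 14 (by decide), i₁]
  have hs₄ := ((hs₁.agree hA₂ (by decide)).agree hA₃ (by decide)).agree hA₄ (by decide)
  refine Runs.seq (T₁ := 1) (T₂ := softT I.n K + 12 * I.n + 30) (Q₁ := fun s' => s'.real 54 0 =
    wn - s.real 44 i) (Runs.rset le_rfl ?_) ?_ (by omega)
  · simp [RExpr.eval, IExpr.eval, w₄, i₄, h₄]
  intro s₅ hA₅ h₅
  have hs₅ := hs₄.agree hA₅ (by decide)
  have i₅ : s₅.int 14 0 = i := by rw [hA₅.int 14 (by decide), i₄]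
  have z₅ : s₅.real 42 = s.real 42 := by
    rw [hA₅.real 42 (by decide), hA₄.real 42 (by decide), hA₃.real 42 (by decide),
      hA₂.real 42 (by decide), hA₁.real 42 (by decide)]
  have u₅ : s₅.real 43 = s.real 43 := by
    rw [hA₅.real 43 (by decide), hA₄.real 43 (by decide), hA₃.real 43 (by decide),
      hA₂.real 43 (by decide), hA₁.real 43 (by decide)]
  have w₅ : s₅.real 44 = s.real 44 := by rw [hA₅.real 44 (by decide), w₄]
  have n₅ : s₅.real 53 0 = wn := by rw [hA₅.real 53 (by decide), h₄]
  have e₅ : s₅.real 40 = s.real 40 := by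
    rw [hA₅.real 40 (by decide), hA₄.real 40 (by decide), hA₃.real 40 (by decide),
      hA₂.real 40 (by decide), hA₁.real 40 (by decide)]
  refine Runs.seq (T₁ := 4 * I.n + 3) (T₂ := softT I.n K + 8 * I.n + 26)
    (Q₁ := fun s' => ∀ j < I.n, s'.real 42 j = (s.real 42 j - pτ I.n I.m q *
        (∑ k ∈ range I.m, s.real 44 k * I.M j k + I.m * (wn - s.real 44 i) * I.M j i)) /
          (1 + pτ I.n I.m q * pG I.n I.m q))
    (Runs.fillId I.n _ (fun s' hA => (hs₅.agree hA (by decide)).n) ?_ (fun s' _ h => h) le_rfl) ?_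
    (by omega)
  · intro j hj s' hA hj' hz
    have hs' := hs₅.agree hA (by decide)
    have hM' := hM s' hs'.toStored j hj hj' (by rw [hA.int 14 (by decide), i₅])
    simp only [RExpr.eval, hs'.τ, hs'.γ, IExpr.eval, hs'.m, hj', hA.real 43 (by decide), u₅,
      hs.u_eq j hj, hz, z₅, hA.real 54 (by decide), h₅] at hM' ⊢
    rw [hM']
    simp
  intro s₆ hA₆ h₆
  have hs₆ := hs₅.agree hA₆ (by decide)
  refine Runs.seq (T₁ := 4 * I.n + 3) (T₂ := softT I.n K + 4 * I.n + 22)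
    (Q₁ := fun s' => ∀ j < I.n, s'.real 43 j = ∑ k ∈ range I.m, s.real 44 k * I.M j k +
      (wn - s.real 44 i) * I.M j i)
    (Runs.fillId I.n _ (fun s' hA => (hs₆.agree hA (by decide)).n) ?_ (fun s' _ h => h) le_rfl) ?_
    (by omega)
  · intro j hj s' hA hj' hu
    have hs' := hs₆.agree hA (by decide)
    have hM' := hM s' hs'.toStored j hj hj'
      (by rw [hA.int 14 (by decide), hA₆.int 14 (by decide), i₅])
    rw [hA₆.real 43 (by decide), u₅, hs.u_eq j hj] at hu
    simp only [RExpr.eval, IExpr.eval, hj', hu, hA.real 54 (by decide), hA₆.real 54 (by decide),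
      h₅] at hM' ⊢
    rw [hM']
  intro s₇ hA₇ h₇
  have hs₇ := hs₆.agree hA₇ (by decide)
  have i₇ : s₇.int 14 0 = i := by rw [hA₇.int 14 (by decide), hA₆.int 14 (by decide), i₅]
  have w₇ : s₇.real 44 = s.real 44 := by rw [hA₇.real 44 (by decide), hA₆.real 44 (by decide), w₅]
  have n₇ : s₇.real 53 0 = wn := by rw [hA₇.real 53 (by decide), hA₆.real 53 (by decide), n₅]
  refine Runs.seq (T₁ := 1) (T₂ := softT I.n K + 4 * I.n + 20)
    (Q₁ := fun s' => s'.real 44 = Function.update (s.real 44) i wn) (Runs.rset le_rfl ?_) ?_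
    (by omega)
  · simp [RExpr.eval, IExpr.eval, i₇, w₇, n₇]
  intro s₈ hA₈ h₈
  have hs₈ := hs₇.agree hA₈ (by decide)
  have e₈ : s₈.real 40 = s.real 40 := by
    rw [hA₈.real 40 (by decide), hA₇.real 40 (by decide), hA₆.real 40 (by decide), e₅]
  refine Runs.seq (T₁ := 4 * I.n + 3) (T₂ := softT I.n K + 10)
    (Q₁ := fun s' => ∀ j < I.n, s'.real 41 j = s.real 40 j)
    (Runs.fillId I.n _ (fun s' hA => (hs₈.agree hA (by decide)).n) ?_ (fun s' _ h => h) le_rfl) ?_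
    (by omega)
  · intro j hj s' hA hj' _
    simp [RExpr.eval, IExpr.eval, hj', hA.real 40 (by decide), e₈]
  intro s₉ hA₉ h₉
  have hs₉ := hs₈.agree hA₉ (by decide)
  have z₉ : ∀ j < I.n, s₉.real 42 j = (s.real 42 j - pτ I.n I.m q *
        (∑ k ∈ range I.m, s.real 44 k * I.M j k + I.m * (wn - s.real 44 i) * I.M j i)) /
          (1 + pτ I.n I.m q * pG I.n I.m q) := by
    intro j hj
    rw [hA₉.real 42 (by decide), hA₈.real 42 (by decide), hA₇.real 42 (by decide), h₆ j hj]
  have hzb : ∀ j < I.n, |s₉.real 42 j| ≤ pZ I.n I.m q := by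
    intro j hj
    rw [z₉ j hj]
    refine dual_bound hq.pG_pos hq.tau_pos rfl (hs.z_le j hj) ?_
    have h1 : |∑ k ∈ range I.m, s.real 44 k * I.M j k| ≤ 2 * I.m := by
      refine (abs_sum_le_sum_abs _ _).trans ?_
      refine (sum_le_card_nsmul _ _ 2 fun k hk => ?_).trans_eq (by simp [mul_comm])
      rw [abs_mul]
      calc _ ≤ 2 * 1 := mul_le_mul (hs.w_le k (mem_range.1 hk))
            (hI.abs_M_le hj (mem_range.1 hk)) (abs_nonneg _) two_pos.le
        _ = 2 := by norm_num
    have h2 : |I.m * (wn - s.real 44 i) * I.M j i| ≤ 4 * I.m := by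
      rw [abs_mul, abs_mul, abs_of_nonneg (Nat.cast_nonneg I.m)]
      have h3 : |wn - s.real 44 i| ≤ 4 := by
        refine (abs_sub _ _).trans ?_
        linarith [hs.w_le i him]
      calc _ ≤ (I.m : ℝ) * 4 * 1 := mul_le_mul (mul_le_mul_of_nonneg_left h3 (Nat.cast_nonneg _))
            (hI.abs_M_le hj him) (abs_nonneg _) (by positivity)
        _ = 4 * I.m := by ring
    exact (abs_add_le _ _).trans (by linarith)
  refine runs_softmax hI hs₉ hq hzb hK (fun s' hA h => ?_) (by omega)
  have w' : s'.real 44 = Function.update (s.real 44) i wn := by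
    rw [hA.real 44 (by decide), hA₉.real 44 (by decide), h₈]
  have z' : s'.real 42 = s₉.real 42 := hA.real 42 (by decide)
  refine ⟨⟨hs₉.agree hA (by decide), by rwa [z'], by rwa [z'], fun k hk => ?_, fun j hj => ?_⟩,
    ?_, w', by rwa [z']⟩
  · rw [w']
    rcases eq_or_ne k i with rfl | hki
    · simpa using hwn2
    · simpa [hki] using hs.w_le k hk
  · rw [hA.real 43 (by decide), hA₉.real 43 (by decide), hA₈.real 43 (by decide), h₇ j hj, w',
      sum_update him (s.real 44) wn fun k x => x * I.M j k]
    ring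
  · intro j hj
    rw [hA.real 41 (by decide), h₉ j hj]

end SPDC

/-! ### The expected decrease of the potential -/

namespace SPDC

open Finset RealRAM

variable {I : Inst} {s : State} {q : ℝ}

/-- No entry of the rotated rows is large. -/
def Inst.Flat (I : Inst) : Prop :=
  ∀ j < I.n, ∀ i < I.m, I.m * I.M j i ^ 2 ≤ 2 * Real.log (4 * I.n ^ 2 * I.m)

/-- The solution `ηs` of the regularized problem, and its primal counterpart. -/
structure Saddle (I : Inst) (q : ℝ) (ηs ws : ℕ → ℝ) : Prop where
  mem : ηs ∈ capSimplex I.n I.ν I.c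
  vi : ∀ u ∈ capSimplex I.n I.ν I.c,
    0 ≤ ∑ j ∈ range I.n, (∑ k ∈ range I.m, ip I.n I.M k ηs * I.M j k) * (u j - ηs j) +
      pG I.n I.m q * (ent I.n u - ent I.n ηs)
  ws_eq : ∀ k, ws k = ip I.n I.M k ηs

lemma Saddle.abs_le {ηs ws : ℕ → ℝ} (hI : I.Valid) (h : Saddle I q ηs ws) {k : ℕ} (hk : k < I.m) :
    |ws k| ≤ 2 := by
  rw [h.ws_eq, ← sum_eq_two hI.c_lt h.mem]
  refine (abs_sum_le_sum_abs _ _).trans (sum_le_sum fun j hj => ?_)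
  have h0 := (h.mem.1 j (mem_range.1 hj)).1
  rw [abs_mul, abs_of_nonneg h0]
  exact mul_le_of_le_one_left h0 (hI.abs_M_le (mem_range.1 hj) hk)

/-- The potential of a memory. -/
noncomputable def pot (I : Inst) (q : ℝ) (ηs ws : ℕ → ℝ) (s : State) : ℝ :=
  Psi I.n I.m I.M ηs ws (pσ I.n I.m q) (4 * pL I.n I.m q) (1 / pτ I.n I.m q + pG I.n I.m q)
    (4 * pδ I.n I.m q) (s.real 40) (s.real 41) (s.real 44) (s.real 42)

lemma Psi_congr {n m : ℕ} {M : ℕ → ℕ → ℝ} {ηs ws : ℕ → ℝ} {σ Λ P e : ℝ} {η ηp ηp' w z : ℕ → ℝ}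
    (h : ∀ j < n, ηp j = ηp' j) :
    Psi n m M ηs ws σ Λ P e η ηp w z = Psi n m M ηs ws σ Λ P e η ηp' w z := by
  have h1 : l1 n η ηp = l1 n η ηp' := sum_congr rfl fun j hj => by rw [h j (mem_range.1 hj)]
  have h2 : ∀ k, ip n M k (fun j => η j - ηp j) = ip n M k (fun j => η j - ηp' j) := fun k =>
    sum_congr rfl fun j hj => by simp only [h j (mem_range.1 hj)]
  simp only [Psi, h1, h2]

lemma ofReal_sum_le (m : ℕ) (f : ℕ → ℝ) :
    ENNReal.ofReal (∑ i ∈ range m, f i) ≤ ∑ i ∈ range m, ENNReal.ofReal (f i) := by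
  induction m with
  | zero => simp
  | succ m ih =>
    rw [sum_range_succ, sum_range_succ]
    exact ENNReal.ofReal_add_le.trans (add_le_add ih le_rfl)

/-- A step multiplies the expected potential by `pθ`, up to the error of the normalization. The
functional `1 - a * pot` is a lower bound for the probability that the final test succeeds. -/
lemma val_step {p K : ℕ} (hI : I.Valid) (hf : I.Flat) (hp : I.m = 2 ^ p) (hq : Level I.n I.m q)
    (hs : Iter I q s) {ηs ws : ℕ → ℝ} (hsad : Saddle I q ηs ws)
    (hK : (2 * pZ I.n I.m q + Real.log I.n) / 2 ^ K ≤ pδ I.n I.m q) {a b : ℝ} (ha : 0 ≤ a)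
    {C : ENNReal} {φ : State → ENNReal}
    (hφ : ∀ s', Iter I q s' → Agree (.seq sample coordStep) s s' →
      ENNReal.ofReal (b - a * pot I q ηs ws s') * C ≤ φ s') :
    ENNReal.ofReal (b - a * (pθ I.n I.m q * pot I q ηs ws s +
      (1 / pτ I.n I.m q + pG I.n I.m q) * (4 * pδ I.n I.m q))) * C ≤
      val φ (6 * p + coordT I.n K + 6) ([.seq sample coordStep], s) := by
  obtain ⟨S, hS, hval⟩ := val_sample (p := p) (s := s) (by rw [hs.m, hp])
  have hm : 0 < I.m := hI.hm
  have hm' : (0 : ℝ) < I.m := by exact_mod_cast hm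
  -- The memory after the step with random index `i`.
  have hrun : ∀ i < I.m, ∃ s', (∀ φ, φ s' ≤ val φ (coordT I.n K) ([coordStep], S i)) ∧
      Iter I q s' ∧ Agree (.seq sample coordStep) s s' ∧ (∀ j < I.n, s'.real 41 j = s.real 40 j) ∧
      ∃ wn, wn = clip ((s.real 44 i + pσ I.n I.m q * ip I.n I.M i (fun j => s.real 40 j +
        pθ I.n I.m q * (s.real 40 j - s.real 41 j))) / (1 + pσ I.n I.m q)) ∧
      s'.real 44 = Function.update (s.real 44) i wn ∧
      (∀ j < I.n, s'.real 42 j = (s.real 42 j - pτ I.n I.m q *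
        (∑ k ∈ range I.m, s.real 44 k * I.M j k + I.m * (wn - s.real 44 i) * I.M j i)) /
          (1 + pτ I.n I.m q * pG I.n I.m q)) := by
    intro i hi
    obtain ⟨hA, h14⟩ := hS i (hp ▸ hi)
    have hit : Iter I q (S i) := by
      refine ⟨hs.agree hA (by decide), ?_, ?_, ?_, ?_⟩
      · rw [hA.real 42 (by decide), hA.real 45 (by decide), hA.real 40 (by decide)]
        exact hs.soft
      · rw [hA.real 42 (by decide)]; exact hs.z_le
      · rw [hA.real 44 (by decide)]; exact hs.w_le
      · rw [hA.real 43 (by decide), hA.real 44 (by decide)]; exact hs.u_eq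
    obtain ⟨s', h1, h2⟩ := runs_coordStep (Q := fun s' => Agree coordStep (S i) s' ∧ Iter I q s' ∧
      (∀ j < I.n, s'.real 41 j = (S i).real 40 j) ∧
      ∃ wn, wn = clip (((S i).real 44 i + pσ I.n I.m q * ip I.n I.M i (fun j => (S i).real 40 j +
        pθ I.n I.m q * ((S i).real 40 j - (S i).real 41 j))) / (1 + pσ I.n I.m q)) ∧
      s'.real 44 = Function.update ((S i).real 44) i wn ∧
      (∀ j < I.n, s'.real 42 j = ((S i).real 42 j - pτ I.n I.m q *
        (∑ k ∈ range I.m, (S i).real 44 k * I.M j k + I.m * (wn - (S i).real 44 i) * I.M j i)) /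
          (1 + pτ I.n I.m q * pG I.n I.m q))) hI hq hit h14 hi hK
      (fun s' wn h0 h1 h2 h3 h4 h5 => ⟨h0, h1, h2, wn, h3, h4, h5⟩) le_rfl
    rw [hA.real 40 (by decide), hA.real 41 (by decide), hA.real 42 (by decide),
      hA.real 44 (by decide)] at h1
    refine ⟨s', h2, h1.2.1, (hA.mono ?_ ?_).trans (h1.1.mono ?_ ?_), h1.2.2⟩ <;> decide
  have : Nonempty State := ⟨s⟩
  choose! S' hv hit hag h41 wn hwn h44 h42 using hrun
  have hδ := pδ_pos (n := I.n) (m := I.m) (q := q)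
  have key : ∑ i ∈ range I.m, pot I q ηs ws (S' i) ≤ I.m * (pθ I.n I.m q * pot I q ηs ws s +
      (1 / pτ I.n I.m q + pG I.n I.m q) * (4 * pδ I.n I.m q)) := by
    have hΛ : 0 ≤ 4 * pL I.n I.m q := by linarith [hq.one_le_pL]
    refine le_trans (le_of_eq (sum_congr rfl fun i hi => ?_)) (sum_Psi_le hm hq.sigma_pos hq.pG_pos
      hq.tau_pos (fun j hj i hi => (hf j hj i hi).trans hq.flat_le) hΛ (fun i _ => hsad.ws_eq i)
      (fun i hi => hsad.abs_le hI hi) inv_tau hq.theta_tau hq.theta_m hq.half_le_theta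
      hq.theta_le_one wn (fun i => (S' i).real 40) (fun i => (S' i).real 42) hwn h42
      (fun i hi => ?_) (fun i hi => hs.soft.le_gap hI.c_lt hδ.le (hit i hi).soft.mem) ?_)
    · have hi' := mem_range.1 hi
      rw [pot, h44 i hi', Psi_congr (h41 i hi')]
    · simp only [hsad.ws_eq]
      exact hsad.vi _ (hit i hi).soft.mem
    · have := hs.soft.le_gap hI.c_lt hδ.le hsad.mem
      nlinarith [sq_nonneg (l1 I.n ηs (s.real 40))]
  calc ENNReal.ofReal (b - a * (pθ I.n I.m q * pot I q ηs ws s +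
      (1 / pτ I.n I.m q + pG I.n I.m q) * (4 * pδ I.n I.m q))) * C
      ≤ ENNReal.ofReal ((∑ i ∈ range I.m, (b - a * pot I q ηs ws (S' i))) / I.m) * C := by
        refine mul_le_mul_left (ENNReal.ofReal_le_ofReal ?_) C
        rw [le_div_iff₀ hm', sum_sub_distrib, ← mul_sum, sum_const, card_range, nsmul_eq_mul]
        have := mul_le_mul_of_nonneg_left key ha
        linarith
    _ = ENNReal.ofReal (∑ i ∈ range I.m, (b - a * pot I q ηs ws (S' i))) * C / 2 ^ p := by
        rw [ENNReal.ofReal_div_of_pos hm', hp]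
        simp [div_eq_mul_inv, mul_right_comm]
    _ ≤ (∑ i ∈ range (2 ^ p), val φ (coordT I.n K) ([coordStep], S i)) / 2 ^ p := by
        refine ENNReal.div_le_div_right ?_ _
        rw [← hp]
        refine (mul_le_mul_left (ofReal_sum_le _ _) C).trans ?_
        rw [sum_mul]
        refine sum_le_sum fun i hi => ?_
        have hi' := mem_range.1 hi
        exact (hφ _ (hit i hi') (hag i hi')).trans (hv i hi' φ)
    _ ≤ val (fun s' => val φ (coordT I.n K) ([coordStep], s')) (6 * p + 5) ([sample], s) := hval _
    _ ≤ _ := val_seq (by omega)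

lemma Iter.agree_iset {s s' : State} {i e : IExpr} (h : Iter I q s)
    (hA : Agree (.iset 16 i e) s s') : Iter I q s' := by
  have hr : s'.real = s.real := funext fun a => hA.real a (by simp [Cmd.wr])
  refine ⟨h.agree hA (by simp [Cmd.Above, Cmd.wi, Cmd.wr]), ?_, ?_, ?_, ?_⟩ <;> rw [hr]
  exacts [h.soft, h.z_le, h.w_le, h.u_eq]

/-- The running time of the iteration. -/
def iterT (n p K N : ℕ) : ℕ := N * (6 * p + coordT n K + 9) + 3

open Classical in
/-- After the iteration, the expected potential is small. -/
lemma val_iterate {p K : ℕ} (hI : I.Valid) (hf : I.Flat) (hp : I.m = 2 ^ p) (hq : Level I.n I.m q)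
    (hs : Iter I q s) {ηs ws : ℕ → ℝ} (hsad : Saddle I q ηs ws)
    (hK : (2 * pZ I.n I.m q + Real.log I.n) / 2 ^ K ≤ pδ I.n I.m q) {a : ℝ} (ha : 0 ≤ a)
    {C : ENNReal} {φ : State → ENNReal} {N : ℕ} (hN : N = ⌈pN I.n I.m q⌉₊)
    (hφ : ∀ s', Iter I q s' → Agree iterate s s' →
      ENNReal.ofReal (1 - a * pot I q ηs ws s') * C ≤ φ s') :
    ENNReal.ofReal (1 - (a * pθ I.n I.m q ^ N * pot I q ηs ws s +
      N * (a * (1 / pτ I.n I.m q + pG I.n I.m q) * (4 * pδ I.n I.m q)))) * C ≤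
      val φ (iterT I.n p K N) ([iterate], s) := by
  set θ := pθ I.n I.m q
  set P := 1 / pτ I.n I.m q + pG I.n I.m q with hP
  set e := 4 * pδ I.n I.m q with he
  have hP0 : 0 ≤ P := add_nonneg (one_div_nonneg.2 hq.tau_pos.le) hq.pG_pos.le
  have he0 : 0 ≤ e := by linarith [pδ_pos (n := I.n) (m := I.m) (q := q)]
  have hθ0 : 0 ≤ θ := by linarith [hq.half_le_theta]
  let ψ : ℕ → State → ENNReal := fun k s' => if Iter I q s' ∧ s'.int 16 0 = k then
    ENNReal.ofReal (1 - (a * θ ^ (N - k) * pot I q ηs ws s' + (N - k : ℕ) * (a * P * e))) * C else 0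
  -- It suffices to bound the expectation of a functional that is infinite off the frame.
  refine le_trans ?_ (val_mono_agree (φ := fun s' => if Agree iterate s s' then φ s' else ⊤)
    fun s' h => by rw [if_pos h])
  set φ' : State → ENNReal := fun s' => if Agree iterate s s' then φ s' else ⊤ with hφ'
  have hφ'' : ∀ s', Iter I q s' → ENNReal.ofReal (1 - a * pot I q ηs ws s') * C ≤ φ' s' := by
    intro s' h
    rw [hφ']
    dsimp only
    split_ifs with hA
    exacts [hφ s' h hA, le_top]
  have hloop := val_loop (b := .rlt (.cast (iv 16)) (rv 27)) (c := .seq (.seq sample coordStep)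
    (.iset 16 (.const 0) (.add (iv 16) (.const 1)))) (φ := φ') ψ N (6 * p + coordT I.n K + 8)
    ?_ ?_ ?_ (s.writeInt 16 0 0)
  · have h0 : Iter I q (s.writeInt 16 0 0) :=
      hs.agree_iset (i := .const 0) (e := .const 0) ⟨fun a ha => writeInt_of_ne _
        (by simpa [Cmd.wi] using ha) _ _, fun _ _ => rfl⟩
    have hpot : pot I q ηs ws (s.writeInt 16 0 0) = pot I q ηs ws s := rfl
    simp only [ψ, h0, writeInt_self, Function.update_self, and_self, if_true, Nat.sub_zero,
      hpot] at hloop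
    refine hloop.trans ?_
    refine le_trans ?_ (val_seq (T₁ := 1) (T₂ := N * (6 * p + coordT I.n K + 9) + 1)
      (by unfold iterT; omega))
    simp [RealRAM.val, IExpr.eval]
  · intro k hk s' hb
    dsimp only [ψ]
    split_ifs with h
    · have hkN : k = N := by
        by_contra hne
        refine hb ?_
        simp only [BExpr.Holds, RExpr.eval, IExpr.eval, h.2, h.1.N]
        exact Nat.lt_ceil.1 (hN ▸ lt_of_le_of_ne hk hne)
      subst hkN
      simpa using hφ'' s' h.1
    · exact zero_le
  · intro k hk s' hb
    dsimp only [ψ]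
    split_ifs with h
    · have h1 : N - k = N - (k + 1) + 1 := by omega
      have hθ1 : a * θ ^ (N - (k + 1)) * (P * e) ≤ a * P * e := by
        have : θ ^ (N - (k + 1)) ≤ 1 := pow_le_one₀ hθ0 hq.theta_le_one
        calc a * θ ^ (N - (k + 1)) * (P * e) ≤ a * 1 * (P * e) := by gcongr
          _ = a * P * e := by ring
      refine le_trans ?_ (val_seq (T₁ := 6 * p + coordT I.n K + 6) (T₂ := 1) (by omega))
      refine le_trans ?_ (val_step hI hf hp hq h.1 hsad hK (a := a * θ ^ (N - (k + 1)))
        (b := 1 - (N - (k + 1) : ℕ) * (a * P * e)) (mul_nonneg ha (pow_nonneg hθ0 _)) (C := C)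
        fun s'' hs'' hA => ?_)
      · refine mul_le_mul_left (ENNReal.ofReal_le_ofReal ?_) C
        rw [h1]
        push_cast
        rw [pow_succ]
        linarith
      · have h16 : s''.int 16 0 = k := by rw [hA.int 16 (by decide), h.2]
        have h0 : Iter I q (s''.writeInt 16 0 (k + 1)) :=
          hs''.agree_iset (i := .const 0) (e := .const 0) ⟨fun a ha => writeInt_of_ne _
            (by simpa [Cmd.wi] using ha) _ _, fun _ _ => rfl⟩
        have hpot : pot I q ηs ws (s''.writeInt 16 0 (k + 1)) = pot I q ηs ws s'' := rfl
        simp only [RealRAM.val, IExpr.eval, h16, h0, writeInt_self, Function.update_self,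
          and_self, if_true, hpot]
        exact le_of_eq (by ring_nf)
    · exact zero_le
  · intro s' hb
    dsimp only [ψ]
    rw [if_neg]
    rintro ⟨h, h16⟩
    simp only [BExpr.Holds, RExpr.eval, IExpr.eval, h16, h.N] at hb
    exact hb.not_ge (hN ▸ Nat.le_ceil _)

end SPDC

/-! ### The levels -/

namespace RealRAM

lemma Runs.setv {a : ℕ} {e : RExpr} {c : Cmd} {T T' : ℕ} {s : State} {Q : State → Prop} (x : ℝ)
    (hx : e.eval s = x) (h : Runs c T (s.writeReal a 0 x) Q) (hT : T + 2 ≤ T') :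
    Runs (.seq (.rset a (.const 0) e) c) T' s Q := by
  refine Runs.seq (T₁ := 1) (Q₁ := fun s' => s' = s.writeReal a 0 x)
    (Runs.rset le_rfl (by simp [IExpr.eval, hx])) ?_ (by omega : 1 + T + 1 ≤ T')
  rintro s' - rfl
  exact h

end RealRAM

namespace SPDC

open Finset RealRAM

variable {I : Inst} {s : State} {Q : State → Prop} {q : ℝ}

lemma Inst.Stored.writeReal (h : I.Stored s) {a : ℕ} (ha : 20 ≤ a) (i : ℕ) (x : ℝ) :
    I.Stored (s.writeReal a i x) := by
  refine h.agree (p := .rset a (.const 0) (rc 0)) ⟨fun _ _ => rfl, fun b hb => ?_⟩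
    (by simpa [Cmd.Above, Cmd.wi, Cmd.wr] using ha)
  exact writeReal_of_ne _ (by simpa [Cmd.wr] using hb) _ _

lemma runs_params {T : ℕ} (hs : I.Stored s) (hq : s.real 20 0 = q) (hm : 1 ≤ I.m)
    (hQ : ∀ s', Agree params s s' → I.AtLevel q s' → Q s') (hT : 21 ≤ T) :
    Runs params T s Q := by
  suffices h : Runs params 21 s (I.AtLevel q) from h.frame.imp hT fun s' h => hQ s' h.1 h.2
  have hn := hs.n
  have hm' := hs.m
  refine Runs.setv (√I.m) ?_ (T := 19) ?_ le_rfl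
  · have : (0 : ℝ) < I.m := by exact_mod_cast hm
    simp [RExpr.eval, IExpr.eval, hm']
    rw [← Real.log_sqrt this.le, Real.exp_log (Real.sqrt_pos.2 this)]
  refine Runs.setv (pL I.n I.m q) ?_ (T := 17) ?_ le_rfl
  · simp [RExpr.eval, IExpr.eval, hm', hn, writeReal_of_ne, hq, pL, sq]
  refine Runs.setv (pG I.n I.m q) ?_ (T := 15) ?_ le_rfl
  · simp [RExpr.eval, IExpr.eval, writeReal_of_ne, hq, pG, sq]
  refine Runs.setv (pS I.n I.m q) ?_ (T := 13) ?_ le_rfl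
  · simp [RExpr.eval, IExpr.eval, writeReal_of_ne, hq, pS]
  refine Runs.setv (pσ I.n I.m q) ?_ (T := 11) ?_ le_rfl
  · simp [RExpr.eval, IExpr.eval, hm', pσ]
  refine Runs.setv (pτ I.n I.m q) ?_ (T := 9) ?_ le_rfl
  · simp [RExpr.eval, IExpr.eval, writeReal_of_ne, pτ]
  refine Runs.setv (2 * I.m + 4 * pS I.n I.m q) ?_ (T := 7) ?_ le_rfl
  · simp [RExpr.eval, IExpr.eval, hm', writeReal_of_ne]
  refine Runs.setv (pθ I.n I.m q) ?_ (T := 5) ?_ le_rfl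
  · simp [RExpr.eval, IExpr.eval, pθ]
  refine Runs.setv (pN I.n I.m q) ?_ (T := 3) ?_ le_rfl
  · simp [RExpr.eval, IExpr.eval, writeReal_of_ne, pN]
  refine Runs.setv (pδ I.n I.m q) ?_ (T := 1) ?_ le_rfl
  · simp [RExpr.eval, IExpr.eval, writeReal_of_ne, pδ]
  refine Runs.rset le_rfl ?_
  refine ⟨?_, ?_, ?_, ?_, ?_, ?_, ?_, ?_, ?_⟩
  · repeat refine Inst.Stored.writeReal ?_ (by norm_num) _ _
    exact hs
  · simp [IExpr.eval, writeReal_of_ne, hq]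
  · simp [IExpr.eval, writeReal_of_ne]
  · simp [IExpr.eval, writeReal_of_ne]
  · simp [IExpr.eval, writeReal_of_ne]
  · simp [IExpr.eval, writeReal_of_ne]
  · simp [IExpr.eval, writeReal_of_ne]
  · simp [IExpr.eval, writeReal_of_ne]
  · simp [RExpr.eval, IExpr.eval, writeReal_of_ne, hm', pZ]

lemma runs_levelInit {T K : ℕ} (hI : I.Valid) (hs : I.AtLevel q s) (hq : Level I.n I.m q)
    (hK : (2 * pZ I.n I.m q + Real.log I.n) / 2 ^ K ≤ pδ I.n I.m q)
    (hQ : ∀ s', Agree levelInit s s' → Iter I q s' → (∀ j < I.n, s'.real 42 j = 0) →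
      (∀ k < I.m, s'.real 44 k = 0) → (∀ j < I.n, s'.real 41 j = s'.real 40 j) → Q s')
    (hT : softT I.n K + 12 * I.n + 4 * I.m + 16 ≤ T) : Runs levelInit T s Q := by
  suffices h : Runs levelInit (softT I.n K + 12 * I.n + 4 * I.m + 16) s fun s' => Iter I q s' ∧
      (∀ j < I.n, s'.real 42 j = 0) ∧ (∀ k < I.m, s'.real 44 k = 0) ∧
      (∀ j < I.n, s'.real 41 j = s'.real 40 j) from
    h.frame.imp hT fun s' h => hQ s' h.1 h.2.1 h.2.2.1 h.2.2.2.1 h.2.2.2.2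
  refine Runs.seq (T₁ := 4 * I.n + 3) (T₂ := softT I.n K + 8 * I.n + 4 * I.m + 12)
    (Q₁ := fun s' => ∀ j < I.n, s'.real 42 j = 0)
    (Runs.fillId I.n _ (fun s' hA => (hs.agree hA (by decide)).n)
      (fun j _ s' _ _ _ => by simp [RExpr.eval, IExpr.eval]) (fun s' _ h => h) le_rfl) ?_ (by omega)
  intro s₁ hA₁ h₁
  have hs₁ := hs.agree hA₁ (by decide)
  refine Runs.seq (T₁ := 4 * I.n + 3) (T₂ := softT I.n K + 4 * I.n + 4 * I.m + 8)
    (Q₁ := fun s' => ∀ j < I.n, s'.real 43 j = 0)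
    (Runs.fillId I.n _ (fun s' hA => (hs₁.agree hA (by decide)).n)
      (fun j _ s' _ _ _ => by simp [RExpr.eval, IExpr.eval]) (fun s' _ h => h) le_rfl) ?_ (by omega)
  intro s₂ hA₂ h₂
  have hs₂ := hs₁.agree hA₂ (by decide)
  refine Runs.seq (T₁ := 4 * I.m + 3) (T₂ := softT I.n K + 4 * I.n + 4)
    (Q₁ := fun s' => ∀ j < I.m, s'.real 44 j = 0)
    (Runs.fillId I.m _ (fun s' hA => (hs₂.agree hA (by decide)).m)
      (fun j _ s' _ _ _ => by simp [RExpr.eval, IExpr.eval]) (fun s' _ h => h) le_rfl) ?_ (by omega)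
  intro s₃ hA₃ h₃
  have hs₃ := hs₂.agree hA₃ (by decide)
  have z₃ : ∀ j < I.n, s₃.real 42 j = 0 := by
    rw [hA₃.real 42 (by decide), hA₂.real 42 (by decide)]; exact h₁
  have u₃ : ∀ j < I.n, s₃.real 43 j = 0 := by rw [hA₃.real 43 (by decide)]; exact h₂
  have hzb : ∀ j < I.n, |s₃.real 42 j| ≤ pZ I.n I.m q := by
    intro j hj; rw [z₃ j hj, abs_zero]; exact hq.pZ_pos.le
  refine Runs.seq (T₁ := softT I.n K) (T₂ := 4 * I.n + 3)
    (runs_softmax hI hs₃ hq hzb hK (fun s' _ h => h) le_rfl) ?_ (by omega)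
  intro s₄ hA₄ h₄
  have hs₄ := hs₃.agree hA₄ (by decide)
  refine Runs.fillId I.n (s₄.real 40) (fun s' hA => (hs₄.agree hA (by decide)).n)
    (fun j _ s' hA hj _ => by simp [RExpr.eval, IExpr.eval, hj, hA.real 40 (by decide)])
    (fun s' hA h => ?_) le_rfl
  have e40 : s'.real 40 = s₄.real 40 := hA.real 40 (by decide)
  have e42 : s'.real 42 = s₃.real 42 := by rw [hA.real 42 (by decide), hA₄.real 42 (by decide)]
  have e43 : s'.real 43 = s₃.real 43 := by rw [hA.real 43 (by decide), hA₄.real 43 (by decide)]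
  have e44 : s'.real 44 = s₃.real 44 := by rw [hA.real 44 (by decide), hA₄.real 44 (by decide)]
  have e45 : s'.real 45 = s₄.real 45 := hA.real 45 (by decide)
  refine ⟨⟨hs₄.agree hA (by decide), ?_, ?_, ?_, ?_⟩, ?_, ?_, ?_⟩
  · rw [e40, e42, e45]; exact h₄
  · rw [e42]; exact hzb
  · intro k hk; rw [e44, h₃ k hk]; norm_num
  · intro j hj
    rw [e43, u₃ j hj, e44]
    exact (sum_eq_zero fun k hk => by rw [h₃ k (mem_range.1 hk), zero_mul]).symm
  · rw [e42]; exact z₃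
  · rw [e44]; exact h₃
  · rw [e40]; exact h

lemma Saddle.sum_sq_le {ηs ws : ℕ → ℝ} (hI : I.Valid) (h : Saddle I q ηs ws) :
    ∑ k ∈ range I.m, ws k ^ 2 ≤ 4 := by
  have h1 : ∑ k ∈ range I.m, ws k ^ 2 = gram I.n I.m I.M ηs ηs :=
    sum_congr rfl fun k _ => by rw [h.ws_eq, sq]
  rw [h1, gram_congr hI.gram, gram_eq_sum]
  have h2 := sum_eq_two hI.c_lt h.mem
  calc _ ≤ ∑ i ∈ range I.n, ∑ j ∈ range I.n, ηs i * ηs j := by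
        refine sum_le_sum fun i hi => sum_le_sum fun j hj => ?_
        have hi' := mem_range.1 hi
        have hj' := mem_range.1 hj
        refine mul_le_of_le_one_left (mul_nonneg (h.mem.1 i hi').1 (h.mem.1 j hj').1) ?_
        exact (_root_.abs_le.1 (abs_gram_entry_le hI.row hi' hj')).2
    _ = 4 := by rw [← sum_mul_sum, h2]; norm_num

/-- The potential at the start of a level. -/
lemma pot_init_le (hI : I.Valid) (hq : Level I.n I.m q) (hs : Iter I q s) {ηs ws : ℕ → ℝ}
    (h : Saddle I q ηs ws) (hz : ∀ j < I.n, s.real 42 j = 0) (hw : ∀ k < I.m, s.real 44 k = 0)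
    (hη : ∀ j < I.n, s.real 41 j = s.real 40 j) :
    pot I q ηs ws s ≤ (1 / pτ I.n I.m q + pG I.n I.m q) * (2 * Real.log I.n + 4 * pδ I.n I.m q) +
      I.m * (1 + 1 / (2 * pσ I.n I.m q)) * 4 := by
  have hP : 0 ≤ 1 / pτ I.n I.m q + pG I.n I.m q :=
    add_nonneg (one_div_nonneg.2 hq.tau_pos.le) hq.pG_pos.le
  have h1 : gap I.n (s.real 42) (s.real 40) ηs ≤ 2 * Real.log I.n := by
    have e1 := ent_nonpos hI.ν_le h.mem
    have e2 := neg_ent_le (by linarith [hI.hn]) hI.c_lt hs.soft.mem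
    have e3 : ∑ j ∈ range I.n, s.real 42 j * (ηs j - s.real 40 j) = 0 :=
      sum_eq_zero fun j hj => by rw [hz j (mem_range.1 hj), zero_mul]
    rw [gap, e3]
    linarith
  have h2 : ∑ k ∈ range I.m, (s.real 44 k - ws k) ^ 2 ≤ 4 := by
    refine le_trans (le_of_eq (sum_congr rfl fun k hk => ?_)) (h.sum_sq_le hI)
    rw [hw k (mem_range.1 hk)]; ring
  have hσ := hq.sigma_pos
  rw [pot, Psi_congr hη, Psi]
  have h3 : l1 I.n (s.real 40) (s.real 40) = 0 := by simp [l1]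
  have h4 : ∀ k, ip I.n I.M k (fun j => s.real 40 j - s.real 40 j) = 0 := fun k => by simp [ip]
  simp only [h3, h4, mul_zero, sum_const_zero, add_zero, ne_eq, OfNat.ofNat_ne_zero,
    not_false_eq_true, zero_pow]
  have h5 := mul_le_mul_of_nonneg_left h1 hP
  have h6 := mul_le_mul_of_nonneg_left h2
    (by positivity : (0 : ℝ) ≤ I.m * (1 + 1 / (2 * pσ I.n I.m q)))
  linarith

end SPDC

/-! ### The test of the result -/

namespace SPDC

open Finset RealRAM

variable {I : Inst} {s : State} {Q : State → Prop} {q : ℝ}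

/-- The memory holds the primal vector, the margins and the dual bounds that belong to the
weights `η`. -/
structure Cert (I : Inst) (η : ℕ → ℝ) (s : State) : Prop where
  w : ∀ k < I.d, s.real 61 k = ip I.n I.A k η
  sq : s.real 62 0 = gram I.n I.d I.A η η
  a : ∀ j < I.n, s.real 63 j = ∑ k ∈ range I.d, ip I.n I.A k η * I.A j k
  slack : ∀ j < I.n, s.real 65 j = max 0 (s.real 64 (I.c j) - s.real 63 j)
  dual : ∀ k < 2, s.real 67 k = dualVal I.n I.ν I.c (s.real 63) (s.real 64) k

/-- The running time of the computation of the dual bounds. -/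
def certT (n d K : ℕ) : ℕ := 8 * (n * d) + 30 * n + 20 * d + softT n K + 60

lemma runs_certificate {T K : ℕ} (hI : I.Valid) (hs : Iter I q s) (hq : Level I.n I.m q)
    (hK : (2 * pZ I.n I.m q + Real.log I.n) / 2 ^ K ≤ pδ I.n I.m q)
    (hQ : ∀ s' z lo η', Agree certificate s s' → Cert I (s.real 40) s' →
      Soft I.n I.ν I.c z lo (pδ I.n I.m q) η' →
      (∀ j < I.n, z j = -s'.real 63 j / pG I.n I.m q) →
      (∀ k < 2, s'.real 64 k = pG I.n I.m q * (lo k - Real.log I.ν)) → Q s')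
    (hT : certT I.n I.d K ≤ T) : Runs certificate T s Q := by
  set η := s.real 40 with hη
  suffices h : Runs certificate (certT I.n I.d K) s fun s' => Cert I η s' ∧ ∃ z lo η',
      Soft I.n I.ν I.c z lo (pδ I.n I.m q) η' ∧
      (∀ j < I.n, z j = -s'.real 63 j / pG I.n I.m q) ∧
      (∀ k < 2, s'.real 64 k = pG I.n I.m q * (lo k - Real.log I.ν)) by
    refine h.frame.imp hT ?_
    rintro s' ⟨h0, h1, z, lo, η', h2, h3, h4⟩
    exact hQ s' z lo η' h0 h1 h2 h3 h4
  have e1 : I.d * (4 * I.n + 10) = 4 * (I.n * I.d) + 10 * I.d := by ring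
  have e2 : I.n * (4 * I.d + 10) = 4 * (I.n * I.d) + 10 * I.n := by ring
  have hγ := hq.pG_pos
  unfold certT
  refine Runs.seq (T₁ := I.d * (4 * I.n + 10) + 3)
    (T₂ := 4 * (I.n * I.d) + 30 * I.n + 10 * I.d + softT I.n K + 56)
    (Q₁ := fun s' => ∀ k < I.d, s'.real 61 k = ip I.n I.A k η)
    (Runs.fillBody I.d (4 * I.n + 7) id (fun k => ip I.n I.A k η) (by decide) (fun _ _ _ _ h => h)
      (fun s' hA => (hs.agree hA (by decide)).d) ?_ (fun s' _ h _ => h) le_rfl) ?_ (by omega)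
  · intro k hk s' hA hk' _
    have hs' := hs.agree hA (by decide)
    refine Runs.seq (T₁ := 4 * I.n + 5) (T₂ := 1) (Q₁ := fun s'' => s''.real 60 0 = ip I.n I.A k η)
      (Runs.accum I.n _ (fun s'' hA' => (hs'.agree hA' (by decide)).n) (fun j hj s'' hA' hj' => ?_)
        (fun s'' _ h => h) le_rfl) ?_ (by omega)
    · have hs'' := hs'.agree hA' (by decide)
      simp [RExpr.eval, IExpr.eval, hj', hA'.int 11 (by decide), hk', hs''.offD j hj,
        hs''.A j hj k hk, hA'.real 40 (by decide), hA.real 40 (by decide), hη]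
    · intro s'' hA' h
      refine Runs.rset le_rfl ?_
      simp [RExpr.eval, IExpr.eval, hA'.int 11 (by decide), hk', h, hA'.real 61 (by decide)]
  intro s₁ hA₁ h₁
  have hs₁ := hs.agree hA₁ (by decide)
  refine Runs.seq (T₁ := 4 * I.d + 5)
    (T₂ := 4 * (I.n * I.d) + 30 * I.n + 6 * I.d + softT I.n K + 50)
    (Q₁ := fun s' => s'.real 62 0 = gram I.n I.d I.A η η)
    (Runs.accum I.d (fun k => ip I.n I.A k η * ip I.n I.A k η)
      (fun s' hA => (hs₁.agree hA (by decide)).d) (fun k hk s' hA hk' => ?_)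
      (fun s' _ h => h) le_rfl) ?_ (by omega)
  · simp [RExpr.eval, IExpr.eval, hk', hA.real 61 (by decide), h₁ k hk]
  intro s₂ hA₂ h₂
  have hs₂ := hs₁.agree hA₂ (by decide)
  have w₂ : s₂.real 61 = s₁.real 61 := hA₂.real 61 (by decide)
  refine Runs.seq (T₁ := I.n * (4 * I.d + 10) + 3)
    (T₂ := 20 * I.n + 6 * I.d + softT I.n K + 46)
    (Q₁ := fun s' => ∀ j < I.n, s'.real 63 j = ∑ k ∈ range I.d, ip I.n I.A k η * I.A j k)
    (Runs.fillBody I.n (4 * I.d + 7) id (fun j => ∑ k ∈ range I.d, ip I.n I.A k η * I.A j k)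
      (by decide) (fun _ _ _ _ h => h) (fun s' hA => (hs₂.agree hA (by decide)).n) ?_
      (fun s' _ h _ => h) le_rfl) ?_ (by omega)
  · intro j hj s' hA hj' _
    have hs' := hs₂.agree hA (by decide)
    refine Runs.seq (T₁ := 4 * I.d + 5) (T₂ := 1)
      (Q₁ := fun s'' => s''.real 60 0 = ∑ k ∈ range I.d, ip I.n I.A k η * I.A j k)
      (Runs.accum I.d _ (fun s'' hA' => (hs'.agree hA' (by decide)).d) (fun k hk s'' hA' hk' => ?_)
        (fun s'' _ h => h) le_rfl) ?_ (by omega)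
    · have hs'' := hs'.agree hA' (by decide)
      simp [RExpr.eval, IExpr.eval, hk', hA'.int 10 (by decide), hj', hs''.offD j hj,
        hs''.A j hj k hk, hA'.real 61 (by decide), hA.real 61 (by decide), w₂, h₁ k hk]
    · intro s'' hA' h
      refine Runs.rset le_rfl ?_
      simp [RExpr.eval, IExpr.eval, hA'.int 10 (by decide), hj', h, hA'.real 63 (by decide)]
  intro s₃ hA₃ h₃
  have hs₃ := hs₂.agree hA₃ (by decide)
  refine Runs.seq (T₁ := 4 * I.n + 3) (T₂ := 16 * I.n + 6 * I.d + softT I.n K + 42)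
    (Q₁ := fun s' => ∀ j < I.n, s'.real 42 j = -s₃.real 63 j / pG I.n I.m q)
    (Runs.fillId I.n _ (fun s' hA => (hs₃.agree hA (by decide)).n)
      (fun j _ s' hA hj' _ => ?_) (fun s' _ h => h) le_rfl) ?_ (by omega)
  · simp [RExpr.eval, IExpr.eval, hj', hA.real 63 (by decide), (hs₃.agree hA (by decide)).γ]
  intro s₄ hA₄ h₄
  have hs₄ := hs₃.agree hA₄ (by decide)
  have hz : ∀ j < I.n, |s₄.real 42 j| ≤ pZ I.n I.m q := by
    intro j hj
    have h5 : |s₃.real 63 j| ≤ 2 := by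
      rw [h₃ j hj]
      have h6 : ∑ k ∈ range I.d, ip I.n I.A k η * I.A j k =
          ∑ i ∈ range I.n, (∑ k ∈ range I.d, I.A i k * I.A j k) * η i := by
        simp only [ip, sum_mul]
        rw [sum_comm]
        exact sum_congr rfl fun i _ => sum_congr rfl fun k _ => by ring
      rw [h6, ← sum_eq_two hI.c_lt hs.soft.mem]
      refine (abs_sum_le_sum_abs _ _).trans (sum_le_sum fun i hi => ?_)
      have h0 := (hs.soft.mem.1 i (mem_range.1 hi)).1
      rw [abs_mul, abs_of_nonneg h0]
      exact mul_le_of_le_one_left h0 (abs_gram_entry_le hI.row (mem_range.1 hi) hj)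
    rw [h₄ j hj, abs_div, abs_neg, abs_of_pos hγ, pZ]
    have := hq.one_le_m
    exact div_le_div_of_nonneg_right (by linarith) hγ.le
  refine Runs.seq (T₁ := softT I.n K) (T₂ := 16 * I.n + 6 * I.d + 40)
    (runs_softmax hI hs₄ hq hz hK (fun s' _ h => h) le_rfl) ?_ (by omega)
  intro s₅ hA₅ h₅
  have hs₅ := hs₄.agree hA₅ (by decide)
  have a₅ : s₅.real 63 = s₃.real 63 := by rw [hA₅.real 63 (by decide), hA₄.real 63 (by decide)]
  set lo := s₅.real 45 with hlo
  refine Runs.seq (T₁ := 1) (T₂ := 16 * I.n + 38)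
    (Q₁ := fun s' => s'.real 64 0 = pG I.n I.m q * (lo 0 - Real.log I.ν))
    (Runs.rset le_rfl ?_) ?_ (by omega)
  · simp [RExpr.eval, IExpr.eval, hs₅.γ, hs₅.ν, hlo]
  intro s₆ hA₆ h₆
  have hs₆ := hs₅.agree hA₆ (by decide)
  refine Runs.seq (T₁ := 1) (T₂ := 16 * I.n + 36)
    (Q₁ := fun s' => ∀ k < 2, s'.real 64 k = pG I.n I.m q * (lo k - Real.log I.ν))
    (Runs.rset le_rfl ?_) ?_ (by omega)
  · intro k hk
    interval_cases k
    · simp [IExpr.eval, h₆]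
    · simp [RExpr.eval, IExpr.eval, hs₆.γ, hs₆.ν, hA₆.real 45 (by decide), hlo]
  intro s₇ hA₇ h₇
  have hs₇ := hs₆.agree hA₇ (by decide)
  have a₇ : s₇.real 63 = s₃.real 63 := by
    rw [hA₇.real 63 (by decide), hA₆.real 63 (by decide), a₅]
  refine Runs.seq (T₁ := 5 * I.n + 3) (T₂ := 11 * I.n + 30)
    (Q₁ := fun s' => ∀ j < I.n, s'.real 65 j = max 0 (s₇.real 64 (I.c j) - s₃.real 63 j))
    (Runs.fillBody I.n 2 id (fun j => max 0 (s₇.real 64 (I.c j) - s₃.real 63 j)) (by decide)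
      (fun _ _ _ _ h => h) (fun s' hA => (hs₇.agree hA (by decide)).n) (fun j hj s' hA hj' _ => ?_)
      (fun s' _ h _ => h) (by omega)) ?_ (by omega)
  · have hs' := hs₇.agree hA (by decide)
    refine Runs.ite (T := 1) (fun h => Runs.rset le_rfl ?_) (fun h => Runs.rset le_rfl ?_) le_rfl
    · simp only [BExpr.Holds, RExpr.eval, IExpr.eval, hj', hs'.c j hj, hA.real 63 (by decide),
        hA.real 64 (by decide), a₇] at h
      rw [max_eq_right (by linarith)]
      simp [RExpr.eval, IExpr.eval, hj', hs'.c j hj, hA.real 63 (by decide),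
        hA.real 64 (by decide), a₇]
    · simp only [BExpr.Holds, RExpr.eval, IExpr.eval, hj', hs'.c j hj, hA.real 63 (by decide),
        hA.real 64 (by decide), a₇, not_lt] at h
      rw [max_eq_left (by linarith)]
      simp [RExpr.eval, IExpr.eval, hj']
  intro s₈ hA₈ h₈
  have hs₈ := hs₇.agree hA₈ (by decide)
  refine Runs.seq (T₁ := 4 * I.n + 7) (T₂ := 10)
    (Q₁ := fun s' => ∀ k < 2, s'.real 66 k = csum I.n I.c (s₈.real 65) k)
    (runs_classSum hs₈.toStored (by norm_num) (by norm_num) (fun s' _ h => h) le_rfl) ?_ (by omega)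
  intro s₉ hA₉ h₉
  have hs₉ := hs₈.agree hA₉ (by decide)
  have t₉ : s₉.real 64 = s₇.real 64 := by rw [hA₉.real 64 (by decide), hA₈.real 64 (by decide)]
  have a₉ : s₉.real 63 = s₃.real 63 := by
    rw [hA₉.real 63 (by decide), hA₈.real 63 (by decide), a₇]
  have key : ∀ k < 2, s₇.real 64 k - I.ν * csum I.n I.c (s₈.real 65) k =
      dualVal I.n I.ν I.c (s₃.real 63) (s₇.real 64) k := by
    intro k hk
    rw [dualVal, csum_congr fun j hj hj' => (h₈ j hj).trans (by rw [hj'])]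
    rfl
  refine Runs.seq (T₁ := 1) (T₂ := 1)
    (Q₁ := fun s' => s'.real 67 0 = dualVal I.n I.ν I.c (s₃.real 63) (s₇.real 64) 0)
    (Runs.rset le_rfl ?_) ?_ (by omega)
  · rw [← key 0 two_pos]
    simp [RExpr.eval, IExpr.eval, hs₉.ν, t₉, h₉ 0 two_pos]
  intro s₁₀ hA₁₀ h₁₀
  have hs₁₀ := hs₉.agree hA₁₀ (by decide)
  have a₁₀ : s₁₀.real 63 = s₃.real 63 := by rw [hA₁₀.real 63 (by decide), a₉]
  have t₁₀ : s₁₀.real 64 = s₇.real 64 := by rw [hA₁₀.real 64 (by decide), t₉]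
  refine Runs.rset le_rfl ⟨⟨?_, ?_, ?_, ?_, ?_⟩, s₄.real 42, lo, s₅.real 40, h₅, ?_, ?_⟩
  · rw [writeReal_of_ne _ (by norm_num), hA₁₀.real 61 (by decide), hA₉.real 61 (by decide),
      hA₈.real 61 (by decide), hA₇.real 61 (by decide), hA₆.real 61 (by decide),
      hA₅.real 61 (by decide), hA₄.real 61 (by decide), hA₃.real 61 (by decide), w₂]
    exact h₁
  · rw [writeReal_of_ne _ (by norm_num), hA₁₀.real 62 (by decide), hA₉.real 62 (by decide),
      hA₈.real 62 (by decide), hA₇.real 62 (by decide), hA₆.real 62 (by decide),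
      hA₅.real 62 (by decide), hA₄.real 62 (by decide), hA₃.real 62 (by decide)]
    exact h₂
  · rw [writeReal_of_ne _ (by norm_num), a₁₀]; exact h₃
  · rw [writeReal_of_ne _ (by norm_num), writeReal_of_ne _ (by norm_num),
      writeReal_of_ne _ (by norm_num), a₁₀, t₁₀, hA₁₀.real 65 (by decide), hA₉.real 65 (by decide)]
    exact h₈
  · rw [writeReal_of_ne (b := 63) _ (by norm_num), writeReal_of_ne (b := 64) _ (by norm_num),
      a₁₀, t₁₀]
    intro k hk
    interval_cases k
    · simp [IExpr.eval, h₁₀]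
    · rw [← key 1 one_lt_two]
      simp [RExpr.eval, IExpr.eval, hs₁₀.ν, t₁₀, hA₁₀.real 66 (by decide), h₉ 1 one_lt_two]
  · rw [writeReal_of_ne _ (by norm_num), a₁₀]; exact h₄
  · rw [writeReal_of_ne _ (by norm_num), t₁₀]; exact h₇

end SPDC

namespace SPDC

open Finset RealRAM

variable {I : Inst} {s : State} {Q : State → Prop} {q : ℝ}

/-- The test of the dual bounds, and the output. -/
def test (out : Cmd) : Cmd :=
  .ite (.rlt (.add (.load 67 (.const 0)) (.load 67 (.const 1)))
      (.mul (.sub (rc 1) (.div (rv 2) (rc 2))) (rv 62)))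
    skip (.seq out (.iset 15 (.const 0) (.const 1)))

/-- The output is right whenever the dual bounds pass the test; it is not affected by the flag that
ends the loop over the levels. -/
def Inst.OutputSpec (I : Inst) (out : Cmd) (T : ℕ) (good : State → Prop) : Prop :=
  (∀ s η, I.Stored s → η ∈ capSimplex I.n I.ν I.c → Cert I η s →
    (1 - I.ε / 2) * gram I.n I.d I.A η η ≤ dualVal I.n I.ν I.c (s.real 63) (s.real 64) 0 +
      dualVal I.n I.ν I.c (s.real 63) (s.real 64) 1 → Runs out T s good) ∧
  ∀ s x, good s → good (s.writeInt 15 0 x)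

lemma val_test {out : Cmd} {K Tout : ℕ} {good : State → Prop} {p : ENNReal} {φ : State → ENNReal}
    (hI : I.Valid) (hs : Iter I q s) (hq : Level I.n I.m q)
    (hK : (2 * pZ I.n I.m q + Real.log I.n) / 2 ^ K ≤ pδ I.n I.m q)
    (hout : I.OutputSpec out Tout good)
    (hfail : ∀ s' z lo η', I.Stored s' → s'.real 20 0 = q → s'.int 15 0 = s.int 15 0 →
      Cert I (s.real 40) s' → Soft I.n I.ν I.c z lo (pδ I.n I.m q) η' →
      (∀ j < I.n, z j = -s'.real 63 j / pG I.n I.m q) →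
      (∀ k < 2, s'.real 64 k = pG I.n I.m q * (lo k - Real.log I.ν)) →
      dualVal I.n I.ν I.c (s'.real 63) (s'.real 64) 0 +
        dualVal I.n I.ν I.c (s'.real 63) (s'.real 64) 1 <
          (1 - I.ε / 2) * gram I.n I.d I.A (s.real 40) (s.real 40) → p ≤ φ (s'.writeInt 17 0 0))
    (hφ : ∀ s', good s' → s'.int 15 0 = 1 → p ≤ φ s') :
    p ≤ val φ (certT I.n I.d K + Tout + 5) ([.seq certificate (test out)], s) := by
  refine le_trans ?_ (val_seq (T₁ := certT I.n I.d K) (T₂ := Tout + 3) (by omega))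
  refine Runs.le_val (runs_certificate (Q := fun s' => ∃ z lo η', Agree certificate s s' ∧
    Cert I (s.real 40) s' ∧ Soft I.n I.ν I.c z lo (pδ I.n I.m q) η' ∧
    (∀ j < I.n, z j = -s'.real 63 j / pG I.n I.m q) ∧
    (∀ k < 2, s'.real 64 k = pG I.n I.m q * (lo k - Real.log I.ν))) hI hs hq hK
    (fun s' z lo η' h0 h1 h2 h3 h4 => ⟨z, lo, η', h0, h1, h2, h3, h4⟩) le_rfl) ?_
  rintro s' ⟨z, lo, η', hA, hc, hsoft, hz, hth⟩
  have hs' := hs.agree hA (by decide)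
  have hb : (BExpr.rlt (.add (.load 67 (.const 0)) (.load 67 (.const 1)))
      (.mul (.sub (rc 1) (.div (rv 2) (rc 2))) (rv 62))).Holds s' ↔
      dualVal I.n I.ν I.c (s'.real 63) (s'.real 64) 0 +
        dualVal I.n I.ν I.c (s'.real 63) (s'.real 64) 1 <
          (1 - I.ε / 2) * gram I.n I.d I.A (s.real 40) (s.real 40) := by
    simp [BExpr.Holds, RExpr.eval, IExpr.eval, hc.dual 0 two_pos, hc.dual 1 one_lt_two, hs'.ε,
      hc.sq]
  by_cases h : (BExpr.rlt (.add (.load 67 (.const 0)) (.load 67 (.const 1)))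
      (.mul (.sub (rc 1) (.div (rv 2) (rc 2))) (rv 62))).Holds s'
  · have := hfail s' z lo η' hs'.toStored hs'.guess (by rw [hA.int 15 (by decide)]) hc hsoft hz hth
      (hb.1 h)
    simpa [RealRAM.val, test, h, IExpr.eval] using this
  · have hr := hout.1 s' (s.real 40) hs'.toStored hs.soft.mem hc (not_lt.1 (mt hb.2 h))
    have h1 : p ≤ val φ (Tout + 2) ([.seq out (.iset 15 (.const 0) (.const 1))], s') := by
      refine le_trans ?_ (val_seq (T₁ := Tout) (T₂ := 1) (by omega))
      refine hr.le_val fun s'' h'' => ?_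
      simpa [RealRAM.val, IExpr.eval] using hφ _ (hout.2 s'' 1 h'') (by simp)
    simpa [RealRAM.val, test, h] using h1

/-- The running time of a level with at most `N` steps. -/
def levelT (n d m p K N Tout : ℕ) : ℕ :=
  iterT n p K N + certT n d K + softT n K + 12 * n + 4 * m + Tout + 60

lemma level_eq (out : Cmd) : level out = .seq (setv 20 (.div (rv 20) (rc 2)))
    (.seq params (.seq levelInit (.seq iterate (.seq certificate (test out))))) := rfl

/-- A level, for a functional `1 - a * pot` of the memory after the iteration. -/
lemma val_level {out : Cmd} {p K N Tout : ℕ} {φ : State → ENNReal} (hI : I.Valid) (hf : I.Flat)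
    (hp : I.m = 2 ^ p) (hq : Level I.n I.m q) (hs : I.Stored s) (h20 : s.real 20 0 = 2 * q)
    {ηs ws : ℕ → ℝ} (hsad : Saddle I q ηs ws)
    (hK : (2 * pZ I.n I.m q + Real.log I.n) / 2 ^ K ≤ pδ I.n I.m q) (hN : ⌈pN I.n I.m q⌉₊ ≤ N)
    {a : ℝ} (ha : 0 ≤ a) {C : ENNReal}
    (hφ : ∀ s', Iter I q s' → s'.int 15 0 = s.int 15 0 → ENNReal.ofReal (1 - a * pot I q ηs ws s') *
      C ≤ val φ (certT I.n I.d K + Tout + 5) ([.seq certificate (test out)], s')) :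
    ENNReal.ofReal (1 - (a * pθ I.n I.m q ^ ⌈pN I.n I.m q⌉₊ * ((1 / pτ I.n I.m q + pG I.n I.m q) *
      (2 * Real.log I.n + 4 * pδ I.n I.m q) + I.m * (1 + 1 / (2 * pσ I.n I.m q)) * 4) +
      (⌈pN I.n I.m q⌉₊ : ℕ) * (a * (1 / pτ I.n I.m q + pG I.n I.m q) * (4 * pδ I.n I.m q)))) * C ≤
      val φ (levelT I.n I.d I.m p K N Tout) ([level out], s) := by
  rw [level_eq]
  unfold levelT
  refine le_trans ?_ (val_seq (T₁ := 1) (T₂ := iterT I.n p K N + certT I.n I.d K + softT I.n K +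
    12 * I.n + 4 * I.m + Tout + 58) (by omega))
  refine Runs.le_val (Q := fun s' => Agree (setv 20 (.div (rv 20) (rc 2))) s s' ∧ s'.real 20 0 = q)
    (Runs.frame (Runs.rset le_rfl ?_)) ?_
  · simp [RExpr.eval, IExpr.eval, h20]
  rintro s₁ ⟨hA₁, h₁⟩
  refine le_trans ?_ (val_seq (T₁ := 21) (T₂ := iterT I.n p K N + certT I.n I.d K + softT I.n K +
    12 * I.n + 4 * I.m + Tout + 34) (by omega))
  refine Runs.le_val (runs_params (Q := fun s' => Agree params s₁ s' ∧ I.AtLevel q s')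
    (hs.agree hA₁ (by decide)) h₁ hI.hm (fun s' h h' => ⟨h, h'⟩) le_rfl) ?_
  rintro s₂ ⟨hA₂, hs₂⟩
  refine le_trans ?_ (val_seq (T₁ := softT I.n K + 12 * I.n + 4 * I.m + 16)
    (T₂ := iterT I.n p K N + certT I.n I.d K + Tout + 10) (by omega))
  refine Runs.le_val (runs_levelInit (Q := fun s' => Agree levelInit s₂ s' ∧ Iter I q s' ∧
    pot I q ηs ws s' ≤ (1 / pτ I.n I.m q + pG I.n I.m q) *
      (2 * Real.log I.n + 4 * pδ I.n I.m q) + I.m * (1 + 1 / (2 * pσ I.n I.m q)) * 4) hI hs₂ hq hK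
    (fun s' h h1 h2 h3 h4 => ⟨h, h1, pot_init_le hI hq h1 hsad h2 h3 h4⟩) le_rfl) ?_
  rintro s₃ ⟨hA₃, hs₃, hpot⟩
  refine le_trans ?_ (val_seq (T₁ := iterT I.n p K N) (T₂ := certT I.n I.d K + Tout + 5)
    (by omega))
  have hT : iterT I.n p K ⌈pN I.n I.m q⌉₊ ≤ iterT I.n p K N := by
    unfold iterT
    have := Nat.mul_le_mul_right (6 * p + coordT I.n K + 9) hN
    omega
  refine le_trans ?_ (val_le_val hT _)
  refine le_trans (mul_le_mul_left (ENNReal.ofReal_le_ofReal ?_) C)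
    (val_iterate hI hf hp hq hs₃ hsad hK ha rfl (C := C) fun s' hs' hA => hφ s' hs' ?_)
  · have := mul_le_mul_of_nonneg_left hpot (mul_nonneg ha (pow_nonneg
      (by linarith [hq.half_le_theta] : 0 ≤ pθ I.n I.m q) ⌈pN I.n I.m q⌉₊))
    linarith
  · rw [hA.int 15 (by decide), hA₃.int 15 (by decide), hA₂.int 15 (by decide),
      hA₁.int 15 (by decide)]

lemma exists_Saddle (hI : I.Valid) (hq : Level I.n I.m q) : ∃ ηs ws, Saddle I q ηs ws := by
  obtain ⟨ηs, h1, h2⟩ := exists_saddle I.M I.m hq.pG_pos hI.nonempty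
  exact ⟨ηs, fun k => ip I.n I.M k ηs, h1, h2, fun _ => rfl⟩

/-- A level whose guess is too large does no harm. -/
lemma le_val_level {out : Cmd} {p K N Tout : ℕ} {good : State → Prop} {φ : State → ENNReal}
    {C : ENNReal} (hI : I.Valid) (hf : I.Flat) (hp : I.m = 2 ^ p) (hq : Level I.n I.m q)
    (hs : I.Stored s) (h20 : s.real 20 0 = 2 * q) (h15 : s.int 15 0 = 0)
    (hK : (2 * pZ I.n I.m q + Real.log I.n) / 2 ^ K ≤ pδ I.n I.m q) (hN : ⌈pN I.n I.m q⌉₊ ≤ N)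
    (hout : I.OutputSpec out Tout good)
    (hfail : ∀ s', I.Stored s' → s'.real 20 0 = q → s'.int 15 0 = 0 → C ≤ φ s')
    (hφ : ∀ s', good s' → s'.int 15 0 = 1 → C ≤ φ s') :
    C ≤ val φ (levelT I.n I.d I.m p K N Tout) ([level out], s) := by
  obtain ⟨ηs, ws, hsad⟩ := exists_Saddle hI hq
  refine le_trans (by simp) (val_level (C := C) hI hf hp hq hs h20 hsad hK hN le_rfl
    fun s' hs' h' => ?_)
  rw [zero_mul, sub_zero, ENNReal.ofReal_one, one_mul]
  refine val_test hI hs' hq hK hout (fun s'' z lo η' h1 h2 h3 _ _ _ _ _ => ?_) hφ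
  have hA : Agree skip s'' (s''.writeInt 17 0 0) :=
    ⟨fun a ha => writeInt_of_ne _ (by simpa [Cmd.wi] using ha) _ _, fun _ _ => rfl⟩
  refine hfail _ (h1.agree hA (by decide)) h2 ?_
  rw [writeInt_of_ne _ (by norm_num), h3, h', h15]

/-- A level whose guess is small enough succeeds with high probability. -/
lemma le_val_level_of_sq_le {out : Cmd} {p K N Tout : ℕ} {good : State → Prop}
    {φ : State → ENNReal} {β : ℝ} (hI : I.Valid) (hf : I.Flat) (hp : I.m = 2 ^ p)
    (hq : Level I.n I.m q) (hs : I.Stored s) (h20 : s.real 20 0 = 2 * q)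
    (hK : (2 * pZ I.n I.m q + Real.log I.n) / 2 ^ K ≤ pδ I.n I.m q) (hN : ⌈pN I.n I.m q⌉₊ ≤ N)
    (hβ : ∀ η ∈ capSimplex I.n I.ν I.c, β ≤ gram I.n I.d I.A η η) (hqβ : q ^ 2 ≤ I.ε * β)
    (hout : I.OutputSpec out Tout good)
    (hφ : ∀ s', good s' → s'.int 15 0 = 1 → 1 ≤ φ s') :
    ENNReal.ofReal (1 - 1 / (2 * I.n)) ≤
      val φ (levelT I.n I.d I.m p K N Tout) ([level out], s) := by
  obtain ⟨ηs, ws, hsad⟩ := exists_Saddle hI hq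
  have hσ := hq.sigma_pos
  have hL := hq.one_le_pL
  have hq0 := hq.hq
  have hδ := pδ_pos (n := I.n) (m := I.m) (q := q)
  set a := 1 / (3 * pσ I.n I.m q * (4 * pL I.n I.m q) * (q ^ 2 / 64) ^ 2) with ha
  have ha0 : 0 ≤ a := by positivity
  have hfl := hq.failure_le (Nat.le_ceil _) (Nat.ceil_lt_add_one (by
    have := hq.rate_ge
    unfold pN; positivity)).le le_rfl
  refine le_trans ?_ (val_level (C := 1) hI hf hp hq hs h20 hsad hK hN ha0 fun s' hs' _ => ?_)
  · rw [mul_one]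
    exact ENNReal.ofReal_le_ofReal (by linarith)
  rw [mul_one]
  -- If the potential is small, then the weights are close to the optimum, and the test succeeds.
  rcases le_or_gt 1 (a * pot I q ηs ws s') with h | h
  · rw [ENNReal.ofReal_of_nonpos (by linarith)]; exact zero_le
  have hpot0 : 3 * pσ I.n I.m q * (4 * pL I.n I.m q) * l1 I.n ηs (s'.real 40) ^ 2 ≤
      pot I q ηs ws s' := by
    refine le_Psi hI.hm hσ (fun j hj i hi => (hf j hj i hi).trans hq.flat_le) (by linarith) ?_
      (hs'.soft.le_gap hI.c_lt hδ.le hsad.mem)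
    rw [inv_tau]; linarith [hq.pG_pos]
  have hl1 : l1 I.n ηs (s'.real 40) ≤ q ^ 2 / 64 := by
    have h1 : a * (3 * pσ I.n I.m q * (4 * pL I.n I.m q) * l1 I.n ηs (s'.real 40) ^ 2) =
        l1 I.n ηs (s'.real 40) ^ 2 / (q ^ 2 / 64) ^ 2 := by
      rw [ha]; field_simp
    have h2 := (mul_le_mul_of_nonneg_left hpot0 ha0).trans_lt h
    rw [h1, div_lt_one (by positivity)] at h2
    exact (lt_of_pow_lt_pow_left₀ 2 (by positivity) h2).le
  have hpot' : 0 ≤ pot I q ηs ws s' := le_trans (by positivity) hpot0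
  refine le_trans (ENNReal.ofReal_le_one.2 (by linarith [mul_nonneg ha0 hpot'])) ?_
  refine val_test hI hs' hq hK hout (fun s'' z lo η' _ _ _ hc hsoft hz hth hlt => ?_) hφ
  exfalso
  have h3 := certificate_of_close (by linarith [hI.hn]) hI.c_lt hI.ν_le hI.ν_pos hq.pG_pos hδ.le
    hI.row hI.gram hsad.mem hsad.vi hs'.soft.mem hl1 hc.a hsoft hz hth
  have h4 := hq.accuracy_le
  have h5 := hβ _ hs'.soft.mem
  nlinarith [mul_le_mul_of_nonneg_left h5 hI.ε_pos.le]

open Classical in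
/-- The loop over the levels, if `J` halvings of the guess suffice. -/
lemma val_levels {out : Cmd} {p K N Tout J : ℕ} {good : State → Prop} {β : ℝ} (hI : I.Valid)
    (hf : I.Flat) (hp : I.m = 2 ^ p) (hs : I.Stored s) (h20 : s.real 20 0 = 1)
    (h15 : s.int 15 0 = 0)
    (hK : ∀ k ≤ J, (2 * pZ I.n I.m ((1 / 2) ^ (k + 1)) + Real.log I.n) / 2 ^ K ≤
      pδ I.n I.m ((1 / 2) ^ (k + 1)))
    (hN : ∀ k ≤ J, ⌈pN I.n I.m ((1 / 2) ^ (k + 1))⌉₊ ≤ N)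
    (hβ : ∀ η ∈ capSimplex I.n I.ν I.c, β ≤ gram I.n I.d I.A η η)
    (hJ : ((1 / 2 : ℝ) ^ (J + 1)) ^ 2 ≤ I.ε * β) (hout : I.OutputSpec out Tout good) :
    ENNReal.ofReal (1 - 1 / (2 * I.n)) ≤ val (fun s => if good s then 1 else 0)
      ((J + 1) * (levelT I.n I.d I.m p K N Tout + 1) + 1)
      ([.loop (.ilt (iv 15) (.const 1)) (level out)], s) := by
  set C := ENNReal.ofReal (1 - 1 / (2 * I.n)) with hC
  have hC1 : C ≤ 1 := ENNReal.ofReal_le_one.2 (by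
    have : (0 : ℝ) ≤ 1 / (2 * I.n) := by positivity
    linarith)
  let ψ : ℕ → State → ENNReal := fun k s =>
    if k ≤ J ∧ I.Stored s ∧ s.real 20 0 = (1 / 2) ^ k ∧ s.int 15 0 = 0 then C
    else if s.int 15 0 = 1 ∧ good s then 1 else 0
  have hψ1 : ∀ k s, good s → s.int 15 0 = 1 → ψ k s = 1 := by
    intro k s hg h1
    simp [ψ, hg, h1]
  have h0 : ψ 0 s = C := by simp [ψ, hs, h20, h15]
  rw [← h0]
  have hL : ∀ k, Level I.n I.m ((1 / 2) ^ (k + 1)) := fun k =>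
    ⟨hI.hn, hI.hm, by positivity, pow_le_one₀ (by norm_num) (by norm_num)⟩
  refine val_loop ψ (J + 1) _ (fun k _ s' hb => ?_) (fun k hk s' hb => ?_) (fun s' hb => ?_) s
  · simp only [BExpr.Holds, IExpr.eval, not_lt] at hb
    dsimp only [ψ]
    rw [if_neg (by omega)]
    split_ifs with h1 h2
    · exact le_rfl
    · exact absurd h1.2 h2
    · exact zero_le
    · exact zero_le
  · simp only [BExpr.Holds, IExpr.eval] at hb
    by_cases h : k ≤ J ∧ I.Stored s' ∧ s'.real 20 0 = (1 / 2) ^ k ∧ s'.int 15 0 = 0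
    · have h20' : s'.real 20 0 = 2 * (1 / 2) ^ (k + 1) := by rw [h.2.2.1, pow_succ]; ring
      have e : ψ k s' = C := if_pos h
      rw [e]
      rcases h.1.lt_or_eq with hlt | rfl
      · refine le_val_level hI hf hp (hL k) h.2.1 h20' h.2.2.2 (hK k h.1) (hN k h.1) hout
          (fun s'' h1 h2 h3 => ?_) fun s'' h1 h2 => ?_
        · exact le_of_eq (if_pos ⟨hlt, h1, h2, h3⟩).symm
        · rw [hψ1 _ _ h1 h2]; exact hC1
      · exact le_val_level_of_sq_le hI hf hp (hL k) h.2.1 h20' (hK k h.1) (hN k h.1) hβ hJ hout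
          fun s'' h1 h2 => (hψ1 _ _ h1 h2).ge
    · have e : ψ k s' = 0 := by
        dsimp only [ψ]
        rw [if_neg h, if_neg (by omega)]
      rw [e]; exact zero_le
  · simp only [BExpr.Holds, IExpr.eval] at hb
    dsimp only [ψ]
    rw [if_neg (by omega), if_neg (by omega)]

end SPDC

/-! ### The preparation of the data -/

namespace RealRAM

lemma Runs.isetSeq {a : ℕ} {i e : IExpr} {c : Cmd} {T T' : ℕ} {s : State} {Q : State → Prop}
    (h : Runs c T (s.writeInt a (i.eval s) (e.eval s)) Q) (hT : T + 2 ≤ T') :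
    Runs (.seq (.iset a i e) c) T' s Q := by
  refine Runs.seq (T₁ := 1) (Q₁ := fun s' => s' = s.writeInt a (i.eval s) (e.eval s))
    (Runs.iset le_rfl rfl) ?_ (by omega : 1 + T + 1 ≤ T')
  rintro s' - rfl
  exact h

lemma rowIndex_inj {m i j k l : ℕ} (hk : k < m) (hl : l < m) (h : i * m + k = j * m + l) :
    i = j ∧ k = l := by
  have h1 : i = j := by
    have := congrArg (· / m) h
    simpa [Nat.add_div_of_dvd_right, Nat.mul_div_cancel _ (by omega : 0 < m),
      Nat.div_eq_of_lt hk, Nat.div_eq_of_lt hl] using this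
  subst h1
  exact ⟨rfl, by omega⟩

/-- A loop whose `j`-th pass writes row `j` of a matrix with row length `m`. -/
lemma Runs.fillRows {v a : ℕ} {N : IExpr} {c : Cmd} {s : State} {Q : State → Prop} {T' : ℕ}
    (n m T : ℕ) (f : ℕ → ℕ → ℝ) (hv : v ∉ c.wi)
    (hN : ∀ s', Agree (RealRAM.forLoop v N c) s s' → N.eval s' = n)
    (hc : ∀ j < n, ∀ s', Agree (RealRAM.forLoop v N c) s s' → s'.int v 0 = j →
      Runs c T s' fun s'' => (∀ k < m, s''.real a (j * m + k) = f j k) ∧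
        ∀ i, (∀ k < m, j * m + k ≠ i) → s''.real a i = s'.real a i)
    (hQ : ∀ s', Agree (RealRAM.forLoop v N c) s s' →
      (∀ j < n, ∀ k < m, s'.real a (j * m + k) = f j k) → Q s')
    (hT : n * (T + 3) + 3 ≤ T') : Runs (RealRAM.forLoop v N c) T' s Q := by
  refine Runs.forLoop (fun j s' => ∀ l < j, l < n → ∀ k < m, s'.real a (l * m + k) = f l k) n T hv
    hN (fun _ _ _ h => h) (by simp) ?_ ?_ hT
  · intro j s' hj hA hj' h
    refine (hc j hj s' hA hj').imp le_rfl fun s'' h2 l hl hln k hk => ?_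
    rcases (Nat.lt_succ_iff_lt_or_eq.1 hl) with hl' | rfl
    · rw [h2.2 _ fun k' hk' h => hl'.ne (rowIndex_inj hk' hk h).1.symm, h l hl' hln k hk]
    · exact h2.1 k hk
  · exact fun s' hA h => hQ s' hA fun j hj k hk => h j hj hj k hk

/-- Writing one row. -/
lemma Runs.fillRow {v a : ℕ} {N idx : IExpr} {e : RExpr} {s : State} {Q : State → Prop} {T' : ℕ}
    (j m : ℕ) (f : ℕ → ℝ)
    (hN : ∀ s', Agree (RealRAM.fill v a N idx e) s s' → N.eval s' = m)
    (he : ∀ k < m, ∀ s', Agree (RealRAM.fill v a N idx e) s s' → s'.int v 0 = k →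
      idx.eval s' = j * m + k ∧ e.eval s' = f k)
    (hQ : ∀ s', Agree (RealRAM.fill v a N idx e) s s' → (∀ k < m, s'.real a (j * m + k) = f k) →
      (∀ i, (∀ k < m, j * m + k ≠ i) → s'.real a i = s.real a i) → Q s')
    (hT : 4 * m + 3 ≤ T') : Runs (RealRAM.fill v a N idx e) T' s Q :=
  Runs.fill m (fun k => j * m + k) f (fun _ _ _ _ h => by omega) hN
    (fun k hk s' hA hk' => ⟨(he k hk s' hA hk').1, fun _ => (he k hk s' hA hk').2⟩) hQ hT

end RealRAM

namespace SPDC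

open Finset RealRAM

variable {s : State} {Q : State → Prop}

lemma runs_powerOfTwo {T d : ℕ} (hd : s.int 0 1 = d)
    (hQ : ∀ s', Agree powerOfTwo s s' → s'.int 1 0 = 2 ^ Nat.clog 2 d →
      IsHalf (2 ^ Nat.clog 2 d) (s'.int 2 0) (Nat.clog 2 d) → Q s')
    (hT : 4 * Nat.clog 2 d + 3 ≤ T) : Runs powerOfTwo T s Q := by
  suffices h : Runs powerOfTwo (4 * Nat.clog 2 d + 3) s fun s' => s'.int 1 0 = 2 ^ Nat.clog 2 d ∧
      IsHalf (2 ^ Nat.clog 2 d) (s'.int 2 0) (Nat.clog 2 d) from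
    h.frame.imp hT fun s' h => hQ s' h.1 h.2.1 h.2.2
  refine Runs.isetSeq (T := 4 * Nat.clog 2 d + 1) ?_ le_rfl
  refine Runs.loop (fun k s' => s'.int 1 0 = 2 ^ k ∧
    (k = 0 ∨ s'.int 2 0 + s'.int 2 0 = 2 ^ k)) (Nat.clog 2 d) 3 ?_ ?_ ?_ ?_ (by omega)
  · simp [IExpr.eval]
  · rintro k s' - hA ⟨h1, -⟩
    have h0 : s'.int 0 1 = d := by
      rw [hA.int 0 (by decide), writeInt_of_ne _ (by norm_num), hd]
    simp only [BExpr.Holds, IExpr.eval, h0, h1]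
    exact (Nat.lt_clog_iff_pow_lt one_lt_two).symm
  · rintro k s' - hA ⟨h1, -⟩ -
    refine Runs.isetSeq (T := 1) (Runs.iset le_rfl ?_) le_rfl
    simp [IExpr.eval, h1, writeInt_of_ne, pow_succ, mul_two]
  · rintro s' - ⟨h1, h2⟩ -
    exact ⟨h1, rfl, h2⟩

lemma runs_tables {T n d m : ℕ} {Y : ℕ → ℝ} (hn : s.int 0 0 = n) (hd : s.int 0 1 = d)
    (hm : s.int 1 0 = m) (hY : ∀ j < n, s.real 1 j = Y j)
    (hQ : ∀ s', Agree tables s s' → (∀ j < n, s'.int 3 j = j * m) → (∀ j < n, s'.int 4 j = j * d) →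
      (∀ j < n, s'.int 5 j = if 0 < Y j then 0 else 1) → Q s')
    (hT : 13 * n + 7 ≤ T) : Runs tables T s Q := by
  suffices h : Runs tables (13 * n + 7) s fun s' => (∀ j < n, s'.int 3 j = j * m) ∧
      (∀ j < n, s'.int 4 j = j * d) ∧ (∀ j < n, s'.int 5 j = if 0 < Y j then 0 else 1) from
    h.frame.imp hT fun s' h => hQ s' h.1 h.2.1 h.2.2.1 h.2.2.2
  refine Runs.isetSeq (T := 13 * n + 5) (Runs.isetSeq (T := 13 * n + 3) ?_ le_rfl) le_rfl
  set s₀ := ((s.writeInt 18 ((IExpr.const 0).eval s) ((IExpr.const 0).eval s)).writeInt 19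
    ((IExpr.const 0).eval (s.writeInt 18 ((IExpr.const 0).eval s) ((IExpr.const 0).eval s)))
    ((IExpr.const 0).eval (s.writeInt 18 ((IExpr.const 0).eval s) ((IExpr.const 0).eval s))))
    with hs₀
  refine Runs.forLoop (fun j s' => s'.int 18 0 = j * m ∧ s'.int 19 0 = j * d ∧
    (∀ l < j, s'.int 3 l = l * m) ∧ (∀ l < j, s'.int 4 l = l * d) ∧
    (∀ l < j, s'.int 5 l = if 0 < Y l then 0 else 1)) n 10 (by decide) (fun s' hA => ?_)
    (fun j s' x h => ?_) ?_ ?_ (fun s' _ h => h.2.2) (by omega)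
  · simp [IExpr.eval, hA.int 0 (by decide), hs₀, writeInt_of_ne, hn]
  · simpa [writeInt_of_ne] using h
  · simp [hs₀, writeInt_of_ne, IExpr.eval]
  · rintro j s' hj hA hj' ⟨h1, h2, h3, h4, h5⟩
    have hd' : s'.int 0 1 = d := by
      simp [hA.int 0 (by decide), hs₀, writeInt_of_ne, hd]
    have hm' : s'.int 1 0 = m := by
      simp [hA.int 1 (by decide), hs₀, writeInt_of_ne, hm]
    have hY' : s'.real 1 j = Y j := by
      simp [hA.real 1 (by decide), hs₀, hY j hj]
    have upd : ∀ (f g : ℕ → ℕ) x, (∀ l < j, f l = g l) → x = g j →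
        ∀ l < j + 1, Function.update f j x l = g l := by
      intro f g x hfg hx l hl
      rcases (Nat.lt_succ_iff_lt_or_eq.1 hl) with hl' | rfl
      · rw [Function.update_of_ne hl'.ne, hfg l hl']
      · simp [hx]
    refine Runs.isetSeq (T := 8) (Runs.isetSeq (T := 6) (Runs.isetSeq (T := 4) (Runs.isetSeq
      (T := 2) (Runs.ite (T := 1) (fun h => Runs.iset le_rfl ?_) (fun h => Runs.iset le_rfl ?_)
      le_rfl) le_rfl) le_rfl) le_rfl) le_rfl
    · simp only [BExpr.Holds, RExpr.eval, IExpr.eval, writeInt_real, writeInt_of_ne, ne_eq,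
        Nat.reduceEqDiff, not_false_eq_true, hj', hY', Nat.cast_zero] at h
      simp only [IExpr.eval, writeInt_self, writeInt_of_ne, ne_eq,
        Nat.reduceEqDiff, not_false_eq_true, hj', h1, h2, hm', hd', OfNat.zero_ne_ofNat,
        OfNat.one_ne_ofNat, Function.update_self]
      exact ⟨by ring, by ring, upd _ (fun l => l * m) _ h3 rfl, upd _ (fun l => l * d) _ h4 rfl,
        upd _ (fun l => if 0 < Y l then 0 else 1) _ h5 (by rw [if_pos h])⟩
    · simp only [BExpr.Holds, RExpr.eval, IExpr.eval, writeInt_real, writeInt_of_ne, ne_eq,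
        Nat.reduceEqDiff, not_false_eq_true, hj', hY', Nat.cast_zero] at h
      simp only [IExpr.eval, writeInt_self, writeInt_of_ne, ne_eq,
        Nat.reduceEqDiff, not_false_eq_true, hj', h1, h2, hm', hd', OfNat.zero_ne_ofNat,
        OfNat.one_ne_ofNat, Function.update_self]
      exact ⟨by ring, by ring, upd _ (fun l => l * m) _ h3 rfl, upd _ (fun l => l * d) _ h4 rfl,
        upd _ (fun l => if 0 < Y l then 0 else 1) _ h5 (by rw [if_neg h])⟩

/-- The running time of the normalization of the data. -/
def centerT (n d : ℕ) : ℕ := 12 * (n * d) + 30 * n + 20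

lemma runs_center {T n d : ℕ} {X : ℕ → ℕ → ℝ} {Y : ℕ → ℝ} (hn0 : 0 < n) (hn : s.int 0 0 = n)
    (hd : s.int 0 1 = d) (hoff : ∀ j < n, s.int 4 j = j * d)
    (hX : ∀ j < n, ∀ k < d, s.real 0 (j * d + k) = X j k) (hY : ∀ j < n, s.real 1 j = Y j)
    (hQ : ∀ s' r, Agree center s s' →
      (∀ j < n, ∑ k ∈ range d, (Y j * (X j k - X 0 k)) * (Y j * (X j k - X 0 k)) ≤ r) →
      (r = 0 ∨ ∃ j < n, r = ∑ k ∈ range d, (Y j * (X j k - X 0 k)) * (Y j * (X j k - X 0 k))) →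
      s'.real 7 0 = Real.exp (Real.log r / 2) →
      (∀ j < n, ∀ k < d, s'.real 6 (j * d + k) =
        Y j * (X j k - X 0 k) / Real.exp (Real.log r / 2)) → Q s')
    (hT : centerT n d ≤ T) : Runs center T s Q := by
  set S : ℕ → ℝ := fun j => ∑ k ∈ range d, (Y j * (X j k - X 0 k)) * (Y j * (X j k - X 0 k)) with hS
  suffices h : Runs center (centerT n d) s fun s' => ∃ r, (∀ j < n, S j ≤ r) ∧
      (r = 0 ∨ ∃ j < n, r = S j) ∧ s'.real 7 0 = Real.exp (Real.log r / 2) ∧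
      (∀ j < n, ∀ k < d, s'.real 6 (j * d + k) =
        Y j * (X j k - X 0 k) / Real.exp (Real.log r / 2)) by
    refine h.frame.imp hT ?_
    rintro s' ⟨h0, r, h1, h2, h3, h4⟩
    exact hQ s' r h0 h1 h2 h3 h4
  unfold centerT
  have e1 : n * (4 * d + 3 + 3) + 3 = 4 * (n * d) + 6 * n + 3 := by ring
  have e2 : n * (4 * d + 8 + 3) + 3 = 4 * (n * d) + 11 * n + 3 := by ring
  refine Runs.seq (T₁ := n * (4 * d + 3 + 3) + 3) (T₂ := 8 * (n * d) + 24 * n + 15)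
    (Q₁ := fun s' => ∀ j < n, ∀ k < d, s'.real 8 (j * d + k) = Y j * (X j k - X 0 k))
    (Runs.fillRows n d (4 * d + 3) _ (by decide) (fun s' hA => ?_) (fun j hj s' hA hj' => ?_)
      (fun s' _ h => h) le_rfl) ?_ (by omega)
  · simp [IExpr.eval, hA.int 0 (by decide), hn]
  · refine Runs.fillRow j d _ (fun s'' hA' => ?_) (fun k hk s'' hA' hk' => ?_)
      (fun s'' _ h h' => ⟨h, h'⟩) le_rfl
    · simp [IExpr.eval, hA'.int 0 (by decide), hA.int 0 (by decide), hd]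
    · have h0 := hX 0 hn0 k hk
      rw [zero_mul, zero_add] at h0
      simp [RExpr.eval, IExpr.eval, hk', hA'.int 4 (by decide), hA.int 4 (by decide),
        hA'.int 10 (by decide), hj', hoff j hj, hA'.real 0 (by decide), hA.real 0 (by decide),
        hA'.real 1 (by decide), hA.real 1 (by decide), hX j hj k hk, hY j hj, h0]
  intro s₁ hA₁ h₁
  refine Runs.setv 0 (by simp [RExpr.eval, IExpr.eval]) (T := 8 * (n * d) + 24 * n + 13) ?_ (by omega)
  have off₁ : ∀ j < n, s₁.int 4 j = j * d := by rw [hA₁.int 4 (by decide)]; exact hoff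
  have n₁ : s₁.int 0 0 = n := by rw [hA₁.int 0 (by decide), hn]
  have d₁ : s₁.int 0 1 = d := by rw [hA₁.int 0 (by decide), hd]
  refine Runs.seq (T₁ := n * (4 * d + 8 + 3) + 3) (T₂ := 4 * (n * d) + 10 * n + 9)
    (Q₁ := fun s' => ∃ r, s'.real 9 0 = r ∧ (∀ j < n, S j ≤ r) ∧ (r = 0 ∨ ∃ j < n, r = S j))
    (Runs.forLoop (fun j s' => ∃ r, s'.real 9 0 = r ∧ (∀ l < j, S l ≤ r) ∧
      (r = 0 ∨ ∃ l < j, r = S l)) n (4 * d + 8) (by decide) (fun s' hA => ?_) (fun _ _ _ h => h) ?_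
      ?_ (fun s' _ h => h) le_rfl) ?_ (by omega)
  · simp [IExpr.eval, hA.int 0 (by decide), n₁]
  · exact ⟨0, by simp, by simp, .inl rfl⟩
  · rintro j s' hj hA hj' ⟨r, hr, hr1, hr2⟩
    refine Runs.seq (T₁ := 4 * d + 5) (T₂ := 2) (Q₁ := fun s'' => s''.real 60 0 = S j)
      (Runs.accum d _ (fun s'' hA' => ?_) (fun k hk s'' hA' hk' => ?_) (fun _ _ h => h) le_rfl) ?_
      le_rfl
    · simp [IExpr.eval, hA'.int 0 (by decide), hA.int 0 (by decide), d₁]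
    · simp [RExpr.eval, IExpr.eval, hk', hA'.int 10 (by decide), hj', hA'.int 4 (by decide),
        hA.int 4 (by decide), off₁ j hj, hA'.real 8 (by decide), hA.real 8 (by decide),
        writeReal_of_ne, h₁ j hj k hk]
    · intro s'' hA'' h''
      have h9 : s''.real 9 0 = r := by rw [hA''.real 9 (by decide), hr]
      refine Runs.ite (T := 1) (fun h => Runs.rset le_rfl ?_) (fun h => Runs.iset le_rfl ?_) le_rfl
      · simp only [BExpr.Holds, RExpr.eval, IExpr.eval, h9, h''] at h
        refine ⟨S j, by simp [RExpr.eval, IExpr.eval, h''], fun l hl => ?_, .inr ⟨j, by omega, rfl⟩⟩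
        rcases (Nat.lt_succ_iff_lt_or_eq.1 hl) with hl' | rfl
        exacts [(hr1 l hl').trans h.le, le_rfl]
      · simp only [BExpr.Holds, RExpr.eval, IExpr.eval, h9, h'', not_lt] at h
        refine ⟨r, by simp [h9], fun l hl => ?_, hr2.imp id fun ⟨l, hl, h⟩ => ⟨l, by omega, h⟩⟩
        rcases (Nat.lt_succ_iff_lt_or_eq.1 hl) with hl' | rfl
        exacts [hr1 l hl', h]
  rintro s₂ hA₂ ⟨r, hr, hr1, hr2⟩
  refine Runs.setv (Real.exp (Real.log r / 2)) (by simp [RExpr.eval, IExpr.eval, hr])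
    (T := 4 * (n * d) + 6 * n + 3) ?_ (by omega)
  set s₃ := s₂.writeReal 7 0 (Real.exp (Real.log r / 2)) with hs₃
  have i₃ : s₃.int = s₂.int := rfl
  have h8 : ∀ j < n, ∀ k < d, s₃.real 8 (j * d + k) = Y j * (X j k - X 0 k) := by
    rw [hs₃, writeReal_of_ne _ (by norm_num), hA₂.real 8 (by decide),
      writeReal_of_ne _ (by norm_num)]
    exact h₁
  have h7 : s₃.real 7 0 = Real.exp (Real.log r / 2) := by simp [hs₃]
  refine Runs.fillRows n d (4 * d + 3) (fun j k => Y j * (X j k - X 0 k) /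
    Real.exp (Real.log r / 2)) (by decide) (fun s' hA => ?_) (fun j hj s' hA hj' => ?_)
    (fun s' hA h => ⟨r, hr1, hr2, ?_, h⟩) e1.le
  · simp [IExpr.eval, hA.int 0 (by decide), i₃, hA₂.int 0 (by decide), n₁]
  · refine Runs.fillRow j d _ (fun s'' hA' => ?_) (fun k hk s'' hA' hk' => ?_)
      (fun s'' _ h h' => ⟨h, h'⟩) le_rfl
    · simp [IExpr.eval, hA'.int 0 (by decide), hA.int 0 (by decide), i₃, hA₂.int 0 (by decide), d₁]
    · simp [RExpr.eval, IExpr.eval, hk', hA'.int 4 (by decide), hA.int 4 (by decide), i₃,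
        hA₂.int 4 (by decide), hA'.int 10 (by decide), hj', off₁ j hj, hA'.real 8 (by decide),
        hA.real 8 (by decide), h8 j hj k hk, hA'.real 7 (by decide), hA.real 7 (by decide), h7]
  · rw [hA.real 7 (by decide), h7]

end SPDC

/-! ### The random rotation -/

namespace SPDC

open Finset RealRAM

variable {s : State} {Q : State → Prop}

lemma flatPot_nonneg (n m : ℕ) (cf : ℕ → ℕ → ℕ → ℝ) (lam t : ℝ) (k : ℕ) (r : ℕ → ℕ) :
    0 ≤ flatPot n m cf lam t k r :=
  sum_nonneg fun _ _ => sum_nonneg fun _ _ => by positivity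

open Classical in
/-- The random signs make the potential `flatPot` small with high probability. -/
lemma val_signs {m n : ℕ} (hm : s.int 1 0 = m) (cf : ℕ → ℕ → ℕ → ℝ) (lam t : ℝ) {C : ENNReal}
    {φ : State → ENNReal}
    (hφ : ∀ s', Agree signs s s' → (∀ k < m, s'.int 6 k ≤ 1) →
      flatPot n m cf lam t m (s'.int 6) < 1 → C ≤ φ s') :
    ENNReal.ofReal (1 - flatPot n m cf lam t 0 (s.int 6)) * C ≤
      val φ (4 * m + 3) ([signs], s) := by
  refine le_trans ?_ (val_mono_agree (φ := fun s' => if Agree signs s s' then φ s' else ⊤)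
    fun s' h => by rw [if_pos h])
  set φ' : State → ENNReal := fun s' => if Agree signs s s' then φ s' else ⊤ with hφ'
  have hφ'' : ∀ s', (∀ k < m, s'.int 6 k ≤ 1) → flatPot n m cf lam t m (s'.int 6) < 1 →
      C ≤ φ' s' := by
    intro s' h1 h2
    rw [hφ']
    dsimp only
    split_ifs with hA
    exacts [hφ s' hA h1 h2, le_top]
  let ψ : ℕ → State → ENNReal := fun k s' =>
    if s'.int 10 0 = k ∧ s'.int 1 0 = m ∧ ∀ l < k, s'.int 6 l ≤ 1 then
      ENNReal.ofReal (1 - flatPot n m cf lam t k (s'.int 6)) * C else 0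
  have hloop := val_loop (b := .ilt (iv 10) (iv 1)) (c := .seq (.flip 6 (iv 10))
    (.iset 10 (.const 0) (.add (iv 10) (.const 1)))) (φ := φ') ψ m 3 ?_ ?_ ?_ (s.writeInt 10 0 0)
  · refine le_trans ?_ (val_seq (T₁ := 1) (T₂ := m * (3 + 1) + 1) (by omega))
    simp only [RealRAM.val, IExpr.eval]
    refine le_trans (le_of_eq ?_) hloop
    simp [ψ, writeInt_of_ne, hm]
  · intro k hk s' hb
    dsimp only [ψ]
    split_ifs with h
    · have hkm : k = m := by
        simp only [BExpr.Holds, IExpr.eval, h.1, h.2.1, not_lt] at hb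
        omega
      subst hkm
      rcases lt_or_ge (flatPot n k cf lam t k (s'.int 6)) 1 with hlt | hge
      · refine le_trans ?_ (hφ'' s' h.2.2 hlt)
        exact mul_le_of_le_one_left' (ENNReal.ofReal_le_one.2
          (by linarith [flatPot_nonneg n k cf lam t k (s'.int 6)]))
      · rw [ENNReal.ofReal_of_nonpos (by linarith), zero_mul]; exact zero_le
    · exact zero_le
  · intro k hk s' hb
    dsimp only [ψ]
    split_ifs with h
    · have hnext : ∀ b ≤ 1, ψ (k + 1) ((s'.writeInt 6 k b).writeInt 10 0 (k + 1)) =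
          ENNReal.ofReal (1 - flatPot n m cf lam t (k + 1) (Function.update (s'.int 6) k b)) *
            C := by
        intro b hb
        dsimp only [ψ]
        rw [if_pos]
        · simp [writeInt_of_ne]
        · refine ⟨by simp, by simp [writeInt_of_ne, h.2.1], fun l hl => ?_⟩
          rw [writeInt_of_ne _ (by norm_num), writeInt_self]
          rcases (Nat.lt_succ_iff_lt_or_eq.1 hl) with hl' | rfl
          · rw [Function.update_of_ne hl'.ne]; exact h.2.2 l hl'
          · simpa using hb
      have hval : val (ψ (k + 1)) 3 ([.seq (.flip 6 (iv 10))
          (.iset 10 (.const 0) (.add (iv 10) (.const 1)))], s') =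
          (ψ (k + 1) ((s'.writeInt 6 k 0).writeInt 10 0 (k + 1)) +
            ψ (k + 1) ((s'.writeInt 6 k 1).writeInt 10 0 (k + 1))) / 2 := by
        simp [RealRAM.val, IExpr.eval, h.1, writeInt_of_ne]
      rw [hval, hnext 0 zero_le_one, hnext 1 le_rfl, ← add_mul, div_eq_mul_inv, mul_right_comm]
      refine mul_le_mul_left (le_trans ?_ (mul_le_mul_left ENNReal.ofReal_add_le _)) C
      rw [← div_eq_mul_inv]
      have e2 : (2 : ENNReal) = ENNReal.ofReal 2 := by simp
      rw [e2, ← ENNReal.ofReal_div_of_pos two_pos]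
      refine ENNReal.ofReal_le_ofReal ?_
      have := flatPot_step n m cf lam t k (s'.int 6)
      linarith
    · exact zero_le
  · intro s' hb
    dsimp only [ψ]
    rw [if_neg]
    rintro ⟨h1, h2, -⟩
    simp only [BExpr.Holds, IExpr.eval, h1, h2, lt_irrefl] at hb

lemma stage_congr {h m : ℕ} (hm : h + h = m) {v w : ℕ → ℝ} (hvw : ∀ k < m, v k = w k) {k : ℕ}
    (hk : k < m) : stage h v k = stage h w k := by
  unfold stage
  split_ifs with hkh
  · rw [hvw _ (by omega), hvw _ (by omega)]
  · rw [hvw _ (by omega), hvw _ (by omega)]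

lemma runs_stageCmd {T h m : ℕ} (hm : s.int 1 0 = m) (hh : s.int 2 0 = h)
    (hQ : ∀ s', Agree stageCmd s s' → (∀ k < m, s'.real 55 k = stage h (s.real 55) k) → Q s')
    (hT : 9 * m + 7 ≤ T) : Runs stageCmd T s Q := by
  suffices H : Runs stageCmd (9 * m + 7) s fun s' => ∀ k < m, s'.real 55 k =
    stage h (s.real 55) k from H.frame.imp hT fun s' h => hQ s' h.1 h.2
  refine Runs.seq (T₁ := 5 * m + 3) (T₂ := 4 * m + 3)
    (Q₁ := fun s' => ∀ k < m, s'.real 56 k = stage h (s.real 55) k)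
    (Runs.fillBody m 2 id (stage h (s.real 55)) (by decide) (fun _ _ _ _ h => h)
      (fun s' hA => by simp [IExpr.eval, hA.int 1 (by decide), hm]) (fun k hk s' hA hk' _ => ?_)
      (fun s' _ h _ => h) (by omega)) ?_ (by omega)
  · have h2 : s'.int 2 0 = h := by rw [hA.int 2 (by decide), hh]
    refine Runs.ite (T := 1) (fun hb => Runs.rset le_rfl ?_) (fun hb => Runs.rset le_rfl ?_) le_rfl
    · simp only [BExpr.Holds, IExpr.eval, hk', h2] at hb
      simp [RExpr.eval, IExpr.eval, hk', hA.real 55 (by decide), stage, hb]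
    · simp only [BExpr.Holds, IExpr.eval, hk', h2] at hb
      simp [RExpr.eval, IExpr.eval, hk', h2, hA.real 55 (by decide), stage, hb]
  · intro s₁ hA₁ h₁
    refine Runs.fillId m _ (fun s' hA => ?_) (fun k hk s' hA hk' _ => ?_) (fun s' _ h => h) le_rfl
    · simp [IExpr.eval, hA.int 1 (by decide), hA₁.int 1 (by decide), hm]
    · simp [RExpr.eval, IExpr.eval, hk', hA.real 56 (by decide), h₁ k hk]

/-- The running time of the rotation. -/
def rotateT (n m p : ℕ) : ℕ := n * (p * (9 * m + 10) + 9 * m + 20) + 10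

lemma runs_rotate {T n d m h p : ℕ} {A : ℕ → ℕ → ℝ} (hn : s.int 0 0 = n) (hd : s.int 0 1 = d)
    (hm : s.int 1 0 = m) (hh : s.int 2 0 = h) (hp : IsHalf m h p)
    (hoffM : ∀ j < n, s.int 3 j = j * m) (hoffD : ∀ j < n, s.int 4 j = j * d)
    (hA : ∀ j < n, ∀ k < d, s.real 6 (j * d + k) = A j k)
    (hQ : ∀ s', Agree rotate s s' → (∀ j < n, ∀ k < m, s'.real 10 (j * m + k) =
      rotated h p d (√m) (s.int 6) A j k) → Q s')
    (hT : rotateT n m p ≤ T) : Runs rotate T s Q := by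
  suffices H : Runs rotate (rotateT n m p) s fun s' => ∀ j < n, ∀ k < m, s'.real 10 (j * m + k) =
    rotated h p d (√m) (s.int 6) A j k from H.frame.imp hT fun s' h => hQ s' h.1 h.2
  have e1 : n * (p * (9 * m + 10) + 9 * m + 20) = n * (p * (9 * m + 10) + 9 * m + 14 + 3) +
    3 * n := by ring
  unfold rotateT
  have hm0 : (0 : ℝ) < m := by rw [hp.1]; positivity
  refine Runs.setv (√m) ?_ (T := n * (p * (9 * m + 10) + 9 * m + 14 + 3) + 3) ?_ (by omega)
  · simp [RExpr.eval, IExpr.eval, hm]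
    rw [← Real.log_sqrt hm0.le, Real.exp_log (Real.sqrt_pos.2 hm0)]
  set s₀ := s.writeReal 57 0 (√m) with hs₀
  have i₀ : s₀.int = s.int := rfl
  refine Runs.fillRows n m (p * (9 * m + 10) + 9 * m + 14) _ (by decide)
    (fun s' hA => by simp [IExpr.eval, hA.int 0 (by decide), i₀, hn]) (fun j hj s₁ hA₁ hj₁ => ?_)
    (fun s' _ h => h) le_rfl
  have n₁ : s₁.int 0 0 = n := by rw [hA₁.int 0 (by decide), i₀, hn]
  have d₁ : s₁.int 0 1 = d := by rw [hA₁.int 0 (by decide), i₀, hd]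
  have m₁ : s₁.int 1 0 = m := by rw [hA₁.int 1 (by decide), i₀, hm]
  have h₁ : s₁.int 2 0 = h := by rw [hA₁.int 2 (by decide), i₀, hh]
  have o₁ : s₁.int 3 j = j * m := by rw [hA₁.int 3 (by decide), i₀, hoffM j hj]
  have o₁' : s₁.int 4 j = j * d := by rw [hA₁.int 4 (by decide), i₀, hoffD j hj]
  have r₁ : s₁.int 6 = s.int 6 := by rw [hA₁.int 6 (by decide), i₀]
  have A₁ : s₁.real 6 = s.real 6 := by
    rw [hA₁.real 6 (by decide), hs₀, writeReal_of_ne _ (by norm_num)]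
  have q₁ : s₁.real 57 0 = √m := by rw [hA₁.real 57 (by decide), hs₀]; simp
  refine Runs.seq (T₁ := 5 * m + 3) (T₂ := p * (9 * m + 10) + 4 * m + 10)
    (Q₁ := fun s' => ∀ k < m, s'.real 55 k = signedRow d (√m) (s.int 6) A j k)
    (Runs.fillBody m 2 id _ (by decide) (fun _ _ _ _ h => h)
      (fun s' hA => by simp [IExpr.eval, hA.int 1 (by decide), m₁]) (fun k hk s' hA' hk' _ => ?_)
      (fun s' _ h _ => h) (by omega)) ?_ (by omega)
  · have d' : s'.int 0 1 = d := by rw [hA'.int 0 (by decide), d₁]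
    refine Runs.ite (T := 1) (fun hb => Runs.rset le_rfl ?_) (fun hb => Runs.rset le_rfl ?_) le_rfl
    · simp only [BExpr.Holds, IExpr.eval, hk', d'] at hb
      simp [RExpr.eval, IExpr.eval, hk', signedRow, hb, hA'.int 6 (by decide), r₁,
        hA'.int 10 (by decide), hj₁, hA'.int 4 (by decide), o₁', hA'.real 6 (by decide), A₁,
        hA j hj k hb, hA'.real 57 (by decide), q₁]
    · simp only [BExpr.Holds, IExpr.eval, hk', d'] at hb
      simp [RExpr.eval, IExpr.eval, hk', signedRow, hb]
  intro s₂ hA₂ h₂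
  refine Runs.isetSeq (T := p * (9 * m + 10) + 4 * m + 8) ?_ le_rfl
  set s₃ := s₂.writeInt 13 ((IExpr.const 0).eval s₂) ((IExpr.const 1).eval s₂) with hs₃
  have i₃ : ∀ a < 11, s₃.int a = s₁.int a := by
    intro a ha
    rw [hs₃, writeInt_of_ne _ (by omega), hA₂.int a ?_]
    simp [forLoop, Cmd.wi]; omega
  refine Runs.seq (T₁ := p * (9 * m + 10) + 1) (T₂ := 4 * m + 3)
    (Q₁ := fun s' => ∀ k < m, s'.real 55 k = rotated h p d (√m) (s.int 6) A j k)
    (Runs.loop (fun i s' => s'.int 13 0 = 2 ^ i ∧ ∀ k < m, s'.real 55 k =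
      (stage h)^[i] (signedRow d (√m) (s.int 6) A j) k) p (9 * m + 9) ⟨?_, ?_⟩ ?_ ?_ ?_ le_rfl) ?_
      (by omega)
  · simp [hs₃, IExpr.eval]
  · exact h₂
  · rintro i s' hi hA' ⟨h13, -⟩
    have m' : s'.int 1 0 = m := by rw [hA'.int 1 (by decide), i₃ 1 (by norm_num), m₁]
    simp only [BExpr.Holds, IExpr.eval, h13, m']
    rw [hp.1]
    exact Nat.pow_lt_pow_iff_right one_lt_two
  · rintro i s' hi hA' ⟨h13, hv⟩ -
    have m' : s'.int 1 0 = m := by rw [hA'.int 1 (by decide), i₃ 1 (by norm_num), m₁]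
    have h' : s'.int 2 0 = h := by rw [hA'.int 2 (by decide), i₃ 2 (by norm_num), h₁]
    refine Runs.seq (T₁ := 9 * m + 7) (T₂ := 1) (runs_stageCmd (Q := fun s'' =>
      s''.int 13 0 = 2 ^ i ∧ ∀ k < m, s''.real 55 k = stage h (s'.real 55) k) m' h'
      (fun s'' hA'' h => ⟨by rw [hA''.int 13 (by decide), h13], h⟩) le_rfl) ?_ le_rfl
    rintro s'' - ⟨h13', hv'⟩
    refine Runs.iset le_rfl ⟨?_, fun k hk => ?_⟩
    · simp [IExpr.eval, h13', pow_succ, mul_two]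
    · rw [writeInt_real, hv' k hk, Function.iterate_succ_apply']
      exact stage_congr (hp.2.resolve_left (by omega)) hv hk
  · rintro s' - ⟨-, hv⟩ -
    exact hv
  intro s₄ hA₄ h₄
  refine Runs.fillRow j m _ (fun s' hA' => ?_) (fun k hk s' hA' hk' => ?_)
    (fun s' hA' h h' => ⟨h, fun i hi => ?_⟩) le_rfl
  · simp [IExpr.eval, hA'.int 1 (by decide), hA₄.int 1 (by decide), i₃ 1 (by norm_num), m₁]
  · simp [RExpr.eval, IExpr.eval, hk', hA'.int 10 (by decide), hA₄.int 10 (by decide),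
      i₃ 10 (by norm_num), hj₁, hA'.int 3 (by decide), hA₄.int 3 (by decide), i₃ 3 (by norm_num),
      o₁, hA'.real 55 (by decide), h₄ k hk]
  · rw [h' i hi, hA₄.real 10 (by decide), hs₃, writeInt_real, hA₂.real 10 (by decide)]

end SPDC

/-! ### The outputs -/

namespace SPDC

open Finset RealRAM SVM

variable {I : Inst} {x : Fin I.n → EuclideanSpace ℝ (Fin I.d)} {y : Fin I.n → ℤˣ}

lemma runs_offsetSum {s : State} {Q : State → Prop} {T : ℕ} {η : ℕ → ℝ} (hs : I.Stored s)
    (hc : Cert I η s)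
    (hQ : ∀ s', Agree offsetSum s s' →
      s'.real 68 0 = ∑ k ∈ range I.d, ip I.n I.A k η * I.x0 k → Q s')
    (hT : 4 * I.d + 5 ≤ T) : Runs offsetSum T s Q := by
  refine Runs.accum I.d _ (fun s' hA => (hs.agree hA (by decide)).d) (fun k hk s' hA hk' => ?_) hQ hT
  simp [RExpr.eval, IExpr.eval, hk', hA.real 61 (by decide), hc.w k hk,
    (hs.agree hA (by decide)).x0 k hk]

/-- The running time of the output. -/
def outT (n d : ℕ) : ℕ := 8 * d + 4 * n + 20

lemma nuOut_spec (h : Normalized x y I.x0 I.D I.A I.c) (hε1 : I.ε < 1) :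
    I.OutputSpec nuOut (outT I.n I.d) fun s =>
      NuApprox I.ε I.ν x y (outW I.d s) (outB s) (outRho s) (outSlack I.n s) := by
  refine ⟨fun s η hs hη hc hcert => ?_, fun s v hg => hg⟩
  unfold outT
  refine Runs.seq (T₁ := 4 * I.d + 5) (T₂ := 4 * I.d + 4 * I.n + 14)
    (runs_offsetSum hs hc (fun _ _ h => h) le_rfl) ?_ (by omega)
  intro s₁ hA₁ h₁
  have hs₁ := hs.agree hA₁ (by decide)
  have w₁ : s₁.real 61 = s.real 61 := hA₁.real 61 (by decide)
  refine Runs.seq (T₁ := 4 * I.d + 3) (T₂ := 4 * I.n + 9)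
    (Q₁ := fun s' => ∀ k < I.d, s'.real 3 k = I.D / 2 * ip I.n I.A k η)
    (Runs.fillId I.d _ (fun s' hA => by simp [IExpr.eval, hA.int 0 (by decide), hs₁.d])
      (fun k hk s' hA hk' _ => by
        simp [RExpr.eval, IExpr.eval, hk', hA.real 7 (by decide), hs₁.D, hA.real 61 (by decide),
          w₁, hc.w k hk]) (fun _ _ h => h) le_rfl) ?_ (by omega)
  intro s₂ hA₂ h₂
  have D₂ : s₂.real 7 0 = I.D := by rw [hA₂.real 7 (by decide), hs₁.D]
  have t₂ : s₂.real 64 = s.real 64 := by rw [hA₂.real 64 (by decide), hA₁.real 64 (by decide)]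
  have b₂ : s₂.real 68 0 = ∑ k ∈ range I.d, ip I.n I.A k η * I.x0 k := by
    rw [hA₂.real 68 (by decide), h₁]
  refine Runs.setv (I.D / 2 * ∑ k ∈ range I.d, ip I.n I.A k η * I.x0 k +
    I.D ^ 2 / 4 * (s.real 64 0 - s.real 64 1)) ?_ (T := 4 * I.n + 7) ?_ (by omega)
  · simp [RExpr.eval, IExpr.eval, D₂, t₂, b₂, sq]
  refine Runs.seq (T₁ := 1) (T₂ := 4 * I.n + 3) (Q₁ := fun s' =>
    s'.real 4 0 = I.D / 2 * ∑ k ∈ range I.d, ip I.n I.A k η * I.x0 k +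
      I.D ^ 2 / 4 * (s.real 64 0 - s.real 64 1) ∧
    s'.real 4 1 = I.D ^ 2 / 4 * (s.real 64 0 + s.real 64 1) ∧ s'.int = s₂.int ∧
    s'.real 3 = s₂.real 3 ∧ s'.real 7 = s₂.real 7 ∧ s'.real 65 = s₂.real 65)
    (Runs.rset le_rfl ?_) ?_ (by omega)
  · simp [RExpr.eval, IExpr.eval, D₂, t₂, writeReal_of_ne, sq]
  rintro s₃ - ⟨hb, hρ, i₃, r3, r7, r65⟩
  refine Runs.fillId I.n (fun j => I.D ^ 2 / 2 * s.real 65 j) (fun s' hA => ?_)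
    (fun j _ s' hA hj _ => ?_) (fun s' hA h5 => ?_) le_rfl
  · simp [IExpr.eval, hA.int 0 (by decide), i₃, hA₂.int 0 (by decide), hs₁.n]
  · simp [RExpr.eval, IExpr.eval, hj, hA.real 7 (by decide), r7, D₂, hA.real 65 (by decide), r65,
      hA₂.real 65 (by decide), hA₁.real 65 (by decide), sq]
  · refine h.nuApprox hη hε1 hc.a hcert (fun k => ?_) ?_ ?_ (fun j => ?_)
    · change s'.real 3 k = _
      rw [hA.real 3 (by decide), r3, h₂ k k.2]
    · change s'.real 4 0 = _
      rw [hA.real 4 (by decide), hb]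
    · change s'.real 4 1 = _
      rw [hA.real 4 (by decide), hρ]
    · change s'.real 5 j = _
      rw [h5 j j.2, hc.slack j j.2]

lemma hmOut_spec (h : Normalized x y I.x0 I.D I.A I.c) (hε : 0 < I.ε) (hε1 : I.ε < 1)
    (hν : I.ν = 1) (hsep : ∃ w b, HMFeasible x y w b) :
    I.OutputSpec hmOut (outT I.n I.d) fun s => HMApprox I.ε x y (outW I.d s) (outB s) := by
  refine ⟨fun s η hs hη hc hcert => ?_, fun s v hg => hg⟩
  have hdual := hc.dual
  rw [hν] at hη hcert hdual
  set G₀ := dualVal I.n 1 I.c (s.real 63) (s.real 64) 0 with hG₀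
  set G₁ := dualVal I.n 1 I.c (s.real 63) (s.real 64) 1 with hG₁
  unfold outT
  refine Runs.seq (T₁ := 4 * I.d + 5) (T₂ := 4 * I.d + 9)
    (runs_offsetSum hs hc (fun _ _ h => h) le_rfl) ?_ (by omega)
  intro s₁ hA₁ h₁
  have hs₁ := hs.agree hA₁ (by decide)
  have w₁ : s₁.real 61 = s.real 61 := hA₁.real 61 (by decide)
  have g₁ : s₁.real 67 0 = G₀ := by rw [hA₁.real 67 (by decide), hdual 0 two_pos]
  have g₁' : s₁.real 67 1 = G₁ := by rw [hA₁.real 67 (by decide), hdual 1 one_lt_two]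
  refine Runs.setv (G₀ + G₁) (by simp [RExpr.eval, IExpr.eval, g₁, g₁']) (T := 4 * I.d + 7) ?_
    (by omega)
  refine Runs.setv (2 / ((G₀ + G₁) * I.D)) (by
    simp [RExpr.eval, IExpr.eval, writeReal_of_ne, hs₁.D]) (T := 4 * I.d + 5) ?_ (by omega)
  set s₂ := (s₁.writeReal 69 0 (G₀ + G₁)).writeReal 70 0 (2 / ((G₀ + G₁) * I.D)) with hs₂
  refine Runs.seq (T₁ := 4 * I.d + 3) (T₂ := 1)
    (Q₁ := fun s' => ∀ k < I.d, s'.real 3 k = 2 / ((G₀ + G₁) * I.D) * ip I.n I.A k η)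
    (Runs.fillId I.d _ (fun s' hA => by simp [IExpr.eval, hA.int 0 (by decide), hs₂, hs₁.d])
      (fun k hk s' hA hk' _ => by
        simp [RExpr.eval, IExpr.eval, hk', hA.real 70 (by decide), hs₂, hA.real 61 (by decide),
          writeReal_of_ne, w₁, hc.w k hk]) (fun _ _ h => h) le_rfl) ?_ (by omega)
  intro s₃ hA₃ h₃
  refine Runs.rset le_rfl (h.hmApprox hη hε hε1 hc.a hcert hsep rfl (fun k => ?_) ?_)
  · exact h₃ k k.2
  · change State.real _ 4 0 = _
    simp [RExpr.eval, IExpr.eval, hA₃.real 70 (by decide), hA₃.real 68 (by decide),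
      hA₃.real 67 (by decide), hA₃.real 69 (by decide), hs₂, writeReal_of_ne, g₁, g₁', h₁]
    rfl

end SPDC

/-! ### The whole program -/

namespace SPDC

open Finset RealRAM SVM

section

variable {n d : ℕ} {x : Fin n → EuclideanSpace ℝ (Fin d)} {y : Fin n → ℤˣ} {ν : ℝ}

/-- The coordinates of the points, extended by zero. -/
noncomputable def ptOf (x : Fin n → EuclideanSpace ℝ (Fin d)) (j k : ℕ) : ℝ :=
  if h : j < n ∧ k < d then x ⟨j, h.1⟩ ⟨k, h.2⟩ else 0

/-- The labels, extended by zero. -/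
noncomputable def labOf (y : Fin n → ℤˣ) (j : ℕ) : ℝ :=
  if h : j < n then ((y ⟨j, h⟩ : ℤ) : ℝ) else 0

lemma labOf_mul_self {j : ℕ} (hj : j < n) : labOf y j * labOf y j = 1 := by
  rw [labOf, dif_pos hj, label_cast]
  split_ifs <;> norm_num

lemma clsOf_eq {j : ℕ} (hj : j < n) : (if 0 < labOf y j then 0 else 1) = clsOf y j := by
  rw [labOf, dif_pos hj, clsOf, dif_pos hj, label_cast]
  split_ifs <;> norm_num at *

lemma inputState_real {params : List ℝ} {j k : ℕ} (hj : j < n) (hk : k < d) :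
    (inputState x y params).real 0 (j * d + k) = ptOf x j k := by
  have h1 : j * d + k < n * d := by
    calc j * d + k < j * d + d := by omega
      _ = (j + 1) * d := by ring
      _ ≤ n * d := Nat.mul_le_mul_right d hj
  have h2 : finProdFinEquiv.symm (⟨j * d + k, h1⟩ : Fin (n * d)) = (⟨j, hj⟩, ⟨k, hk⟩) := by
    rw [Equiv.symm_apply_eq]
    ext
    simp [finProdFinEquiv]
    ring
  simp only [inputState, if_pos, dif_pos h1]
  rw [ h2, ptOf, dif_pos ⟨hj, hk⟩]

lemma sum_sq_eq_dist {j : ℕ} (hj : j < n) (hn : 0 < n) :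
    ∑ k ∈ range d, (labOf y j * (ptOf x j k - ptOf x 0 k)) *
      (labOf y j * (ptOf x j k - ptOf x 0 k)) = dist (x ⟨j, hj⟩) (x ⟨0, hn⟩) ^ 2 := by
  rw [EuclideanSpace.dist_eq, Real.sq_sqrt (sum_nonneg fun _ _ => sq_nonneg _),
    ← Fin.sum_univ_eq_sum_range (fun k => (labOf y j * (ptOf x j k - ptOf x 0 k)) *
      (labOf y j * (ptOf x j k - ptOf x 0 k)))]
  refine sum_congr rfl fun k _ => ?_
  rw [mul_mul_mul_comm, labOf_mul_self hj, one_mul, Real.dist_eq, sq_abs, sq]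
  simp [ptOf, hj, hn]

/-- The largest distance from the first point is positive, and at most the diameter. -/
lemma scale_bounds {r : ℝ} (hn : 0 < n) (hdiam : 0 < Metric.diam (Set.range x))
    (h1 : ∀ j < n, ∑ k ∈ range d, (labOf y j * (ptOf x j k - ptOf x 0 k)) *
      (labOf y j * (ptOf x j k - ptOf x 0 k)) ≤ r)
    (h2 : r = 0 ∨ ∃ j < n, r = ∑ k ∈ range d, (labOf y j * (ptOf x j k - ptOf x 0 k)) *
      (labOf y j * (ptOf x j k - ptOf x 0 k))) :
    0 < r ∧ Real.exp (Real.log r / 2) ≤ Metric.diam (Set.range x) := by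
  have hb : Bornology.IsBounded (Set.range x) := (Set.finite_range x).isBounded
  have hr : 0 < r := by
    by_contra hr
    have h0 : ∀ i : Fin n, x i = x ⟨0, hn⟩ := by
      intro i
      have := h1 i i.2
      rw [sum_sq_eq_dist i.2 hn] at this
      exact dist_eq_zero.1 (pow_eq_zero_iff two_ne_zero |>.1
        (le_antisymm (this.trans (not_lt.1 hr)) (sq_nonneg _)))
    refine hdiam.not_ge (Metric.diam_le_of_forall_dist_le le_rfl ?_)
    rintro _ ⟨i, rfl⟩ _ ⟨j, rfl⟩
    rw [h0 i, h0 j, dist_self]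
  refine ⟨hr, ?_⟩
  obtain ⟨j, hj, h3⟩ := h2.resolve_left hr.ne'
  rw [sum_sq_eq_dist hj hn] at h3
  rw [← Real.log_sqrt hr.le, Real.exp_log (Real.sqrt_pos.2 hr), h3, Real.sqrt_sq dist_nonneg]
  exact Metric.dist_le_diam_of_mem hb ⟨_, rfl⟩ ⟨_, rfl⟩

lemma two_le_of_nonempty (h1 : (reducedHull ν x y 1).Nonempty)
    (h2 : (reducedHull ν x y (-1)).Nonempty) : 2 ≤ n := by
  have key : ∀ σ, (reducedHull ν x y σ).Nonempty → ∃ i, y i = σ := by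
    rintro σ ⟨_, η, -, h, hs, -⟩
    by_contra hne
    rw [sum_eq_zero fun i _ => h i fun hi => hne ⟨i, hi⟩] at hs
    exact zero_ne_one hs
  obtain ⟨i, hi⟩ := key 1 h1
  obtain ⟨j, hj⟩ := key (-1) h2
  have hij : i ≠ j := by
    rintro rfl
    rw [hi] at hj
    exact absurd hj (by decide)
  have := i.2
  have := j.2
  have : (i : ℕ) ≠ j := fun h => hij (Fin.ext h)
  omega

/-- The running time of the program with `J + 1` levels. -/
def progT (n d m p K N J : ℕ) : ℕ :=
  4 * p + 13 * n + centerT n d + 4 * m + rotateT n m p +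
    ((J + 1) * (levelT n d m p K N (outT n d) + 1) + 1) + 40

/-- The instance after the normalization and the rotation with random bits `r`. -/
noncomputable def instOf (x : Fin n → EuclideanSpace ℝ (Fin d)) (y : Fin n → ℤˣ) (ν ε D : ℝ)
    (h : ℕ) (r : ℕ → ℕ) : Inst where
  n := n
  d := d
  m := 2 ^ Nat.clog 2 d
  ν := ν
  ε := ε
  D := D
  c := clsOf y
  A j k := labOf y j * (ptOf x j k - ptOf x 0 k) / D
  M := rotated h (Nat.clog 2 d) d (√(2 ^ Nat.clog 2 d : ℕ)) r
    fun j k => labOf y j * (ptOf x j k - ptOf x 0 k) / D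
  x0 k := ptOf x 0 k

lemma instOf_normalized (ν ε : ℝ) {D : ℝ} (hD : 0 < D) (h : ℕ) (r : ℕ → ℕ) :
    Normalized x y (instOf x y ν ε D h r).x0 D (instOf x y ν ε D h r).A
      (instOf x y ν ε D h r).c := by
  refine ⟨hD, fun j => ?_, fun j k => ?_⟩
  · simp [instOf, clsOf]
  · have := j.2
    have hn : 0 < n := by omega
    simp [instOf, labOf, ptOf, hn]

open Classical in
/-- The program succeeds with probability `1 - 1 / n`, if the levels with guess at least
`2 ^ (-J - 1)` take at most `N` steps of the iteration and at most `K` bisection steps. -/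
lemma val_prog {params : List ℝ} {ε : ℝ} {e : RExpr} {out : Cmd} {good : State → Prop}
    {K N J : ℕ} (hε : 0 < ε) (hν : 0 < ν) (hν1 : ν ≤ 1) (hparams : params.getD 0 0 = ε)
    (he : e.eval (inputState x y params) = ν)
    (h1 : (reducedHull ν x y 1).Nonempty) (h2 : (reducedHull ν x y (-1)).Nonempty)
    (hdis : Disjoint (reducedHull ν x y 1) (reducedHull ν x y (-1)))
    (hout : ∀ D h r, 0 < D → (instOf x y ν ε D h r).OutputSpec out (outT n d) good)
    (hK : ∀ k ≤ J, (2 * pZ n (2 ^ Nat.clog 2 d) ((1 / 2) ^ (k + 1)) + Real.log n) / 2 ^ K ≤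
      pδ n (2 ^ Nat.clog 2 d) ((1 / 2) ^ (k + 1)))
    (hN : ∀ k ≤ J, ⌈pN n (2 ^ Nat.clog 2 d) ((1 / 2) ^ (k + 1))⌉₊ ≤ N)
    (hJ : ((1 / 2 : ℝ) ^ (J + 1)) ^ 2 ≤
      ε * distRatio x (reducedHull ν x y 1) (reducedHull ν x y (-1))) :
    ENNReal.ofReal (1 - 1 / n) ≤ val (fun s => if good s then 1 else 0)
      (progT n d (2 ^ Nat.clog 2 d) (Nat.clog 2 d) K N J)
      ([prog (.rset 13 (.const 0) e) out], inputState x y params) := by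
  set p := Nat.clog 2 d with hp
  set m := 2 ^ p with hm
  set s := inputState x y params with hs
  set φ : State → ENNReal := fun s => if good s then 1 else 0 with hφ
  have hn2 : 2 ≤ n := two_le_of_nonempty h1 h2
  have hn0 : 0 < n := by omega
  have hdiam : 0 < Metric.diam (Set.range x) :=
    (minDist_pos h1 h2 hdis).trans_le (minDist_le_diam hν1 h1 h2)
  set TL := (J + 1) * (levelT n d m p K N (outT n d) + 1) + 1 with hTL
  unfold progT
  refine le_trans ?_ (val_seq (T₁ := 1) (T₂ := 4 * p + 13 * n + centerT n d + 4 * m +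
    rotateT n m p + TL + 38) (by omega))
  refine Runs.le_val (Q := fun s' => s' = s.writeReal 13 0 ν)
    (Runs.rset le_rfl (by simp [IExpr.eval, he])) ?_
  rintro s₀ rfl
  have n₀ : s.int 0 0 = n := by simp [hs, inputState]
  have d₀ : s.int 0 1 = d := by simp [hs, inputState]
  have z₀ : s.int 15 0 = 0 := by simp [hs, inputState]
  have X₀ : ∀ j < n, ∀ k < d, s.real 0 (j * d + k) = ptOf x j k := fun j hj k hk =>
    inputState_real hj hk
  have Y₀ : ∀ j < n, s.real 1 j = labOf y j := fun j hj => by simp [hs, inputState, labOf]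
  have ε₀ : s.real 2 0 = ε := by rw [← hparams]; simp [hs, inputState]
  refine le_trans ?_ (val_seq (T₁ := 4 * p + 3) (T₂ := 13 * n + centerT n d + 4 * m +
    rotateT n m p + TL + 33) (by omega))
  refine Runs.le_val (runs_powerOfTwo (s := s.writeReal 13 0 ν) (d := d) (Q := fun s' => Agree powerOfTwo (s.writeReal 13 0 ν) s' ∧
    s'.int 1 0 = m ∧ IsHalf m (s'.int 2 0) p) d₀ (fun s' h h' h'' => ⟨h, h', h''⟩) le_rfl) ?_
  rintro s₁ ⟨hA₁, m₁, half₁⟩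
  set h := s₁.int 2 0 with hh
  refine le_trans ?_ (val_seq (T₁ := 13 * n + 7) (T₂ := centerT n d + 4 * m +
    rotateT n m p + TL + 24) (by omega))
  refine Runs.le_val (runs_tables (Q := fun s' => Agree tables s₁ s' ∧
    (∀ j < n, s'.int 3 j = j * m) ∧ (∀ j < n, s'.int 4 j = j * d) ∧
    (∀ j < n, s'.int 5 j = if 0 < labOf y j then 0 else 1)) (n := n) (d := d) (Y := labOf y) ?_ ?_
    m₁ ?_ (fun s' h h' h'' h''' => ⟨h, h', h'', h'''⟩) le_rfl) ?_
  · rw [hA₁.int 0 (by decide)]; exact n₀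
  · rw [hA₁.int 0 (by decide)]; exact d₀
  · rw [hA₁.real 1 (by decide), writeReal_of_ne _ (by norm_num)]; exact Y₀
  rintro s₂ ⟨hA₂, offM, offD, cls₂⟩
  have n₂ : s₂.int 0 0 = n := by rw [hA₂.int 0 (by decide), hA₁.int 0 (by decide)]; exact n₀
  have d₂ : s₂.int 0 1 = d := by rw [hA₂.int 0 (by decide), hA₁.int 0 (by decide)]; exact d₀
  have X₂ : ∀ j < n, ∀ k < d, s₂.real 0 (j * d + k) = ptOf x j k := by
    rw [hA₂.real 0 (by decide), hA₁.real 0 (by decide), writeReal_of_ne _ (by norm_num)]; exact X₀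
  have Y₂ : ∀ j < n, s₂.real 1 j = labOf y j := by
    rw [hA₂.real 1 (by decide), hA₁.real 1 (by decide), writeReal_of_ne _ (by norm_num)]; exact Y₀
  refine le_trans ?_ (val_seq (T₁ := centerT n d) (T₂ := 4 * m + rotateT n m p + TL + 20)
    (by omega))
  refine Runs.le_val (runs_center (Q := fun s' => Agree center s₂ s' ∧ ∃ D > 0,
    D ≤ Metric.diam (Set.range x) ∧ (∀ j < n, ∑ k ∈ range d,
      (labOf y j * (ptOf x j k - ptOf x 0 k) / D) ^ 2 ≤ 1) ∧ s'.real 7 0 = D ∧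
    ∀ j < n, ∀ k < d, s'.real 6 (j * d + k) = labOf y j * (ptOf x j k - ptOf x 0 k) / D)
    hn0 n₂ d₂ offD X₂ Y₂ (fun s' r h h3 h4 h5 h6 => ?_) le_rfl) ?_
  · obtain ⟨hr, hrD⟩ := scale_bounds hn0 hdiam h3 h4
    refine ⟨h, _, Real.exp_pos _, hrD, fun j hj => ?_, h5, h6⟩
    have hsq : Real.exp (Real.log r / 2) ^ 2 = r := by
      rw [← Real.exp_nat_mul, Nat.cast_ofNat, mul_div_cancel₀ _ two_ne_zero, Real.exp_log hr]
    simp only [div_pow, hsq]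
    rw [← sum_div, div_le_one hr]
    simpa only [sq] using h3 j hj
  rintro s₃ ⟨hA₃, D, hD, hDle, hrow, D₃, A₃⟩
  set A : ℕ → ℕ → ℝ := fun j k => labOf y j * (ptOf x j k - ptOf x 0 k) / D with hAdef
  have int₃ : ∀ a < 10, s₃.int a = s₂.int a := fun a ha =>
    hA₃.int_of_lt (i := 10) (r := 6) (by decide) ha
  have hdm : d ≤ m := Nat.le_pow_clog one_lt_two d
  have hrm : √(m : ℝ) ^ 2 = m := Real.sq_sqrt (Nat.cast_nonneg m)
  have hm0 : 0 < m := by positivity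
  obtain ⟨cf, hcf, hcf2⟩ := exists_rotated_coeff half₁ hdm hrm hrow
  set Λ := 2 * Real.log (4 * n ^ 2 * m) with hΛ
  have hΛ0 : 0 < Λ := by
    have e1 : (2 : ℝ) ≤ n := by exact_mod_cast hn2
    have e2 : (1 : ℝ) ≤ m := by exact_mod_cast hm0
    have : (1 : ℝ) < 4 * n ^ 2 * m := by nlinarith
    have := Real.log_pos this
    linarith
  refine le_trans ?_ (val_seq (T₁ := 4 * m + 3) (T₂ := rotateT n m p + TL + 15) (by omega))
  have m₃ : s₃.int 1 0 = m := by rw [int₃ 1 (by norm_num), hA₂.int 1 (by decide), m₁]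
  -- The two sources of failure are the signs and the last level.
  have hprob : ENNReal.ofReal (1 - 1 / n) ≤ ENNReal.ofReal (1 - flatPot n m cf (√(m * Λ))
      (√(Λ / m)) 0 (s₃.int 6)) * ENNReal.ofReal (1 - 1 / (2 * n)) := by
    have e1 : (2 : ℝ) ≤ n := by exact_mod_cast hn2
    have e2 : 1 / (2 * (n : ℝ)) ≤ 1 := by rw [div_le_one (by positivity)]; linarith
    rw [flatPot_zero hn0 hm0 hΛ, ← ENNReal.ofReal_mul (by linarith)]
    refine ENNReal.ofReal_le_ofReal ?_
    have e3 : 1 / (n : ℝ) = 2 * (1 / (2 * n)) := by field_simp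
    rw [e3]
    nlinarith [sq_nonneg (1 / (2 * (n : ℝ)))]
  refine hprob.trans (val_signs m₃ cf _ _ fun s₄ hA₄ hbits hflat => ?_)
  set r := s₄.int 6 with hr
  refine le_trans ?_ (val_seq (T₁ := rotateT n m p) (T₂ := TL + 10) (by omega))
  have half₂ : s₄.int 2 0 = h := by
    rw [hA₄.int 2 (by decide), int₃ 2 (by norm_num), hA₂.int 2 (by decide)]
  refine Runs.le_val (runs_rotate (Q := fun s' => Agree rotate s₄ s' ∧ ∀ j < n, ∀ k < m,
    s'.real 10 (j * m + k) = rotated h p d (√m) r A j k) (n := n) (d := d) (m := m) (A := A)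
    ?_ ?_ ?_ half₂ half₁ ?_ ?_ ?_ (fun s' h h' => ⟨h, h'⟩) le_rfl) ?_
  · rw [hA₄.int 0 (by decide), int₃ 0 (by norm_num), n₂]
  · rw [hA₄.int 0 (by decide), int₃ 0 (by norm_num), d₂]
  · rw [hA₄.int 1 (by decide), m₃]
  · rw [hA₄.int 3 (by decide), int₃ 3 (by norm_num)]; exact offM
  · rw [hA₄.int 4 (by decide), int₃ 4 (by norm_num)]; exact offD
  · rw [hA₄.real 6 (by decide)]; exact A₃
  rintro s₅ ⟨hA₅, M₅⟩
  refine le_trans ?_ (val_seq (T₁ := 1) (T₂ := TL) (by omega))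
  refine Runs.le_val (Q := fun s' => s' = s₅.writeReal 20 0 1)
    (Runs.rset le_rfl (by simp [RExpr.eval, IExpr.eval])) ?_
  rintro s₆ rfl
  set I := instOf x y ν ε D h r with hI
  have hnorm := instOf_normalized (x := x) (y := y) ν ε hD h r
  have hvalid : I.Valid := by
    refine ⟨hn2, hm0, hν, hν1, hε, hnorm.cls_lt, capSimplex_nonempty h1 h2, hrow, ?_⟩
    exact fun i _ j _ => sum_rotated_mul half₁ hdm hrm hbits A i j
  have hflat' : I.Flat := by
    intro j hj i hi
    have e1 : I.M j i = ∑ l ∈ range m, (1 - 2 * (r l : ℝ)) * cf j i l := hcf r j i hi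
    rw [e1]
    exact flat_of_flatPot_lt hm0 hΛ0 hcf2 hflat hj hi
  have hstored : I.Stored (s₅.writeReal 20 0 1) := by
    refine Inst.Stored.writeReal ?_ (by norm_num) _ _
    have i₅ : ∀ a < 6, s₅.int a = s₂.int a := by
      intro a ha
      rw [hA₅.int a (by
        have : ∀ a < 6, a ∉ rotate.wi := by decide
        exact this a ha), hA₄.int a (by
        have : ∀ a < 6, a ∉ signs.wi := by decide
        exact this a ha), int₃ a (by omega)]
    refine ⟨?_, ?_, ?_, ?_, ?_, ?_, ?_, ?_, ?_, ?_, M₅, ?_⟩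
    · rw [i₅ 0 (by norm_num)]; exact n₂
    · rw [i₅ 0 (by norm_num)]; exact d₂
    · rw [i₅ 1 (by norm_num), hA₂.int 1 (by decide)]; exact m₁
    · rw [i₅ 3 (by norm_num)]; exact offM
    · rw [i₅ 4 (by norm_num)]; exact offD
    · rw [i₅ 5 (by norm_num)]
      exact fun j hj => (cls₂ j hj).trans (clsOf_eq hj)
    · intro k hk
      have := X₂ 0 hn0 k hk
      rw [zero_mul, zero_add] at this
      rw [hA₅.real 0 (by decide), hA₄.real 0 (by decide), hA₃.real 0 (by decide), this]
      rfl
    · rw [hA₅.real 2 (by decide), hA₄.real 2 (by decide), hA₃.real 2 (by decide),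
        hA₂.real 2 (by decide), hA₁.real 2 (by decide), writeReal_of_ne _ (by norm_num)]
      exact ε₀
    · rw [hA₅.real 6 (by decide), hA₄.real 6 (by decide)]; exact A₃
    · rw [hA₅.real 7 (by decide), hA₄.real 7 (by decide)]; exact D₃
    · rw [hA₅.real 13 (by decide), hA₄.real 13 (by decide), hA₃.real 13 (by decide),
        hA₂.real 13 (by decide), hA₁.real 13 (by decide)]
      simp [hI, instOf]
  have h15 : (s₅.writeReal 20 0 1).int 15 0 = 0 := by
    rw [writeReal_int, hA₅.int 15 (by decide), hA₄.int 15 (by decide), hA₃.int 15 (by decide),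
      hA₂.int 15 (by decide), hA₁.int 15 (by decide)]
    exact z₀
  have hfin := val_levels (β := distRatio x (reducedHull ν x y 1) (reducedHull ν x y (-1)))
    (N := N) (K := K) (J := J) hvalid hflat' rfl hstored (by simp) h15 hK hN
    (fun η hη => hnorm.distRatio_le_gram hη hDle) hJ (hout D h r hD)
  rw [hTL]
  exact hfin

end

end SPDC

/-! ### The running time -/

namespace SPDC

open Finset RealRAM SVM

/-- The step count in terms of the logarithmic factor `L` and of `W = d + √(d / (ε β))`. -/
lemma progT_le {n d m p K N J : ℕ} {L W : ℝ} (hL : 1 ≤ L) (hW : 1 ≤ W) (hn : 1 ≤ n) (hd : d ≤ W)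
    (hm : m ≤ 2 * W) (hp : p ≤ 2 * L) (hK : K ≤ 240 * L) (hN : N ≤ 100000 * (L ^ 2 * W))
    (hJ : (J : ℝ) + 1 ≤ 2 * L) :
    (progT n d m p K N J : ℝ) ≤ 4000000000 * L ^ 4 * (n * W) := by
  obtain ⟨l, hl, rfl⟩ : ∃ l : ℝ, 0 ≤ l ∧ L = l + 1 := ⟨L - 1, by linarith, by ring⟩
  obtain ⟨w, hw, rfl⟩ : ∃ w : ℝ, 0 ≤ w ∧ W = w + 1 := ⟨W - 1, by linarith, by ring⟩
  obtain ⟨b, rfl⟩ : ∃ b, n = b + 1 := ⟨n - 1, by omega⟩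
  set v : ℝ := ((b + 1 : ℕ) : ℝ) with hv
  have hv' : v = b + 1 := by rw [hv]; push_cast; ring
  have hb : (0 : ℝ) ≤ b := Nat.cast_nonneg b
  have e1 : (softT (b + 1) K : ℝ) ≤ 8000 * ((l + 1) * v) := by
    have : (softT (b + 1) K : ℝ) = (K + 2) * (11 * v + 21) + 4 * v + 24 := by
      unfold softT; push_cast; rw [hv']
    rw [this]
    calc ((K : ℝ) + 2) * (11 * v + 21) + 4 * v + 24
        ≤ (240 * (l + 1) + 2) * (11 * v + 21) + 4 * v + 24 := by gcongr
      _ ≤ _ := by rw [← sub_nonneg, hv']; ring_nf; positivity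
  have e2 : (iterT (b + 1) p K N : ℝ) ≤ 900000000 * ((l + 1) ^ 3 * (v * (w + 1))) := by
    have : (iterT (b + 1) p K N : ℝ) =
        N * (6 * p + (softT (b + 1) K + 16 * v + 50) + 9) + 3 := by
      unfold iterT coordT; push_cast; rw [hv']
    rw [this]
    calc (N : ℝ) * (6 * p + (softT (b + 1) K + 16 * v + 50) + 9) + 3
        ≤ 100000 * ((l + 1) ^ 2 * (w + 1)) * (6 * (2 * (l + 1)) +
          (8000 * ((l + 1) * v) + 16 * v + 50) + 9) + 3 := by gcongr
      _ ≤ _ := by rw [← sub_nonneg, hv']; ring_nf; positivity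
  have e3 : (levelT (b + 1) d m p K N (outT (b + 1) d) : ℝ) ≤
      1000000000 * ((l + 1) ^ 3 * (v * (w + 1))) := by
    have : (levelT (b + 1) d m p K N (outT (b + 1) d) : ℝ) = iterT (b + 1) p K N +
        (8 * (v * d) + 30 * v + 20 * d + softT (b + 1) K + 60) + softT (b + 1) K + 12 * v + 4 * m +
        (8 * d + 4 * v + 20) + 60 := by
      unfold levelT certT outT; push_cast; rw [hv']
    rw [this]
    calc _ ≤ 900000000 * ((l + 1) ^ 3 * (v * (w + 1))) +
        (8 * (v * (w + 1)) + 30 * v + 20 * (w + 1) + 8000 * ((l + 1) * v) + 60) +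
        8000 * ((l + 1) * v) + 12 * v + 4 * (2 * (w + 1)) +
        (8 * (w + 1) + 4 * v + 20) + 60 := by gcongr
      _ ≤ _ := by rw [← sub_nonneg, hv']; ring_nf; positivity
  have e4 : (progT (b + 1) d m p K N J : ℝ) = 4 * p + 13 * v + (12 * (v * d) + 30 * v + 20) +
      4 * m + (v * (p * (9 * m + 10) + 9 * m + 20) + 10) +
      ((J + 1) * (levelT (b + 1) d m p K N (outT (b + 1) d) + 1) + 1) + 40 := by
    unfold progT centerT rotateT; push_cast; rw [hv']
  rw [e4]
  calc _ ≤ 4 * (2 * (l + 1)) + 13 * v + (12 * (v * (w + 1)) + 30 * v + 20) +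
      4 * (2 * (w + 1)) + (v * (2 * (l + 1) * (9 * (2 * (w + 1)) + 10) +
        9 * (2 * (w + 1)) + 20) + 10) +
      (2 * (l + 1) * (1000000000 * ((l + 1) ^ 3 * (v * (w + 1))) + 1) + 1) + 40 := by gcongr
    _ ≤ _ := by rw [← sub_nonneg, hv']; ring_nf; positivity

lemma clog_le_two_mul {d : ℕ} (hd : 1 ≤ d) : (Nat.clog 2 d : ℝ) ≤ 2 * (1 + Real.log d) ∧
    2 ^ Nat.clog 2 d ≤ 2 * d := by
  rcases hd.eq_or_lt with rfl | hd
  · simp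
  have h1 := Nat.pow_pred_clog_lt_self one_lt_two hd
  have h2 : 0 < Nat.clog 2 d := Nat.clog_pos one_lt_two hd
  obtain ⟨p, hp⟩ : ∃ p, Nat.clog 2 d = p + 1 := ⟨Nat.clog 2 d - 1, by omega⟩
  rw [hp, Nat.pred_succ] at h1
  rw [hp]
  refine ⟨?_, by rw [pow_succ]; omega⟩
  have h3 : Real.log (2 ^ p : ℕ) ≤ Real.log d :=
    Real.log_le_log (by positivity) (by exact_mod_cast h1.le)
  rw [Nat.cast_pow, Real.log_pow] at h3
  have := Real.log_two_gt_d9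
  push_cast at h3 ⊢
  nlinarith [(Nat.cast_nonneg p : (0 : ℝ) ≤ p)]

/-- The parameters of the program, and its running time. All guesses down to the `J`-th are of
the order of `√(ε β)` at least. -/
lemma exists_params {n d : ℕ} {ε β : ℝ} (hn : 2 ≤ n) (hd : 1 ≤ d) (hε : 0 < ε) (hε1 : ε < 1)
    (hβ : 0 < β) (hβ1 : β ≤ 1) :
    ∃ K N J : ℕ,
      (∀ k ≤ J, (2 * pZ n (2 ^ Nat.clog 2 d) ((1 / 2) ^ (k + 1)) + Real.log n) / 2 ^ K ≤
        pδ n (2 ^ Nat.clog 2 d) ((1 / 2) ^ (k + 1))) ∧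
      (∀ k ≤ J, ⌈pN n (2 ^ Nat.clog 2 d) ((1 / 2) ^ (k + 1))⌉₊ ≤ N) ∧
      ((1 / 2 : ℝ) ^ (J + 1)) ^ 2 ≤ ε * β ∧
      (progT n d (2 ^ Nat.clog 2 d) (Nat.clog 2 d) K N J : ℝ) ≤
        timeBound 4000000000 4 n d ε β := by
  obtain ⟨hp, hm2⟩ := clog_le_two_mul hd
  have hdm : d ≤ 2 ^ Nat.clog 2 d := Nat.le_pow_clog one_lt_two d
  set m := 2 ^ Nat.clog 2 d with hm
  set L := 1 + Real.log n + Real.log d + Real.log (1 / ε) + Real.log (1 / β) with hL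
  have hn' : (2 : ℝ) ≤ n := by exact_mod_cast hn
  have hd' : (1 : ℝ) ≤ d := by exact_mod_cast hd
  have hm1 : (1 : ℝ) ≤ m := by exact_mod_cast hd.trans hdm
  have hm2' : (m : ℝ) ≤ 2 * d := by exact_mod_cast hm2
  have l1 : 0 ≤ Real.log n := Real.log_nonneg (by linarith)
  have l2 : 0 ≤ Real.log d := Real.log_nonneg hd'
  have l3 : 0 ≤ Real.log (1 / ε) := Real.log_nonneg (by rw [le_div_iff₀ hε]; linarith)
  have l4 : 0 ≤ Real.log (1 / β) := Real.log_nonneg (by rw [le_div_iff₀ hβ]; linarith)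
  have hL1 : 1 ≤ L := by linarith
  have hεβ : 0 < ε * β := mul_pos hε hβ
  have hεβ1 : ε * β ≤ 1 := by nlinarith
  set R := √(d / (ε * β)) with hR
  have hR0 : 0 ≤ R := Real.sqrt_nonneg _
  -- The last level is the first whose guess is small enough.
  have hex : ∃ J : ℕ, ((1 / 2 : ℝ) ^ (J + 1)) ^ 2 ≤ ε * β := by
    obtain ⟨J, hJ⟩ := exists_pow_lt_of_lt_one hεβ (show (1 / 4 : ℝ) < 1 by norm_num)
    refine ⟨J, le_trans ?_ hJ.le⟩
    rw [← pow_mul, mul_comm, pow_mul, pow_succ]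
    norm_num
  obtain ⟨J, hJ, hJmin⟩ : ∃ J : ℕ, ((1 / 2 : ℝ) ^ (J + 1)) ^ 2 ≤ ε * β ∧
      ε * β ≤ ((1 / 2 : ℝ) ^ J) ^ 2 := by
    classical
    refine ⟨Nat.find hex, Nat.find_spec hex, ?_⟩
    rcases Nat.eq_zero_or_pos (Nat.find hex) with h0 | h0
    · rw [h0]; simpa using hεβ1
    · have := Nat.find_min hex (Nat.sub_lt h0 one_pos)
      rw [show Nat.find hex - 1 + 1 = Nat.find hex by omega] at this
      exact (not_le.1 this).le
  have hq : ∀ k ≤ J, ε * β ≤ 4 * ((1 / 2 : ℝ) ^ (k + 1)) ^ 2 := by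
    intro k hk
    have : ((1 / 2 : ℝ) ^ J) ^ 2 ≤ ((1 / 2 : ℝ) ^ k) ^ 2 := by
      gcongr ?_ ^ 2
      exact pow_le_pow_of_le_one (by norm_num) (by norm_num) hk
    rw [pow_succ (1 / 2 : ℝ) k, mul_pow]
    linarith
  have hJL : (J : ℝ) + 1 ≤ 2 * L := by
    have h1 := Real.log_le_log hεβ hJmin
    rw [← pow_mul, Real.log_pow, Real.log_mul hε.ne' hβ.ne', one_div, Real.log_inv] at h1
    have h2 : Real.log (1 / ε) = -Real.log ε := by rw [one_div, Real.log_inv]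
    have h3 : Real.log (1 / β) = -Real.log β := by rw [one_div, Real.log_inv]
    have := Real.log_two_gt_d9
    push_cast at h1
    nlinarith [(Nat.cast_nonneg J : (0 : ℝ) ≤ J)]
  have hlevel : ∀ k, Level n m ((1 / 2) ^ (k + 1)) := fun k =>
    ⟨hn, by exact_mod_cast hm1, by positivity, pow_le_one₀ (by norm_num) (by norm_num)⟩
  have hpL : ∀ k ≤ J, pL n m ((1 / 2) ^ (k + 1)) ≤ 6 * L := by
    intro k hk
    have h1 : 16 * (n : ℝ) * m / ((1 / 2) ^ (k + 1)) ^ 2 ≤ 128 * n * d * (1 / ε) * (1 / β) := by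
      rw [div_le_iff₀ (by positivity)]
      have : 128 * (n : ℝ) * d * (1 / ε) * (1 / β) * ((1 / 2) ^ (k + 1)) ^ 2 =
          32 * n * d * (4 * ((1 / 2) ^ (k + 1)) ^ 2 / (ε * β)) := by field_simp; ring
      rw [this]
      have h2 : 1 ≤ 4 * ((1 / 2 : ℝ) ^ (k + 1)) ^ 2 / (ε * β) := by
        rw [le_div_iff₀ hεβ, one_mul]; exact hq k hk
      calc 16 * (n : ℝ) * m ≤ 16 * n * (2 * d) := by gcongr
        _ = 32 * n * d * 1 := by ring
        _ ≤ _ := by gcongr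
    have h2 := Real.log_le_log (by positivity) h1
    rw [Real.log_mul (by positivity) (by positivity), Real.log_mul (by positivity) (by positivity),
      Real.log_mul (by positivity) (by positivity), Real.log_mul (by positivity) (by positivity),
      show (128 : ℝ) = 2 ^ 7 by norm_num, Real.log_pow] at h2
    have := Real.log_two_lt_d9
    unfold pL
    push_cast at h2
    linarith
  have hpN : ∀ k ≤ J, pN n m ((1 / 2) ^ (k + 1)) ≤ 90000 * (L ^ 2 * (d + R)) := by
    intro k hk
    have h0 : 0 ≤ pL n m ((1 / 2) ^ (k + 1)) := zero_le_one.trans (hlevel k).one_le_pL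
    have h1 : √(m : ℝ) / (1 / 2) ^ (k + 1) ≤ 3 * R := by
      rw [div_le_iff₀ (by positivity)]
      refine Real.sqrt_le_iff.2 ⟨by positivity, ?_⟩
      rw [mul_pow, mul_pow, hR, Real.sq_sqrt (by positivity)]
      have : (3 : ℝ) ^ 2 * (d / (ε * β)) * ((1 / 2) ^ (k + 1)) ^ 2 =
          9 / 4 * d * (4 * ((1 / 2) ^ (k + 1)) ^ 2 / (ε * β)) := by field_simp; ring
      rw [this]
      have h2 : 1 ≤ 4 * ((1 / 2 : ℝ) ^ (k + 1)) ^ 2 / (ε * β) := by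
        rw [le_div_iff₀ hεβ, one_mul]; exact hq k hk
      calc (m : ℝ) ≤ 2 * d := hm2'
        _ ≤ 9 / 4 * d * 1 := by linarith
        _ ≤ _ := by gcongr
    have h2 : pN n m ((1 / 2) ^ (k + 1)) = 13 * pL n m ((1 / 2) ^ (k + 1)) * (2 * m +
        64 * pL n m ((1 / 2) ^ (k + 1)) * (√(m : ℝ) / (1 / 2) ^ (k + 1))) := by
      unfold pN pS; ring
    rw [h2]
    calc _ ≤ 13 * (6 * L) * (2 * (2 * d) + 64 * (6 * L) * (3 * R)) := by
          gcongr <;> exact hpL k hk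
      _ ≤ _ := by
        obtain ⟨l, hl, hl'⟩ : ∃ l : ℝ, 0 ≤ l ∧ L = l + 1 := ⟨L - 1, by linarith, by ring⟩
        rw [← sub_nonneg, hl']
        ring_nf
        positivity
  have hW : 1 ≤ d + R := by linarith
  refine ⟨⌊240 * L⌋₊, ⌈90000 * (L ^ 2 * (d + R))⌉₊, J, fun k hk => ?_,
    fun k hk => Nat.ceil_mono (hpN k hk), hJ, ?_⟩
  · obtain ⟨K, hK, hKL⟩ := (hlevel k).bisection_steps
    refine le_trans ?_ hK
    have h1 : K ≤ ⌊240 * L⌋₊ := Nat.le_floor (hKL.trans (by linarith [hpL k hk]))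
    have h2 : 0 ≤ pZ n m ((1 / 2) ^ (k + 1)) := by
      have := zero_le_one.trans (hlevel k).one_le_pL
      unfold pZ pG
      positivity
    gcongr
    norm_num
  · unfold timeBound
    refine progT_le hL1 hW (by omega) (by linarith) (by linarith) (by linarith)
      (Nat.floor_le (by linarith)) ?_ hJL
    refine (Nat.ceil_lt_add_one (by positivity)).le.trans ?_
    have : 1 ≤ L ^ 2 * (d + R) := one_le_mul_of_one_le_of_one_le (one_le_pow₀ hL1) hW
    linarith

section

variable {n d : ℕ} {x : Fin n → EuclideanSpace ℝ (Fin d)} {y : Fin n → ℤˣ} {ν : ℝ}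

lemma one_le_dim (hν : ν ≤ 1) (h1 : (reducedHull ν x y 1).Nonempty)
    (h2 : (reducedHull ν x y (-1)).Nonempty)
    (hdis : Disjoint (reducedHull ν x y 1) (reducedHull ν x y (-1))) : 1 ≤ d := by
  rcases Nat.eq_zero_or_pos d with rfl | hd
  · exact absurd (Metric.diam_subsingleton (Set.subsingleton_of_subsingleton (s := Set.range x)))
      ((minDist_pos h1 h2 hdis).trans_le (minDist_le_diam hν h1 h2)).ne'
  · exact hd

/-- The common part of the two algorithms: `e` computes the bound `ν` of the weights, and `out` the
output from a certificate. -/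
lemma succeedsWithin_prog {params : List ℝ} {ε : ℝ} {e : RExpr} {out : Cmd} {good : State → Prop}
    (hε : 0 < ε) (hε1 : ε < 1) (hν : 0 < ν) (hν1 : ν ≤ 1) (hparams : params.getD 0 0 = ε)
    (he : e.eval (inputState x y params) = ν)
    (h1 : (reducedHull ν x y 1).Nonempty) (h2 : (reducedHull ν x y (-1)).Nonempty)
    (hdis : Disjoint (reducedHull ν x y 1) (reducedHull ν x y (-1)))
    (hout : ∀ D h r, 0 < D → (instOf x y ν ε D h r).OutputSpec out (outT n d) good) :
    SucceedsWithin (prog (.rset 13 (.const 0) e) out) (inputState x y params)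
      (timeBound 4000000000 4 n d ε
        (distRatio x (reducedHull ν x y 1) (reducedHull ν x y (-1)))) (1 - 1 / (n : ℝ)) good := by
  obtain ⟨hβ, hβ1⟩ := distRatio_pos_le_one hν1 h1 h2 hdis
  obtain ⟨K, N, J, hK, hN, hJ, hT⟩ := exists_params (two_le_of_nonempty h1 h2)
    (one_le_dim hν1 h1 h2 hdis) hε hε1 hβ hβ1
  exact succeedsWithin_of_val hT (val_prog hε hν hν1 hparams he h1 h2 hdis hout hK hN hJ)

end

end SPDC

theorem mainTheorem1 :
    (∃ (c : RealRAM.Cmd) (C : ℝ) (k : ℕ), 0 < C ∧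
      ∀ (n d : ℕ) (x : Fin n → EuclideanSpace ℝ (Fin d)) (y : Fin n → ℤˣ) (ε : ℝ),
        0 < ε → ε < 1 →
        (SVM.classPoints x y 1).Nonempty → (SVM.classPoints x y (-1)).Nonempty →
        (∃ w b, SVM.HMFeasible x y w b) →
        RealRAM.SucceedsWithin c (SVM.inputState x y [ε])
          (SVM.timeBound C k n d ε
            (SVM.distRatio x (convexHull ℝ (SVM.classPoints x y 1))
              (convexHull ℝ (SVM.classPoints x y (-1)))))
          (1 - 1 / (n : ℝ))
          (fun s => SVM.HMApprox ε x y (SVM.outW d s) (SVM.outB s))) ∧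
    (∃ (c : RealRAM.Cmd) (C : ℝ) (k : ℕ), 0 < C ∧
      ∀ (n d : ℕ) (x : Fin n → EuclideanSpace ℝ (Fin d)) (y : Fin n → ℤˣ) (ε ν : ℝ),
        0 < ε → ε < 1 → 0 < ν → ν ≤ 1 →
        (SVM.reducedHull ν x y 1).Nonempty → (SVM.reducedHull ν x y (-1)).Nonempty →
        Disjoint (SVM.reducedHull ν x y 1) (SVM.reducedHull ν x y (-1)) →
        RealRAM.SucceedsWithin c (SVM.inputState x y [ε, ν])
          (SVM.timeBound C k n d ε
            (SVM.distRatio x (SVM.reducedHull ν x y 1) (SVM.reducedHull ν x y (-1))))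
          (1 - 1 / (n : ℝ))
          (fun s => SVM.NuApprox ε ν x y (SVM.outW d s) (SVM.outB s) (SVM.outRho s)
            (SVM.outSlack n s))) := by
  open SVM SPDC in
  refine ⟨⟨prog (.rset 13 (.const 0) (rc 1)) hmOut, 4000000000, 4, by norm_num, ?_⟩,
    ⟨prog (.rset 13 (.const 0) (.load 2 (.const 1))) nuOut, 4000000000, 4, by norm_num, ?_⟩⟩
  · intro n d x y ε hε hε1 h1 h2 hsep
    rw [← convexHull_nonempty_iff (𝕜 := ℝ), classPoints_convexHull] at h1 h2
    rw [classPoints_convexHull, classPoints_convexHull]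
    obtain ⟨w, b, hwb⟩ := hsep
    exact succeedsWithin_prog hε hε1 one_pos le_rfl rfl (by simp [RealRAM.RExpr.eval,
      RealRAM.IExpr.eval]) h1 h2 (disjoint_of_separable hwb) fun D h r hD =>
      hmOut_spec (instOf_normalized 1 ε hD h r) hε hε1 rfl ⟨w, b, hwb⟩
  · intro n d x y ε ν hε hε1 hν hν1 h1 h2 hdis
    exact succeedsWithin_prog hε hε1 hν hν1 rfl rfl h1 h2 hdis fun D h r hD =>
      nuOut_spec (instOf_normalized ν ε hD h r) hε1
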